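/- **Setting.** Let $(\eta^{\alpha\beta})$ be a symmetric invertible constant complex $n\times n$ matrix and $U\subset\mathbb C^n$ an open set with coordinates $v=(v^1,\dots,v^n)$. Write $v_\ell=\partial_x^\ell v$, $\partial_\alpha=\partial/\partial v^\alpha$. Local functionals $F=\int f\,dx$ are identified when their variational derivatives $\frac{\delta F}{\delta v^\beta(x)}=\sum_\ell(-\partial_x)^\ell\frac{\partial f}{\partial v^\beta_\ell}$ agree, and $\{F,G\}=\int\frac{\delta F}{\delta v^\alpha(x)}\eta^{\alpha\beta}\partial_x\frac{\delta G}{\delta v^\beta(x)}\,dx$. Let $H=\sum_{k\ge0}\epsilon^kH_k$, $H_k=\int h_k\,dx$, where $h_k$ is a differential polynomial (a polynomial in $v_1,v_2,\dots$ with coefficients holomorphic in $v\in U$), homogeneous of degree $k$ for $\deg v^\alpha_\ell=\ell$; in particular $h_0=h_0(v)$. The Hamiltonian perturbation is $\partial_tv^\alpha=\eta^{\alpha\beta}\partial_x\frac{\delta H}{\delta v^\beta(x)}$; its dispersionless limit is $\partial_tv^\alpha=A^\alpha_\gamma v^\gamma_x$ with $A^\alpha_\gamma=\eta^{\alpha\beta}\partial_\beta\partial_\gamma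 h_0$. Let $R_1,\dots,R_n$ be a complete set of Riemann invariants on $U$: holomorphic functions with non-degenerate Jacobian such that $A^\alpha_\beta\,\partial_\alpha R_i=\lambda_i\,\partial_\beta R_i$, where $\lambda_1,\dots,\lambda_n$ are pairwise distinct at every point of $U$. Write $f_{,i}=\partial f/\partial R_i$ and $R_{i,x}=\partial_xR_i$. **Definitions.** A conserved quantity of the dispersionless limit over an open set $V$ is $F_0=\int f_0(v)\,dx$ with $f_0$ holomorphic on $V$ and $\{H_0,F_0\}=0$; it is *generic* if $(\eta^{\alpha\gamma}\partial_\gamma\partial_\beta f_0)$ has pairwise distinct eigenvalues at every point of $V$. The dispersionless limit is *integrable* if near every point $p\in U$ it has a family of conserved quantities parametrized by $n$ arbitrary holomorphic functions of one variable: there are local holomorphic coordinates $r_1,\dots,r_n$ at $p$ such that for all germs of holomorphic functions $g_i$ at $r_i(p)$ some conserved quantity $\int f\,dx$ near $p$ satisfies, for every $i$, $f(v)-f(p)=g_i(r_i(v))-g_i(r_i(p))$ for all $v$ near $p$ with $r_k(v)=r_k(p)$ for all $k\ne i$. The perturbation is *$\mathcal O(\epsilon^N)$-integrable* if its dispersionless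 limit is integrable and every generic conserved quantity $F_0$ of it over an open $V\subset U$ extends, near every point of $V$, to $F=\sum_k\epsilon^kF_k$, with $F_k$ having a differential polynomial density homogeneous of degree $k$, such that $\{H,F\}=\mathcal O(\epsilon^{N+1})$. A *quasi-Miura generator* over an open set $W$ of pairs $(v,v_x)$ with $v\in U$ is $K=K_0+\epsilon K_1$, $K_0=\int k_0(v)\,dx$, $K_1=\int k_1(v,v_x)\,dx$, with $k_0$ and $k_1$ holomorphic, the variational derivatives of $K_1$ homogeneous of degree $1$ for $\deg v^\alpha_\ell=\ell$, and $H_1=\{H_0,K_0\}$, $H_2=\{H_0,K_1\}+\tfrac12\{\{H_0,K_0\},K_0\}$. The perturbation is *quasi-trivial up to the second order approximation* if over every $p\in U$ there is a pair $(p,q)$ having a neighbourhood over which there is a quasi-Miura generator. **Theorem.** Assume that the dispersionless limit is integrable and that $\lambda_{i,i}$ is nowhere zero on $U$, for $i=1,\dots,n$. *Part I.* Up to the second order approximation, the perturbation is quasi-trivial if and only if it is integrable (that is, $\mathcal O(\epsilon^2)$-integrable). Moreover, for every quasi-Miura generator $K_0+\epsilon K_1$ over an open set $W$ on which holomorphic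 branches of $\log R_{i,x}$ are given, near each point of $W$ there are holomorphic functions $C_i$ of the single variable $R_i$ and $\phi_i$ of $v$ such that $$K_1=\int\sum_{i=1}^n\bigl(C_i(R_i)R_{i,x}\log R_{i,x}-C_i(R_i)R_{i,x}+\phi_iR_{i,x}\bigr)\,dx .$$ Conversely, if the perturbation is quasi-trivial up to the second order approximation, then each point of $U$ has an open neighbourhood $V\subset U$ with holomorphic $k_0,C_i,\phi_i$ over $V$ such that $\int k_0\,dx+\epsilon K_1$, with $K_1$ of this form, is a quasi-Miura generator over every open set of pairs $(v,v_x)$, $v\in V$, on which branches of $\log R_{i,x}$ exist, for any choice of the branches. *Part II.* If $H_1=0$ and if, near every point of $U$, there are holomorphic $C_i$ and $\phi_i$ with $$H_2=\int\Bigl(-\sum_{i=1}^nC_i(R_i)\,\lambda_{i,i}\,R_{i,x}^2+\tfrac12\sum_{i\ne j}(\lambda_i-\lambda_j)\,s_{ij}\,R_{i,x}R_{j,x}\Bigr)dx,\qquad s_{ij}=\phi_{i,j}-\phi_{j,i},$$ then the perturbation is $\mathcal O(\epsilon^2)$-integrable. -/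

import Mathlib

noncomputable section

namespace HamPDE

/-! ## Jets, densities, local functionals -/

/-- Jets of infinite order of a curve `x ↦ v(x)` in `ℂⁿ`: `j ℓ α` is the coordinate
`v^α_ℓ = ∂_x^ℓ v^α`, and `j 0` is the base point `v`. -/
abbrev Jet (n : ℕ) := ℕ → Fin n → ℂ

/-- Densities are functions of the jet variables. Those used below depend on finitely many jet
variables only and are holomorphic in these on the relevant open sets. -/
abbrev Density (n : ℕ) := Jet n → ℂ

/-- The jets with base point `v` in `V`. -/
def jetsOver {n : ℕ} (V : Set (Fin n → ℂ)) : Set (Jet n) := {j | j 0 ∈ V}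

/-- The jets with `(v, v_x)` in `W`. -/
def jetsOver₁ {n : ℕ} (W : Set ((Fin n → ℂ) × (Fin n → ℂ))) : Set (Jet n) :=
  {j | (j 0, j 1) ∈ W}

/-- A function `f(v)`, as a density. -/
def lift₀ {n : ℕ} (f : (Fin n → ℂ) → ℂ) : Density n := fun j => f (j 0)

/-- A function `k(v, v_x)`, as a density. -/
def lift₁ {n : ℕ} (k : (Fin n → ℂ) × (Fin n → ℂ) → ℂ) : Density n := fun j => k (j 0, j 1)

/-- The partial derivative `∂ f / ∂ v^α_ℓ`. -/
def jetPartial {n : ℕ} (ℓ : ℕ) (α : Fin n) (f : Density n) : Density n := fun j =>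
  deriv (fun z : ℂ => f (Function.update j ℓ (Function.update (j ℓ) α z))) (j ℓ α)

/-- The total derivative `∂_x f = ∑_{ℓ, α} v^α_{ℓ+1} ∂ f / ∂ v^α_ℓ`. -/
def totalDeriv {n : ℕ} (f : Density n) : Density n := fun j =>
  ∑ᶠ ℓ : ℕ, ∑ α, j (ℓ + 1) α * jetPartial ℓ α f j

/-- The variational derivative `δF/δv^β(x) = ∑_ℓ (-∂_x)^ℓ (∂ f / ∂ v^β_ℓ)` of `F = ∫ f dx`. -/
def varDeriv {n : ℕ} (β : Fin n) (f : Density n) : Density n := fun j =>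
  ∑ᶠ ℓ : ℕ, (-1 : ℂ) ^ ℓ * (totalDeriv^[ℓ] (jetPartial ℓ β f)) j

/-- The local functionals `∫ f dx` and `∫ g dx` agree over the set `D` of jets: they have the same
variational derivatives there. -/
def EqFunctionalOn {n : ℕ} (D : Set (Jet n)) (f g : Density n) : Prop :=
  ∀ j ∈ D, ∀ β, varDeriv β f j = varDeriv β g j

/-- The density of the Poisson bracket
`{F, G} = ∫ (δF/δv^α(x)) η^{αβ} ∂_x (δG/δv^β(x)) dx`. -/
def bracket {n : ℕ} (η : Matrix (Fin n) (Fin n) ℂ) (f g : Density n) : Density n := fun j =>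
  ∑ α, ∑ β, varDeriv α f j * η α β * totalDeriv (varDeriv β g) j

/-- `f` is, over `V`, a differential polynomial, homogeneous of degree `d` for `deg v^α_ℓ = ℓ`:
a polynomial in the `v^α_ℓ`, `ℓ ≥ 1`, whose coefficients are holomorphic functions of `v ∈ V`.
The variable with index `(ℓ, α)` stands for `v^α_{ℓ+1}`. -/
def IsDiffPoly {n : ℕ} (V : Set (Fin n → ℂ)) (d : ℕ) (f : Density n) : Prop :=
  ∃ P : MvPolynomial (ℕ × Fin n) ((Fin n → ℂ) → ℂ),
    P.IsWeightedHomogeneous (fun q : ℕ × Fin n => q.1 + 1) d ∧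
    (∀ m, AnalyticOnNhd ℂ (P.coeff m) V) ∧
    ∀ j ∈ jetsOver V,
      f j = P.eval₂ (Pi.evalRingHom (fun _ : Fin n → ℂ => ℂ) (j 0)) (fun q => j (q.1 + 1) q.2)

/-! ## Functions on the base, Riemann invariants -/

/-- `∂_α f = ∂ f / ∂ v^α` for a function of `v`. -/
def pd {n : ℕ} (α : Fin n) (f : (Fin n → ℂ) → ℂ) : (Fin n → ℂ) → ℂ := fun v =>
  fderiv ℂ f v (Pi.single α 1)

/-- The Hessian with one index raised, `η^{αβ} ∂_β ∂_γ f` (row `α`, column `γ`). For `f = h_0` it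
is the matrix `A^α_γ` of the dispersionless system. -/
def raisedHessian {n : ℕ} (η : Matrix (Fin n) (Fin n) ℂ) (f : (Fin n → ℂ) → ℂ)
    (v : Fin n → ℂ) : Matrix (Fin n) (Fin n) ℂ :=
  η * Matrix.of fun β γ => pd β (pd γ f) v

/-- The Jacobian matrix `R_{i,α} = ∂_α R_i` (row `i`, column `α`). -/
def jacobian {n : ℕ} (R : Fin n → (Fin n → ℂ) → ℂ) (v : Fin n → ℂ) : Matrix (Fin n) (Fin n) ℂ :=
  Matrix.of fun i α => pd α (R i) v

/-- `∂_i f = ∂ f / ∂ R_i = ∑_α (∂ v^α / ∂ R_i) ∂_α f`. -/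
def pdR {n : ℕ} (R : Fin n → (Fin n → ℂ) → ℂ) (i : Fin n) (f : (Fin n → ℂ) → ℂ) :
    (Fin n → ℂ) → ℂ := fun v => ∑ α, (jacobian R v)⁻¹ α i * pd α f v

/-- `R_{i,x} = ∑_α R_{i,α} v^α_x` at `w = (v, v_x)`. -/
def Rx {n : ℕ} (R : Fin n → (Fin n → ℂ) → ℂ) (i : Fin n)
    (w : (Fin n → ℂ) × (Fin n → ℂ)) : ℂ := ∑ α, pd α (R i) w.1 * w.2 α

/-- `R` is a complete set of Riemann invariants on `U`, with the pairwise distinct characteristic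
velocities `lam`, of the dispersionless system with Hamiltonian `∫ h_0(v) dx`: the evolution is
`∂_t R_i = lam_i ∂_x R_i`, that is `A^α_β R_{i,α} = lam_i R_{i,β}`. -/
structure IsRiemannInvariants {n : ℕ} (η : Matrix (Fin n) (Fin n) ℂ) (h₀ : (Fin n → ℂ) → ℂ)
    (U : Set (Fin n → ℂ)) (R lam : Fin n → (Fin n → ℂ) → ℂ) : Prop where
  analytic : ∀ i, AnalyticOnNhd ℂ (R i) U
  nondegenerate : ∀ v ∈ U, (jacobian R v).det ≠ 0
  diagonal : ∀ v ∈ U, ∀ i β,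
    ∑ α, raisedHessian η h₀ v α β * pd α (R i) v = lam i v * pd β (R i) v
  distinct : ∀ v ∈ U, Function.Injective fun i => lam i v

/-! ## Conservation laws and integrability -/

/-- `∫ f(v) dx` is a conserved quantity, over `V`, of the dispersionless system:
`f` is holomorphic and `{H_0, F_0} = 0`. -/
def IsConservationLaw {n : ℕ} (η : Matrix (Fin n) (Fin n) ℂ) (h₀ : (Fin n → ℂ) → ℂ)
    (V : Set (Fin n → ℂ)) (f : (Fin n → ℂ) → ℂ) : Prop :=
  AnalyticOnNhd ℂ f V ∧ EqFunctionalOn (jetsOver V) (bracket η (lift₀ h₀) (lift₀ f)) 0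

/-- Genericity of `∫ f(v) dx`: the eigenvalues of the raised Hessian of `f` are pairwise distinct
at every point of `V`. -/
def IsGeneric {n : ℕ} (η : Matrix (Fin n) (Fin n) ℂ)
    (V : Set (Fin n → ℂ)) (f : (Fin n → ℂ) → ℂ) : Prop :=
  ∀ v ∈ V, ∃ μ : Fin n → ℂ, Function.Injective μ ∧
    ∀ i, Module.End.HasEigenvalue (Matrix.toLin' (raisedHessian η f v)) (μ i)

/-- Integrability of the dispersionless system on `U`: near every point there is a family of
conserved quantities parametrized by `n` arbitrary functions of one variable. The `n` functions
`g_i` are the values (up to a common constant) of the density along the `n` coordinate curves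
through the point, in some system `r` of local coordinates. -/
def IsIntegrable {n : ℕ} (η : Matrix (Fin n) (Fin n) ℂ) (h₀ : (Fin n → ℂ) → ℂ)
    (U : Set (Fin n → ℂ)) : Prop :=
  ∀ p ∈ U, ∃ r : Fin n → (Fin n → ℂ) → ℂ,
    (∀ i, AnalyticAt ℂ (r i) p) ∧ (jacobian r p).det ≠ 0 ∧
    ∀ g : Fin n → ℂ → ℂ, (∀ i, AnalyticAt ℂ (g i) (r i p)) →
      ∃ (V : Set (Fin n → ℂ)) (f : (Fin n → ℂ) → ℂ), IsOpen V ∧ p ∈ V ∧ V ⊆ U ∧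
        IsConservationLaw η h₀ V f ∧
        ∀ i, ∀ v ∈ V, (∀ k, k ≠ i → r k v = r k p) →
          f v - f p = g i (r i v) - g i (r i p)

/-- `O(ε^N)`-integrability on `U` of the system with Hamiltonian `H = ∑_k ε^k ∫ h_k dx`: its
dispersionless limit is integrable, and every generic conservation law `F_0 = ∫ f_0 dx` of the
dispersionless limit (over any open `V ⊆ U`) extends, near each point, to some
`F = ∑_k ε^k ∫ F_k dx` with `{H, F} = O(ε^{N+1})`, where `F_k` is a differential polynomial
homogeneous of degree `k`. -/
def IsOIntegrable {n : ℕ} (N : ℕ) (η : Matrix (Fin n) (Fin n) ℂ) (h₀ : (Fin n → ℂ) → ℂ)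
    (h : ℕ → Density n) (U : Set (Fin n → ℂ)) : Prop :=
  IsIntegrable η h₀ U ∧
  ∀ (V : Set (Fin n → ℂ)) (f₀ : (Fin n → ℂ) → ℂ), IsOpen V → V ⊆ U →
    IsConservationLaw η h₀ V f₀ → IsGeneric η V f₀ →
    ∀ p ∈ V, ∃ (V' : Set (Fin n → ℂ)) (F : ℕ → Density n), IsOpen V' ∧ p ∈ V' ∧ V' ⊆ V ∧
      F 0 = lift₀ f₀ ∧ (∀ k, IsDiffPoly V' k (F k)) ∧
      ∀ m ≤ N, EqFunctionalOn (jetsOver V')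
        (∑ ab ∈ Finset.HasAntidiagonal.antidiagonal m, bracket η (h ab.1) (F ab.2)) 0

/-! ## Quasi-triviality -/

/-- `K = ∫ k_0(v) dx + ε ∫ k_1(v, v_x) dx` generates, for `(v, v_x)` in the open set `W`, a
canonical quasi-Miura transformation which carries `H_0` to `H = ∑_k ε^k ∫ h_k dx` up to second
order: `H_0 + ε {H_0, K} + ε²/2 {{H_0, K}, K} = H + O(ε³)`. Here `k_0`, `k_1` are holomorphic,
and the variational derivatives of `∫ k_1 dx` are homogeneous of degree `1`. -/
structure IsQuasiGenerator {n : ℕ} (η : Matrix (Fin n) (Fin n) ℂ) (h₀ : (Fin n → ℂ) → ℂ)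
    (h : ℕ → Density n) (W : Set ((Fin n → ℂ) × (Fin n → ℂ))) (k₀ : (Fin n → ℂ) → ℂ)
    (k₁ : (Fin n → ℂ) × (Fin n → ℂ) → ℂ) : Prop where
  analytic₀ : AnalyticOnNhd ℂ k₀ (Prod.fst '' W)
  analytic₁ : AnalyticOnNhd ℂ k₁ W
  homogeneous : ∀ j ∈ jetsOver₁ W, ∀ β,
    ∑ᶠ r : ℕ, ∑ α, (r : ℂ) * j r α * jetPartial r α (varDeriv β (lift₁ k₁)) j =
      varDeriv β (lift₁ k₁) j
  first : EqFunctionalOn (jetsOver (Prod.fst '' W)) (h 1) (bracket η (lift₀ h₀) (lift₀ k₀))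
  second : EqFunctionalOn (jetsOver₁ W) (h 2)
    (bracket η (lift₀ h₀) (lift₁ k₁) +
      (1 / 2 : ℂ) • bracket η (bracket η (lift₀ h₀) (lift₀ k₀)) (lift₀ k₀))

/-- Quasi-triviality on `U` at the second order approximation: over every point of `U` there is a
jet `(p, q)` near which `H` is generated from `H_0` by some canonical quasi-Miura
transformation. -/
def IsQuasiTrivial {n : ℕ} (η : Matrix (Fin n) (Fin n) ℂ) (h₀ : (Fin n → ℂ) → ℂ)
    (h : ℕ → Density n) (U : Set (Fin n → ℂ)) : Prop :=
  ∀ p ∈ U, ∃ (q : Fin n → ℂ) (W : Set ((Fin n → ℂ) × (Fin n → ℂ))),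
    IsOpen W ∧ (p, q) ∈ W ∧ Prod.fst '' W ⊆ U ∧
    ∃ k₀ k₁, IsQuasiGenerator η h₀ h W k₀ k₁

/-- `L i` is a holomorphic branch of `log R_{i,x}` on `W`, for every `i`. -/
def IsLogBranch {n : ℕ} (R : Fin n → (Fin n → ℂ) → ℂ) (W : Set ((Fin n → ℂ) × (Fin n → ℂ)))
    (L : Fin n → (Fin n → ℂ) × (Fin n → ℂ) → ℂ) : Prop :=
  ∀ i, AnalyticOnNhd ℂ (L i) W ∧ ∀ w ∈ W, Complex.exp (L i w) = Rx R i w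

/-- `C_i` are holomorphic functions of the single variable `R_i`, and `φ_i` are holomorphic
functions of `(R_1, …, R_n)`, over `V`. -/
def IsCoefficients {n : ℕ} (R : Fin n → (Fin n → ℂ) → ℂ) (V : Set (Fin n → ℂ))
    (C : Fin n → ℂ → ℂ) (φ : Fin n → (Fin n → ℂ) → ℂ) : Prop :=
  ∀ i, AnalyticOnNhd ℂ (C i) (R i '' V) ∧ AnalyticOnNhd ℂ (φ i) V

/-- `∑_i (C_i(R_i) R_{i,x} log R_{i,x} - C_i(R_i) R_{i,x} + φ_i R_{i,x})`, with the branch `L` of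
the logarithms. -/
def generatorForm {n : ℕ} (R : Fin n → (Fin n → ℂ) → ℂ) (C : Fin n → ℂ → ℂ)
    (φ : Fin n → (Fin n → ℂ) → ℂ) (L : Fin n → (Fin n → ℂ) × (Fin n → ℂ) → ℂ)
    (w : (Fin n → ℂ) × (Fin n → ℂ)) : ℂ :=
  ∑ i, (C i (R i w.1) * Rx R i w * L i w - C i (R i w.1) * Rx R i w + φ i w.1 * Rx R i w)

/-- `-∑_i C_i(R_i) lam_{i,i} R_{i,x}² + ½ ∑_{i≠k} (lam_i - lam_k) s_{ik} R_{i,x} R_{k,x}`, where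
`s_{ik} = φ_{i,k} - φ_{k,i}`. -/
def hamiltonianForm {n : ℕ} (R lam : Fin n → (Fin n → ℂ) → ℂ) (C : Fin n → ℂ → ℂ)
    (φ : Fin n → (Fin n → ℂ) → ℂ) (w : (Fin n → ℂ) × (Fin n → ℂ)) : ℂ :=
  -(∑ i, C i (R i w.1) * pdR R i (lam i) w.1 * Rx R i w ^ 2) +
    1 / 2 * ∑ i, ∑ k ∈ Finset.univ.filter (fun k => k ≠ i),
      (lam i w.1 - lam k w.1) * (pdR R k (φ i) w.1 - pdR R i (φ k) w.1) * Rx R i w * Rx R k w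

end HamPDE

end

open HamPDE

/-!
Integrability and quasi-triviality are both equivalent to a local normal form of the perturbation
(`HasLocalNormalForm`): near every point there is `K₀ = ∫ k₀(v) dx` such that `H₁ = {H₀, K₀}` and
`H₂ - ½{{H₀, K₀}, K₀}` is
`∫ (-∑ C_i(R_i) λ_{i,i} R_{i,x}² + ½ ∑ (λ_i - λ_j) s_ij R_{i,x} R_{j,x}) dx` with
`s_ij = φ_{i,j} - φ_{j,i}`.

The computations take place in a `JetAlgebra`, a ring of functions of `v, v_x, v_xx, …` with its
partial derivatives; trivial functionals are its elements with vanishing variational derivatives,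
and the Jacobi identity holds modulo these. Functionals are expanded in the frame of Riemann
invariants, in which `η⁻¹` is diagonal, with Christoffel coefficients
`Γ^i_{ij} = λ_{i,j} / (λ_j - λ_i)`, and every conserved quantity of the dispersionless limit is
again a diagonal Hamiltonian, with velocities `μ_i` satisfying the same equations as `λ_i`.

*Integrable ⇒ normal form* (`IsOIntegrable.hasLocalNormalForm`). Integrability yields conserved
quantities with prescribed `μ_i` and `∂_i μ_i` at a given point (`IsIntegrable.exists_velocities`).
The equation `H₁ = {H₀, K₀}` reduces to an overdetermined linear system
`∂_j u_i = Γ^i_{ij} u_i + Γ^j_{ji} u_j + k_ij`, `i ≠ j`, which is solved as a Goursat problem. Its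
compatibility conditions, times `(μ_j - μ_i)(λ_l - λ_j) - (λ_j - λ_i)(μ_l - μ_j)`, follow from the
existence of first order extensions (`IsOIntegrable.first_order_compat`). At second order, a
quadratic functional is given by coefficients `c_i` and `s_ij = -s_ji`, and the existence of
extensions forces `∂_k c_i = 0` for `k ≠ i` and `ds = 0` (`IsOIntegrable.second_order_compat`);
the former uses `λ_{i,i} ≠ 0`, and the latter gives the potential `φ` of `s`.

*Normal form ⇒ integrable* (`HasLocalNormalForm.isOIntegrable`). The functional with `λ` replaced
by `μ` extends a conserved quantity, after the transformation generated by `K₀`. As the extension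
has to be a differential polynomial over all of a neighbourhood, no logarithms may be used here.

*Normal form ⇔ quasi-trivial* (`HasLocalNormalForm.exists_generator`,
`IsQuasiTrivial.hasLocalNormalForm`). The logarithms cancel in the bracket of `H₀` with
`∫ ∑ (C_i R_{i,x} log R_{i,x} - C_i R_{i,x} + φ_i R_{i,x}) dx`: it is the functional of the normal
form, with `φ` shifted by potentials of `C_i Γ^i_{ik}` (`bracket_generatorForm`). Conversely, if
`{H₀, K₁}` has a quadratic density and `K₁` is homogeneous of degree one, the mixed second
derivatives of `k₁` in the `R_{i,x}` vanish, and by homogeneity `∂²k₁ / ∂R_{i,x}²` is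
`c_i(v) / R_{i,x}`; that `c_i` depends on `R_i` only follows again from the form of the bracket
(`exists_logForm`).

The results on holomorphic functions of several variables that this needs (complex
differentiable functions are analytic, Poincaré lemmas, the Goursat problem by iteration of an
integral operator) are proved below.
-/

noncomputable section

namespace HamPDE

local notation:max "ℂ^" n:max => Fin n → ℂ
local notation "Holo" => AnalyticOnNhd ℂ
local notation "DiffOn" => DifferentiableOn ℂ
local notation "π" => Set.image Prod.fst

variable {n : ℕ} {A : Type*} [CommRing A] [Algebra ℂ A] {η : Matrix (Fin n) (Fin n) ℂ}
  {i j k l : Fin n}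

open Derivation (leibniz)
open Finset (sum_congr mul_sum sum_add_distrib sum_comm sum_eq_zero sum_sub_distrib sum_mul
  sum_eq_single analyticAt_fun_sum sum_range_succ mem_univ sum_range_one smul_sum)

section

variable {ι M : Type*} {s : Finset ι} {N : ℕ} {a b : A}

/-! ### Jet algebras -/

theorem sum_ext [AddCommMonoid M] {f g : ι → M} (h : ∀ i, f i = g i) :
    ∑ i ∈ s, f i = ∑ i ∈ s, g i := sum_congr rfl fun i _ => h i

theorem sum_ext₂ {κ : Type*} [AddCommMonoid M] {t : Finset κ} {f g : ι → κ → M}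
    (h : ∀ i j, f i j = g i j) : ∑ i ∈ s, ∑ j ∈ t, f i j = ∑ i ∈ s, ∑ j ∈ t, g i j :=
  sum_ext fun i => sum_ext fun j => h i j

/-- An algebra of functions of the jet variables `x ℓ α = v^α_ℓ`: a commutative algebra with
commuting derivations `d ℓ α = ∂ / ∂ v^α_ℓ`, each element of which depends on finitely many jet
variables only. -/
structure JetAlgebra (n : ℕ) (A : Type*) [CommRing A] [Algebra ℂ A] where
  x : ℕ → Fin n → A
  d : ℕ → Fin n → Derivation ℂ A A
  d_x : ∀ k β ℓ α, d ℓ α (x k β) = if k = ℓ ∧ β = α then 1 else 0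
  d_comm : ∀ k β ℓ α a, d k β (d ℓ α a) = d ℓ α (d k β a)
  finite_order : ∀ a, ∃ N, ∀ ℓ ≥ N, ∀ α, d ℓ α a = 0

namespace JetAlgebra

variable (S : JetAlgebra n A)

/-- `a` depends on the jet variables `v_ℓ` with `ℓ < N` only. -/
def OrdLT (N : ℕ) (a : A) : Prop := ∀ ℓ ≥ N, ∀ α, S.d ℓ α a = 0

variable {S} in
theorem OrdLT.mono {M : ℕ} (h : S.OrdLT N a) (hNM : N ≤ M) : S.OrdLT M a :=
  fun ℓ hℓ α => h ℓ (hNM.trans hℓ) α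

variable {S} in
theorem OrdLT.d (h : S.OrdLT N a) (ℓ : ℕ) (α : Fin n) : S.OrdLT N (S.d ℓ α a) :=
  fun k hk β => by rw [S.d_comm, h k hk β, map_zero]

variable {S} in
theorem OrdLT.add (ha : S.OrdLT N a) (hb : S.OrdLT N b) :
    S.OrdLT N (a + b) := fun ℓ hℓ α => by rw [map_add, ha ℓ hℓ, hb ℓ hℓ, add_zero]

variable {S} in
theorem OrdLT.sub (ha : S.OrdLT N a) (hb : S.OrdLT N b) :
    S.OrdLT N (a - b) := fun ℓ hℓ α => by rw [map_sub, ha ℓ hℓ, hb ℓ hℓ, sub_zero]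

variable {S} in
theorem OrdLT.mul (ha : S.OrdLT N a) (hb : S.OrdLT N b) : S.OrdLT N (a * b) := fun ℓ hℓ α => by
  rw [leibniz, ha ℓ hℓ, hb ℓ hℓ, smul_zero, smul_zero, add_zero]

variable {S} in
theorem OrdLT.neg (ha : S.OrdLT N a) : S.OrdLT N (-a) :=
  fun ℓ hℓ α => by rw [map_neg, ha ℓ hℓ, neg_zero]

variable {S} in
theorem OrdLT.sum {a : ι → A}
    (ha : ∀ i ∈ s, S.OrdLT N (a i)) : S.OrdLT N (∑ i ∈ s, a i) := fun ℓ hℓ α => by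
  rw [map_sum]; exact sum_eq_zero fun i hi => ha i hi ℓ hℓ α

theorem ordLT_algebraMap (N : ℕ) (c : ℂ) : S.OrdLT N (algebraMap ℂ A c) :=
  fun _ _ _ => Derivation.map_algebraMap _ c

theorem finite_ord (a : A) : ∃ N, S.OrdLT N a := S.finite_order a

theorem exists_ordLT₂ (a b : A) : ∃ N, S.OrdLT N a ∧ S.OrdLT N b := by
  obtain ⟨N, hN⟩ := S.finite_ord a
  obtain ⟨M, hM⟩ := S.finite_ord b
  exact ⟨max N M, hN.mono (le_max_left _ _), hM.mono (le_max_right _ _)⟩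

theorem finsum_eq_sum_range [AddCommMonoid M] {f : ℕ → M} (h : ∀ ℓ ≥ N, f ℓ = 0) : ∑ᶠ ℓ, f ℓ = ∑ ℓ ∈ Finset.range N, f ℓ := by
  apply finsum_eq_sum_of_support_subset
  intro ℓ hℓ
  simp only [Finset.coe_range, Set.mem_Iio]
  by_contra hc
  exact hℓ (h ℓ (not_lt.mp hc))

/-- The action of the vector field `∑ Y ℓ α ∂ / ∂ v^α_ℓ`. -/
def vfFun (Y : ℕ → Fin n → A) (a : A) : A := ∑ᶠ ℓ : ℕ, ∑ α, Y ℓ α * S.d ℓ α a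

variable {S} in
theorem vfFun_eq_sum (Y : ℕ → Fin n → A) (h : S.OrdLT N a) :
    S.vfFun Y a = ∑ ℓ ∈ Finset.range N, ∑ α, Y ℓ α * S.d ℓ α a :=
  finsum_eq_sum_range fun ℓ hℓ => sum_eq_zero fun α _ => by rw [h ℓ hℓ, mul_zero]

/-- The vector field `∑ Y ℓ α ∂ / ∂ v^α_ℓ` on the space of jets, as a derivation. -/
def vf (Y : ℕ → Fin n → A) : Derivation ℂ A A := Derivation.mk'
  { toFun := S.vfFun Y
    map_add' := fun a b => by
      obtain ⟨N, ha, hb⟩ := S.exists_ordLT₂ a b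
      rw [vfFun_eq_sum Y ha, vfFun_eq_sum Y hb, vfFun_eq_sum Y (ha.add hb), ← sum_add_distrib]
      simp only [map_add, mul_add, sum_add_distrib]
    map_smul' := fun c a => by
      obtain ⟨N, ha⟩ := S.finite_ord a
      have hc : S.OrdLT N (c • a) := fun ℓ hℓ α => by rw [Derivation.map_smul, ha ℓ hℓ, smul_zero]
      rw [vfFun_eq_sum Y ha, vfFun_eq_sum Y hc]
      simp only [Derivation.map_smul, Algebra.mul_smul_comm, RingHom.id_apply, smul_sum] }
  (fun a b => by
    obtain ⟨N, ha, hb⟩ := S.exists_ordLT₂ a b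
    change S.vfFun Y (a * b) = a • S.vfFun Y b + b • S.vfFun Y a
    rw [vfFun_eq_sum Y ha, vfFun_eq_sum Y hb, vfFun_eq_sum Y (ha.mul hb)]
    simp only [smul_eq_mul, mul_sum, ← sum_add_distrib, leibniz]
    exact sum_ext₂ fun ℓ α => by ring)

variable {S} in
theorem vf_eq_sum (Y : ℕ → Fin n → A) (h : S.OrdLT N a) :
    S.vf Y a = ∑ q ∈ Finset.range N ×ˢ Finset.univ, Y q.1 q.2 * S.d q.1 q.2 a := by
  rw [Finset.sum_product]; exact vfFun_eq_sum Y h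

variable {S} in
theorem vf_eq_sum' (Y : ℕ → Fin n → A) (h : S.OrdLT N a) :
    S.vf Y a = ∑ ℓ ∈ Finset.range N, ∑ α, Y ℓ α * S.d ℓ α a := vfFun_eq_sum Y h

variable {S} in
/-- A vector field acts on functions of order `0` through its components of order `0`. -/
theorem vf_ordLT_one (Y : ℕ → Fin n → A) (h : S.OrdLT 1 a) : S.vf Y a = ∑ α, Y 0 α * S.d 0 α a := by
  rw [vf_eq_sum' Y h, sum_range_one]

theorem ordLT_x (ℓ : ℕ) (α : Fin n) : S.OrdLT (ℓ + 1) (S.x ℓ α) := fun k hk β => by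
  rw [S.d_x, if_neg (by omega)]

@[simp] theorem vf_x (Y : ℕ → Fin n → A) (ℓ : ℕ) (α : Fin n) : S.vf Y (S.x ℓ α) = Y ℓ α := by
  rw [vf_eq_sum' Y (S.ordLT_x ℓ α)]
  simp only [S.d_x, mul_ite, mul_one, mul_zero]
  rw [sum_eq_single ℓ, sum_eq_single α]
  · simp
  · intro β _ hβ; simp [hβ.symm]
  · simp
  · intro k _ hk; simp [hk.symm]
  · simp

/-- The commutator of two vector fields on the space of jets. -/
theorem vf_commutator (Y Z : ℕ → Fin n → A) (a : A) :
    S.vf Y (S.vf Z a) - S.vf Z (S.vf Y a) =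
      S.vf (fun ℓ α => S.vf Y (Z ℓ α) - S.vf Z (Y ℓ α)) a := by
  obtain ⟨N, ha⟩ := S.finite_ord a
  have key : ∀ P Q : ℕ → Fin n → A, S.vf P (S.vf Q a) =
      ∑ q ∈ Finset.range N ×ˢ Finset.univ, S.vf P (Q q.1 q.2) * S.d q.1 q.2 a +
      ∑ q ∈ Finset.range N ×ˢ Finset.univ, ∑ r ∈ Finset.range N ×ˢ Finset.univ,
        Q q.1 q.2 * P r.1 r.2 * S.d r.1 r.2 (S.d q.1 q.2 a) := by
    intro P Q
    rw [vf_eq_sum Q ha, map_sum, ← sum_add_distrib]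
    refine sum_ext fun q => ?_
    rw [leibniz, vf_eq_sum P (ha.d q.1 q.2), smul_eq_mul, smul_eq_mul, mul_sum, add_comm]
    congr 1
    · ring
    · exact sum_ext fun r => by ring
  rw [key, key, vf_eq_sum _ ha]
  have h2 : ∑ q ∈ Finset.range N ×ˢ Finset.univ, ∑ r ∈ Finset.range N ×ˢ Finset.univ,
        Z q.1 q.2 * Y r.1 r.2 * S.d r.1 r.2 (S.d q.1 q.2 a) =
      ∑ q ∈ Finset.range N ×ˢ Finset.univ, ∑ r ∈ Finset.range N ×ˢ Finset.univ,
        Y q.1 q.2 * Z r.1 r.2 * S.d r.1 r.2 (S.d q.1 q.2 a) := by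
    rw [sum_comm]
    refine sum_ext₂ fun q r => ?_
    rw [S.d_comm]; ring
  rw [h2, add_sub_add_right_eq_sub, ← sum_sub_distrib]
  exact sum_ext fun q => by ring

/-- The total derivative `∂_x`. -/
def D : Derivation ℂ A A := S.vf fun ℓ α => S.x (ℓ + 1) α

/-- The evolutionary vector field with characteristic `X`: the prolongation of `∂_t v = X` to
jets. -/
def pr (X : Fin n → A) : Derivation ℂ A A := S.vf fun ℓ α => S.D^[ℓ] (X α)

@[simp] theorem D_x (ℓ : ℕ) (α : Fin n) : S.D (S.x ℓ α) = S.x (ℓ + 1) α := S.vf_x _ ℓ α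

theorem d_D_succ (ℓ : ℕ) (α : Fin n) (a : A) :
    S.d (ℓ + 1) α (S.D a) = S.D (S.d (ℓ + 1) α a) + S.d ℓ α a := by
  obtain ⟨N, ha⟩ := S.finite_ord a
  have ha' := ha.mono (Nat.le_add_right N (ℓ + 1))
  rw [D, vf_eq_sum _ ha', vf_eq_sum _ (ha'.d _ _), map_sum]
  simp only [leibniz, smul_eq_mul, S.d_x, sum_add_distrib]
  congr 1
  · exact sum_ext fun q => by rw [S.d_comm]
  · rw [sum_eq_single (ℓ, α)]
    · simp
    · rintro ⟨k, β⟩ _ hq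
      rw [if_neg, mul_zero]
      rintro ⟨h1, h2⟩
      exact hq (by simp only at h1 h2; rw [Prod.mk.injEq]; exact ⟨by omega, h2⟩)
    · intro hq
      exact absurd (Finset.mem_product.mpr
        ⟨Finset.mem_range.mpr (by simp only; omega), mem_univ _⟩) hq

theorem d_D_zero (α : Fin n) (a : A) : S.d 0 α (S.D a) = S.D (S.d 0 α a) := by
  obtain ⟨N, ha⟩ := S.finite_ord a
  rw [D, vf_eq_sum _ ha, vf_eq_sum _ (ha.d _ _), map_sum]
  simp only [leibniz, smul_eq_mul, S.d_x]
  refine sum_ext fun q => ?_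
  rw [S.d_comm, if_neg (by omega), mul_zero, add_zero]

variable {S} in
theorem OrdLT.D (h : S.OrdLT N a) : S.OrdLT (N + 1) (S.D a) := by
  intro ℓ hℓ α
  obtain ⟨k, rfl⟩ : ∃ k, ℓ = k + 1 := ⟨ℓ - 1, by omega⟩
  rw [S.d_D_succ, h _ (by omega), h _ (by omega), map_zero, add_zero]

theorem D_iterate_succ (ℓ : ℕ) (a : A) : S.D^[ℓ + 1] a = S.D (S.D^[ℓ] a) :=
  Function.iterate_succ_apply' _ _ _

theorem D_iterate_add (ℓ : ℕ) (a b : A) : S.D^[ℓ] (a + b) = S.D^[ℓ] a + S.D^[ℓ] b :=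
  iterate_map_add S.D ℓ a b

theorem D_iterate_sub (ℓ : ℕ) (a b : A) : S.D^[ℓ] (a - b) = S.D^[ℓ] a - S.D^[ℓ] b :=
  iterate_map_sub S.D ℓ a b

theorem D_iterate_zero (ℓ : ℕ) : S.D^[ℓ] (0 : A) = 0 := iterate_map_zero S.D ℓ

theorem D_iterate_smul (ℓ : ℕ) (c : ℂ) (a : A) : S.D^[ℓ] (c • a) = c • S.D^[ℓ] a := by
  induction ℓ with
  | zero => rfl
  | succ ℓ ih => rw [D_iterate_succ, D_iterate_succ, ih, Derivation.map_smul]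

theorem pr_D (X : Fin n → A) (a : A) : S.pr X (S.D a) = S.D (S.pr X a) := by
  have h := S.vf_commutator (fun ℓ α => S.D^[ℓ] (X α)) (fun ℓ α => S.x (ℓ + 1) α) a
  have h0 : (fun (ℓ : ℕ) (α : Fin n) => S.vf (fun ℓ α => S.D^[ℓ] (X α)) (S.x (ℓ + 1) α) -
      S.vf (fun ℓ α => S.x (ℓ + 1) α) (S.D^[ℓ] (X α))) = fun _ _ => 0 := by
    funext ℓ α
    rw [vf_x, D_iterate_succ, ← D, sub_self]
  rw [h0] at h
  have h1 : S.vf (fun _ _ => (0 : A)) a = 0 := by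
    obtain ⟨N, ha⟩ := S.finite_ord a
    rw [vf_eq_sum _ ha]
    exact sum_eq_zero fun _ _ => zero_mul _
  rw [h1, sub_eq_zero] at h
  exact h

theorem pr_D_iterate (X : Fin n → A) (ℓ : ℕ) (a : A) : S.pr X (S.D^[ℓ] a) = S.D^[ℓ] (S.pr X a) := by
  induction ℓ with
  | zero => rfl
  | succ ℓ ih => rw [D_iterate_succ, D_iterate_succ, pr_D, ih]

theorem pr_commutator (X Y : Fin n → A) (a : A) :
    S.pr X (S.pr Y a) - S.pr Y (S.pr X a) = S.pr (fun α => S.pr X (Y α) - S.pr Y (X α)) a := by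
  have h := S.vf_commutator (fun ℓ α => S.D^[ℓ] (X α)) (fun ℓ α => S.D^[ℓ] (Y α)) a
  refine h.trans ?_
  congr 1
  rw [pr]
  congr 1
  funext ℓ α
  rw [D_iterate_sub, ← S.pr_D_iterate X, ← S.pr_D_iterate Y]; rfl

/-! ### Variational derivatives -/

/-- The variational derivative `δ/δv^β`. -/
def δ (β : Fin n) : A →ₗ[ℂ] A where
  toFun a := ∑ᶠ ℓ : ℕ, (-1) ^ ℓ * S.D^[ℓ] (S.d ℓ β a)
  map_add' a b := by
    obtain ⟨N, ha, hb⟩ := S.exists_ordLT₂ a b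
    have h : ∀ a, S.OrdLT N a → ∀ ℓ ≥ N, (-1) ^ ℓ * S.D^[ℓ] (S.d ℓ β a) = 0 := fun a ha ℓ hℓ => by
      rw [ha ℓ hℓ, D_iterate_zero, mul_zero]
    rw [finsum_eq_sum_range (h a ha), finsum_eq_sum_range (h b hb),
      finsum_eq_sum_range (h _ (ha.add hb)), ← sum_add_distrib]
    exact sum_ext fun ℓ => by rw [map_add, D_iterate_add, mul_add]
  map_smul' c a := by
    rw [RingHom.id_apply, smul_finsum]
    exact finsum_congr fun ℓ => by rw [Derivation.map_smul, D_iterate_smul, Algebra.mul_smul_comm]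

variable {S} in
theorem δ_eq_sum (β : Fin n) (h : S.OrdLT N a) :
    S.δ β a = ∑ ℓ ∈ Finset.range N, (-1) ^ ℓ * S.D^[ℓ] (S.d ℓ β a) :=
  finsum_eq_sum_range fun ℓ hℓ => by rw [h ℓ hℓ, D_iterate_zero, mul_zero]

/-- The elements whose variational derivatives vanish: two densities define the same local
functional if and only if their difference is null. -/
def null : Submodule ℂ A := ⨅ β, LinearMap.ker (S.δ β)

theorem mem_null : a ∈ S.null ↔ ∀ β, S.δ β a = 0 := by simp [null]

variable {S} in
theorem δ_congr (h : a - b ∈ S.null) (β : Fin n) : S.δ β a = S.δ β b := by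
  rw [← sub_eq_zero, ← map_sub]; exact S.mem_null.mp h β

/-- The total derivatives. -/
def tot : Submodule ℂ A := LinearMap.range (S.D : A →ₗ[ℂ] A)

theorem D_mem_tot (a : A) : S.D a ∈ S.tot := ⟨a, rfl⟩

theorem δ_D (β : Fin n) (a : A) : S.δ β (S.D a) = 0 := by
  obtain ⟨N, ha⟩ := S.finite_ord a
  have h : ∀ M, ∑ ℓ ∈ Finset.range (M + 1), (-1) ^ ℓ * S.D^[ℓ] (S.d ℓ β (S.D a)) =
      (-1) ^ M * S.D^[M + 1] (S.d M β a) := by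
    intro M
    induction M with
    | zero => simp [d_D_zero]
    | succ M ih =>
      rw [sum_range_succ, ih, d_D_succ, D_iterate_add, ← Function.iterate_succ_apply, pow_succ]
      ring
  rw [δ_eq_sum β ha.D, h, ha N le_rfl, D_iterate_zero, mul_zero]

theorem tot_le_null : S.tot ≤ S.null := by
  rintro _ ⟨a, rfl⟩
  exact S.mem_null.mpr fun β => S.δ_D β a

theorem D_mem_null (a : A) : S.D a ∈ S.null := S.tot_le_null (S.D_mem_tot a)

theorem pr_mem_tot (X : Fin n → A) (h : a ∈ S.tot) : S.pr X a ∈ S.tot := by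
  obtain ⟨b, rfl⟩ := h
  exact ⟨S.pr X b, (S.pr_D X b).symm⟩

/-- Repeated integration by parts. -/
theorem D_iterate_mul_sub_mem_tot (ℓ : ℕ) (a b : A) :
    S.D^[ℓ] a * b - a * ((-1) ^ ℓ * S.D^[ℓ] b) ∈ S.tot := by
  induction ℓ generalizing b with
  | zero => simp
  | succ ℓ ih =>
    have h := sub_mem (S.D_mem_tot (S.D^[ℓ] a * b)) (ih (S.D b))
    rw [leibniz, smul_eq_mul, smul_eq_mul, ← Function.iterate_succ_apply S.D ℓ b] at h
    rw [D_iterate_succ ]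
    convert h using 1
    rw [D_iterate_succ]
    ring

/-- The first variation formula. -/
theorem pr_sub_mem_tot (X : Fin n → A) (a : A) : S.pr X a - ∑ α, X α * S.δ α a ∈ S.tot := by
  obtain ⟨N, ha⟩ := S.finite_ord a
  have h : S.pr X a - ∑ α, X α * S.δ α a = ∑ ℓ ∈ Finset.range N, ∑ α,
      (S.D^[ℓ] (X α) * S.d ℓ α a - X α * ((-1) ^ ℓ * S.D^[ℓ] (S.d ℓ α a))) := by
    rw [pr, vf_eq_sum' _ ha]
    simp only [δ_eq_sum _ ha, mul_sum, sum_sub_distrib]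
    rw [sum_comm (s := Finset.univ)]
  rw [h]
  exact sum_mem fun ℓ _ => sum_mem fun α _ => S.D_iterate_mul_sub_mem_tot ℓ _ _

/-- The second variation is symmetric: the variational derivatives of a functional satisfy the
Helmholtz conditions. -/
theorem second_variation_symm (X Y : Fin n → A) (a : A) :
    ∑ α, Y α * S.pr X (S.δ α a) - ∑ α, X α * S.pr Y (S.δ α a) ∈ S.tot := by
  have h1 := S.pr_mem_tot X (S.pr_sub_mem_tot Y a)
  have h2 := S.pr_mem_tot Y (S.pr_sub_mem_tot X a)
  have h3 := S.pr_sub_mem_tot (fun α => S.pr X (Y α) - S.pr Y (X α)) a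
  rw [← pr_commutator] at h3
  have h := add_mem (sub_mem h2 h1) h3
  convert h using 1
  simp only [map_sub, map_sum, leibniz, smul_eq_mul, sum_add_distrib, mul_sub,
    sum_sub_distrib, mul_comm]
  ring

/-! ### The Poisson bracket -/

variable (η : Matrix (Fin n) (Fin n) ℂ)

/-- The Hamiltonian vector field of `b`. -/
def ham (b : A) (α : Fin n) : A := ∑ β, algebraMap ℂ A (η α β) * S.D (S.δ β b)

/-- The density of the Poisson bracket of two local functionals. -/
def br (a b : A) : A := ∑ α, S.δ α a * S.ham η b α

theorem D_algebraMap (c : ℂ) : S.D (algebraMap ℂ A c) = 0 := Derivation.map_algebraMap _ c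

theorem pr_sub_br_mem_tot (a b : A) : S.pr (S.ham η b) a - S.br η a b ∈ S.tot := by
  have h := S.pr_sub_mem_tot (S.ham η b) a
  simpa only [br, mul_comm] using h

theorem pr_sub_br_mem_null (a b : A) : S.pr (S.ham η b) a - S.br η a b ∈ S.null :=
  S.tot_le_null (S.pr_sub_br_mem_tot η a b)

variable {S η} in
theorem br_congr {a' b' : A} (ha : a - a' ∈ S.null) (hb : b - b' ∈ S.null) :
    S.br η a b = S.br η a' b' := by
  simp only [br, ham, δ_congr ha, δ_congr hb]

theorem br_add_left (a b c : A) : S.br η (a + b) c = S.br η a c + S.br η b c := by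
  simp only [br, map_add, add_mul, sum_add_distrib]

theorem br_smul_left (r : ℂ) (a c : A) : S.br η (r • a) c = r • S.br η a c := by
  simp only [br, map_smul, smul_mul_assoc, smul_sum]

theorem ham_add (a b : A) (α : Fin n) : S.ham η (a + b) α = S.ham η a α + S.ham η b α := by
  simp only [ham, map_add, mul_add, sum_add_distrib]

theorem ham_smul (r : ℂ) (a : A) (α : Fin n) : S.ham η (r • a) α = r • S.ham η a α := by
  simp only [ham, map_smul, Derivation.map_smul, mul_smul_comm, smul_sum]

theorem br_add_right (a b c : A) : S.br η a (b + c) = S.br η a b + S.br η a c := by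
  simp only [br, ham_add, mul_add, sum_add_distrib]

theorem br_smul_right (r : ℂ) (a c : A) : S.br η a (r • c) = r • S.br η a c := by
  simp only [br, ham_smul, mul_smul_comm, smul_sum]

theorem br_zero_right (a : A) : S.br η a 0 = 0 := by simp [br, ham]

theorem br_zero_left (a : A) : S.br η 0 a = 0 := by simp [br]

variable {η} (hη : η.IsSymm)
include hη

/-- Skew-symmetry of the Poisson bracket. -/
theorem br_add_br_mem_tot (a b : A) : S.br η a b + S.br η b a ∈ S.tot := by
  refine ⟨∑ α, ∑ β, algebraMap ℂ A (η α β) * (S.δ α a * S.δ β b), ?_⟩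
  change S.D _ = _
  simp only [map_sum, leibniz, smul_eq_mul, D_algebraMap, br, ham, mul_zero, add_zero,
    mul_add, sum_add_distrib, mul_sum]
  congr 1
  · exact sum_ext₂ fun α β => by ring
  · rw [sum_comm]
    refine sum_ext₂ fun α β => ?_
    rw [hη.apply]; ring

theorem br_br_sub_mem_tot (a b c : A) :
    S.br η (S.br η a b) c - (∑ α, S.ham η b α * S.pr (S.ham η c) (S.δ α a) -
      ∑ α, S.ham η a α * S.pr (S.ham η c) (S.δ α b)) ∈ S.tot := by
  have h1 := neg_mem (S.pr_sub_br_mem_tot η (S.br η a b) c)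
  have h2 := S.D_mem_tot (∑ α, ∑ β, algebraMap ℂ A (η α β) * (S.δ α a * S.pr (S.ham η c) (S.δ β b)))
  have h := add_mem h1 h2
  convert h using 1
  have e1 : S.pr (S.ham η c) (S.br η a b) = ∑ α, S.ham η b α * S.pr (S.ham η c) (S.δ α a) +
      ∑ α, ∑ β, algebraMap ℂ A (η α β) * (S.δ α a * S.D (S.pr (S.ham η c) (S.δ β b))) := by
    rw [br, map_sum, ← sum_add_distrib]
    refine sum_ext fun α => ?_
    rw [leibniz, smul_eq_mul, smul_eq_mul, add_comm]
    congr 1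
    rw [ham, map_sum, mul_sum]
    refine sum_ext fun β => ?_
    rw [leibniz, Derivation.map_algebraMap, smul_zero, add_zero, smul_eq_mul, pr_D]
    ring
  have e2 : ∑ α, S.ham η a α * S.pr (S.ham η c) (S.δ α b) =
      ∑ α, ∑ β, algebraMap ℂ A (η α β) * (S.pr (S.ham η c) (S.δ β b) * S.D (S.δ α a)) := by
    rw [sum_comm]
    refine sum_ext fun α => ?_
    rw [ham, sum_mul]
    refine sum_ext fun β => ?_
    rw [hη.apply]; ring
  rw [e1, e2]
  simp only [map_sum, leibniz, smul_eq_mul, D_algebraMap, mul_zero, add_zero,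
    mul_add, sum_add_distrib]
  ring

/-- The Jacobi identity for the Poisson bracket. -/
theorem jacobi (a b c : A) :
    S.br η (S.br η a b) c + S.br η (S.br η b c) a + S.br η (S.br η c a) b ∈ S.tot := by
  have h := add_mem (add_mem (S.br_br_sub_mem_tot hη a b c) (S.br_br_sub_mem_tot hη b c a))
    (S.br_br_sub_mem_tot hη c a b)
  have h1 := S.second_variation_symm (S.ham η c) (S.ham η b) a
  have h2 := S.second_variation_symm (S.ham η a) (S.ham η c) b
  have h3 := S.second_variation_symm (S.ham η b) (S.ham η a) c
  convert add_mem h (add_mem (add_mem h1 h2) h3) using 1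
  ring

/-- `{·, K}` acts on brackets as a derivation. -/
theorem br_br_leibniz (a b c : A) :
    S.br η (S.br η a b) c - (S.br η (S.br η a c) b + S.br η a (S.br η b c)) ∈ S.null := by
  have h := S.tot_le_null (S.jacobi hη a b c)
  have h1 := S.tot_le_null (S.br_add_br_mem_tot hη (S.br η b c) a)
  have h2 : S.br η (S.br η c a) b = - S.br η (S.br η a c) b := by
    have h0 := S.tot_le_null (S.br_add_br_mem_tot hη a c)
    have : S.br η c a - (-1 : ℂ) • S.br η a c ∈ S.null := by
      convert h0 using 1; rw [neg_one_smul]; ring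
    rw [br_congr (b' := b) this (by simp), br_smul_left, neg_one_smul]
  rw [h2] at h
  convert sub_mem h h1 using 1
  ring

omit hη

/-! ### Null elements of low order -/

/-- A function of `(v, v_x)` whose functional is trivial is affine in `v_x`. -/
theorem d_one_d_one_of_null (ha : S.OrdLT 2 a) (h : a ∈ S.null) (β γ : Fin n) :
    S.d 1 γ (S.d 1 β a) = 0 := by
  have h0 := S.mem_null.mp h β
  rw [δ_eq_sum β ha, sum_range_succ, sum_range_one] at h0
  simp only [pow_zero, one_mul, Function.iterate_zero, id, pow_one, Function.iterate_one] at h0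
  have h1 := congrArg (S.d 2 γ) h0
  rw [map_add, map_zero, (ha.d 0 β) 2 le_rfl, neg_one_mul, map_neg, d_D_succ,
    (ha.d 1 β) 2 le_rfl, map_zero] at h1
  simpa using h1

/-- The condition on the coefficients of `v_xx` in a trivial functional with a density of second
order. -/
theorem d_one_d_two_of_null (ha : S.OrdLT 3 a) (h : a ∈ S.null)
    (h2 : ∀ β γ, S.d 2 γ (S.d 2 β a) = 0) (β γ : Fin n) :
    S.d 1 γ (S.d 2 β a) = S.d 1 β (S.d 2 γ a) := by
  have h0 := S.mem_null.mp h β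
  rw [δ_eq_sum β ha, sum_range_succ, sum_range_succ, sum_range_one] at h0
  simp only [pow_zero, one_mul, Function.iterate_zero, id, pow_one,
    Function.iterate_succ, Function.comp_apply, neg_one_mul, neg_one_sq] at h0
  have h1 := congrArg (S.d 3 γ) h0
  rw [map_add, map_add, map_zero, map_neg, (ha.d 0 β) 3 le_rfl, d_D_succ,
    (ha.d 1 β) 3 le_rfl, map_zero, d_D_succ, d_D_succ, d_D_succ, (ha.d 2 β) 3 le_rfl, h2] at h1
  simp only [map_zero, zero_add] at h1
  rw [S.d_comm 2 γ 1 β] at h1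
  linear_combination h1

/-! ### Homogeneity -/

/-- The Euler vector field of the grading `deg v^α_ℓ = ℓ`. -/
def euler : Derivation ℂ A A := S.vf fun ℓ α => (ℓ : A) * S.x ℓ α

theorem euler_D (a : A) : S.euler (S.D a) = S.D (S.euler a) + S.D a := by
  have h := S.vf_commutator (fun ℓ α => (ℓ : A) * S.x ℓ α) (fun ℓ α => S.x (ℓ + 1) α) a
  have h0 : (fun (ℓ : ℕ) (α : Fin n) => S.vf (fun ℓ α => (ℓ : A) * S.x ℓ α) (S.x (ℓ + 1) α) -
      S.vf (fun ℓ α => S.x (ℓ + 1) α) ((ℓ : A) * S.x ℓ α)) = fun ℓ α => S.x (ℓ + 1) α := by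
    funext ℓ α
    rw [vf_x, leibniz, vf_x, Derivation.map_natCast, smul_zero, add_zero, smul_eq_mul]
    push_cast; ring
  rw [h0] at h
  exact sub_eq_iff_eq_add'.mp h

theorem euler_d (ℓ : ℕ) (α : Fin n) (a : A) :
    S.euler (S.d ℓ α a) = S.d ℓ α (S.euler a) - (ℓ : A) * S.d ℓ α a := by
  obtain ⟨N, ha⟩ := S.finite_ord a
  have ha' := ha.mono (Nat.le_add_right N (ℓ + 1))
  rw [euler, vf_eq_sum _ ha', vf_eq_sum _ (ha'.d _ _), map_sum, eq_sub_iff_add_eq]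
  simp only [leibniz, smul_eq_mul, S.d_x, Derivation.map_natCast, sum_add_distrib,
    mul_zero, add_zero]
  congr 1
  · exact sum_ext fun q => by rw [S.d_comm]
  · rw [sum_eq_single (ℓ, α)]
    · simp [mul_comm]
    · rintro ⟨k, β⟩ _ hq
      rw [if_neg, mul_zero, mul_zero]
      rintro ⟨h1, h2⟩
      exact hq (Prod.ext h1 h2)
    · intro hq
      exact absurd (Finset.mem_product.mpr
        ⟨Finset.mem_range.mpr (by simp only; omega), mem_univ _⟩) hq

theorem euler_D_iterate (ℓ : ℕ) (a : A) :
    S.euler (S.D^[ℓ] a) = S.D^[ℓ] (S.euler a) + (ℓ : A) * S.D^[ℓ] a := by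
  induction ℓ with
  | zero => simp
  | succ ℓ ih =>
    rw [D_iterate_succ, euler_D, ih, map_add, leibniz, Derivation.map_natCast, D_iterate_succ]
    simp only [smul_eq_mul, mul_zero, add_zero, Nat.cast_add, Nat.cast_one]
    ring

theorem D_iterate_natCast_mul (ℓ m : ℕ) (a : A) : S.D^[ℓ] ((m : A) * a) = m * S.D^[ℓ] a := by
  have := S.D_iterate_smul ℓ (m : ℂ) a
  simpa [Algebra.smul_def] using this

/-- The variational derivatives preserve the grading. -/
theorem euler_δ (β : Fin n) (a : A) : S.euler (S.δ β a) = S.δ β (S.euler a) := by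
  obtain ⟨N, ha, he⟩ := S.exists_ordLT₂ a (S.euler a)
  rw [δ_eq_sum β ha, δ_eq_sum β he, map_sum]
  refine sum_ext fun ℓ => ?_
  have : S.euler ((-1 : A) ^ ℓ) = 0 := by simp
  rw [leibniz, this, euler_D_iterate, euler_d, D_iterate_sub, D_iterate_natCast_mul]
  simp only [smul_eq_mul]; ring

end JetAlgebra

end

variable {S : JetAlgebra n A}

section

variable {a : A} {b ω : Fin n → A} {q : Fin n → Fin n → A} {t : Fin n → Fin n → Fin n → A}

/-! ### Frames of coordinates -/

theorem derivation_sum_apply {ι : Type*} (s : Finset ι)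
    (f : ι → Derivation ℂ A A) (a : A) : (∑ i ∈ s, f i) a = ∑ i ∈ s, f i a := by
  classical
  induction s using Finset.induction_on with
  | empty => simp
  | insert i s hi ih => rw [Finset.sum_insert hi, Finset.sum_insert hi, Derivation.add_apply, ih]

namespace JetAlgebra

/-- Local coordinates `R_i` on the base, inside a jet algebra, with the coordinate vector fields
`∂ / ∂ R_i = ∑_α W i α ∂ / ∂ v^α`. -/
structure Frame (S : JetAlgebra n A) where
  R : Fin n → A
  W : Fin n → Fin n → A
  ord_R : ∀ i, S.OrdLT 1 (R i)
  ord_W : ∀ i α, S.OrdLT 1 (W i α)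
  W_R : ∀ i j, ∑ α, W i α * S.d 0 α (R j) = if i = j then 1 else 0
  R_W : ∀ α β, ∑ i, S.d 0 α (R i) * W i β = if α = β then 1 else 0

namespace Frame

variable (F : S.Frame)

/-- The derivation `∂ / ∂ R_i` on functions of `v`. -/
def E (i : Fin n) : Derivation ℂ A A := ∑ α, F.W i α • S.d 0 α

theorem E_apply (i : Fin n) (a : A) : F.E i a = ∑ α, F.W i α * S.d 0 α a := by
  simp [E, derivation_sum_apply]

theorem E_R (i j : Fin n) : F.E i (F.R j) = if i = j then 1 else 0 := by rw [E_apply, W_R]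

variable {F} in
theorem _root_.HamPDE.JetAlgebra.OrdLT.E {N : ℕ} (hN : 1 ≤ N) (h : S.OrdLT N a)
    (i : Fin n) : S.OrdLT N (F.E i a) := by
  rw [E_apply]
  exact OrdLT.sum fun α _ => ((F.ord_W i α).mono hN).mul (h.d 0 α)

theorem ord_E (h : S.OrdLT 1 a) (i : Fin n) : S.OrdLT 1 (F.E i a) := h.E le_rfl i

theorem d_zero_eq (a : A) (β : Fin n) : S.d 0 β a = ∑ i, F.E i a * S.d 0 β (F.R i) := by
  simp only [E_apply, sum_mul]
  rw [sum_comm]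
  have : ∀ α, ∑ i, F.W i α * S.d 0 α a * S.d 0 β (F.R i) =
      (if β = α then 1 else 0) * S.d 0 α a := by
    intro α
    rw [← F.R_W, sum_mul]
    exact sum_ext fun i => by ring
  simp [this]

theorem vf_eq (h : S.OrdLT 1 a) (Y : ℕ → Fin n → A) : S.vf Y a = ∑ i, F.E i a * S.vf Y (F.R i) := by
  rw [vf_ordLT_one Y h]
  simp only [vf_ordLT_one Y (F.ord_R _), mul_sum]
  rw [sum_comm]
  refine sum_ext fun α => ?_
  rw [F.d_zero_eq a, mul_sum]
  exact sum_ext fun i => by ring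

/-- The jet coordinate `R_{i,x}`. -/
def p (i : Fin n) : A := S.D (F.R i)

theorem D_eq (h : S.OrdLT 1 a) : S.D a = ∑ i, F.E i a * F.p i := F.vf_eq h _

theorem pr_eq (X : Fin n → A) (h : S.OrdLT 1 a) :
    S.pr X a = ∑ i, F.E i a * S.pr X (F.R i) := F.vf_eq h _

/-- The derivations `∂ / ∂ R_i` commute. -/
theorem E_comm_x (i j α : Fin n) : F.E i (F.W j α) = F.E j (F.W i α) := by
  have h : ∀ k, ∑ β, (F.E i (F.W j β) - F.E j (F.W i β)) * S.d 0 β (F.R k) = 0 := by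
    intro k
    have e : ∀ i j, ∑ β, F.E i (F.W j β) * S.d 0 β (F.R k) =
        - ∑ β, ∑ γ, F.W j β * F.W i γ * S.d 0 γ (S.d 0 β (F.R k)) := by
      intro i j
      have h0 : F.E i (F.E j (F.R k)) = 0 := by rw [E_R]; split_ifs <;> simp
      rw [F.E_apply j, map_sum] at h0
      simp only [leibniz, smul_eq_mul, sum_add_distrib] at h0
      rw [eq_neg_iff_add_eq_zero, add_comm, ← h0]
      congr 1
      · refine sum_ext fun β => ?_
        rw [E_apply, mul_sum]
        exact sum_ext fun γ => by ring
      · exact sum_ext fun β => by ring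
    simp only [sub_mul, sum_sub_distrib, e]
    rw [sum_comm, neg_sub_neg, sub_eq_zero]
    refine sum_ext₂ fun β γ => ?_
    rw [S.d_comm]; ring
  have h1 : ∑ k, (∑ β, (F.E i (F.W j β) - F.E j (F.W i β)) * S.d 0 β (F.R k)) * F.W k α = 0 :=
    sum_eq_zero fun k _ => by rw [h, zero_mul]
  simp only [sum_mul, mul_assoc] at h1
  rw [sum_comm] at h1
  simp only [← mul_sum, F.R_W] at h1
  simpa [sub_eq_zero] using h1

theorem E_comm (i j : Fin n) (a : A) : F.E i (F.E j a) = F.E j (F.E i a) := by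
  have e : ∀ i j, F.E i (F.E j a) = ∑ β, F.E i (F.W j β) * S.d 0 β a +
      ∑ β, ∑ γ, F.W j β * F.W i γ * S.d 0 γ (S.d 0 β a) := by
    intro i j
    rw [F.E_apply j, map_sum]
    simp only [leibniz, smul_eq_mul, sum_add_distrib]
    rw [add_comm]
    congr 1
    · exact sum_ext fun β => by ring
    · refine sum_ext fun β => ?_
      rw [E_apply, mul_sum]
      exact sum_ext fun γ => by ring
  rw [e, e]
  simp only [F.E_comm_x i j]
  congr 1
  rw [sum_comm]
  refine sum_ext₂ fun β γ => ?_
  rw [S.d_comm]; ring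

/-! ### Vertical derivatives -/

/-- The derivation `∂ / ∂ R_{i,x}` on functions of `(v, v_x)`. -/
def V (i : Fin n) : Derivation ℂ A A := ∑ α, F.W i α • S.d 1 α

theorem V_apply (i : Fin n) (a : A) : F.V i a = ∑ α, F.W i α * S.d 1 α a := by
  simp [V, derivation_sum_apply]

theorem ord_p (i : Fin n) : S.OrdLT 2 (F.p i) := (F.ord_R i).D

theorem d_one_p (α i : Fin n) : S.d 1 α (F.p i) = S.d 0 α (F.R i) := by
  rw [p, d_D_succ, F.ord_R i 1 le_rfl, map_zero, zero_add]

theorem V_p (i j : Fin n) : F.V i (F.p j) = if i = j then 1 else 0 := by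
  simp only [V_apply, d_one_p, W_R]

theorem V_ord_one (h : S.OrdLT 1 a) (i : Fin n) : F.V i a = 0 := by
  rw [V_apply]; exact sum_eq_zero fun α _ => by rw [h 1 le_rfl, mul_zero]

theorem V_ord (h : S.OrdLT 2 a) (i : Fin n) : S.OrdLT 2 (F.V i a) := by
  rw [V_apply]; exact OrdLT.sum fun α _ => ((F.ord_W i α).mono (by norm_num)).mul (h.d 1 α)

theorem d_two_D_p (α i : Fin n) : S.d 2 α (S.D (F.p i)) = S.d 0 α (F.R i) := by
  rw [d_D_succ, F.ord_p i 2 le_rfl, map_zero, zero_add, d_one_p]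

theorem d_one_eq (a : A) (β : Fin n) : S.d 1 β a = ∑ i, F.V i a * S.d 0 β (F.R i) := by
  simp only [V_apply, sum_mul]
  rw [sum_comm]
  have : ∀ α, ∑ i, F.W i α * S.d 1 α a * S.d 0 β (F.R i) =
      (if β = α then 1 else 0) * S.d 1 α a := by
    intro α
    rw [← F.R_W, sum_mul]
    exact sum_ext fun i => by ring
  simp [this]

/-- Contracting a covector with the coordinate fields and back. -/
theorem eq_of_sum_mul_dR {c : Fin n → A}
    (h : ∀ β, ∑ j, b j * S.d 0 β (F.R j) = ∑ j, c j * S.d 0 β (F.R j)) : b = c := by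
  have key : ∀ (b : Fin n → A) i, ∑ β, F.W i β * ∑ j, b j * S.d 0 β (F.R j) = b i := by
    intro b i
    simp only [mul_sum]
    rw [sum_comm]
    have : ∀ j, ∑ β, F.W i β * (b j * S.d 0 β (F.R j)) = b j * if i = j then 1 else 0 := by
      intro j
      rw [← F.W_R, mul_sum]
      exact sum_ext fun _ => by ring
    simp [this]
  funext i
  rw [← key b, ← key c]
  simp only [h]

theorem eq_of_sum_mul_W {c : Fin n → A}
    (h : ∀ α, ∑ j, b j * F.W j α = ∑ j, c j * F.W j α) : b = c := by
  have key : ∀ (b : Fin n → A) i, ∑ α, (∑ j, b j * F.W j α) * S.d 0 α (F.R i) = b i := by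
    intro b i
    simp only [sum_mul]
    rw [sum_comm]
    have : ∀ j, ∑ α, b j * F.W j α * S.d 0 α (F.R i) = b j * if j = i then 1 else 0 := by
      intro j
      rw [← F.W_R, mul_sum]
      exact sum_ext fun _ => by ring
    simp [this]
  funext i
  rw [← key b, ← key c]
  simp only [h]

/-- A trivial functional with a density `∑ b_j R_{j,xx} + c`: the coefficients `b_j(v, v_x)` are
curl-free in `v_x`. -/
theorem V_symm_of_null {c : A} (hb : ∀ j, S.OrdLT 2 (b j)) (hc : S.OrdLT 2 c)
    (h : ∑ j, b j * S.D (F.p j) + c ∈ S.null) (i k : Fin n) : F.V i (b k) = F.V k (b i) := by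
  have ho : S.OrdLT 3 (∑ j, b j * S.D (F.p j) + c) :=
    (OrdLT.sum fun j _ => ((hb j).mono (by norm_num)).mul (F.ord_p j).D).add (hc.mono (by norm_num))
  have h2 : ∀ β, S.d 2 β (∑ j, b j * S.D (F.p j) + c) = ∑ j, b j * S.d 0 β (F.R j) := by
    intro β
    rw [map_add, hc 2 le_rfl, add_zero, map_sum]
    refine sum_ext fun j => ?_
    rw [leibniz, hb j 2 le_rfl, smul_zero, add_zero, d_two_D_p, smul_eq_mul]
  have hR : ∀ γ β j, S.d 1 γ (S.d 0 β (F.R j)) = 0 := fun γ β j => ((F.ord_R j).d 0 β) 1 le_rfl γ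
  have h1 : ∀ β γ, ∑ j, S.d 1 γ (b j) * S.d 0 β (F.R j) = ∑ j, S.d 1 β (b j) * S.d 0 γ (F.R j) := by
    intro β γ
    have := S.d_one_d_two_of_null ho h (fun β γ => by
      rw [h2, map_sum]
      refine sum_eq_zero fun j _ => ?_
      rw [leibniz, hb j 2 le_rfl, ((F.ord_R j).d 0 β) 2 (by norm_num), smul_zero,
        smul_zero, add_zero]) β γ
    rw [h2, h2, map_sum, map_sum] at this
    simp only [leibniz, hR, mul_zero, zero_add, smul_eq_mul] at this
    simpa only [mul_comm] using this
  have h3 : ∀ γ j, S.d 1 γ (b j) = ∑ i, F.V j (b i) * S.d 0 γ (F.R i) := by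
    intro γ
    have := F.eq_of_sum_mul_dR (b := fun j => S.d 1 γ (b j))
      (c := fun j => ∑ i, F.V j (b i) * S.d 0 γ (F.R i)) (fun β => by
        rw [h1]
        simp only [F.d_one_eq _ β, sum_mul]
        rw [sum_comm]
        exact sum_ext₂ fun _ _ => by ring)
    exact fun j => congrFun this j
  have h4 := F.eq_of_sum_mul_dR (b := fun i => F.V i (b k)) (c := fun i => F.V k (b i))
    (fun γ => by rw [← F.d_one_eq, h3])
  exact congrFun h4 i

theorem V_V_of_null {c : A} (hc : S.OrdLT 2 c) (h : c ∈ S.null) (i k : Fin n) :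
    F.V i (F.V k c) = 0 := by
  simp only [V_apply]
  refine sum_eq_zero fun α _ => ?_
  rw [map_sum, mul_sum]
  refine sum_eq_zero fun β _ => ?_
  rw [leibniz, S.d_one_d_one_of_null hc h, F.ord_W k β 1 le_rfl]
  simp

/-! ### Functionals `∫ ∑ ω_i R_{i,x} dx` -/

/-- The density `∑ ω_i R_{i,x}` of a one-form `∑ ω_i dR_i`. -/
def oneForm (ω : Fin n → A) : A := ∑ i, ω i * F.p i

theorem ord_oneForm (hω : ∀ i, S.OrdLT 1 (ω i)) : S.OrdLT 2 (F.oneForm ω) :=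
  OrdLT.sum fun i _ => ((hω i).mono (by norm_num)).mul (F.ord_p i)

theorem δ_oneForm (hω : ∀ i, S.OrdLT 1 (ω i)) (β : Fin n) :
    S.δ β (F.oneForm ω) = ∑ j, (∑ i, (F.E j (ω i) - F.E i (ω j)) * F.p i) * S.d 0 β (F.R j) := by
  rw [δ_eq_sum β (F.ord_oneForm hω), sum_range_succ, sum_range_one]
  simp only [pow_zero, one_mul, Function.iterate_zero, id, pow_one, Function.iterate_one, oneForm,
    map_sum, leibniz, smul_eq_mul, d_one_p, (hω _) 1 le_rfl β, mul_zero, add_zero]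
  have e1 : ∀ i, S.d 0 β (F.p i) = S.D (S.d 0 β (F.R i)) := fun i => S.d_D_zero β _
  simp only [e1, sum_add_distrib, sum_mul, sub_mul, sum_sub_distrib]
  have e2 : ∑ i, F.p i * S.d 0 β (ω i) = ∑ j, ∑ i, F.E j (ω i) * F.p i * S.d 0 β (F.R j) := by
    rw [sum_comm]
    refine sum_ext fun i => ?_
    rw [F.d_zero_eq, mul_sum]
    exact sum_ext fun j => by ring
  have e3 : ∑ i, S.d 0 β (F.R i) * S.D (ω i) = ∑ j, ∑ i, F.E i (ω j) * F.p i * S.d 0 β (F.R j) := by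
    refine sum_ext fun i => ?_
    rw [F.D_eq (hω i), mul_sum]
    exact sum_ext fun j => by ring
  rw [e2, e3]
  ring

/-- A one-form defines the trivial functional if and only if it is closed. -/
theorem oneForm_mem_null_iff (hω : ∀ i, S.OrdLT 1 (ω i)) :
    F.oneForm ω ∈ S.null ↔ ∀ i j, F.E j (ω i) = F.E i (ω j) := by
  rw [S.mem_null]
  constructor
  · intro h i j
    have h1 : (fun j => ∑ i, (F.E j (ω i) - F.E i (ω j)) * F.p i) = fun _ => 0 :=
      F.eq_of_sum_mul_dR fun β => by rw [← F.δ_oneForm hω, h]; simp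
    have h2 := congrArg (F.V i) (congrFun h1 j)
    simp only [map_sum, map_zero, leibniz, V_p, smul_eq_mul, mul_ite, mul_one, mul_zero,
      map_sub, F.V_ord_one (F.ord_E (hω _) _), sub_zero, add_zero, Finset.sum_ite_eq,
      mem_univ, if_true] at h2
    exact sub_eq_zero.mp h2
  · intro h β
    rw [F.δ_oneForm hω]
    refine sum_eq_zero fun j _ => ?_
    rw [sum_eq_zero fun i _ => by rw [h i j, sub_self, zero_mul], zero_mul]

theorem oneForm_sub (ω θ : Fin n → A) :
    F.oneForm ω - F.oneForm θ = F.oneForm (fun i => ω i - θ i) := by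
  simp only [oneForm, sub_mul, sum_sub_distrib]

theorem pr_oneForm (X : Fin n → A) (hω : ∀ i, S.OrdLT 1 (ω i)) :
    S.pr X (F.oneForm ω) - ∑ i, ∑ k, F.E k (ω i) * (S.pr X (F.R k) * F.p i -
      S.pr X (F.R i) * F.p k) ∈ S.tot := by
  refine ⟨∑ i, ω i * S.pr X (F.R i), ?_⟩
  change S.D _ = _
  simp only [oneForm, map_sum, ← sum_sub_distrib]
  refine sum_ext fun i => ?_
  rw [leibniz, leibniz, F.D_eq (hω i), F.pr_eq X (hω i), p, pr_D]
  simp only [smul_eq_mul, mul_sub, sum_sub_distrib, mul_sum]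
  have : ∀ j, S.D (F.R i) * (F.E j (ω i) * S.pr X (F.R j)) =
    F.E j (ω i) * (S.pr X (F.R j) * S.D (F.R i)) := fun j => by ring
  have h' : ∀ j, S.pr X (F.R i) * (F.E j (ω i) * F.p j) =
    F.E j (ω i) * (S.pr X (F.R i) * F.p j) := fun j => by ring
  simp only [this, h']
  ring

/-! ### Functionals `∫ ∑ q_ij R_{i,x} R_{j,x} dx` -/

/-- The density `∑ q_ij R_{i,x} R_{j,x}` of a quadratic form `∑ q_ij dR_i dR_j`. -/
def quad (q : Fin n → Fin n → A) : A := ∑ i, ∑ j, q i j * F.p i * F.p j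

theorem ord_quad (hq : ∀ i j, S.OrdLT 1 (q i j)) : S.OrdLT 2 (F.quad q) :=
  OrdLT.sum fun i _ => OrdLT.sum fun j _ =>
    (((hq i j).mono (by norm_num)).mul (F.ord_p i)).mul (F.ord_p j)

theorem quad_sub (q r : Fin n → Fin n → A) :
    F.quad q - F.quad r = F.quad (fun i j => q i j - r i j) := by
  simp only [quad, sub_mul, sum_sub_distrib]

theorem V_quad (hq : ∀ i j, S.OrdLT 1 (q i j)) (k : Fin n) :
    F.V k (F.quad q) = ∑ i, (q i k + q k i) * F.p i := by
  have h0 : ∀ i j, F.V k (q i j) = 0 := fun i j => F.V_ord_one (hq i j) k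
  simp only [quad, map_sum, leibniz, smul_eq_mul, V_p, h0, mul_zero, add_zero,
    mul_ite, mul_one, sum_add_distrib, add_mul]
  congr 1
  · simp
  · rw [sum_comm]; simp [mul_comm]

theorem V_V_quad (hq : ∀ i j, S.OrdLT 1 (q i j)) (k l : Fin n) :
    F.V l (F.V k (F.quad q)) = q l k + q k l := by
  have h0 : ∀ i j, F.V l (q i j) = 0 := fun i j => F.V_ord_one (hq i j) l
  rw [F.V_quad hq]
  simp [leibniz, V_p, h0]

theorem quad_mem_null_imp (hq : ∀ i j, S.OrdLT 1 (q i j))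
    (h : F.quad q ∈ S.null) (k l : Fin n) : q l k + q k l = 0 := by
  rw [← F.V_V_quad hq]; exact F.V_V_of_null (F.ord_quad hq) h l k

theorem eq_zero_of_add_self (h : a + a = 0) : a = 0 := by
  have h1 : (2 : ℂ) • a = 0 := by rw [two_smul, h]
  exact (smul_eq_zero_iff_right (two_ne_zero)).mp h1

theorem quad_eq_zero (h : ∀ i j, q i j + q j i = 0) : F.quad q = 0 := by
  apply eq_zero_of_add_self
  have : F.quad q = ∑ i, ∑ j, q j i * F.p i * F.p j := by
    rw [quad, sum_comm]
    exact sum_ext₂ fun _ _ => by ring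
  nth_rewrite 1 [this]
  rw [quad, ← sum_add_distrib]
  refine sum_eq_zero fun i _ => ?_
  rw [← sum_add_distrib]
  refine sum_eq_zero fun j _ => ?_
  linear_combination F.p i * F.p j * h i j

/-- The density `∑ t_ijk R_{i,x} R_{j,x} R_{k,x}`. -/
def cubic (t : Fin n → Fin n → Fin n → A) : A := ∑ i, ∑ j, ∑ k, t i j k * F.p i * F.p j * F.p k

theorem ord_cubic (ht : ∀ i j k, S.OrdLT 1 (t i j k)) : S.OrdLT 2 (F.cubic t) :=
  OrdLT.sum fun i _ => OrdLT.sum fun j _ => OrdLT.sum fun k _ =>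
    ((((ht i j k).mono (by norm_num)).mul (F.ord_p i)).mul (F.ord_p j)).mul (F.ord_p k)

theorem V_cubic (ht : ∀ i j k, S.OrdLT 1 (t i j k))
    (l : Fin n) : F.V l (F.cubic t) = F.quad fun i j => t l i j + t i l j + t i j l := by
  have h0 : ∀ i j k, F.V l (t i j k) = 0 := fun i j k => F.V_ord_one (ht i j k) l
  simp only [cubic, quad, map_sum, leibniz, smul_eq_mul, V_p, h0, mul_zero, add_zero,
    mul_ite, mul_one, sum_add_distrib, add_mul, mul_add]
  have e1 : ∑ i, ∑ j, ∑ k, (if l = k then t i j k * F.p i * F.p j else 0) =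
      ∑ i, ∑ j, t i j l * F.p i * F.p j := by simp
  have e2 : ∑ i, ∑ j, ∑ k, (if l = j then F.p k * (t i j k * F.p i) else 0) =
      ∑ i, ∑ j, t i l j * F.p i * F.p j := by
    refine sum_ext fun i => ?_
    rw [sum_comm]
    simp [mul_comm]
  have e3 : ∑ i, ∑ j, ∑ k, (if l = i then F.p k * (F.p j * t i j k) else 0) =
      ∑ i, ∑ j, t l i j * F.p i * F.p j := by
    rw [sum_eq_single l]
    · exact sum_ext₂ fun _ _ => by rw [if_pos rfl]; ring
    · intro i _ hi
      simp [hi.symm]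
    · simp
  rw [e1, e2, e3]; ring

theorem cubic_eq_zero_iff (ht : ∀ i j k, S.OrdLT 1 (t i j k)) (hs : ∀ i j k, t i j k = t j i k) :
    F.cubic t ∈ S.null ↔ ∀ i j k, t i j k + t j k i + t k i j = 0 := by
  constructor
  · intro h i j k
    have h1 := F.V_V_of_null (F.ord_cubic ht) h i j
    rw [F.V_cubic ht, F.V_quad fun _ _ => (((ht _ _ _).add (ht _ _ _)).add (ht _ _ _))] at h1
    have h2 := congrArg (F.V k) h1
    have h0 : ∀ i j l, F.V k (t i j l) = 0 := fun i j l => F.V_ord_one (ht i j l) k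
    simp only [map_sum, map_zero, leibniz, V_p, smul_eq_mul, mul_ite, mul_one, mul_zero,
      map_add, h0, add_zero, Finset.sum_ite_eq, mem_univ, if_true] at h2
    apply eq_zero_of_add_self
    rw [← h2, hs i j k, hs k i j, hs j k i]
    ring
  · intro h
    have e1 : F.cubic t = ∑ i, ∑ j, ∑ k, t j k i * F.p i * F.p j * F.p k := by
      rw [cubic, Finset.sum_comm_cycle]
      exact sum_ext₂ fun _ _ => sum_ext fun _ => by ring
    have e2 : F.cubic t = ∑ i, ∑ j, ∑ k, t k i j * F.p i * F.p j * F.p k := by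
      rw [cubic, Finset.sum_comm_cycle, Finset.sum_comm_cycle]
      exact sum_ext₂ fun _ _ => sum_ext fun _ => by ring
    have e3 : F.cubic t + F.cubic t + F.cubic t = 0 := by
      have e5 : F.cubic t + F.cubic t + F.cubic t = F.cubic t +
          (∑ i, ∑ j, ∑ k, t j k i * F.p i * F.p j * F.p k) +
          ∑ i, ∑ j, ∑ k, t k i j * F.p i * F.p j * F.p k := by rw [← e1, ← e2]
      rw [e5, cubic, ← sum_add_distrib, ← sum_add_distrib]
      refine sum_eq_zero fun i _ => ?_
      rw [← sum_add_distrib, ← sum_add_distrib]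
      refine sum_eq_zero fun j _ => ?_
      rw [← sum_add_distrib, ← sum_add_distrib]
      refine sum_eq_zero fun k _ => ?_
      linear_combination F.p i * F.p j * F.p k * h i j k
    have e4 : (3 : ℂ) • F.cubic t = 0 := by
      rw [← e3, show (3 : ℂ) = 1 + 1 + 1 by norm_num, add_smul, add_smul, one_smul]
    rw [(smul_eq_zero_iff_right (three_ne_zero)).mp e4]
    exact zero_mem _

end Frame

end JetAlgebra

end

section

variable {f : A} {μ : Fin n → A}

/-! ### Riemann invariants -/

namespace JetAlgebra

/-- The coordinates of a `Frame` are Riemann invariants of the system with Hamiltonian `∫ h₀ dx`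
and characteristic velocities `lam`; `a i j = ∂_j lam_i / (lam_j - lam_i)` are the Christoffel
coefficients `Γ^i_{ij}` of the diagonal flat metric `η⁻¹`. -/
structure Riemann (S : JetAlgebra n A) (η : Matrix (Fin n) (Fin n) ℂ) extends Frame S where
  h₀ : A
  lam : Fin n → A
  a : Fin n → Fin n → A
  ord_h₀ : S.OrdLT 1 h₀
  ord_lam : ∀ i, S.OrdLT 1 (lam i)
  isUnit_sub : ∀ i j, i ≠ j → IsUnit (lam i - lam j)
  E_lam : ∀ i j, i ≠ j → toFrame.E j (lam i) = a i j * (lam j - lam i)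
  diag : ∀ i β, ∑ α, (∑ γ, algebraMap ℂ A (η α γ) * S.d 0 γ (S.d 0 β h₀)) * S.d 0 α (R i) =
    lam i * S.d 0 β (R i)

namespace Frame

variable (F : S.Frame) (η : Matrix (Fin n) (Fin n) ℂ)

/-- The flow with Hamiltonian `∫ f dx`, `f` a function of `v`, is diagonal in the coordinates
`R_i`, with velocities `μ_i`. -/
def Diagonalizes (f : A) (μ : Fin n → A) : Prop := ∀ i β,
  ∑ α, (∑ γ, algebraMap ℂ A (η α γ) * S.d 0 γ (S.d 0 β f)) * S.d 0 α (F.R i) = μ i * S.d 0 β (F.R i)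

/-- The Jacobian matrix `∂ R_i / ∂ v^α`. -/
def J : Matrix (Fin n) (Fin n) A := Matrix.of fun i α => S.d 0 α (F.R i)

/-- The inverse Jacobian matrix `∂ v^α / ∂ R_i`. -/
def Wm : Matrix (Fin n) (Fin n) A := Matrix.of fun α i => F.W i α

theorem J_mul_Wm : F.J * F.Wm = 1 := by
  ext i j
  simp only [Matrix.mul_apply, J, Wm, Matrix.of_apply, Matrix.one_apply]
  simpa [mul_comm, eq_comm] using F.W_R j i

theorem Wm_mul_J : F.Wm * F.J = 1 := by
  ext α β
  simp only [Matrix.mul_apply, J, Wm, Matrix.of_apply, Matrix.one_apply]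
  simpa [mul_comm, eq_comm] using F.R_W β α

variable (S) in
/-- The Hessian with a raised index. -/
def rHess (f : A) : Matrix (Fin n) (Fin n) A :=
  η.map (algebraMap ℂ A) * Matrix.of fun γ β => S.d 0 γ (S.d 0 β f)

theorem diagonalizes_iff (f : A) (μ : Fin n → A) :
    F.Diagonalizes η f μ ↔ F.J * rHess S η f = Matrix.diagonal μ * F.J := by
  rw [← Matrix.ext_iff]
  refine forall_congr' fun i => forall_congr' fun β => ?_
  rw [Matrix.diagonal_mul]
  simp [Matrix.mul_apply, rHess, J, mul_comm]

theorem diagonalizes_iff' (f : A) (μ : Fin n → A) :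
    F.Diagonalizes η f μ ↔ rHess S η f * F.Wm = F.Wm * Matrix.diagonal μ := by
  rw [diagonalizes_iff]
  constructor
  · intro h
    calc rHess S η f * F.Wm = F.Wm * (F.J * rHess S η f) * F.Wm := by
          rw [← Matrix.mul_assoc F.Wm, Wm_mul_J, Matrix.one_mul]
      _ = F.Wm * Matrix.diagonal μ * (F.J * F.Wm) := by rw [h]; simp only [Matrix.mul_assoc]
      _ = _ := by rw [J_mul_Wm, Matrix.mul_one]
  · intro h
    calc F.J * rHess S η f = F.J * (rHess S η f * F.Wm) * F.J := by
          rw [Matrix.mul_assoc F.J, Matrix.mul_assoc (rHess S η f), Wm_mul_J, Matrix.mul_one]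
      _ = (F.J * F.Wm) * Matrix.diagonal μ * F.J := by rw [h]; simp only [Matrix.mul_assoc]
      _ = _ := by rw [J_mul_Wm, Matrix.one_mul]

variable {F η} in
theorem Diagonalizes.mul_W (h : F.Diagonalizes η f μ) (i α : Fin n) :
    ∑ β, (∑ γ, algebraMap ℂ A (η α γ) * S.d 0 γ (S.d 0 β f)) * F.W i β = μ i * F.W i α := by
  have := congrFun (congrFun ((F.diagonalizes_iff' η f μ).mp h) α) i
  rw [Matrix.mul_diagonal] at this
  simpa [Matrix.mul_apply, rHess, Wm, mul_comm] using this

variable (S) in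
theorem δ_ord_one (hf : S.OrdLT 1 f) (β : Fin n) : S.δ β f = S.d 0 β f := by
  rw [δ_eq_sum β hf]; simp

variable {F η} in
/-- The flow of a diagonal Hamiltonian in the coordinates `R_i`: `∂_t R_i = μ_i R_{i,x}`. -/
theorem Diagonalizes.pr_R (h : F.Diagonalizes η f μ)
    (hf : S.OrdLT 1 f) (i : Fin n) : S.pr (S.ham η f) (F.R i) = μ i * F.p i := by
  have hD : ∀ β, S.D (S.d 0 β f) = ∑ γ, S.x 1 γ * S.d 0 γ (S.d 0 β f) := fun β =>
    vf_ordLT_one _ (hf.d 0 β)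
  have hp : F.p i = ∑ γ, S.x 1 γ * S.d 0 γ (F.R i) := vf_ordLT_one _ (F.ord_R i)
  rw [pr, vf_ordLT_one _ (F.ord_R i), hp, mul_sum]
  simp only [Function.iterate_zero, id, ham, δ_ord_one S hf, hD]
  have h1 : ∀ γ, μ i * (S.x 1 γ * S.d 0 γ (F.R i)) =
      S.x 1 γ * (μ i * S.d 0 γ (F.R i)) := fun γ => by ring
  simp only [h1, ← h i, mul_sum, sum_mul]
  conv_rhs => rw [sum_comm]
  refine sum_ext fun α => ?_
  conv_rhs => rw [sum_comm]
  refine sum_ext₂ fun β γ => ?_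
  rw [S.d_comm]; ring

variable {F η} in
/-- Compatibility of the velocities of a diagonal flow with the coordinate fields. -/
theorem Diagonalizes.E_mul_W (h : F.Diagonalizes η f μ)
    (i k α : Fin n) : F.E k (μ i) * F.W i α - F.E i (μ k) * F.W k α =
      (μ k - μ i) * F.E k (F.W i α) := by
  have key : ∀ i k, F.E k (μ i) * F.W i α + μ i * F.E k (F.W i α) =
      ∑ β, (∑ γ, algebraMap ℂ A (η α γ) * S.d 0 γ (S.d 0 β f)) * F.E k (F.W i β) +
      ∑ β, ∑ γ, ∑ δ, algebraMap ℂ A (η α γ) * F.W i β * F.W k δ *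
        S.d 0 δ (S.d 0 γ (S.d 0 β f)) := by
    intro i k
    have h1 := congrArg (F.E k) (h.mul_W i α)
    rw [leibniz, map_sum] at h1
    simp only [leibniz, smul_eq_mul, map_sum, Derivation.map_algebraMap, mul_zero,
      add_zero, sum_add_distrib] at h1
    rw [add_comm, mul_comm (F.E k _), ← h1]
    congr 1
    refine sum_ext fun β => ?_
    rw [mul_sum]
    refine sum_ext fun γ => ?_
    rw [F.E_apply, mul_sum, mul_sum]
    exact sum_ext fun δ => by ring
  have h1 := key i k
  have h2 := key k i
  have h3 : ∑ β, ∑ γ, ∑ δ, algebraMap ℂ A (η α γ) * F.W i β * F.W k δ *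
        S.d 0 δ (S.d 0 γ (S.d 0 β f)) = ∑ β, ∑ γ, ∑ δ, algebraMap ℂ A (η α γ) * F.W k β *
        F.W i δ * S.d 0 δ (S.d 0 γ (S.d 0 β f)) := by
    rw [sum_comm]
    conv_rhs => rw [sum_comm]
    refine sum_ext fun γ => ?_
    rw [sum_comm]
    refine sum_ext₂ fun δ β => ?_
    rw [S.d_comm 0 δ 0 γ, S.d_comm 0 δ 0 β, S.d_comm 0 γ 0 β]; ring
  simp only [F.E_comm_x i k] at h2
  linear_combination h1 - h2 + h3

/-- The constant `1 / 2`. -/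
def half (A : Type*) [CommRing A] [Algebra ℂ A] : A := algebraMap ℂ A (1 / 2)

theorem two_mul_half : 2 * half A = 1 := by
  rw [half, ← map_ofNat (algebraMap ℂ A) 2, ← map_mul]; norm_num

theorem derivation_half (d : Derivation ℂ A A) : d (half A) = 0 := d.map_algebraMap _

/-- The coefficient of `R_{i,x} R_{j,x} R_{k,x}` in the derivative of `∑ q_ij R_{i,x} R_{j,x}`
along a diagonal flow, after integration by parts. -/
def flowCoeff (q : Fin n → Fin n → A) (μ : Fin n → A) (i j k : Fin n) : A :=
  F.E k (q i j) * (μ k - half A * (μ i + μ j)) + half A * q i j * (F.E k (μ i) + F.E k (μ j))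

/-- The symmetrization of `flowCoeff`. -/
def flowSymm (q : Fin n → Fin n → A) (μ : Fin n → A) (i j k : Fin n) : A :=
  F.flowCoeff q μ i j k + F.flowCoeff q μ j k i + F.flowCoeff q μ k i j

theorem ord_flowCoeff {q : Fin n → Fin n → A} (hq : ∀ i j, S.OrdLT 1 (q i j))
    (hμ : ∀ i, S.OrdLT 1 (μ i)) (i j k : Fin n) : S.OrdLT 1 (F.flowCoeff q μ i j k) :=
  ((F.ord_E (hq i j) k).mul ((hμ k).sub ((S.ordLT_algebraMap 1 _).mul ((hμ i).add (hμ j))))).add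
    (((S.ordLT_algebraMap 1 _).mul (hq i j)).mul ((F.ord_E (hμ i) k).add (F.ord_E (hμ j) k)))

theorem pr_quad {X : Fin n → A} (hμ : ∀ i, S.OrdLT 1 (μ i))
    (hX : ∀ i, S.pr X (F.R i) = μ i * F.p i) {q : Fin n → Fin n → A}
    (hq : ∀ i j, S.OrdLT 1 (q i j)) (hs : ∀ i j, q i j = q j i) :
    S.pr X (F.quad q) - (∑ j, (∑ i, q i j * (μ j - μ i) * F.p i) * S.D (F.p j) +
      F.cubic (F.flowCoeff q μ)) ∈ S.tot := by
  have hp : ∀ i, S.pr X (F.p i) = μ i * S.D (F.p i) + S.D (μ i) * F.p i := by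
    intro i
    rw [p, pr_D, hX, leibniz, smul_eq_mul, smul_eq_mul, mul_comm (F.p i)]; rfl
  have e0 : S.pr X (F.quad q) = ∑ i, ∑ j, (q i j * μ i * S.D (F.p i) * F.p j +
      q i j * μ j * S.D (F.p j) * F.p i + (S.pr X (q i j) + q i j * S.D (μ i)) *
      F.p i * F.p j + q i j * S.D (μ j) * F.p i * F.p j) := by
    simp only [quad, map_sum, leibniz, smul_eq_mul, hp]
    exact sum_ext₂ fun i j => by ring
  refine ⟨half A * ∑ i, ∑ j, q i j * (μ i + μ j) * F.p i * F.p j, ?_⟩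
  change S.D _ = _
  have e1 : S.D (half A * ∑ i, ∑ j, q i j * (μ i + μ j) * F.p i * F.p j) =
      half A * ∑ i, ∑ j, (q i j * (μ i + μ j) * S.D (F.p i) * F.p j +
        q i j * (μ i + μ j) * S.D (F.p j) * F.p i +
        (S.D (q i j) * (μ i + μ j) + q i j * (S.D (μ i) + S.D (μ j))) * F.p i * F.p j) := by
    rw [leibniz, derivation_half, smul_zero, add_zero, smul_eq_mul]
    simp only [map_sum, leibniz, smul_eq_mul, map_add]
    congr 1
    exact sum_ext₂ fun i j => by ring
  have sw1 : ∑ i, ∑ j, q i j * μ i * S.D (F.p i) * F.p j =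
      ∑ i, ∑ j, q i j * μ j * S.D (F.p j) * F.p i := by
    rw [sum_comm]
    exact sum_ext₂ fun i j => by rw [hs]
  have sw2 : ∑ i, ∑ j, q i j * μ j * S.D (F.p i) * F.p j =
      ∑ i, ∑ j, q i j * μ i * S.D (F.p j) * F.p i := by
    rw [sum_comm]
    exact sum_ext₂ fun i j => by rw [hs]
  have e2 : F.cubic (F.flowCoeff q μ) = ∑ i, ∑ j, (S.pr X (q i j) -
      half A * (μ i + μ j) * S.D (q i j) +
      half A * q i j * (S.D (μ i) + S.D (μ j))) * F.p i * F.p j := by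
    refine sum_ext₂ fun i j => ?_
    rw [F.D_eq (hq i j), F.D_eq (hμ i), F.D_eq (hμ j), F.pr_eq X (hq i j)]
    simp only [hX, mul_sum, sum_mul, ← sum_add_distrib, ← sum_sub_distrib]
    exact sum_ext fun k => by rw [flowCoeff]; ring
  have e3 : ∑ j, (∑ i, q i j * (μ j - μ i) * F.p i) * S.D (F.p j) =
      ∑ i, ∑ j, (q i j * μ j * S.D (F.p j) * F.p i - q i j * μ i * S.D (F.p j) * F.p i) := by
    simp only [sum_mul]
    rw [sum_comm]
    exact sum_ext₂ fun i j => by ring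
  rw [e0, e1, e2, e3]
  simp only [mul_add, add_mul, sub_mul, sum_add_distrib, sum_sub_distrib, mul_sum] at sw1 sw2 ⊢
  have hh : ∀ g : Fin n → Fin n → A, ∑ i, ∑ j, half A * g i j = half A * ∑ i, ∑ j, g i j :=
    fun g => by simp only [mul_sum]
  have sw3 : ∑ i, ∑ j, q i j * S.D (μ i) * F.p i * F.p j =
      ∑ i, ∑ j, q i j * S.D (μ j) * F.p i * F.p j := by
    rw [sum_comm]
    exact sum_ext₂ fun i j => by rw [hs]; ring
  simp only [mul_assoc, hh] at sw1 sw2 sw3 ⊢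
  simp only [mul_left_comm (S.D (q _ _))] at sw1 sw2 sw3 ⊢
  rw [sw1, sw2, sw3]
  linear_combination (∑ i, ∑ j, q i j * (μ j * (S.D (F.p j) * F.p i)) +
    ∑ i, ∑ j, q i j * (μ i * (S.D (F.p j) * F.p i)) +
    2 * ∑ i, ∑ j, q i j * (S.D (μ j) * (F.p i * F.p j))) * two_mul_half (A := A)

end Frame

end JetAlgebra

end

section

variable {f : A} {μ ω : Fin n → A} {q : Fin n → Fin n → A}

/-! ### Brackets with diagonal Hamiltonians -/

namespace JetAlgebra

namespace Frame

variable (F : S.Frame)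

variable {F} in
/-- The bracket of a one-form with a diagonal Hamiltonian. -/
theorem Diagonalizes.br_oneForm (h : F.Diagonalizes η f μ)
    (hf : S.OrdLT 1 f) (hω : ∀ i, S.OrdLT 1 (ω i)) :
    S.br η (F.oneForm ω) f - F.quad (fun i k => F.E k (ω i) * (μ k - μ i)) ∈ S.tot := by
  have h1 := F.pr_oneForm (S.ham η f) hω
  have h2 := S.pr_sub_br_mem_tot η (F.oneForm ω) f
  convert sub_mem h1 h2 using 1
  simp only [h.pr_R hf, quad]
  rw [sub_sub_sub_cancel_left]
  congr 1
  exact sum_ext₂ fun i k => by ring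

variable {F} in
theorem Diagonalizes.br_quad (h : F.Diagonalizes η f μ)
    (hf : S.OrdLT 1 f) (hμ : ∀ i, S.OrdLT 1 (μ i)) (hq : ∀ i j, S.OrdLT 1 (q i j)) (hs : ∀ i j, q i j = q j i) :
    S.br η (F.quad q) f - (∑ j, (∑ i, q i j * (μ j - μ i) * F.p i) * S.D (F.p j) +
      F.cubic (F.flowCoeff q μ)) ∈ S.tot := by
  have h1 := F.pr_quad hμ (h.pr_R hf) hq hs
  have h2 := S.pr_sub_br_mem_tot η (F.quad q) f
  convert sub_mem h1 h2 using 1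
  ring

theorem flowCoeff_symm (hs : ∀ i j, q i j = q j i) (μ : Fin n → A)
    (i j k : Fin n) : F.flowCoeff q μ i j k = F.flowCoeff q μ j i k := by
  rw [flowCoeff, flowCoeff, hs i j]; ring

theorem cubic_sub (t u : Fin n → Fin n → Fin n → A) :
    F.cubic t - F.cubic u = F.cubic fun i j k => t i j k - u i j k := by
  simp only [cubic, sub_mul, sum_sub_distrib]

/-- Two quadratic Hamiltonians deform commuting diagonal Hamiltonians to commuting ones exactly
if their flow coefficients agree. -/
theorem br_quad_add_br_quad_mem_null_iff (hη : η.IsSymm) {g : A} {ν : Fin n → A}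
    (hf : F.Diagonalizes η f μ) (hg : F.Diagonalizes η g ν) (of : S.OrdLT 1 f)
    (og : S.OrdLT 1 g) (hμ : ∀ i, S.OrdLT 1 (μ i)) (hν : ∀ i, S.OrdLT 1 (ν i))
    {r : Fin n → Fin n → A} (hq : ∀ i j, S.OrdLT 1 (q i j)) (hr : ∀ i j, S.OrdLT 1 (r i j))
    (hqs : ∀ i j, q i j = q j i) (hrs : ∀ i j, r i j = r j i) :
    S.br η (F.quad q) f + S.br η g (F.quad r) ∈ S.null ↔
      (∀ i j, q i j * (μ j - μ i) = r i j * (ν j - ν i)) ∧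
      ∀ i j k, F.flowSymm q μ i j k = F.flowSymm r ν i j k := by
  have e : S.br η (F.quad q) f + S.br η g (F.quad r) -
      (∑ j, (∑ i, (q i j * (μ j - μ i) - r i j * (ν j - ν i)) * F.p i) * S.D (F.p j) +
        F.cubic (fun i j k => F.flowCoeff q μ i j k - F.flowCoeff r ν i j k)) ∈ S.null := by
    have h1 := S.tot_le_null (hf.br_quad of hμ hq hqs)
    have h2 := S.tot_le_null (hg.br_quad og hν hr hrs)
    have h3 := S.tot_le_null (S.br_add_br_mem_tot hη g (F.quad r))
    convert add_mem (sub_mem h1 h2) h3 using 1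
    rw [← cubic_sub]
    simp only [sub_mul, sum_sub_distrib]
    ring
  have ot : ∀ i j k, S.OrdLT 1 (F.flowCoeff q μ i j k - F.flowCoeff r ν i j k) := fun i j k =>
    (F.ord_flowCoeff hq hμ i j k).sub (F.ord_flowCoeff hr hν i j k)
  have oc := F.ord_cubic ot
  have hts : ∀ i j k, F.flowCoeff q μ i j k - F.flowCoeff r ν i j k =
      F.flowCoeff q μ j i k - F.flowCoeff r ν j i k := fun i j k => by
    rw [F.flowCoeff_symm hqs, F.flowCoeff_symm hrs]
  have od : ∀ i j, S.OrdLT 1 (q i j * (μ j - μ i) - r i j * (ν j - ν i)) := fun i j =>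
    ((hq i j).mul ((hμ j).sub (hμ i))).sub ((hr i j).mul ((hν j).sub (hν i)))
  have hc : (∀ i j, q i j * (μ j - μ i) = r i j * (ν j - ν i)) →
      (∑ j, (∑ i, (q i j * (μ j - μ i) - r i j * (ν j - ν i)) * F.p i) * S.D (F.p j) +
        F.cubic (fun i j k => F.flowCoeff q μ i j k - F.flowCoeff r ν i j k)) =
        F.cubic (fun i j k => F.flowCoeff q μ i j k - F.flowCoeff r ν i j k) := by
    intro h
    simp [h]
  rw [← Submodule.sub_mem_iff_left _ e, sub_sub_cancel]
  constructor
  · intro h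
    have hI : ∀ i j, q i j * (μ j - μ i) = r i j * (ν j - ν i) := by
      intro i j
      have h1 := F.V_symm_of_null (fun j => OrdLT.sum fun i _ =>
        ((od i j).mono (by norm_num)).mul (F.ord_p i)) oc h i j
      simp only [map_sum, leibniz, V_p, smul_eq_mul, mul_ite, mul_one, mul_zero,
        F.V_ord_one (od _ _), add_zero, Finset.sum_ite_eq, mem_univ, if_true] at h1
      rw [hqs j i, hrs j i] at h1
      rw [← sub_eq_zero]
      apply eq_zero_of_add_self
      linear_combination h1
    refine ⟨hI, fun i j k => ?_⟩
    rw [hc hI, F.cubic_eq_zero_iff ot hts] at h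
    have := h i j k
    rw [flowSymm, flowSymm]
    linear_combination this
  · rintro ⟨hI, hII⟩
    rw [hc hI, F.cubic_eq_zero_iff ot hts]
    intro i j k
    have := hII i j k
    rw [flowSymm, flowSymm] at this
    linear_combination this

end Frame

namespace Riemann

variable (F : S.Riemann η)

theorem diagonalizes : F.Diagonalizes η F.h₀ F.lam := F.diag

theorem eq_zero_of_sub_mul (hij : i ≠ j) {b : A}
    (h : (F.lam i - F.lam j) * b = 0) : b = 0 := (F.isUnit_sub i j hij).mul_right_eq_zero.mp h

/-- The Christoffel symbols `Γ^k_{ij}`, `i ≠ j`, of the flat metric in the coordinates `R_i`. -/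
theorem E_W (hik : i ≠ k) (α : Fin n) :
    F.E k (F.W i α) = F.a i k * F.W i α + F.a k i * F.W k α := by
  have h := F.diagonalizes.E_mul_W i k α
  rw [F.E_lam i k hik, F.E_lam k i hik.symm] at h
  rw [← sub_eq_zero]
  apply F.eq_zero_of_sub_mul hik.symm
  linear_combination -h

variable {F} in
/-- The velocities of commuting diagonal flows satisfy the same linear system. -/
theorem E_vel (h : F.Diagonalizes η f μ) (hik : i ≠ k) : F.E k (μ i) = F.a i k * (μ k - μ i) := by
  have h1 : (fun j => if j = i then F.E k (μ i) else if j = k then - F.E i (μ k) else 0) =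
      fun j => if j = i then F.a i k * (μ k - μ i) else
        if j = k then F.a k i * (μ k - μ i) else 0 := by
    apply F.eq_of_sum_mul_W
    intro α
    have h2 := h.E_mul_W i k α
    rw [F.E_W hik] at h2
    have key : ∀ b c : A, ∑ j, (if j = i then b else if j = k then c else 0) * F.W j α =
        b * F.W i α + c * F.W k α := by
      intro b c
      rw [Finset.sum_eq_add i k hik]
      · simp [hik.symm]
      · rintro j - ⟨h1, h2⟩; simp [h1, h2]
      · simp
      · simp
    rw [key, key]
    linear_combination h2
  have := congrFun h1 i
  simpa using this

/-- The compatibility conditions of the system `∂_j ∂_i k = a_ij ∂_i k + a_ji ∂_j k`. -/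
theorem compat (hij : i ≠ j) (hik : i ≠ k) (hjk : j ≠ k) : F.E k (F.a i j) = F.E j (F.a i k) ∧
    F.E k (F.a j i) + F.a j i * F.a j k = F.a i k * F.a j i + F.a k i * F.a j k := by
  have h1 : (fun l => if l = i then F.E k (F.a i j) - F.E j (F.a i k) else
      if l = j then F.E k (F.a j i) + F.a j i * F.a j k - F.a i k * F.a j i - F.a k i * F.a j k
      else if l = k then F.a i j * F.a k i + F.a j i * F.a k j - F.E j (F.a k i) -
        F.a k i * F.a k j else 0) = fun _ => 0 := by
    apply F.eq_of_sum_mul_W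
    intro α
    have key : ∀ b c d : A, ∑ l, (if l = i then b else if l = j then c else if l = k then d else 0)
        * F.W l α = b * F.W i α + c * F.W j α + d * F.W k α := by
      intro b c d
      have : ∀ l, (if l = i then b else if l = j then c else if l = k then d else 0) * F.W l α =
          (if l = i then b * F.W l α else 0) + (if l = j then c * F.W l α else 0) +
          (if l = k then d * F.W l α else 0) := by
        intro l
        split_ifs <;> simp_all
      simp only [this, sum_add_distrib]
      simp
    rw [key]
    have h2 := F.E_comm j k (F.W i α)
    rw [F.E_W hij, F.E_W hik, map_add, map_add, leibniz, leibniz,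
      leibniz, leibniz, F.E_W hij, F.E_W hik, F.E_W hjk,
      F.E_W hjk.symm] at h2
    simp only [smul_eq_mul] at h2
    simp only [zero_mul, Finset.sum_const_zero]
    linear_combination -h2
  have hi := congrFun h1 i
  have hj := congrFun h1 j
  simp only [if_true, if_neg hij.symm] at hi hj
  exact ⟨sub_eq_zero.mp hi, by linear_combination hj⟩

/-- `{H₀, K₀}` is the functional of a one-form. -/
theorem br_h₀_ord_one (hη : η.IsSymm) {k : A} (hk : S.OrdLT 1 k) :
    S.br η F.h₀ k - F.oneForm (fun i => -(F.lam i * F.E i k)) ∈ S.tot := by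
  have h1 := S.br_add_br_mem_tot hη F.h₀ k
  have h2 := S.pr_sub_br_mem_tot η k F.h₀
  convert add_mem h1 h2 using 1
  rw [F.pr_eq _ hk, Frame.oneForm]
  simp only [F.diagonalizes.pr_R F.ord_h₀, neg_mul, Finset.sum_neg_distrib]
  have : ∑ i, F.lam i * F.E i k * F.p i = ∑ i, F.E i k * (F.lam i * F.p i) :=
    sum_ext fun i => by ring
  rw [this]; ring

/-- `H₁ = {H₀, K₀}`, as a linear equation of second order for `k₀`. -/
theorem oneForm_sub_br_mem_null_iff (hη : η.IsSymm) {k : A} (hk : S.OrdLT 1 k) (hω : ∀ i, S.OrdLT 1 (ω i)) :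
    F.oneForm ω - S.br η F.h₀ k ∈ S.null ↔ ∀ i j, i ≠ j →
      (F.lam i - F.lam j) * (F.E j (F.E i k) - F.a i j * F.E i k - F.a j i * F.E j k) =
        F.E i (ω j) - F.E j (ω i) := by
  have h1 := S.tot_le_null (F.br_h₀_ord_one hη hk)
  have o1 : ∀ i, S.OrdLT 1 (-(F.lam i * F.E i k)) := fun i => ((F.ord_lam i).mul (F.ord_E hk i)).neg
  rw [← Submodule.add_mem_iff_left _ h1, sub_add_sub_cancel, F.oneForm_sub,
    F.oneForm_mem_null_iff fun i => (hω i).sub (o1 i)]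
  refine forall_congr' fun i => forall_congr' fun j => ?_
  by_cases hij : i = j
  · subst hij; simp
  have e : F.E j (ω i - -(F.lam i * F.E i k)) - F.E i (ω j - -(F.lam j * F.E j k)) =
      (F.lam i - F.lam j) * (F.E j (F.E i k) - F.a i j * F.E i k - F.a j i * F.E j k) -
        (F.E i (ω j) - F.E j (ω i)) := by
    simp only [map_sub, map_neg, leibniz, smul_eq_mul, F.E_lam i j hij,
      F.E_lam j i (Ne.symm hij), F.E_comm i j]
    ring
  rw [← sub_eq_zero, e, sub_eq_zero]
  exact ⟨fun h _ => h, fun h => h hij⟩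

/-- The first order condition for the extension of a conservation law. -/
theorem first_order (hη : η.IsSymm) (hf : F.Diagonalizes η f μ)
    (of : S.OrdLT 1 f) (hμ : ∀ i, S.OrdLT 1 (μ i)) {θ : Fin n → A}
    (hω : ∀ i, S.OrdLT 1 (ω i)) (hθ : ∀ i, S.OrdLT 1 (θ i))
    (h : S.br η (F.oneForm ω) f + S.br η F.h₀ (F.oneForm θ) ∈ S.null) (i k : Fin n) :
    (μ k - μ i) * (F.E k (ω i) - F.E i (ω k)) =
      (F.lam k - F.lam i) * (F.E k (θ i) - F.E i (θ k)) := by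
  have h1 := S.tot_le_null (hf.br_oneForm of hω)
  have h2 := S.tot_le_null (F.diagonalizes.br_oneForm F.ord_h₀ hθ)
  have h3 := S.tot_le_null (S.br_add_br_mem_tot hη F.h₀ (F.oneForm θ))
  have h4 := sub_mem (add_mem (sub_mem h2 h1) h) h3
  have h5 : F.quad (fun i k => F.E k (ω i) * (μ k - μ i)) -
      F.quad (fun i k => F.E k (θ i) * (F.lam k - F.lam i)) ∈ S.null := by
    convert h4 using 1; ring
  rw [F.quad_sub] at h5
  have := F.quad_mem_null_imp (fun i j => ((F.ord_E (hω i) j).mul ((hμ j).sub (hμ i))).sub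
    ((F.ord_E (hθ i) j).mul ((F.ord_lam j).sub (F.ord_lam i)))) h5 k i
  linear_combination this

/-- The flat metric on covectors, in the coordinates `R_i`. -/
def metric : Matrix (Fin n) (Fin n) A := F.J * η.map (algebraMap ℂ A) * F.J.transpose

theorem rHess_symm (hη : η.IsSymm) (f : A) :
    (Frame.rHess S η f * η.map (algebraMap ℂ A)).IsSymm := by
  have h1 : (η.map (algebraMap ℂ A)).transpose = η.map (algebraMap ℂ A) := by
    rw [← Matrix.transpose_map, hη]
  have h2 : (Matrix.of fun γ β => S.d 0 γ (S.d 0 β f)).transpose =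
      Matrix.of fun γ β => S.d 0 γ (S.d 0 β f) := by
    ext γ β; simp [S.d_comm 0 β 0 γ]
  rw [Matrix.IsSymm, Frame.rHess, Matrix.transpose_mul, Matrix.transpose_mul, h1, h2,
    Matrix.mul_assoc]

/-- The Riemann invariants are orthogonal coordinates. -/
theorem metric_eq_zero (hη : η.IsSymm) (hij : i ≠ j) : F.metric i j = 0 := by
  have h1 : F.J * (Frame.rHess S η F.h₀ * η.map (algebraMap ℂ A)) * F.J.transpose =
      Matrix.diagonal F.lam * F.metric := by
    rw [← Matrix.mul_assoc, (F.diagonalizes_iff η F.h₀ F.lam).mp F.diagonalizes, metric]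
    simp only [Matrix.mul_assoc]
  have h2 : (Matrix.diagonal F.lam * F.metric).IsSymm := by
    rw [← h1, Matrix.IsSymm, Matrix.transpose_mul, Matrix.transpose_mul, (rHess_symm hη _).eq,
      Matrix.transpose_transpose]
    simp only [Matrix.mul_assoc]
  have h3 : F.metric.IsSymm := by
    have : (η.map (algebraMap ℂ A)).transpose = η.map (algebraMap ℂ A) := by
      rw [← Matrix.transpose_map, hη]
    rw [Matrix.IsSymm, metric, Matrix.transpose_mul, Matrix.transpose_mul, this,
      Matrix.transpose_transpose, Matrix.mul_assoc]
  have h4 := h2.apply i j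
  rw [Matrix.diagonal_mul, Matrix.diagonal_mul, h3.apply] at h4
  apply F.eq_zero_of_sub_mul hij
  linear_combination -h4

theorem metric_eq_diagonal (hη : η.IsSymm) : F.metric = Matrix.diagonal fun i => F.metric i i := by
  ext i j
  by_cases hij : i = j
  · subst hij; simp
  · rw [F.metric_eq_zero hη hij, Matrix.diagonal_apply_ne _ hij]

theorem isUnit_metric (hη : η.IsSymm) (hη' : η.det ≠ 0) (i : Fin n) : IsUnit (F.metric i i) := by
  have h1 : F.metric * (F.Wm.transpose * η⁻¹.map (algebraMap ℂ A) * F.Wm) = 1 := by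
    have e1 : F.J.transpose * F.Wm.transpose = 1 := by
      rw [← Matrix.transpose_mul, F.Wm_mul_J, Matrix.transpose_one]
    have e2 : η.map (algebraMap ℂ A) * η⁻¹.map (algebraMap ℂ A) = 1 := by
      rw [← Matrix.map_mul, Matrix.mul_nonsing_inv _ (isUnit_iff_ne_zero.mpr hη'), Matrix.map_one]
      · exact map_zero _
      · exact map_one _
    calc _ = F.J * η.map (algebraMap ℂ A) * (F.J.transpose * F.Wm.transpose) *
          η⁻¹.map (algebraMap ℂ A) * F.Wm := by rw [metric]; simp only [Matrix.mul_assoc]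
      _ = F.J * (η.map (algebraMap ℂ A) * η⁻¹.map (algebraMap ℂ A)) * F.Wm := by
          rw [e1]; simp only [Matrix.mul_assoc, Matrix.one_mul]
      _ = 1 := by rw [e2, Matrix.mul_one, F.J_mul_Wm]
  rw [F.metric_eq_diagonal hη] at h1
  have h2 := congrFun (congrFun h1 i) i
  rw [Matrix.diagonal_mul, Matrix.one_apply_eq] at h2
  exact IsUnit.of_mul_eq_one _ h2

/-- The Christoffel coefficients are logarithmic derivatives of the metric coefficients. -/
theorem E_metric (hη : η.IsSymm) (hik : i ≠ k) :
    F.E k (F.metric i i) = -2 * F.a i k * F.metric i i := by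
  have h1 : ∀ α, ∑ β, algebraMap ℂ A (η α β) * S.d 0 β (F.R i) = F.metric i i * F.W i α := by
    intro α
    have : F.Wm * F.metric = η.map (algebraMap ℂ A) * F.J.transpose := by
      rw [metric, ← Matrix.mul_assoc, ← Matrix.mul_assoc, F.Wm_mul_J, Matrix.one_mul]
    rw [F.metric_eq_diagonal hη] at this
    have h2 := congrFun (congrFun this α) i
    rw [Matrix.mul_diagonal] at h2
    simp only [Frame.Wm, Matrix.of_apply, Matrix.mul_apply, Matrix.map_apply, Frame.J,
      Matrix.transpose_apply] at h2
    rw [← h2, mul_comm]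
  have h2 : ∑ α, F.W i α * F.E k (S.d 0 α (F.R i)) = - F.a i k := by
    have h3 := congrArg (F.E k) (F.W_R i i)
    rw [if_pos rfl, Derivation.map_one_eq_zero, map_sum] at h3
    simp only [leibniz, smul_eq_mul, sum_add_distrib, F.E_W hik, mul_add] at h3
    have e1 : ∑ α, S.d 0 α (F.R i) * (F.a i k * F.W i α) = F.a i k := by
      have := congrArg (F.a i k * ·) (F.W_R i i)
      simp only [if_true, mul_one, mul_sum] at this
      exact (sum_ext fun _ => by ring).trans this
    have e2 : ∑ α, S.d 0 α (F.R i) * (F.a k i * F.W k α) = 0 := by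
      have := congrArg (F.a k i * ·) (F.W_R k i)
      simp only [if_neg hik.symm, mul_zero, mul_sum] at this
      exact (sum_ext fun _ => by ring).trans this
    rw [e1, e2] at h3
    linear_combination h3
  have h4 : F.metric i i = ∑ α, S.d 0 α (F.R i) *
      ∑ β, algebraMap ℂ A (η α β) * S.d 0 β (F.R i) := by
    simp only [metric, Matrix.mul_apply, Matrix.map_apply, Frame.J, Matrix.of_apply,
      Matrix.transpose_apply, sum_mul, mul_sum]
    rw [sum_comm]
    exact sum_ext₂ fun _ _ => by ring
  have h5 : F.E k (F.metric i i) = 2 * ∑ α, F.E k (S.d 0 α (F.R i)) *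
      ∑ β, algebraMap ℂ A (η α β) * S.d 0 β (F.R i) := by
    rw [h4, map_sum]
    simp only [leibniz, smul_eq_mul, map_sum, Derivation.map_algebraMap, mul_zero,
      add_zero, sum_add_distrib]
    rw [two_mul]
    congr 1
    · simp only [mul_sum]
      rw [sum_comm]
      refine sum_ext₂ fun _ _ => ?_
      rw [hη.apply]; ring
    · exact sum_ext fun _ => mul_comm _ _
  rw [h5]
  simp only [h1]
  have h6 : ∑ α, F.E k (S.d 0 α (F.R i)) * (F.metric i i * F.W i α) =
      F.metric i i * ∑ α, F.W i α * F.E k (S.d 0 α (F.R i)) := by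
    rw [mul_sum]
    exact sum_ext fun _ => by ring
  rw [h6, h2]; ring

/-- A Hamiltonian `∫ f(v) dx` commuting with `∫ h₀ dx` is diagonal in the Riemann invariants. -/
theorem exists_diagonalizes (hη : η.IsSymm) (hf : S.OrdLT 1 f) (h : S.br η F.h₀ f ∈ S.null) :
    ∃ μ : Fin n → A, (∀ i, S.OrdLT 1 (μ i)) ∧ F.Diagonalizes η f μ := by
  have h1 : ∀ i j, i ≠ j → ∑ α, F.W i α * F.E j (S.d 0 α f) = 0 := by
    intro i j hij
    have h2 := (F.oneForm_sub_br_mem_null_iff hη hf (ω := fun _ => 0)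
      (fun _ _ _ _ => map_zero _)).mp (by
        convert neg_mem h using 1
        simp [Frame.oneForm]) i j hij
    have h3 : F.E j (F.E i f) = F.a i j * F.E i f + F.a j i * F.E j f +
        ∑ α, F.W i α * F.E j (S.d 0 α f) := by
      rw [F.E_apply i f, map_sum]
      simp only [leibniz, smul_eq_mul, F.E_W hij, sum_add_distrib, F.E_apply j f, mul_sum, mul_add]
      rw [add_comm]
      congr 1
      congr 1 <;> exact sum_ext fun _ => by ring
    apply F.eq_zero_of_sub_mul hij
    simp only [map_zero, sub_zero] at h2
    rw [h3] at h2
    linear_combination h2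
  let X : Matrix (Fin n) (Fin n) A :=
    F.Wm.transpose * (Matrix.of fun γ β => S.d 0 γ (S.d 0 β f)) * F.Wm
  have hX : ∀ i j, X i j = ∑ α, F.W i α * F.E j (S.d 0 α f) := by
    intro i j
    simp only [X, Matrix.mul_apply, Matrix.of_apply, Frame.Wm, Matrix.transpose_apply,
      F.E_apply, mul_sum, sum_mul]
    rw [sum_comm]
    refine sum_ext₂ fun _ _ => ?_
    rw [S.d_comm]; ring
  have hXd : X = Matrix.diagonal fun i => X i i := by
    ext i j
    by_cases hij : i = j
    · subst hij; simp
    · rw [Matrix.diagonal_apply_ne _ hij, hX, h1 i j hij]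
  refine ⟨fun i => F.metric i i * X i i, fun i => ?_, ?_⟩
  · refine OrdLT.mul ?_ ?_
    · simp only [metric, Matrix.mul_apply, Matrix.map_apply, Frame.J, Matrix.of_apply,
        Matrix.transpose_apply]
      exact OrdLT.sum fun _ _ => (OrdLT.sum fun _ _ => ((F.ord_R _).d _ _).mul
        (S.ordLT_algebraMap _ _)).mul ((F.ord_R _).d _ _)
    · rw [hX]
      exact OrdLT.sum fun _ _ => (F.ord_W _ _).mul (F.ord_E (hf.d _ _) _)
  · rw [F.diagonalizes_iff]
    have e1 : F.J.transpose * F.Wm.transpose = 1 := by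
      rw [← Matrix.transpose_mul, F.Wm_mul_J, Matrix.transpose_one]
    have e2 : F.metric * X * F.J = F.J * Frame.rHess S η f := by
      calc _ = F.J * η.map (algebraMap ℂ A) * (F.J.transpose * F.Wm.transpose) *
            (Matrix.of fun γ β => S.d 0 γ (S.d 0 β f)) * (F.Wm * F.J) := by
            simp only [metric, X, Matrix.mul_assoc]
        _ = _ := by
            rw [e1, F.Wm_mul_J, Matrix.mul_one, Matrix.mul_one, Frame.rHess, Matrix.mul_assoc]
    rw [← e2]
    nth_rewrite 1 [F.metric_eq_diagonal hη]
    nth_rewrite 1 [hXd]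
    rw [Matrix.diagonal_mul_diagonal]

/-! ### The normal form of quadratic Hamiltonians -/

/-- The coefficients of `-∑ c_i μ_{i,i} R_{i,x}² + ∑_{i≠k} (μ_i - μ_k) s_ik R_{i,x} R_{k,x}`. -/
def stdQuad (μ c : Fin n → A) (s : Fin n → Fin n → A) (i k : Fin n) : A :=
  if i = k then -(c i * F.E i (μ i)) else (μ i - μ k) * s i k

end Riemann

end JetAlgebra

end

section

variable {a f : A} {μ c : Fin n → A} {s : Fin n → Fin n → A}

/-! ### Commuting quadratic Hamiltonians -/

namespace JetAlgebra

namespace Frame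

variable (F : S.Frame)

/-- Twice `flowSymm`, with integral coefficients. -/
theorem two_mul_flowSymm (q : Fin n → Fin n → A) (μ : Fin n → A) (i j k : Fin n) :
    2 * F.flowSymm q μ i j k =
      F.E k (q i j) * (2 * μ k - μ i - μ j) + q i j * (F.E k (μ i) + F.E k (μ j)) +
      (F.E i (q j k) * (2 * μ i - μ j - μ k) + q j k * (F.E i (μ j) + F.E i (μ k))) +
      (F.E j (q k i) * (2 * μ j - μ k - μ i) + q k i * (F.E j (μ k) + F.E j (μ i))) := by
  simp only [flowSymm, flowCoeff]
  linear_combination (q i j * (F.E k (μ i) + F.E k (μ j)) - F.E k (q i j) * (μ i + μ j) +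
    (q j k * (F.E i (μ j) + F.E i (μ k)) - F.E i (q j k) * (μ j + μ k)) +
    (q k i * (F.E j (μ k) + F.E j (μ i)) - F.E j (q k i) * (μ k + μ i))) * two_mul_half (A := A)

theorem flowSymm_rotate (q : Fin n → Fin n → A) (μ : Fin n → A) (i j k : Fin n) :
    F.flowSymm q μ j k i = F.flowSymm q μ i j k := by
  simp only [flowSymm]; ring

theorem two_mul_cancel {b : A} (h : 2 * a = 2 * b) : a = b := by
  rw [← sub_eq_zero]; apply eq_zero_of_add_self; linear_combination h

end Frame

namespace Riemann

variable (F : S.Riemann η)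

theorem ord_stdQuad (hμ : ∀ i, S.OrdLT 1 (μ i))
    (hc : ∀ i, S.OrdLT 1 (c i)) (hs : ∀ i k, S.OrdLT 1 (s i k)) (i k : Fin n) :
    S.OrdLT 1 (F.stdQuad μ c s i k) := by
  rw [stdQuad]
  split_ifs
  · exact ((hc i).mul (F.ord_E (hμ i) i)).neg
  · exact ((hμ i).sub (hμ k)).mul (hs i k)

theorem stdQuad_symm (hs : ∀ i k, s i k = - s k i)
    (i k : Fin n) : F.stdQuad μ c s i k = F.stdQuad μ c s k i := by
  by_cases h : i = k
  · subst h; rfl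
  · rw [stdQuad, stdQuad, if_neg h, if_neg (Ne.symm h), hs i k]; ring

variable {F} in
/-- The coefficient of `R_{i,x}² R_{k,x}` measures the dependence of `c_i` on `R_k`. -/
theorem flowSymm_stdQuad_diag (hf : F.Diagonalizes η f μ)
    (c : Fin n → A) (hs : ∀ i k, s i k = - s k i) (hik : i ≠ k) :
    F.flowSymm (F.stdQuad F.lam c s) μ i i k - F.flowSymm (F.stdQuad μ c s) F.lam i i k =
      - (F.E k (c i) * (F.E i (F.lam i) * (μ k - μ i) - F.E i (μ i) * (F.lam k - F.lam i))) := by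
  apply Frame.two_mul_cancel
  rw [mul_sub, F.two_mul_flowSymm, F.two_mul_flowSymm]
  have d1 : F.E k (F.E i (F.lam i)) = F.E i (F.a i k) * (F.lam k - F.lam i) +
      F.a i k * (F.a k i * (F.lam i - F.lam k) - F.E i (F.lam i)) := by
    rw [F.E_comm, F.E_lam i k hik, leibniz, map_sub, F.E_lam k i hik.symm]
    simp only [smul_eq_mul]; ring
  have d2 : F.E k (F.E i (μ i)) = F.E i (F.a i k) * (μ k - μ i) +
      F.a i k * (F.a k i * (μ i - μ k) - F.E i (μ i)) := by
    rw [F.E_comm, E_vel hf hik, leibniz, map_sub, E_vel hf hik.symm]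
    simp only [smul_eq_mul]; ring
  simp only [stdQuad, if_true, if_neg hik, if_neg hik.symm, map_neg, map_sub, leibniz,
    smul_eq_mul, F.E_lam i k hik, F.E_lam k i hik.symm, E_vel hf hik, E_vel hf hik.symm, d1, d2,
    hs k i]
  ring

variable {F} in
/-- The coefficient of `R_{i,x} R_{j,x} R_{k,x}` measures the failure of `s` to be closed. -/
theorem flowSymm_stdQuad_off_diag (hf : F.Diagonalizes η f μ)
    (c : Fin n → A) (hij : i ≠ j) (hik : i ≠ k) (hjk : j ≠ k) :
    F.flowSymm (F.stdQuad F.lam c s) μ i j k - F.flowSymm (F.stdQuad μ c s) F.lam i j k =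
      (F.E k (s i j) + F.E i (s j k) + F.E j (s k i)) *
      ((F.lam j - F.lam k) * (μ i - μ k) - (F.lam i - F.lam k) * (μ j - μ k)) := by
  apply Frame.two_mul_cancel
  rw [mul_sub, F.two_mul_flowSymm, F.two_mul_flowSymm]
  simp only [stdQuad, if_neg hij, if_neg hjk, if_neg hik.symm, map_sub, leibniz,
    smul_eq_mul, F.E_lam i k hik, F.E_lam k i hik.symm, E_vel hf hik, E_vel hf hik.symm,
    F.E_lam i j hij, F.E_lam j i hij.symm, E_vel hf hij, E_vel hf hij.symm,
    F.E_lam j k hjk, F.E_lam k j hjk.symm, E_vel hf hjk, E_vel hf hjk.symm]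
  ring

variable {F} in
theorem flowSymm_stdQuad_self (c : Fin n → A) (s : Fin n → Fin n → A) (i : Fin n) :
    F.flowSymm (F.stdQuad F.lam c s) μ i i i = F.flowSymm (F.stdQuad μ c s) F.lam i i i := by
  apply Frame.two_mul_cancel
  rw [F.two_mul_flowSymm, F.two_mul_flowSymm]
  simp only [stdQuad, if_true, map_neg, leibniz, smul_eq_mul]
  ring

/-- If `c_i` depends on `R_i` only and `s` is closed, the quadratic Hamiltonians in normal form
with these data, attached to commuting diagonal flows, are compatible deformations. -/
theorem br_stdQuad_mem_null (hη : η.IsSymm) (hf : F.Diagonalizes η f μ)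
    (of : S.OrdLT 1 f) (hμ : ∀ i, S.OrdLT 1 (μ i)) (oc : ∀ i, S.OrdLT 1 (c i)) (os : ∀ i k, S.OrdLT 1 (s i k)) (hs : ∀ i k, s i k = - s k i)
    (hc : ∀ i k, i ≠ k → F.E k (c i) = 0)
    (hd : ∀ i j k, F.E k (s i j) + F.E i (s j k) + F.E j (s k i) = 0) :
    S.br η (F.quad (F.stdQuad F.lam c s)) f + S.br η F.h₀ (F.quad (F.stdQuad μ c s)) ∈ S.null := by
  rw [F.br_quad_add_br_quad_mem_null_iff hη hf F.diagonalizes of F.ord_h₀ hμ F.ord_lam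
    (F.ord_stdQuad F.ord_lam oc os) (F.ord_stdQuad hμ oc os) (F.stdQuad_symm hs)
    (F.stdQuad_symm hs)]
  constructor
  · intro i j
    by_cases h : i = j
    · subst h; ring
    · rw [stdQuad, stdQuad, if_neg h, if_neg h]; ring
  · have key : ∀ i k, i ≠ k → F.flowSymm (F.stdQuad F.lam c s) μ i i k =
        F.flowSymm (F.stdQuad μ c s) F.lam i i k := by
      intro i k hik
      rw [← sub_eq_zero, flowSymm_stdQuad_diag hf c hs hik, hc i k hik]; ring
    intro i j k
    by_cases hij : i = j
    · subst hij
      by_cases hik : i = k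
      · subst hik; exact flowSymm_stdQuad_self c s i
      · exact key i k hik
    · by_cases hik : i = k
      · subst hik
        rw [F.flowSymm_rotate _ _ i i j, F.flowSymm_rotate _ _ i i j]
        exact key i j hij
      · by_cases hjk : j = k
        · subst hjk
          rw [← F.flowSymm_rotate _ _ i j j, ← F.flowSymm_rotate _ _ i j j]
          exact key j i (Ne.symm hij)
        · rw [← sub_eq_zero, flowSymm_stdQuad_off_diag hf c hij hik hjk, hd]; ring

/-! ### Logarithmic generators -/

/-- Branches `L_i` of `log R_{i,x}`, given by their derivatives. -/
structure LogBranch (F : S.Frame) where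
  L : Fin n → A
  ord_L : ∀ i, S.OrdLT 2 (L i)
  isUnit_p : ∀ i, IsUnit (F.p i)
  vf_L : ∀ i (Y : ℕ → Fin n → A), F.p i * S.vf Y (L i) = S.vf Y (F.p i)

end Riemann

namespace Frame

open HamPDE.JetAlgebra.Riemann

variable {F : S.Frame} (L : LogBranch F)

/-- The density `∑ c_i (R_{i,x} log R_{i,x} - R_{i,x})`. -/
def logForm (c : Fin n → A) : A := ∑ i, c i * (F.p i * L.L i - F.p i)

theorem ord_logForm (hc : ∀ i, S.OrdLT 1 (c i)) : S.OrdLT 2 (logForm L c) :=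
  OrdLT.sum fun i _ => ((hc i).mono (by norm_num)).mul
    (((F.ord_p i).mul (L.ord_L i)).sub (F.ord_p i))

/-- The derivation property `d (p log p - p) = log p dp`. -/
theorem vf_p_L (Y : ℕ → Fin n → A) (i : Fin n) :
    S.vf Y (F.p i * L.L i - F.p i) = L.L i * S.vf Y (F.p i) := by
  rw [map_sub, leibniz, smul_eq_mul, smul_eq_mul, L.vf_L]; ring

theorem V_eq_vf (k : Fin n) (a : A) :
    F.V k a = S.vf (fun ℓ α => if ℓ = 1 then F.W k α else 0) a := by
  obtain ⟨N, ha⟩ := S.finite_ord a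
  rw [vf_eq_sum' _ (ha.mono (Nat.le_add_right N 2)), V_apply]
  symm
  rw [sum_eq_single 1]
  · simp
  · intro ℓ _ hℓ; simp [hℓ]
  · intro h; exact absurd (Finset.mem_range.mpr (by omega)) h

theorem V_L (k i : Fin n) : F.p i * F.V k (L.L i) = if k = i then 1 else 0 := by
  rw [V_eq_vf, L.vf_L, ← V_eq_vf, V_p]

theorem V_L_of_ne (h : k ≠ i) : F.V k (L.L i) = 0 := by
  have := V_L L k i
  rw [if_neg h] at this
  exact (L.isUnit_p i).mul_right_eq_zero.mp this

theorem V_p_L (k i : Fin n) : F.V k (F.p i * L.L i - F.p i) = if k = i then L.L i else 0 := by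
  rw [V_eq_vf, vf_p_L, ← V_eq_vf, V_p, mul_ite, mul_one, mul_zero]

theorem V_logForm (hc : ∀ i, S.OrdLT 1 (c i)) (k : Fin n) : F.V k (logForm L c) = c k * L.L k := by
  have h0 : ∀ i, F.V k (c i) = 0 := fun i => F.V_ord_one (hc i) k
  simp [logForm, leibniz, V_p_L, h0]

theorem V_comm (i k : Fin n) (a : A) : F.V i (F.V k a) = F.V k (F.V i a) := by
  have e : ∀ i k, F.V i (F.V k a) = ∑ β, ∑ γ, F.W k β * F.W i γ * S.d 1 γ (S.d 1 β a) := by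
    intro i k
    rw [F.V_apply k, map_sum]
    refine sum_ext fun β => ?_
    rw [leibniz, F.V_ord_one (F.ord_W k β), smul_zero, add_zero, smul_eq_mul, V_apply, mul_sum]
    exact sum_ext fun γ => by ring
  rw [e, e, sum_comm]
  refine sum_ext₂ fun β γ => ?_
  rw [S.d_comm]; ring

/-- A function of `(v, v_x)` killed by all `∂ / ∂ R_{i,x}` is a function of `v`. -/
theorem ord_one_of_V (h : S.OrdLT 2 a) (h' : ∀ i, F.V i a = 0) : S.OrdLT 1 a := by
  intro ℓ hℓ α
  by_cases h1 : ℓ = 1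
  · subst h1
    rw [F.d_one_eq]; exact sum_eq_zero fun i _ => by rw [h', zero_mul]
  · exact h ℓ (by omega) α

theorem euler_ord_one (h : S.OrdLT 1 a) : S.euler a = 0 := by rw [euler, vf_ordLT_one _ h]; simp

theorem euler_ord_two (h : S.OrdLT 2 a) : S.euler a = ∑ i, F.p i * F.V i a := by
  have e : ∀ i, F.p i = ∑ α, S.x 1 α * S.d 0 α (F.R i) := fun i => vf_ordLT_one _ (F.ord_R i)
  rw [euler, vf_eq_sum' _ h, sum_range_succ, sum_range_one]
  simp only [Nat.cast_zero, zero_mul, Finset.sum_const_zero, zero_add, Nat.cast_one, one_mul]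
  simp only [e, sum_mul]
  rw [sum_comm]
  refine sum_ext fun α => ?_
  rw [F.d_one_eq, mul_sum]
  exact sum_ext fun i => by ring

theorem V_euler (h : S.OrdLT 2 a) (k : Fin n) :
    F.V k (S.euler a) = S.euler (F.V k a) + F.V k a := by
  rw [euler_ord_two (F := F) h, euler_ord_two (F := F) (F.V_ord h k), map_sum]
  simp only [leibniz, V_p, smul_eq_mul, sum_add_distrib, F.V_comm k]
  simp

end Frame

namespace Riemann

open HamPDE.JetAlgebra.Frame

variable (F : S.Riemann η) (L : LogBranch F.toFrame)

/-- The bracket of a one-form with `H₀`. -/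
theorem br_h₀_oneForm (hη : η.IsSymm) {ω : Fin n → A} (hω : ∀ i, S.OrdLT 1 (ω i)) :
    S.br η F.h₀ (F.oneForm ω) + F.quad (fun i k => F.E k (ω i) * (F.lam k - F.lam i)) ∈ S.tot := by
  have h1 := F.diagonalizes.br_oneForm F.ord_h₀ hω
  have h2 := S.br_add_br_mem_tot hη F.h₀ (F.oneForm ω)
  convert sub_mem h2 h1 using 1
  ring

/-- The bracket of `H₀` with a logarithmic functional. -/
theorem br_h₀_logForm (hη : η.IsSymm) (hc : ∀ i, S.OrdLT 1 (c i)) :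
    S.br η F.h₀ (logForm L c) +
      (∑ i, ∑ k, F.E k (c i) * (F.lam k - F.lam i) * (F.p i * L.L i) * F.p k +
        F.quad (fun i k => F.E k (F.lam i * c i) - F.E k (c i) * F.lam k)) ∈ S.tot := by
  set X := S.ham η F.h₀
  have hX : ∀ i, S.pr X (F.R i) = F.lam i * F.p i := F.diagonalizes.pr_R F.ord_h₀
  have h1 := S.pr_sub_br_mem_tot η (logForm L c) F.h₀
  have h2 := S.br_add_br_mem_tot hη F.h₀ (logForm L c)
  have h3 := S.D_mem_tot (∑ i, (c i * L.L i * F.lam i * F.p i - F.lam i * c i * F.p i))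
  have e1 : S.pr X (logForm L c) = ∑ i, (S.pr X (c i) * (F.p i * L.L i - F.p i) +
      c i * L.L i * S.D (F.lam i * F.p i)) := by
    rw [logForm, map_sum]
    refine sum_ext fun i => ?_
    rw [leibniz, pr, vf_p_L, ← pr, p, pr_D, hX, smul_eq_mul, smul_eq_mul]
    simp only [p]; ring
  have e2 : S.D (∑ i, (c i * L.L i * F.lam i * F.p i - F.lam i * c i * F.p i)) =
      ∑ i, (c i * L.L i * S.D (F.lam i * F.p i) + F.lam i * F.p i * S.D (c i) * L.L i -
        S.D (F.lam i * c i) * F.p i) := by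
    rw [map_sum]
    refine sum_ext fun i => ?_
    have hL : F.p i * S.D (L.L i) = S.D (F.p i) := L.vf_L i _
    simp only [map_sub, leibniz, smul_eq_mul]
    linear_combination c i * F.lam i * hL
  have e3 : ∑ i, ∑ k, F.E k (c i) * (F.lam k - F.lam i) * (F.p i * L.L i) * F.p k +
        F.quad (fun i k => F.E k (F.lam i * c i) - F.E k (c i) * F.lam k) =
      ∑ i, (S.pr X (c i) * (F.p i * L.L i - F.p i) - F.lam i * F.p i * S.D (c i) * L.L i +
        S.D (F.lam i * c i) * F.p i) := by
    rw [quad, ← sum_add_distrib]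
    refine sum_ext fun i => ?_
    rw [F.pr_eq X (hc i), F.D_eq (hc i), F.D_eq ((F.ord_lam i).mul (hc i))]
    simp only [hX, sum_mul, mul_sum, ← sum_add_distrib, ← sum_sub_distrib]
    exact sum_ext fun k => by ring
  convert sub_mem (add_mem h1 h2) h3 using 1
  rw [e1, e2, e3]
  simp only [sum_add_distrib, sum_sub_distrib]
  ring

/-- `{H₀, K₁}` for a generator of logarithmic form is a quadratic Hamiltonian in normal form. -/
theorem br_h₀_generator (hη : η.IsSymm) {φ ψ : Fin n → A} (oc : ∀ i, S.OrdLT 1 (c i))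
    (oφ : ∀ i, S.OrdLT 1 (φ i))
    (hc : ∀ i k, i ≠ k → F.E k (c i) = 0)
    (hψ : ∀ i k, i ≠ k → F.E k (ψ i) = c i * F.a i k) :
    S.br η F.h₀ (logForm L c + F.oneForm φ) -
      F.quad (F.stdQuad F.lam c fun i k => half A * (F.E k (φ i + ψ i) - F.E i (φ k + ψ k))) ∈
        S.null := by
  have h1 := S.tot_le_null (F.br_h₀_logForm L hη oc)
  have h2 := S.tot_le_null (F.br_h₀_oneForm hη oφ)
  have h3 : ∑ i, ∑ k, F.E k (c i) * (F.lam k - F.lam i) * (F.p i * L.L i) * F.p k = 0 := by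
    refine sum_eq_zero fun i _ => sum_eq_zero fun k _ => ?_
    by_cases hik : i = k
    · subst hik; ring
    · rw [hc i k hik]; ring
  rw [h3, zero_add] at h1
  have h4 : F.quad (fun i k => F.stdQuad F.lam c
      (fun i k => half A * (F.E k (φ i + ψ i) - F.E i (φ k + ψ k))) i k -
      (0 - (F.E k (F.lam i * c i) - F.E k (c i) * F.lam k) -
        F.E k (φ i) * (F.lam k - F.lam i))) = 0 := by
    apply F.quad_eq_zero
    intro i k
    by_cases hik : i = k
    · subst hik
      simp only [stdQuad, if_true, leibniz, smul_eq_mul]; ring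
    · simp only [stdQuad, if_neg hik, if_neg (Ne.symm hik), map_add, hψ i k hik,
        hψ k i (Ne.symm hik), hc i k hik, hc k i (Ne.symm hik), leibniz, smul_eq_mul,
        F.E_lam i k hik, F.E_lam k i (Ne.symm hik)]
      linear_combination (F.lam i - F.lam k) * (F.E k (φ i) + c i * F.a i k - F.E i (φ k) -
        c k * F.a k i) * two_mul_half (A := A)
  convert add_mem h1 h2 using 1
  rw [br_add_right]
  have h5 : F.quad (F.stdQuad F.lam c fun i k =>
      half A * (F.E k (φ i + ψ i) - F.E i (φ k + ψ k))) =
      - F.quad (fun i k => F.E k (F.lam i * c i) - F.E k (c i) * F.lam k) -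
      F.quad (fun i k => F.E k (φ i) * (F.lam k - F.lam i)) := by
    rw [← F.quad_sub, ← F.quad_sub, ← F.quad_sub] at h4
    have h6 : F.quad (fun _ _ => (0 : A)) = 0 := by simp [quad]
    rw [h6] at h4
    linear_combination h4
  rw [h5]; ring

/-- The variational derivatives of a generator of logarithmic form are homogeneous of degree
one. -/
theorem euler_δ_generator {φ : Fin n → A} (oc : ∀ i, S.OrdLT 1 (c i))
    (oφ : ∀ i, S.OrdLT 1 (φ i)) (hc : ∀ i k, i ≠ k → F.E k (c i) = 0) :
    S.euler (logForm L c + F.oneForm φ) - (logForm L c + F.oneForm φ) ∈ S.null := by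
  have h1 : F.oneForm c ∈ S.null := by
    rw [F.oneForm_mem_null_iff oc]
    intro i j
    by_cases hij : i = j
    · subst hij; rfl
    · rw [hc i j hij, hc j i (Ne.symm hij)]
  have hp : ∀ i, S.euler (F.p i) = F.p i := fun i => by
    rw [p, euler_D, euler_ord_one (F.ord_R i), map_zero, zero_add]
  convert h1 using 1
  have e1 : ∀ i, S.euler (F.p i * L.L i - F.p i) = F.p i * L.L i := fun i => by
    rw [euler, vf_p_L, ← euler, hp]; ring
  simp only [map_add, logForm, oneForm, map_sum, leibniz, euler_ord_one (oc _),
    euler_ord_one (oφ _), hp, e1, smul_eq_mul, mul_zero, add_zero, ← sum_add_distrib,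
    ← sum_sub_distrib]
  exact sum_ext fun i => by ring

end Riemann

end JetAlgebra

end

/-! ### Generators of degree one -/

namespace JetAlgebra

namespace Frame

variable (F : S.Frame)

/-- The chain rule for functions of the coordinates `(R_i, R_{i,x})`. -/
theorem vf_ord_two {a : A} (h : S.OrdLT 2 a) (Y : ℕ → Fin n → A) :
    S.vf Y a = ∑ i, F.V i a * S.vf Y (F.p i) +
      ∑ j, (F.E j a - ∑ i, F.V i a * F.E j (F.p i)) * S.vf Y (F.R j) := by
  have h1 : ∀ {b : A}, S.OrdLT 2 b → S.vf Y b = ∑ j, F.E j b * S.vf Y (F.R j) +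
      ∑ α, Y 1 α * S.d 1 α b := by
    intro b hb
    rw [vf_eq_sum' Y hb, sum_range_succ, sum_range_one]
    congr 1
    simp only [vf_ordLT_one Y (F.ord_R _), mul_sum]
    rw [sum_comm]
    refine sum_ext fun α => ?_
    rw [F.d_zero_eq b, mul_sum]
    exact sum_ext fun i => by ring
  have h2 : ∑ α, Y 1 α * S.d 1 α a = ∑ i, F.V i a * ∑ α, Y 1 α * S.d 1 α (F.p i) := by
    simp only [d_one_p, mul_sum]
    rw [sum_comm]
    refine sum_ext fun α => ?_
    rw [F.d_one_eq a, mul_sum]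
    exact sum_ext fun i => by ring
  have h3 : ∑ j, (∑ i, F.V i a * F.E j (F.p i)) * S.vf Y (F.R j) =
      ∑ i, F.V i a * ∑ j, F.E j (F.p i) * S.vf Y (F.R j) := by
    simp only [mul_sum, sum_mul]
    rw [sum_comm]
    exact sum_ext₂ fun _ _ => by ring
  simp only [h1 (F.ord_p _)]
  rw [h1 h, h2]
  simp only [sub_mul, mul_add, sum_sub_distrib, sum_add_distrib, h3]
  ring

variable {F} in
theorem _root_.HamPDE.JetAlgebra.OrdLT.euler {N : ℕ} {a : A} (h : S.OrdLT N a) :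
    S.OrdLT N (S.euler a) := by
  intro ℓ hℓ α
  have := S.euler_d ℓ α a
  rw [h ℓ hℓ, map_zero, mul_zero, sub_zero] at this
  exact this.symm

theorem V_L_add (L : Riemann.LogBranch F) (k i : Fin n) :
    F.V k (F.p i * L.L i) = if k = i then L.L i + 1 else 0 := by
  have h := V_p_L L k i
  rw [map_sub, V_p, sub_eq_iff_eq_add] at h
  rw [h]; split_ifs <;> simp

end Frame

namespace Riemann

open HamPDE.JetAlgebra.Frame

variable (F : S.Riemann η) (L : LogBranch F.toFrame)

/-- A first order functional whose bracket with `H₀` is a quadratic functional splits in the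
variables `R_{i,x}`, up to trivial terms. -/
theorem V_V_eq_zero (hη : η.IsSymm) {k₁ : A} (ok : S.OrdLT 2 k₁) {q : Fin n → Fin n → A}
    (oq : ∀ i j, S.OrdLT 1 (q i j)) (h : S.br η F.h₀ k₁ - F.quad q ∈ S.null) (hik : i ≠ k) : F.V i (F.V k k₁) = 0 := by
  set X := S.ham η F.h₀
  have hX : ∀ i, S.pr X (F.R i) = F.lam i * F.p i := F.diagonalizes.pr_R F.ord_h₀
  have h1 := S.tot_le_null (S.pr_sub_br_mem_tot η k₁ F.h₀)
  have h2 := S.tot_le_null (S.br_add_br_mem_tot hη F.h₀ k₁)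
  have oc : S.OrdLT 2 (∑ i, F.V i k₁ * (S.D (F.lam i) * F.p i) +
      ∑ j, (F.E j k₁ - ∑ i, F.V i k₁ * F.E j (F.p i)) * (F.lam j * F.p j) + F.quad q) := by
    refine ((OrdLT.sum fun i _ => (F.V_ord ok i).mul ((F.ord_lam i).D.mul (F.ord_p i))).add
      (OrdLT.sum fun j _ => ((ok.E (by norm_num) j).sub
        (OrdLT.sum fun i _ => (F.V_ord ok i).mul ((F.ord_p i).E (by norm_num) j))).mul
        (((F.ord_lam j).mono (by norm_num)).mul (F.ord_p j)))).add (F.ord_quad oq)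
  have h3 := F.V_symm_of_null (b := fun i => F.V i k₁ * F.lam i)
    (fun i => (F.V_ord ok i).mul ((F.ord_lam i).mono (by norm_num))) oc (by
      convert sub_mem (add_mem h1 h2) h using 1
      have e : ∀ i, S.pr X (F.p i) = F.lam i * S.D (F.p i) + S.D (F.lam i) * F.p i := fun i => by
        rw [p, pr_D, hX, leibniz, smul_eq_mul, smul_eq_mul, p]; ring
      have e' := F.vf_ord_two ok (fun ℓ α => S.D^[ℓ] (X α))
      rw [← pr] at e'
      rw [e']
      simp only [e, hX, mul_add, sum_add_distrib]
      have e2 : ∀ i, F.V i k₁ * (F.lam i * S.D (F.p i)) = F.V i k₁ * F.lam i * S.D (F.p i) :=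
        fun i => by ring
      simp only [e2]; ring) i k
  rw [leibniz, leibniz, F.V_ord_one (F.ord_lam i), F.V_ord_one (F.ord_lam k), F.V_comm k i] at h3
  simp only [smul_eq_mul, mul_zero, zero_add] at h3
  apply F.eq_zero_of_sub_mul hik
  linear_combination -h3

/-- A generator of degree one that carries `H₀` to a quadratic functional is of logarithmic
form. -/
theorem exists_logForm (hη : η.IsSymm) {k₁ : A} (ok : S.OrdLT 2 k₁)
    (hom : ∀ β, S.euler (S.δ β k₁) = S.δ β k₁) {q : Fin n → Fin n → A}
    (oq : ∀ i j, S.OrdLT 1 (q i j)) (h : S.br η F.h₀ k₁ - F.quad q ∈ S.null) :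
    ∃ c φ : Fin n → A, (∀ i, S.OrdLT 1 (c i)) ∧ (∀ i, S.OrdLT 1 (φ i)) ∧
      (∀ i k, i ≠ k → F.E k (c i) = 0) ∧ k₁ - (logForm L c + F.oneForm φ) ∈ S.null := by
  have hE : S.euler k₁ - k₁ ∈ S.null := by
    rw [S.mem_null]; intro β
    rw [map_sub, ← euler_δ, hom, sub_self]
  -- `k₁` is a sum of functions of `v` and a single `R_{i,x}` each
  have hV : ∀ i k, i ≠ k → F.V i (F.V k k₁) = 0 := fun i k hik => F.V_V_eq_zero hη ok oq h hik
  set κ : Fin n → A := fun i => F.V i (F.V i k₁) with hκ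
  have oκ : ∀ i, S.OrdLT 2 (κ i) := fun i => F.V_ord (F.V_ord ok i) i
  have hκV : ∀ i k, k ≠ i → F.V k (κ i) = 0 := fun i k hki => by
    simp only [hκ]
    rw [F.V_comm, hV k i hki, map_zero]
  have hκE : ∀ i, S.euler (κ i) + κ i = 0 := fun i => by
    have h1 := F.V_V_of_null (ok.euler.sub ok) hE i i
    rw [map_sub, V_euler ok, map_sub, map_add, V_euler (F.V_ord ok i)] at h1
    linear_combination h1
  -- `∂²k₁/∂R_{i,x}²` is homogeneous of degree `-1`
  set c : Fin n → A := fun i => F.p i * κ i with hc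
  have oc : ∀ i, S.OrdLT 1 (c i) := fun i => by
    refine ord_one_of_V (F := F.toFrame) ((F.ord_p i).mul (oκ i)) fun k => ?_
    rw [leibniz, V_p, smul_eq_mul, smul_eq_mul]
    by_cases hki : k = i
    · subst hki
      have h1 := hκE k
      rw [euler_ord_two (F := F.toFrame) (oκ k), sum_eq_single k] at h1
      · rw [if_pos rfl, mul_one, h1]
      · intro b _ hb; rw [hκV k b hb, mul_zero]
      · simp
    · rw [if_neg hki, hκV i k hki, mul_zero, mul_zero, add_zero]
  set y := k₁ - logForm L c with hy
  have oy : S.OrdLT 2 y := ok.sub (ord_logForm L oc)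
  have hyV : ∀ i k, F.V i (F.V k y) = 0 := fun i k => by
    rw [hy, map_sub, V_logForm L oc, map_sub, leibniz, F.V_ord_one (oc k), smul_zero,
      add_zero, smul_eq_mul]
    by_cases hik : i = k
    · subst hik
      have h1 := V_L L i i
      rw [if_pos rfl] at h1
      simp only [hc, hκ]
      linear_combination (-F.V i (F.V i k₁)) * h1
    · rw [hV i k hik, V_L_of_ne L hik, mul_zero, sub_zero]
  set φ : Fin n → A := fun k => F.V k y with hφ
  have oφ : ∀ k, S.OrdLT 1 (φ k) := fun k => ord_one_of_V (F.V_ord oy k) fun i => hyV i k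
  set ψ := y - F.oneForm φ with hψ
  have oψ : S.OrdLT 1 ψ := ord_one_of_V (F := F.toFrame) (oy.sub (F.ord_oneForm oφ)) fun k => by
    rw [hψ, map_sub, oneForm, map_sum]
    simp only [leibniz, F.V_ord_one (oφ _), V_p, smul_eq_mul, mul_zero, add_zero,
      mul_ite, mul_one, Finset.sum_ite_eq, mem_univ, if_true]
    simp [hφ]
  have hk : k₁ = logForm L c + F.oneForm φ + ψ := by rw [hψ, hy]; ring
  -- the coefficients of the logarithms in `{H₀, K₁}` have to vanish
  have hcE : ∀ i k, i ≠ k → F.E k (c i) = 0 := by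
    have h1 := S.tot_le_null (F.br_h₀_logForm L hη oc)
    have h2 := S.tot_le_null (F.br_h₀_oneForm hη oφ)
    have h3 := S.tot_le_null (F.br_h₀_ord_one hη oψ)
    set m : Fin n → Fin n → A := fun i k => F.E k (c i) * (F.lam k - F.lam i) with hm
    have om : ∀ i k, S.OrdLT 1 (m i k) := fun i k =>
      (F.ord_E (oc i) k).mul ((F.ord_lam k).sub (F.ord_lam i))
    set r : Fin n → Fin n → A := fun i k => q i k + ((F.E k (F.lam i * c i) -
      F.E k (c i) * F.lam k) + F.E k (φ i) * (F.lam k - F.lam i)) with hr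
    have or : ∀ i k, S.OrdLT 1 (r i k) := fun i k => (oq i k).add
      (((F.ord_E ((F.ord_lam i).mul (oc i)) k).sub ((F.ord_E (oc i) k).mul (F.ord_lam k))).add
        ((F.ord_E (oφ i) k).mul ((F.ord_lam k).sub (F.ord_lam i))))
    have oθ : ∀ i, S.OrdLT 1 (-(F.lam i * F.E i ψ)) := fun i =>
      ((F.ord_lam i).mul (F.ord_E oψ i)).neg
    have oZ1 : S.OrdLT 2 (∑ i, ∑ k, m i k * (F.p i * L.L i) * F.p k) :=
      OrdLT.sum fun i _ => OrdLT.sum fun k _ => (((om i k).mono (by norm_num)).mul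
        ((F.ord_p i).mul (L.ord_L i))).mul (F.ord_p k)
    have hZ : ∑ i, ∑ k, m i k * (F.p i * L.L i) * F.p k + F.quad r -
        F.oneForm (fun i => -(F.lam i * F.E i ψ)) ∈ S.null := by
      have h4 := h
      rw [hk, br_add_right, br_add_right] at h4
      convert sub_mem (add_mem (add_mem h1 h2) h3) h4 using 1
      have : F.quad r = F.quad q + (F.quad (fun i k => F.E k (F.lam i * c i) -
          F.E k (c i) * F.lam k) + F.quad fun i k => F.E k (φ i) * (F.lam k - F.lam i)) := by
        simp only [hr, quad, add_mul, sum_add_distrib]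
      rw [this]; ring
    intro i k hik
    have h5 := F.V_V_of_null ((oZ1.add (F.ord_quad or)).sub (F.ord_oneForm oθ)) hZ i k
    have e1 : ∀ k, F.V k (∑ i, ∑ k, m i k * (F.p i * L.L i) * F.p k) =
        ∑ i, m i k * (F.p i * L.L i) + ∑ i, m k i * (L.L k + 1) * F.p i := by
      intro k
      simp only [map_sum, leibniz, F.V_ord_one (om _ _), F.V_p, F.V_L_add L,
        smul_eq_mul, mul_zero, add_zero, mul_ite, mul_one, sum_add_distrib]
      congr 1
      · simp
      · rw [sum_eq_single k]
        · exact sum_ext fun _ => by rw [if_pos rfl]; ring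
        · intro b _ hb; simp [hb.symm]
        · simp
    have e2 : F.V i (F.V k (∑ i, ∑ k, m i k * (F.p i * L.L i) * F.p k)) =
        m i k * (L.L i + 1) + m k i * (L.L k + 1) := by
      rw [e1, map_add, map_sum, map_sum]
      simp only [leibniz, F.V_ord_one (om _ _), F.V_p, F.V_L_add L, map_add,
        Derivation.map_one_eq_zero, V_L_of_ne L hik,
        smul_eq_mul, mul_zero, add_zero, mul_ite, mul_one]
      simp
    have e3 : F.V i (F.V k (F.oneForm fun i => -(F.lam i * F.E i ψ))) = 0 := by
      simp only [oneForm, map_sum, leibniz, F.V_ord_one (oθ _), F.V_p, smul_eq_mul,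
        mul_zero, add_zero, mul_ite, mul_one]
      rw [sum_eq_single k (fun b _ hb => by simp [hb.symm]) (by simp), if_pos rfl]
      exact F.V_ord_one (oθ k) i
    rw [map_sub, map_sub, map_add, map_add, e2, e3, F.V_V_quad or] at h5
    have h6 := congrArg (F.V i) h5
    simp only [map_add, map_zero, leibniz, F.V_ord_one (om _ _),
      F.V_ord_one (or _ _), Derivation.map_one_eq_zero, V_L_of_ne L hik, smul_eq_mul, mul_zero,
      add_zero, sub_zero] at h6
    have h7 := V_L L i i
    rw [if_pos rfl] at h7
    have h8 : m i k = 0 := by linear_combination F.p i * h6 - m i k * h7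
    apply F.eq_zero_of_sub_mul hik
    simp only [hm] at h8
    linear_combination -h8
  refine ⟨c, φ, oc, oφ, hcE, ?_⟩
  have h1 := F.euler_δ_generator L oc oφ hcE
  have h2 : k₁ - (logForm L c + F.oneForm φ) = ψ := by rw [hψ, hy]; ring
  rw [h2]
  have h3 : S.euler k₁ = S.euler (logForm L c + F.oneForm φ) := by
    rw [hk, map_add, euler_ord_one oψ, add_zero]
  convert sub_mem h1 hE using 1
  rw [h3, ← h2]; ring

end Riemann

end JetAlgebra

variable {U V V' : Set ℂ^n} {W W' : Set (ℂ^n × ℂ^n)} {R lam : Fin n → ℂ^n → ℂ} {h₀ k₀ : ℂ^n → ℂ}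
  {p v x : ℂ^n} {w : ℂ^n × ℂ^n}

local notation "𝔹" => Metric.ball (0 : Fin _ → ℂ)

/-! ### Holomorphic functions of several variables -/

section Osgood

open Metric Set Filter Topology

theorem exists_ball_bounded {E F : Type} [PseudoMetricSpace E] [SeminormedAddCommGroup F]
    {f : E → F} {s : Set E} {x : E} (hs : IsOpen s) (hf : ContinuousOn f s)
    (hx : x ∈ s) : ∃ r > 0, ball x r ⊆ s ∧ ∃ M, ∀ y ∈ ball x r, ‖f y‖ ≤ M := by
  have h2 := ((hf.continuousAt (hs.mem_nhds hx)).norm.eventually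
    (gt_mem_nhds (lt_add_one ‖f x‖))).and (hs.mem_nhds hx)
  obtain ⟨r, hr, hb⟩ := Metric.eventually_nhds_iff_ball.mp h2
  exact ⟨r, hr, fun y hy => (hb y hy).2, _, fun y hy => (hb y hy).1.le⟩

variable {E F : Type} [NormedAddCommGroup E] [NormedSpace ℂ E] [NormedAddCommGroup F]
  [NormedSpace ℂ F] {f : E → F} {r M : ℝ} {s : Set E} {x : E}

/-- The Cauchy estimate. -/
theorem norm_fderiv_le_of_ball (hr : 0 < r)
    (hf : DiffOn f (ball x r)) (hM : ∀ y ∈ ball x r, ‖f y‖ ≤ M) :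
    ‖fderiv ℂ f x‖ ≤ 2 * M / r := by
  refine Complex.norm_fderiv_le_div_of_mapsTo_ball hf (fun y hy => ?_) hr
  rw [mem_closedBall, dist_eq_norm]
  calc ‖f y - f x‖ ≤ ‖f y‖ + ‖f x‖ := norm_sub_le _ _
    _ ≤ 2 * M := by linarith [hM y hy, hM x (mem_ball_self hr)]

/-- A second order Taylor estimate. -/
theorem norm_sub_sub_fderiv_le {x z : E} (hr : 0 < r)
    (hf : DiffOn f (ball x r)) (hM : ∀ y ∈ ball x r, ‖f y‖ ≤ M)
    (hz : z ∈ ball x r) :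
    ‖f z - f x - fderiv ℂ f x (z - x)‖ ≤ 4 * M * (‖z - x‖ / r) ^ 2 := by
  have hd : DifferentiableAt ℂ f x := hf.differentiableAt (ball_mem_nhds x hr)
  have h0 : 0 ≤ M := (norm_nonneg _).trans (hM x (mem_ball_self hr))
  set g : E → F := fun y => f y - fderiv ℂ f x (y - x) with hg
  have hgx : g x = f x := by simp [hg]
  have h1 : DiffOn g (ball x r) :=
    hf.sub ((fderiv ℂ f x).differentiable.comp (differentiable_id.sub_const x)).differentiableOn
  have h2 : MapsTo g (ball x r) (closedBall (g x) (4 * M)) := by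
    intro y hy
    rw [mem_closedBall, dist_eq_norm, hgx]
    have h3 : ‖fderiv ℂ f x (y - x)‖ ≤ 2 * M := by
      calc _ ≤ ‖fderiv ℂ f x‖ * ‖y - x‖ := (fderiv ℂ f x).le_opNorm _
        _ ≤ 2 * M / r * r := by
          gcongr
          · exact norm_fderiv_le_of_ball hr hf hM
          · exact (mem_ball_iff_norm.mp hy).le
        _ = 2 * M := by field_simp
    calc ‖g y - f x‖ = ‖(f y - f x) - fderiv ℂ f x (y - x)‖ := by
          congr 1; exact sub_right_comm _ _ _
      _ ≤ ‖f y‖ + ‖f x‖ + ‖fderiv ℂ f x (y - x)‖ := (norm_sub_le _ _).trans (by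
        gcongr; exact norm_sub_le _ _)
      _ ≤ 4 * M := by linarith [hM y hy, hM x (mem_ball_self hr)]
  have h3 : (g · - g x) =o[𝓝 x] fun w => ‖w - x‖ ^ 1 := by
    have := hd.hasFDerivAt.isLittleO
    simp only [pow_one, hgx]
    refine (this.congr_left fun y => ?_).norm_right
    exact sub_right_comm _ _ _
  have := Complex.dist_le_mul_div_pow_of_mapsTo_ball_of_isLittleO h1 h2 h3 hz
  rw [dist_eq_norm, dist_eq_norm, hgx] at this
  have e : f z - f x - fderiv ℂ f x (z - x) = g z - f x := sub_right_comm _ _ _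
  rw [e]; exact this

/-- A function whose derivative along a segment vanishes has the same values at its ends. -/
theorem eq_of_fderiv_segment_eq_zero {y : E} (h : ∀ t ∈ Icc (0 : ℝ) 1,
    DifferentiableAt ℂ f (x + (t : ℂ) • (y - x)) ∧
      fderiv ℂ f (x + (t : ℂ) • (y - x)) (y - x) = 0) : f y = f x := by
  have hd : ∀ t ∈ Icc (0 : ℝ) 1, HasDerivAt (fun t : ℝ => f (x + (t : ℂ) • (y - x))) 0 t := by
    intro t ht
    have h1 : HasDerivAt (fun t : ℝ => x + (t : ℂ) • (y - x)) (y - x) t := by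
      simpa using ((Complex.ofRealCLM.hasDerivAt (x := t)).smul_const (y - x)).const_add x
    exact (((h t ht).1.hasFDerivAt.restrictScalars ℝ).comp_hasDerivAt t h1).congr_deriv (h t ht).2
  simpa using constant_of_has_deriv_right_zero
    (fun t ht => (hd t ht).continuousAt.continuousWithinAt)
    (fun t ht => (hd t ⟨ht.1, ht.2.le⟩).hasDerivWithinAt) 1 (right_mem_Icc.mpr zero_le_one)

theorem differentiableOn_clm_apply_iff {H : Type} [NormedAddCommGroup H] [NormedSpace ℂ H]
    [FiniteDimensional ℂ H] {f : E → H →L[ℂ] F} :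
    DiffOn f s ↔ ∀ y, DiffOn (fun x => f x y) s := by
  refine ⟨fun h y => h.clm_apply (differentiableOn_const y), fun h => ?_⟩
  let d := Module.finrank ℂ H
  have hd : d = Module.finrank ℂ (Fin d → ℂ) := (Module.finrank_fin_fun ℂ).symm
  let e₁ := ContinuousLinearEquiv.ofFinrankEq hd
  let e₂ := (e₁.arrowCongr (1 : F ≃L[ℂ] F)).trans (ContinuousLinearEquiv.piRing (Fin d))
  rw [← Function.id_comp f, ← e₂.symm_comp_self]
  exact e₂.symm.differentiable.comp_differentiableOn (differentiableOn_pi.mpr fun i => h _)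

variable [CompleteSpace F]

/-- Uniform limits of holomorphic functions are holomorphic. -/
theorem differentiableOn_of_tendstoUniformlyOn {f : ℕ → E → F} {g : E → F} (hs : IsOpen s) (hf : ∀ m, DiffOn (f m) s) (h : TendstoUniformlyOn f g atTop s) :
    DiffOn g s := by
  intro x hx
  obtain ⟨r, hr, hrs⟩ := Metric.isOpen_iff.mp hs x hx
  have hsub : ∀ y ∈ ball x (r / 2), ball y (r / 2) ⊆ s := fun y hy =>
    (ball_subset_ball' (by rw [mem_ball] at hy; linarith)).trans hrs
  have hxy : ball x (r / 2) ⊆ s := (ball_subset_ball (by linarith)).trans hrs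
  have hda : ∀ m, ∀ y ∈ ball x (r / 2), DifferentiableAt ℂ (f m) y := fun m y hy =>
    (hf m).differentiableAt (hs.mem_nhds (hxy hy))
  have hc : UniformCauchySeqOn (fun m => fderiv ℂ (f m)) atTop (ball x (r / 2)) := by
    rw [Metric.uniformCauchySeqOn_iff]
    intro ε hε
    obtain ⟨N, hN⟩ := (Metric.uniformCauchySeqOn_iff.mp h.uniformCauchySeqOn) (ε * r / 8)
      (by positivity)
    refine ⟨N, fun m hm k hk y hy => ?_⟩
    have h1 := norm_fderiv_le_of_ball (f := fun z => f m z - f k z) (M := ε * r / 8)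
      (half_pos hr) (((hf m).sub (hf k)).mono (hsub y hy)) (fun z hz => by
        have := hN m hm k hk z (hsub y hy hz)
        rw [dist_eq_norm] at this; exact this.le)
    rw [fderiv_fun_sub (hda m y hy) (hda k y hy)] at h1
    rw [dist_eq_norm]
    refine h1.trans_lt ?_
    have : 2 * (ε * r / 8) / (r / 2) = ε / 2 := by field_simp; norm_num
    rw [this]; exact half_lt_self hε
  have hl : ∀ y ∈ ball x (r / 2), ∃ L, Tendsto (fun m => fderiv ℂ (f m) y) atTop (𝓝 L) :=
    fun y hy => cauchySeq_tendsto_of_complete (hc.cauchySeq hy)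
  choose! L hL using hl
  have h2 := hc.tendstoUniformlyOn_of_tendsto hL
  exact (hasFDerivAt_of_tendstoUniformlyOn isOpen_ball h2
    (fun m y hy => (hda m y hy).hasFDerivAt) (fun y hy => h.tendsto_at (hxy hy))
    (mem_ball_self (half_pos hr))).differentiableAt.differentiableWithinAt

/-- The derivative of a holomorphic function of several variables is holomorphic. -/
theorem _root_.DifferentiableOn.fderiv_of_isOpen [FiniteDimensional ℂ E] (hs : IsOpen s) (hf : DiffOn f s) : DiffOn (fderiv ℂ f) s := by
  rw [differentiableOn_clm_apply_iff]
  intro h x hx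
  obtain ⟨r, hr, hrs, M, hM⟩ := exists_ball_bounded hs hf.continuousOn hx
  have h0 : 0 ≤ M := (norm_nonneg _).trans (hM x (mem_ball_self hr))
  have hsub : ∀ y ∈ ball x (r / 2), ball y (r / 2) ⊆ ball x r := fun y hy =>
    ball_subset_ball' (by rw [mem_ball] at hy; linarith)
  obtain ⟨N, hN⟩ := exists_nat_gt (2 * ‖h‖ / r)
  -- the difference quotients with step `1 / (N + m + 1)`
  set t : ℕ → ℝ := fun m => (N + m + 1 : ℝ) with ht
  have tpos : ∀ m, 0 < t m := fun m => by positivity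
  have hst : ∀ m, ‖((t m : ℂ)⁻¹) • h‖ = ‖h‖ / t m := fun m => by
    rw [norm_smul, norm_inv, Complex.norm_real, Real.norm_of_nonneg (tpos m).le, div_eq_inv_mul]
  have hsm : ∀ m, ‖((t m : ℂ)⁻¹) • h‖ < r / 2 := fun m => by
    rw [hst, div_lt_iff₀ (tpos m)]
    have : 2 * ‖h‖ / r < t m := hN.trans_le (by simp only [ht]; linarith [m.cast_nonneg (α := ℝ)])
    rw [div_lt_iff₀ hr] at this
    linarith
  have hu : TendstoUniformlyOn (fun m y => (t m : ℂ) • (f (y + (t m : ℂ)⁻¹ • h) - f y))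
      (fun y => fderiv ℂ f y h) atTop (ball x (r / 2)) := by
    rw [Metric.tendstoUniformlyOn_iff]
    intro ε hε
    have h3 : Tendsto (fun m : ℕ => 4 * M * (‖h‖ / (r / 2)) ^ 2 / t m) atTop (𝓝 0) := by
      refine Tendsto.const_div_atTop ?_ _
      simp only [ht]
      refine tendsto_atTop_add_const_right _ _ (tendsto_atTop_add_const_left _ _
        tendsto_natCast_atTop_atTop)
    filter_upwards [h3.eventually (gt_mem_nhds hε)] with m hm y hy
    have h4 := norm_sub_sub_fderiv_le (half_pos hr) (hf.mono ((hsub y hy).trans hrs))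
      (fun z hz => hM z (hsub y hy hz)) (z := y + (t m : ℂ)⁻¹ • h)
      (by rw [mem_ball_iff_norm, add_sub_cancel_left]; exact hsm m)
    rw [add_sub_cancel_left, map_smul, hst] at h4
    have tn : (t m : ℂ) ≠ 0 := by exact_mod_cast (tpos m).ne'
    have h5 : (t m : ℂ) • (f (y + (t m : ℂ)⁻¹ • h) - f y) - fderiv ℂ f y h =
        (t m : ℂ) • (f (y + (t m : ℂ)⁻¹ • h) - f y - (t m : ℂ)⁻¹ • fderiv ℂ f y h) := by
      rw [smul_sub _ (_ - _), smul_smul, mul_inv_cancel₀ tn, one_smul]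
    rw [dist_comm, dist_eq_norm, h5, norm_smul, Complex.norm_real, Real.norm_of_nonneg (tpos m).le]
    refine lt_of_le_of_lt ((mul_le_mul_of_nonneg_left h4 (tpos m).le).trans_eq ?_) hm
    have := (tpos m).ne'
    field_simp
  refine ((differentiableOn_of_tendstoUniformlyOn isOpen_ball (fun m => ?_) hu).differentiableAt
    (ball_mem_nhds x (half_pos hr))).differentiableWithinAt
  have h6 : DiffOn f (ball x r) := hf.mono hrs
  refine DifferentiableOn.const_smul (DifferentiableOn.sub (h6.comp
    (differentiable_id.add_const _).differentiableOn fun y hy => ?_)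
    (h6.mono (ball_subset_ball (by linarith)))) _
  rw [mem_ball_iff_norm] at hy ⊢
  calc ‖y + (t m : ℂ)⁻¹ • h - x‖ = ‖(y - x) + (t m : ℂ)⁻¹ • h‖ := by congr 1; abel
    _ ≤ ‖y - x‖ + ‖(t m : ℂ)⁻¹ • h‖ := norm_add_le _ _
    _ < r := by linarith [hsm m]

theorem _root_.DifferentiableOn.contDiffOn_of_finiteDimensional [FiniteDimensional ℂ E] (m : ℕ)
    (hs : IsOpen s) (hf : DiffOn f s) : ContDiffOn ℂ m f s := by
  induction m generalizing F with
  | zero => exact contDiffOn_zero.mpr hf.continuousOn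
  | succ m ih =>
    rw [Nat.cast_succ, contDiffOn_succ_iff_fderiv_of_isOpen hs]
    exact ⟨hf, by simp, ih (hf.fderiv_of_isOpen hs)⟩

/-- The Cauchy estimates for derivatives of all orders. -/
theorem norm_iteratedFDeriv_le_of_ball [FiniteDimensional ℂ E] (m : ℕ) {x : E} {d : ℝ}
    (hd : 0 < d) (hr : m * d < r) (hf : DiffOn f (ball x r))
    (hM : ∀ y ∈ ball x r, ‖f y‖ ≤ M) :
    ‖iteratedFDeriv ℂ m f x‖ ≤ M * (2 / d) ^ m := by
  induction m generalizing F r M with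
  | zero =>
    rw [norm_iteratedFDeriv_zero, pow_zero, mul_one]
    exact hM x (mem_ball_self (by simpa using hr))
  | succ m ih =>
    push_cast at hr
    have hsub : ∀ y ∈ ball x (r - d), ball y d ⊆ ball x r := fun y hy =>
      ball_subset_ball' (by rw [mem_ball] at hy; linarith)
    rw [← norm_iteratedFDeriv_fderiv]
    have h1 := ih (r := r - d) (M := 2 * M / d) (f := fderiv ℂ f) (by linarith)
      ((hf.fderiv_of_isOpen isOpen_ball).mono (ball_subset_ball (by linarith)))
      (fun y hy => norm_fderiv_le_of_ball hd (hf.mono (hsub y hy)) fun z hz => hM z (hsub y hy hz))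
    refine h1.trans_eq ?_
    rw [pow_succ]; ring

/-- **Osgood's lemma**: a complex differentiable function of several variables is analytic. -/
theorem _root_.DifferentiableOn.analyticOnNhd_of_finiteDimensional [FiniteDimensional ℂ E]
    (hs : IsOpen s) (hf : DiffOn f s) :
    Holo f s := by
  intro x hx
  obtain ⟨r, hr, hrs, M, hM⟩ := exists_ball_bounded hs hf.continuousOn hx
  have h0 : 0 ≤ M := (norm_nonneg _).trans (hM x (mem_ball_self hr))
  have hfr : DiffOn f (ball x r) := hf.mono hrs
  set p : FormalMultilinearSeries ℂ E F := fun m => (m.factorial : ℂ)⁻¹ • iteratedFDeriv ℂ m f x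
  have hp : ∀ m, ‖p m‖ ≤ M * (4 * Real.exp 1 / r) ^ m := by
    intro m
    rcases Nat.eq_zero_or_pos m with rfl | hm
    · simp [p, hM x (mem_ball_self hr)]
    have hm' : (0 : ℝ) < m := by exact_mod_cast hm
    have h1 := norm_iteratedFDeriv_le_of_ball m (f := f) (x := x) (d := r / (2 * m)) (r := r)
      (by positivity) (by field_simp; norm_num) hfr hM
    have h2 := Real.pow_div_factorial_le_exp (x := (m : ℝ)) hm'.le m
    have h3 : Real.exp m = Real.exp 1 ^ m := by rw [← Real.exp_nat_mul, mul_one]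
    have hfac : (0 : ℝ) < m.factorial := by exact_mod_cast m.factorial_pos
    calc ‖p m‖ = (m.factorial : ℝ)⁻¹ * ‖iteratedFDeriv ℂ m f x‖ := by
          simp only [p, norm_smul, norm_inv, Complex.norm_natCast]
      _ ≤ (m.factorial : ℝ)⁻¹ * (M * (2 / (r / (2 * m))) ^ m) := by gcongr
      _ = M * (4 / r) ^ m * ((m : ℝ) ^ m / m.factorial) := by
          rw [show 2 / (r / (2 * (m : ℝ))) = 4 / r * m by field_simp; norm_num, mul_pow]
          field_simp
      _ ≤ M * (4 / r) ^ m * Real.exp 1 ^ m := by rw [← h3]; gcongr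
      _ = M * (4 * Real.exp 1 / r) ^ m := by rw [mul_assoc, ← mul_pow]; congr 2; ring
  have he : 0 < Real.exp 1 := Real.exp_pos 1
  have he1 : 1 < Real.exp 1 := by simp
  set ρ : NNReal := ⟨r / (4 * Real.exp 1), by positivity⟩ with hρ
  have hρr : (ρ : ℝ) < r := by
    change r / (4 * Real.exp 1) < r
    rw [div_lt_iff₀ (by positivity)]; nlinarith
  have hρ0 : (0 : ℝ) < ρ := by change 0 < r / (4 * Real.exp 1); positivity
  refine ⟨p, ρ, ?_, by exact_mod_cast hρ0, fun {y} hy => ?_⟩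
  · refine p.le_radius_of_bound M fun m => ?_
    calc ‖p m‖ * (ρ : ℝ) ^ m ≤ M * (4 * Real.exp 1 / r) ^ m * (ρ : ℝ) ^ m := by
          gcongr; exact hp m
      _ = M := by
          rw [mul_assoc, ← mul_pow, show 4 * Real.exp 1 / r * (ρ : ℝ) = 1 by
            change 4 * Real.exp 1 / r * (r / (4 * Real.exp 1)) = 1
            field_simp, one_pow, mul_one]
  · have hy' : ‖y‖ < ρ := by
      rw [Metric.mem_eball, edist_zero_right] at hy
      have : ‖y‖ₑ < (ρ : ENNReal) := hy
      rw [enorm_eq_nnnorm] at this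
      exact_mod_cast this
    have hyr : ‖y‖ < r := hy'.trans hρr
    obtain ⟨R, hR1, hR⟩ : ∃ R > 1, R * ‖y‖ < r := by
      by_cases hy0 : ‖y‖ = 0
      · exact ⟨2, by norm_num, by rw [hy0, mul_zero]; exact hr⟩
      · have : 0 < ‖y‖ := lt_of_le_of_ne (norm_nonneg _) (Ne.symm hy0)
        obtain ⟨R, h1, h2⟩ := exists_between ((one_lt_div this).mpr hyr)
        exact ⟨R, h1, (lt_div_iff₀ this).mp h2⟩
    have hmem : ∀ z ∈ ball (0 : ℂ) R, x + z • y ∈ ball x r := fun z hz => by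
      rw [mem_ball_iff_norm, add_sub_cancel_left, norm_smul]
      rw [mem_ball_zero_iff] at hz
      exact lt_of_le_of_lt (mul_le_mul_of_nonneg_right hz.le (norm_nonneg _)) hR
    have hg : DiffOn (fun z : ℂ => f (x + z • y)) (ball 0 R) := hfr.comp (by fun_prop) hmem
    have h1 := Complex.hasSum_taylorSeries_on_ball hg (z := 1) (by simpa using hR1)
    have h2 : ∀ m, ∀ z ∈ ball (0 : ℂ) R, iteratedDeriv m (fun z : ℂ => f (x + z • y)) z =
        iteratedFDeriv ℂ m f (x + z • y) fun _ => y := by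
      intro m
      induction m with
      | zero => intro z _; simp
      | succ m ih =>
        intro z hz
        have h3 : ContDiffAt ℂ (m + 1 : ℕ) f (x + z • y) :=
          (hfr.contDiffOn_of_finiteDimensional (m + 1) isOpen_ball).contDiffAt
            (isOpen_ball.mem_nhds (hmem z hz))
        rw [iteratedDeriv_succ, Filter.EventuallyEq.deriv_eq (Filter.eventuallyEq_of_mem
          (isOpen_ball.mem_nhds hz) ih)]
        exact ContDiffAt.deriv_fderiv_add_smul (by exact_mod_cast h3)
    have h3 : ∀ m, iteratedDeriv m (fun z : ℂ => f (x + z • y)) 0 =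
        iteratedFDeriv ℂ m f x fun _ => y := fun m => by
      rw [h2 m 0 (mem_ball_self (by linarith)), zero_smul, add_zero]
    simpa [h3, p] using h1

end Osgood

section

variable {f : ℂ^n → ℂ} {r : ℝ}

/-! ### Poincaré lemmas -/

section Integrals

open Metric Set Filter Topology MeasureTheory

variable {F : Type} [NormedAddCommGroup F] [NormedSpace ℂ F] [CompleteSpace F]

theorem fderiv_apply_eq_sum (x y : ℂ^n) : fderiv ℂ f x y = ∑ j, y j * pd j f x := by
  conv_lhs => rw [pi_eq_sum_univ' y]
  rw [map_sum]
  refine sum_ext fun j => ?_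
  rw [pd, map_smul, smul_eq_mul]

/-- Differentiation of an integral along the segments `t ↦ P x + t Q x`. -/
theorem hasFDerivAt_integral_segment {h : ℂ^n → F} (hh : DiffOn h (𝔹 r)) {P Q : ℂ^n →L[ℂ] ℂ^n}
    (hPQ : ∀ t ∈ Icc (0 : ℝ) 1, ∀ x, ‖P x + (t : ℂ) • Q x‖ ≤ ‖x‖) {w : ℝ → ℂ}
    (hw : Continuous w) (hx : x ∈ ball 0 r) :
    HasFDerivAt (fun x => ∫ t in (0 : ℝ)..1, w t • h (P x + (t : ℂ) • Q x))
      (∫ t in (0 : ℝ)..1, w t • (fderiv ℂ h (P x + (t : ℂ) • Q x)).comp (P + (t : ℂ) • Q)) x := by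
  rw [mem_ball_zero_iff] at hx
  obtain ⟨r', h1, h2⟩ := exists_between hx
  have hK : MapsTo (fun q : ℝ × ℂ^n => P q.2 + (q.1 : ℂ) • Q q.2)
      (Icc 0 1 ×ˢ closedBall 0 r') (𝔹 r) := fun q hq => by
    rw [mem_ball_zero_iff]
    exact (hPQ q.1 hq.1 q.2).trans_lt ((mem_closedBall_zero_iff.mp hq.2).trans_lt h2)
  have hc0 : ContinuousOn (fun q : ℝ × ℂ^n => w q.1 • h (P q.2 + (q.1 : ℂ) • Q q.2))
      (Icc 0 1 ×ˢ closedBall 0 r') :=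
    (hw.comp continuous_fst).continuousOn.smul
      (hh.continuousOn.comp (Continuous.continuousOn (by fun_prop)) hK)
  have hc1 : ContinuousOn (fun q : ℝ × ℂ^n =>
      w q.1 • (fderiv ℂ h (P q.2 + (q.1 : ℂ) • Q q.2)).comp (P + (q.1 : ℂ) • Q))
      (Icc 0 1 ×ˢ closedBall 0 r') :=
    (hw.comp continuous_fst).continuousOn.smul (ContinuousOn.clm_comp
      ((hh.fderiv_of_isOpen isOpen_ball).continuousOn.comp (Continuous.continuousOn (by fun_prop))
        hK) (Continuous.continuousOn (by fun_prop)))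
  obtain ⟨C, hC⟩ := (isCompact_Icc.prod
    (isCompact_closedBall (0 : ℂ^n) r')).exists_bound_of_continuousOn hc1
  have hs : 𝔹 r' ∈ 𝓝 x := isOpen_ball.mem_nhds (mem_ball_zero_iff.mpr h1)
  have hslice : ∀ y ∈ 𝔹 r', ∀ {G : Type} [NormedAddCommGroup G]
      {g : ℝ × ℂ^n → G}, ContinuousOn g (Icc 0 1 ×ˢ closedBall 0 r') →
      ContinuousOn (fun t => g (t, y)) (uIcc 0 1) := fun y hy G _ g hg => by
    rw [uIcc_of_le zero_le_one]
    exact hg.comp (by fun_prop) fun t ht => ⟨ht, ball_subset_closedBall hy⟩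
  refine intervalIntegral.hasFDerivAt_integral_of_dominated_of_fderiv_le (bound := fun _ => C)
    (F' := fun x t => w t • (fderiv ℂ h (P x + (t : ℂ) • Q x)).comp (P + (t : ℂ) • Q)) hs
    (Filter.mem_of_superset hs fun y hy => ?_) ?_ ?_ ?_ ?_ ?_
  · exact ((hslice y hy hc0).intervalIntegrable).def'.aestronglyMeasurable
  · exact (hslice x (mem_of_mem_nhds hs) hc0).intervalIntegrable
  · exact ((hslice x (mem_of_mem_nhds hs) hc1).intervalIntegrable).def'.aestronglyMeasurable
  · refine Eventually.of_forall fun t ht y hy => hC (t, y) ⟨?_, ball_subset_closedBall hy⟩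
    rw [uIoc_of_le zero_le_one] at ht
    exact ⟨ht.1.le, ht.2⟩
  · exact intervalIntegrable_const
  · refine Eventually.of_forall fun t ht y hy => ?_
    rw [uIoc_of_le zero_le_one] at ht
    have hd : DifferentiableAt ℂ h (P y + (t : ℂ) • Q y) := hh.differentiableAt
      (isOpen_ball.mem_nhds (hK (x := (t, y)) ⟨⟨ht.1.le, ht.2⟩, ball_subset_closedBall hy⟩))
    have h3 : HasFDerivAt (fun y => P y + (t : ℂ) • Q y) (P + (t : ℂ) • Q) y :=
      P.hasFDerivAt.add (Q.hasFDerivAt.const_smul (t : ℂ))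
    exact (hd.hasFDerivAt.comp y h3).const_smul _

theorem pd_eq_of_hasFDerivAt {f' : ℂ^n →L[ℂ] ℂ} (h : HasFDerivAt f f' x) (j : Fin n) : pd j f x = f' (Pi.single j 1) := by
  rw [pd, h.fderiv]

theorem differentiableOn_pd {s : Set ℂ^n} (hs : IsOpen s)
    (hf : DiffOn f s) (j : Fin n) : DiffOn (pd j f) s :=
  (hf.fderiv_of_isOpen hs).clm_apply (differentiableOn_const _)

theorem pd_comm {s : Set ℂ^n} (hs : IsOpen s) (hf : DiffOn f s) (j k : Fin n) (hx : x ∈ s) :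
    pd j (pd k f) x = pd k (pd j f) x := by
  have h1 : DifferentiableAt ℂ (fderiv ℂ f) x :=
    (hf.fderiv_of_isOpen hs).differentiableAt (hs.mem_nhds hx)
  have h2 : IsSymmSndFDerivAt ℂ f x :=
    ((hf.contDiffOn_of_finiteDimensional 2 hs).contDiffAt (hs.mem_nhds hx)).isSymmSndFDerivAt
      (by simp)
  have h3 : ∀ i l, pd i (pd l f) x =
      fderiv ℂ (fderiv ℂ f) x (Pi.single i 1) (Pi.single l 1) := fun i l => by
    have h4 : HasFDerivAt (pd l f) _ x := h1.hasFDerivAt.clm_apply (hasFDerivAt_const _ x)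
    rw [pd_eq_of_hasFDerivAt h4]; simp
  rw [h3, h3]; exact h2 _ _

/-- Chain rule along a segment. -/
theorem hasDerivAt_comp_segment {q : ℂ^n} {t : ℝ} (hf : DifferentiableAt ℂ f (p + (t : ℂ) • q)) :
    HasDerivAt (fun s : ℝ => f (p + (s : ℂ) • q)) (∑ j, q j * pd j f (p + (t : ℂ) • q)) t := by
  rw [← fderiv_apply_eq_sum]
  have h1 : HasDerivAt (fun s : ℝ => p + (s : ℂ) • q) q t := by
    have := ((Complex.ofRealCLM.hasDerivAt (x := t)).smul_const q).const_add p
    simpa using this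
  have h2 : HasFDerivAt f (fderiv ℂ f (p + (t : ℂ) • q)) (p + (t : ℂ) • q) := hf.hasFDerivAt
  exact (h2.restrictScalars ℝ).comp_hasDerivAt t h1

/-- The Poincaré lemma for holomorphic one-forms on a ball. -/
theorem exists_potential {u : Fin n → ℂ^n → ℂ} (hu : ∀ i, DiffOn (u i) (𝔹 r))
    (hc : ∀ i j, ∀ x ∈ 𝔹 r, pd j (u i) x = pd i (u j) x) :
    ∃ f : ℂ^n → ℂ, DiffOn f (𝔹 r) ∧ ∀ i, ∀ x ∈ 𝔹 r, pd i f x = u i x := by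
  set ω : ℂ^n → ℂ^n →L[ℂ] ℂ := fun x =>
    ∑ i, u i x • (ContinuousLinearMap.proj i : ℂ^n →L[ℂ] ℂ) with hω
  have hd : ∀ a ∈ 𝔹 r, HasFDerivAt ω
      (∑ i, (fderiv ℂ (u i) a).smulRight (ContinuousLinearMap.proj i : ℂ^n →L[ℂ] ℂ)) a :=
    fun a ha => HasFDerivAt.fun_sum fun i _ =>
      HasFDerivAt.smul_const ((hu i).differentiableAt (isOpen_ball.mem_nhds ha)).hasFDerivAt
        (ContinuousLinearMap.proj i : ℂ^n →L[ℂ] ℂ)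
  obtain ⟨f, hf⟩ := (convex_ball (0 : ℂ^n) r).exists_forall_hasFDerivAt_of_fderiv_symmetric
    isOpen_ball (ω := ω) (fun a ha =>
      ((hd a ha).restrictScalars ℝ).differentiableAt.differentiableWithinAt) (fun a ha x y => by
      rw [((hd a ha).restrictScalars ℝ).fderiv]
      simp only [ContinuousLinearMap.coe_restrictScalars', _root_.sum_apply,
        ContinuousLinearMap.smulRight_apply, _root_.smul_apply,
        ContinuousLinearMap.proj_apply, smul_eq_mul, fderiv_apply_eq_sum, sum_mul]
      rw [sum_comm]
      refine sum_ext₂ fun i j => ?_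
      rw [hc j i a ha]; ring)
  refine ⟨f, fun a ha => (hf a ha).differentiableAt.differentiableWithinAt, fun i x hx => ?_⟩
  rw [pd_eq_of_hasFDerivAt (hf x hx)]
  simp [hω, Pi.single_apply]

/-- The Poincaré lemma for holomorphic two-forms on a ball. -/
theorem exists_potential_two {s : Fin n → Fin n → ℂ^n → ℂ} (hs : ∀ i j, DiffOn (s i j) (𝔹 r))
    (ha : ∀ i j, ∀ x ∈ 𝔹 r, s i j x = - s j i x)
    (hc : ∀ i j k, ∀ x ∈ 𝔹 r, pd k (s i j) x + pd i (s j k) x + pd j (s k i) x = 0) :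
    ∃ φ : Fin n → ℂ^n → ℂ, (∀ i, DiffOn (φ i) (𝔹 r)) ∧
      ∀ i k, ∀ x ∈ 𝔹 r, pd k (φ i) x - pd i (φ k) x = s i k x := by
  have hPQ : ∀ t ∈ Icc (0 : ℝ) 1, ∀ x : ℂ^n,
      ‖(0 : ℂ^n →L[ℂ] ℂ^n) x + (t : ℂ) • ContinuousLinearMap.id ℂ _ x‖ ≤ ‖x‖ := by
    intro t ht x
    simp only [_root_.zero_apply, zero_add, ContinuousLinearMap.id_apply, norm_smul,
      Complex.norm_real, Real.norm_of_nonneg ht.1]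
    exact mul_le_of_le_one_left (norm_nonneg _) ht.2
  have hm : ∀ x ∈ 𝔹 r, ∀ t ∈ Icc (0 : ℝ) 1, (t : ℂ) • x ∈ ball (0 : ℂ^n) r := by
    intro x hx t ht
    have := hPQ t ht x
    rw [mem_ball_zero_iff] at hx ⊢
    simp only [_root_.zero_apply, zero_add, ContinuousLinearMap.id_apply] at this
    exact this.trans_lt hx
  set g : Fin n → Fin n → ℂ^n → ℂ := fun i j x => ∫ t in (0 : ℝ)..1, (t : ℂ) * s i j ((t : ℂ) • x)
    with hg
  have hgd : ∀ i j, ∀ x ∈ 𝔹 r, HasFDerivAt (g i j)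
      (∫ t in (0 : ℝ)..1, (t : ℂ) • (fderiv ℂ (s i j) ((t : ℂ) • x)).comp
        ((t : ℂ) • ContinuousLinearMap.id ℂ _)) x := by
    intro i j x hx
    have := hasFDerivAt_integral_segment (hs i j) hPQ (w := fun t => (t : ℂ))
      Complex.continuous_ofReal hx
    simpa [hg] using this
  have hci : ∀ x ∈ 𝔹 r, ∀ {G : Type} [NormedAddCommGroup G]
      {h : ℂ^n → G}, ContinuousOn h (𝔹 r) →
      ContinuousOn (fun t : ℝ => h ((t : ℂ) • x)) (uIcc 0 1) := fun x hx G _ h hh => by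
    rw [uIcc_of_le zero_le_one]
    exact hh.comp (Continuous.continuousOn (by fun_prop)) (hm x hx)
  have hgp : ∀ i j k, ∀ x ∈ 𝔹 r, pd k (g i j) x =
      ∫ t in (0 : ℝ)..1, (t : ℂ) ^ 2 * pd k (s i j) ((t : ℂ) • x) := by
    intro i j k x hx
    rw [pd_eq_of_hasFDerivAt (hgd i j x hx), ContinuousLinearMap.intervalIntegral_apply]
    · refine intervalIntegral.integral_congr fun t _ => ?_
      simp only [_root_.smul_apply, ContinuousLinearMap.comp_apply,
        ContinuousLinearMap.id_apply, map_smul, smul_eq_mul, pd]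
      ring
    · refine ContinuousOn.intervalIntegrable (ContinuousOn.smul
        (Complex.continuous_ofReal.continuousOn) (ContinuousOn.clm_comp
          (hci x hx ((hs i j).fderiv_of_isOpen isOpen_ball).continuousOn)
          (Continuous.continuousOn (by fun_prop))))
  -- the homotopy operator of the radial contraction
  refine ⟨fun i x => - ∑ j, x j * g j i x, fun i x hx => ?_, fun i k x hx => ?_⟩
  · have : ∀ j, DifferentiableAt ℂ (g j i) x := fun j => (hgd j i x hx).differentiableAt
    exact DifferentiableAt.differentiableWithinAt (by fun_prop)
  have hφ : ∀ i k, pd k (fun x => - ∑ j, x j * g j i x) x =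
      - (g k i x + ∑ j, x j * pd k (g j i) x) := by
    intro i k
    have h1 : HasFDerivAt (fun x : ℂ^n => - ∑ j, x j * g j i x) _ x :=
      (HasFDerivAt.fun_sum (u := Finset.univ) fun j _ =>
        (hasFDerivAt_apply (𝕜 := ℂ) j x).mul (hgd j i x hx)).neg
    rw [pd_eq_of_hasFDerivAt h1]
    simp only [_root_.neg_apply, _root_.sum_apply, _root_.add_apply, _root_.smul_apply, smul_eq_mul,
      sum_add_distrib, ContinuousLinearMap.proj_apply,
      pd_eq_of_hasFDerivAt (hgd _ i x hx) k]
    simp [Pi.single_apply, add_comm]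
  rw [hφ, hφ]
  simp only [hgp _ _ _ x hx]
  have hpd : ∀ i j k, ContinuousOn (pd k (s i j)) (𝔹 r) := fun i j k =>
    (differentiableOn_pd isOpen_ball (hs i j) k).continuousOn
  have hsc : ∀ i j, ContinuousOn (fun t : ℝ => s i j ((t : ℂ) • x)) (uIcc 0 1) := fun i j =>
    hci x hx (hs i j).continuousOn
  have htc : Continuous fun t : ℝ => (t : ℂ) := Complex.continuous_ofReal
  have hi1 : ∀ i j, IntervalIntegrable (fun t : ℝ => (t : ℂ) * s i j ((t : ℂ) • x)) volume 0 1 :=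
    fun i j => (htc.continuousOn.mul (hsc i j)).intervalIntegrable
  have hi2 : ∀ i j k, IntervalIntegrable
      (fun t : ℝ => (t : ℂ) ^ 2 * pd k (s i j) ((t : ℂ) • x)) volume 0 1 :=
    fun i j k => ((htc.pow 2).continuousOn.mul (hci x hx (hpd i j k))).intervalIntegrable
  have hderiv : ∀ t ∈ uIcc (0 : ℝ) 1, HasDerivAt (fun t : ℝ => (t : ℂ) ^ 2 * s i k ((t : ℂ) • x))
      (2 * ((t : ℂ) * s i k ((t : ℂ) • x)) +
        ∑ j, x j * ((t : ℂ) ^ 2 * pd j (s i k) ((t : ℂ) • x))) t := by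
    intro t ht
    rw [uIcc_of_le zero_le_one] at ht
    have h1 := hasDerivAt_comp_segment (f := s i k) (p := 0) (q := x) (t := t) (by
      rw [zero_add]; exact (hs i k).differentiableAt (isOpen_ball.mem_nhds (hm x hx t ht)))
    simp only [zero_add] at h1
    have h2 : HasDerivAt (fun t : ℝ => (t : ℂ) ^ 2) (2 * (t : ℂ)) t := by
      have := (Complex.ofRealCLM.hasDerivAt (x := t)).pow 2
      exact this.congr_deriv (by simp)
    refine (h2.mul h1).congr_deriv ?_
    rw [mul_sum, mul_assoc]
    congr 1
    exact sum_ext fun j => by ring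
  have hint : IntervalIntegrable (fun t : ℝ => ∑ j, x j * ((t : ℂ) ^ 2 *
      pd j (s i k) ((t : ℂ) • x))) volume 0 1 := by
    have : (fun t : ℝ => ∑ j, x j * ((t : ℂ) ^ 2 * pd j (s i k) ((t : ℂ) • x))) =
      ∑ j, fun t : ℝ => x j * ((t : ℂ) ^ 2 * pd j (s i k) ((t : ℂ) • x)) := by
      ext t; simp
    rw [this]
    exact IntervalIntegrable.sum _ fun j _ => (hi2 i k j).const_mul _
  have hftc := intervalIntegral.integral_eq_sub_of_hasDerivAt hderiv
    (((hi1 i k).const_mul 2).add hint)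
  rw [intervalIntegral.integral_add ((hi1 i k).const_mul 2) hint,
    intervalIntegral.integral_const_mul, intervalIntegral.integral_finsetSum
      (fun j _ => (hi2 i k j).const_mul _)] at hftc
  simp only [intervalIntegral.integral_const_mul, Complex.ofReal_one, one_pow, one_mul, one_smul,
    Complex.ofReal_zero, ne_eq, OfNat.ofNat_ne_zero, not_false_eq_true, zero_pow, zero_mul,
    sub_zero] at hftc
  rw [← hftc]
  have e1 : g k i x = - g i k x := by
    simp only [hg]
    rw [← intervalIntegral.integral_neg]
    refine intervalIntegral.integral_congr fun t ht => ?_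
    rw [uIcc_of_le zero_le_one] at ht
    simp only [ha k i _ (hm x hx t ht)]; ring
  have e2 : ∀ j, ∫ t in (0 : ℝ)..1, (t : ℂ) ^ 2 * pd j (s i k) ((t : ℂ) • x) =
      (∫ t in (0 : ℝ)..1, (t : ℂ) ^ 2 * pd i (s j k) ((t : ℂ) • x)) -
      ∫ t in (0 : ℝ)..1, (t : ℂ) ^ 2 * pd k (s j i) ((t : ℂ) • x) := by
    intro j
    rw [← intervalIntegral.integral_sub (hi2 j k i) (hi2 j i k)]
    refine intervalIntegral.integral_congr fun t ht => ?_
    rw [uIcc_of_le zero_le_one] at ht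
    have hy := hm x hx t ht
    have h1 := hc i j k _ hy
    have h2 : ∀ a b l, pd l (s a b) ((t : ℂ) • x) = - pd l (s b a) ((t : ℂ) • x) := by
      intro a b l
      have : s a b =ᶠ[𝓝 ((t : ℂ) • x)] fun y => - s b a y :=
        Filter.eventuallyEq_of_mem (isOpen_ball.mem_nhds hy) fun y hy => ha a b y hy
      rw [pd, this.fderiv_eq, fderiv_fun_neg]; rfl
    have h3 := h2 k i j
    have h4 := h2 i j k
    linear_combination (t : ℂ) ^ 2 * (h3 + h4 - h1)
  simp only [e2, mul_sub, sum_sub_distrib, e1]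
  simp only [hg]
  ring

end Integrals

end

section

variable {r : ℝ} {h : ℂ^n → ℂ}

/-! ### Goursat problem: integral operators -/

section Goursat

open Metric Set Filter Topology MeasureTheory

/-- The projection to the `i`-th axis. -/
def axisProj (i : Fin n) : ℂ^n →L[ℂ] ℂ^n :=
  (ContinuousLinearMap.single ℂ (fun _ => ℂ) i).comp (ContinuousLinearMap.proj i)

/-- The projection along the `i`-th axis. -/
def coProj (i : Fin n) : ℂ^n →L[ℂ] ℂ^n := ContinuousLinearMap.id ℂ _ - axisProj i

theorem axisProj_apply (i j : Fin n) (x : ℂ^n) : axisProj i x j = if j = i then x j else 0 := by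
  by_cases h : j = i
  · subst h; simp [axisProj]
  · simp [axisProj, h]

theorem coProj_apply (i j : Fin n) (x : ℂ^n) : coProj i x j = if j = i then 0 else x j := by
  rw [coProj, _root_.sub_apply, ContinuousLinearMap.id_apply, Pi.sub_apply, axisProj_apply]
  split_ifs <;> simp

/-- The segment from the projection of `x` to the `i`-th axis to `x`. -/
def axisSeg (i : Fin n) (x : ℂ^n) (t : ℝ) : ℂ^n := axisProj i x + (t : ℂ) • coProj i x

theorem axisSeg_apply (i j : Fin n) (x : ℂ^n) (t : ℝ) :
    axisSeg i x t j = if j = i then x j else t * x j := by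
  rw [axisSeg, Pi.add_apply, Pi.smul_apply, axisProj_apply, coProj_apply]
  split_ifs <;> simp

theorem axisSeg_one (i : Fin n) (x : ℂ^n) : axisSeg i x 1 = x := by ext j; rw [axisSeg_apply]; simp

theorem axisSeg_axisSeg (i : Fin n) (x : ℂ^n) (s t : ℝ) :
    axisSeg i (axisSeg i x s) t = axisSeg i x (t * s) := by
  ext j
  simp only [axisSeg_apply]
  split_ifs
  · rfl
  · push_cast; ring

theorem norm_axisSeg_le (i : Fin n) (x : ℂ^n) {t : ℝ} (ht : t ∈ Icc (0 : ℝ) 1) :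
    ‖axisSeg i x t‖ ≤ ‖x‖ := by
  refine (pi_norm_le_iff_of_nonneg (norm_nonneg x)).mpr fun j => ?_
  rw [axisSeg_apply]
  split_ifs
  · exact norm_le_pi_norm x j
  · rw [norm_mul, Complex.norm_real, Real.norm_of_nonneg ht.1]
    exact (mul_le_of_le_one_left (norm_nonneg _) ht.2).trans (norm_le_pi_norm x j)

theorem axisSeg_mem (hx : x ∈ 𝔹 r)
    {t : ℝ} (ht : t ∈ Icc (0 : ℝ) 1) : axisSeg i x t ∈ 𝔹 r := by
  rw [mem_ball_zero_iff] at hx ⊢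
  exact (norm_axisSeg_le i x ht).trans_lt hx

theorem continuous_axisSeg (i : Fin n) (x : ℂ^n) : Continuous (axisSeg i x) := by
  unfold axisSeg; fun_prop

theorem continuousOn_axisSeg (hx : x ∈ 𝔹 r) (hh : ContinuousOn h (𝔹 r)) :
    ContinuousOn (fun t => h (axisSeg i x t)) (uIcc 0 1) := by
  rw [uIcc_of_le zero_le_one]
  exact hh.comp (continuous_axisSeg i x).continuousOn fun t ht => axisSeg_mem hx ht

/-- The average of a function over the segments `axisSeg`. -/
def axisAverage (i : Fin n) (h : ℂ^n → ℂ) (x : ℂ^n) : ℂ := ∫ t in (0 : ℝ)..1, h (axisSeg i x t)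

theorem differentiableOn_axisAverage (hh : DiffOn h (𝔹 r)) : DiffOn (axisAverage i h) (𝔹 r) := by
  intro x hx
  have := hasFDerivAt_integral_segment hh (P := axisProj i) (Q := coProj i)
    (fun t ht x => norm_axisSeg_le i x ht) (w := fun _ => 1) continuous_const hx
  simp only [one_smul] at this
  exact this.differentiableAt.differentiableWithinAt

theorem norm_axisAverage_sub_le {C : ℝ} {g : ℂ^n → ℂ}
    (hg : ContinuousOn g (𝔹 r)) (hh : ContinuousOn h (𝔹 r))
    (hC : ∀ y ∈ 𝔹 r, ‖g y - h y‖ ≤ C) (hx : x ∈ 𝔹 r) : ‖axisAverage i g x - axisAverage i h x‖ ≤ C := by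
  rw [axisAverage, axisAverage, ← intervalIntegral.integral_sub
    (continuousOn_axisSeg hx hg).intervalIntegrable
    (continuousOn_axisSeg hx hh).intervalIntegrable]
  have := intervalIntegral.norm_integral_le_of_norm_le_const (a := (0 : ℝ)) (b := 1)
    (f := fun t => g (axisSeg i x t) - h (axisSeg i x t)) (C := C) (fun t ht => by
      rw [uIoc_of_le zero_le_one] at ht
      exact hC _ (axisSeg_mem hx ⟨ht.1.le, ht.2⟩))
  simpa using this

/-- The value of `∑_{j ≠ i} x_j ∂_j` on a function `u` constant on the `i`-th axis with
`u = ∑_{j ≠ i} x_j ∫ f_j` is `∑_{j ≠ i} x_j f_j`. -/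
theorem sum_mul_pd_eq {u : ℂ^n → ℂ} {f : Fin n → ℂ^n → ℂ}
    (hu : DiffOn u (𝔹 r)) (hf : ∀ j, ContinuousOn (f j) (𝔹 r))
    (h : ∀ x ∈ 𝔹 r, u x = ∑ j, coProj i x j * axisAverage i (f j) x) (hx : x ∈ 𝔹 r) :
    ∑ j, coProj i x j * pd j u x = ∑ j, coProj i x j * f j x := by
  -- both sides are the left derivative of `u` along the segment at its end point
  have h1 : HasDerivWithinAt (fun s : ℝ => u (axisSeg i x s))
      (∑ j, coProj i x j * pd j u x) (Icc 0 1) 1 := by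
    have h2 := hasDerivAt_comp_segment (f := u) (p := axisProj i x) (q := coProj i x) (t := 1)
      (by
        have : axisProj i x + ((1 : ℝ) : ℂ) • coProj i x = x := axisSeg_one i x
        rw [this]; exact hu.differentiableAt (isOpen_ball.mem_nhds hx))
    have h3 : axisProj i x + ((1 : ℝ) : ℂ) • coProj i x = x := axisSeg_one i x
    rw [h3] at h2
    exact h2.hasDerivWithinAt
  have hcont : ∀ j, ContinuousOn (fun t => f j (axisSeg i x t)) (Icc 0 1) := fun j => by
    have := continuousOn_axisSeg (i := i) hx (hf j)
    rwa [uIcc_of_le zero_le_one] at this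
  have h4 : ∀ s ∈ Icc (0 : ℝ) 1, u (axisSeg i x s) =
      ∑ j, coProj i x j * ∫ t in (0 : ℝ)..s, f j (axisSeg i x t) := by
    intro s hs
    rw [h _ (axisSeg_mem hx hs)]
    refine sum_ext fun j => ?_
    have h5 : coProj i (axisSeg i x s) j = s * coProj i x j := by
      rw [coProj_apply, coProj_apply, axisSeg_apply]
      split_ifs <;> simp
    have h6 : (s : ℂ) * axisAverage i (f j) (axisSeg i x s) =
        ∫ t in (0 : ℝ)..s, f j (axisSeg i x t) := by
      have := intervalIntegral.smul_integral_comp_mul_right (a := 0) (b := 1)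
        (fun t => f j (axisSeg i x t)) s
      simp only [zero_mul, one_mul] at this
      rw [← this, axisAverage, Complex.real_smul]
      simp only [axisSeg_axisSeg]
    rw [h5, mul_right_comm, h6, mul_comm]
  have h7 : HasDerivWithinAt (fun s : ℝ => u (axisSeg i x s))
      (∑ j, coProj i x j * f j x) (Icc 0 1) 1 := by
    have h8 : ∀ j, HasDerivWithinAt (fun s : ℝ => ∫ t in (0 : ℝ)..s, f j (axisSeg i x t))
        (f j x) (Icc 0 1) 1 := by
      intro j
      have hI : IntervalIntegrable (fun t => f j (axisSeg i x t)) volume 0 1 := by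
        apply ContinuousOn.intervalIntegrable
        rw [uIcc_of_le zero_le_one]; exact hcont j
      have hmem : (1 : ℝ) ∈ Icc (0 : ℝ) 1 := ⟨zero_le_one, le_rfl⟩
      have : Fact ((1 : ℝ) ∈ Icc (0 : ℝ) 1) := ⟨hmem⟩
      have := intervalIntegral.integral_hasDerivWithinAt_right (s := Icc 0 1) (t := Icc 0 1) hI
        ((hcont j).stronglyMeasurableAtFilter_nhdsWithin measurableSet_Icc 1)
        ((hcont j) 1 hmem)
      simpa only [axisSeg_one] using this
    exact (HasDerivWithinAt.fun_sum fun j _ => (h8 j).const_mul _).congr (fun s hs => h4 s hs)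
      (h4 1 ⟨zero_le_one, le_rfl⟩)
  exact (uniqueDiffOn_Icc zero_lt_one 1 ⟨zero_le_one, le_rfl⟩).eq_deriv _ h1 h7

end Goursat

end

section

variable {u : ℂ^n → ℂ^n}

/-! ### Goursat problem: solution of the integral equation -/

section GoursatExistence

open Metric Set Filter Topology MeasureTheory

/-- The right hand side of the system `∂_j u_i = a_ij u_i + a_ji u_j + k_ij`, `i ≠ j`. -/
def goursatRhs (a k : Fin n → Fin n → ℂ^n → ℂ) (u : ℂ^n → ℂ^n)
    (i j : Fin n) (x : ℂ^n) : ℂ := a i j x * u x i + a j i x * u x j + k i j x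

/-- The integral operator of the Goursat problem with zero data on the axes. -/
def goursatOp (a k : Fin n → Fin n → ℂ^n → ℂ) (u : ℂ^n → ℂ^n) (x : ℂ^n) (i : Fin n) : ℂ :=
  ∑ j, coProj i x j * axisAverage i (goursatRhs a k u i j) x

variable {a k : Fin n → Fin n → ℂ^n → ℂ} {r A : ℝ}

theorem differentiableOn_goursatRhs (ha : ∀ i j, DiffOn (a i j) (𝔹 r))
    (hk : ∀ i j, DiffOn (k i j) (𝔹 r)) (hu : DiffOn u (𝔹 r)) (i j : Fin n) :
    DiffOn (goursatRhs a k u i j) (𝔹 r) :=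
  (((ha i j).mul (differentiableOn_pi.mp hu i)).add
    ((ha j i).mul (differentiableOn_pi.mp hu j))).add (hk i j)

theorem differentiableOn_goursatOp (ha : ∀ i j, DiffOn (a i j) (𝔹 r))
    (hk : ∀ i j, DiffOn (k i j) (𝔹 r)) (hu : DiffOn u (𝔹 r)) : DiffOn (goursatOp a k u) (𝔹 r) := by
  refine differentiableOn_pi.mpr fun i => DifferentiableOn.fun_sum fun j _ => ?_
  have h1 : Differentiable ℂ fun x : ℂ^n => coProj i x j := by fun_prop
  exact h1.differentiableOn.mul
    (differentiableOn_axisAverage (differentiableOn_goursatRhs ha hk hu i j))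

theorem norm_sum_coProj_le {C : ℝ} (hx : ‖x‖ ≤ r) (i : Fin n)
    {b : ℂ^n} (hb : ∀ j, ‖b j‖ ≤ C) : ‖∑ j, coProj i x j * b j‖ ≤ n * r * C := by
  have h1 : ∀ j, ‖coProj i x j‖ ≤ r := fun j => by
    rw [coProj_apply]
    split_ifs
    · rw [norm_zero]; exact (norm_nonneg x).trans hx
    · exact (norm_le_pi_norm x j).trans hx
  calc _ ≤ ∑ j : Fin n, r * C := norm_sum_le_of_le _ fun j _ => by
        rw [norm_mul]
        exact mul_le_mul (h1 j) (hb j) (norm_nonneg _) ((norm_nonneg _).trans (h1 j))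
    _ = n * r * C := by simp [mul_assoc]

theorem norm_goursatOp_sub_le (ha : ∀ i j, DiffOn (a i j) (𝔹 r))
    (hk : ∀ i j, DiffOn (k i j) (𝔹 r))
    (hA : ∀ i j, ∀ x ∈ 𝔹 r, ‖a i j x‖ ≤ A) (hA0 : 0 ≤ A) (hr : 4 * n * r * A ≤ 1)
    {v : ℂ^n → ℂ^n} (hu : DiffOn u (𝔹 r))
    (hv : DiffOn v (𝔹 r)) {C : ℝ} (hC0 : 0 ≤ C)
    (hC : ∀ x ∈ 𝔹 r, ‖u x - v x‖ ≤ C) (hx : x ∈ 𝔹 r) :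
    ‖goursatOp a k u x - goursatOp a k v x‖ ≤ C / 2 := by
  refine (pi_norm_le_iff_of_nonneg (by positivity)).mpr fun i => ?_
  have h1 : goursatOp a k u x i - goursatOp a k v x i = ∑ j, coProj i x j *
      (axisAverage i (goursatRhs a k u i j) x - axisAverage i (goursatRhs a k v i j) x) := by
    simp only [goursatOp, mul_sub, sum_sub_distrib]
  rw [Pi.sub_apply, h1]
  have h2 : ∀ j, ‖axisAverage i (goursatRhs a k u i j) x -
      axisAverage i (goursatRhs a k v i j) x‖ ≤ 2 * A * C := by
    intro j
    refine norm_axisAverage_sub_le (differentiableOn_goursatRhs ha hk hu i j).continuousOn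
      (differentiableOn_goursatRhs ha hk hv i j).continuousOn (fun y hy => ?_) hx
    have e : goursatRhs a k u i j y - goursatRhs a k v i j y =
        a i j y * (u y - v y) i + a j i y * (u y - v y) j := by
      simp only [goursatRhs, Pi.sub_apply]; ring
    rw [e]
    have h3 : ∀ l, ‖(u y - v y) l‖ ≤ C := fun l => (norm_le_pi_norm _ l).trans (hC y hy)
    calc _ ≤ ‖a i j y‖ * ‖(u y - v y) i‖ + ‖a j i y‖ * ‖(u y - v y) j‖ := by
          rw [← norm_mul, ← norm_mul]; exact norm_add_le _ _
      _ ≤ A * C + A * C := by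
          gcongr
          · exact hA i j y hy
          · exact h3 i
          · exact hA j i y hy
          · exact h3 j
      _ = 2 * A * C := by ring
  have h4 := norm_sum_coProj_le (mem_ball_zero_iff.mp hx).le i h2
  refine h4.trans ?_
  nlinarith [mul_le_mul_of_nonneg_right hr hC0]

/-- The integral equation of the Goursat problem is solvable near the origin. -/
theorem exists_goursatOp_eq (ha : ∀ i j, DiffOn (a i j) (𝔹 r))
    (hk : ∀ i j, DiffOn (k i j) (𝔹 r))
    (hA : ∀ i j, ∀ x ∈ 𝔹 r, ‖a i j x‖ ≤ A) (hA0 : 0 ≤ A)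
    (hr : 4 * n * r * A ≤ 1)
    (hkA : ∀ i j, ∀ x ∈ 𝔹 r, ‖k i j x‖ ≤ A) :
    ∃ u : ℂ^n → ℂ^n, DiffOn u (𝔹 r) ∧ ∀ x ∈ 𝔹 r, u x = goursatOp a k u x := by
  set v : ℕ → ℂ^n → ℂ^n := fun m => (goursatOp a k)^[m] 0 with hv
  have hv1 : ∀ m, v (m + 1) = goursatOp a k (v m) := fun m => Function.iterate_succ_apply' _ _ _
  have hvd : ∀ m, DiffOn (v m) (𝔹 r) := by
    intro m
    induction m with
    | zero => exact differentiableOn_const 0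
    | succ m ih => rw [hv1]; exact differentiableOn_goursatOp ha hk ih
  have hstep : ∀ m, ∀ x ∈ 𝔹 r, ‖v m x - v (m + 1) x‖ ≤ 1 * (1 / 2) ^ m := by
    intro m
    induction m with
    | zero =>
      intro x hx
      rw [hv1]
      have h0 : v 0 = 0 := rfl
      rw [h0, Pi.zero_apply, zero_sub, norm_neg]
      refine (pi_norm_le_iff_of_nonneg (by norm_num)).mpr fun i => ?_
      have h1 : ∀ j, ‖axisAverage i (goursatRhs a k 0 i j) x‖ ≤ A := by
        intro j
        have h2 := norm_axisAverage_sub_le (i := i) (h := fun _ => 0) (C := A)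
          (differentiableOn_goursatRhs ha hk (differentiableOn_const 0) i j).continuousOn
          continuousOn_const (fun y hy => by simpa [goursatRhs] using hkA i j y hy) hx
        have h3 : axisAverage i (fun _ => 0) x = 0 := by simp [axisAverage]
        rw [h3, sub_zero] at h2
        exact h2
      have h4 := norm_sum_coProj_le (mem_ball_zero_iff.mp hx).le i h1
      refine h4.trans ?_
      norm_num
      nlinarith [mul_nonneg (mul_nonneg (Nat.cast_nonneg (α := ℝ) n)
        ((norm_nonneg x).trans (mem_ball_zero_iff.mp hx).le)) hA0]
    | succ m ih =>
      intro x hx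
      rw [hv1 (m + 1), hv1 m]
      have := norm_goursatOp_sub_le ha hk hA hA0 hr (hvd m) (hvd (m + 1)) (by positivity) ih hx
      rw [← hv1 m] at this ⊢
      refine this.trans_eq ?_
      rw [pow_succ]; ring
  have hlim : ∀ x ∈ 𝔹 r, ∃ y, Tendsto (fun m => v m x) atTop (𝓝 y) :=
    fun x hx => cauchySeq_tendsto_of_complete (cauchySeq_of_le_geometric (1 / 2) 1 (by norm_num)
      fun m => by rw [dist_eq_norm]; exact hstep m x hx)
  choose! u hu using hlim
  have hdist : ∀ m, ∀ x ∈ 𝔹 r, ‖v m x - u x‖ ≤ 2 * (1 / 2) ^ m := by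
    intro m x hx
    have := dist_le_of_le_geometric_of_tendsto (1 / 2) 1 (by norm_num)
      (fun m => by rw [dist_eq_norm]; exact hstep m x hx) (hu x hx) m
    rw [dist_eq_norm] at this
    refine this.trans_eq ?_
    ring
  have hpow : Tendsto (fun m : ℕ => 2 * (1 / 2 : ℝ) ^ m) atTop (𝓝 0) := by
    simpa using (tendsto_pow_atTop_nhds_zero_of_lt_one (r := (1 / 2 : ℝ)) (by norm_num)
      (by norm_num)).const_mul 2
  have hud : DiffOn u (𝔹 r) := by
    refine differentiableOn_of_tendstoUniformlyOn isOpen_ball hvd ?_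
    rw [Metric.tendstoUniformlyOn_iff]
    intro ε hε
    filter_upwards [hpow.eventually (gt_mem_nhds hε)] with m hm x hx
    rw [dist_comm, dist_eq_norm]
    exact (hdist m x hx).trans_lt hm
  refine ⟨u, hud, fun x hx => ?_⟩
  have h1 : Tendsto (fun m => v (m + 1) x) atTop (𝓝 (goursatOp a k u x)) := by
    rw [tendsto_iff_norm_sub_tendsto_zero]
    refine squeeze_zero (fun _ => norm_nonneg _) (fun m => ?_) hpow
    rw [hv1]
    have := norm_goursatOp_sub_le ha hk hA hA0 hr (hvd m) hud (by positivity) (hdist m) hx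
    refine this.trans (half_le_self (by positivity))
  exact tendsto_nhds_unique ((tendsto_add_atTop_iff_nat 1).mpr (hu x hx)) h1

end GoursatExistence

end

section

variable {f g : ℂ^n → ℂ}

/-! ### Goursat problem: compatibility -/

section GoursatCompat

open Metric Set Filter Topology MeasureTheory

theorem pd_add (hf : DifferentiableAt ℂ f x) (hg : DifferentiableAt ℂ g x) (l : Fin n) :
    pd l (fun x => f x + g x) x = pd l f x + pd l g x := by
  rw [pd, fderiv_fun_add hf hg]; rfl

theorem pd_sub (hf : DifferentiableAt ℂ f x) (hg : DifferentiableAt ℂ g x) (l : Fin n) :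
    pd l (fun x => f x - g x) x = pd l f x - pd l g x := by
  rw [pd, fderiv_fun_sub hf hg]; rfl

theorem pd_mul (hf : DifferentiableAt ℂ f x) (hg : DifferentiableAt ℂ g x) (l : Fin n) :
    pd l (fun x => f x * g x) x = f x * pd l g x + pd l f x * g x := by
  rw [pd, fderiv_fun_mul hf hg]
  simp only [pd, _root_.add_apply, _root_.smul_apply, smul_eq_mul]
  ring

theorem pd_sum {ι : Type*} {s : Finset ι} {f : ι → ℂ^n → ℂ} (hf : ∀ i ∈ s, DifferentiableAt ℂ (f i) x) (l : Fin n) :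
    pd l (fun x => ∑ i ∈ s, f i x) x = ∑ i ∈ s, pd l (f i) x := by
  rw [pd, fderiv_fun_sum hf, _root_.sum_apply]; rfl

variable {a k : Fin n → Fin n → ℂ^n → ℂ} {r A : ℝ} {u : ℂ^n → ℂ^n}

/-- The defect of a solution of the integral equation. -/
def defect (a k : Fin n → Fin n → ℂ^n → ℂ) (u : ℂ^n → ℂ^n)
    (i j : Fin n) (x : ℂ^n) : ℂ := pd j (fun x => u x i) x - goursatRhs a k u i j x

theorem differentiableOn_defect (ha : ∀ i j, DiffOn (a i j) (𝔹 r))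
    (hk : ∀ i j, DiffOn (k i j) (𝔹 r)) (hu : DiffOn u (𝔹 r))
    (i j : Fin n) : DiffOn (defect a k u i j) (𝔹 r) :=
  (differentiableOn_pd isOpen_ball (differentiableOn_pi.mp hu i) j).sub
    (differentiableOn_goursatRhs ha hk hu i j)

theorem sum_mul_defect (ha : ∀ i j, DiffOn (a i j) (𝔹 r))
    (hk : ∀ i j, DiffOn (k i j) (𝔹 r)) (hu : DiffOn u (𝔹 r))
    (h : ∀ x ∈ 𝔹 r, u x = goursatOp a k u x) (i : Fin n) (hx : x ∈ 𝔹 r) :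
    ∑ j, coProj i x j * defect a k u i j x = 0 := by
  simp only [defect, mul_sub, sum_sub_distrib]
  rw [sub_eq_zero]
  exact sum_mul_pd_eq (differentiableOn_pi.mp hu i)
    (fun j => (differentiableOn_goursatRhs ha hk hu i j).continuousOn)
    (fun y hy => congrFun (h y hy) i) hx

theorem defect_eq (ha : ∀ i j, DiffOn (a i j) (𝔹 r))
    (hk : ∀ i j, DiffOn (k i j) (𝔹 r)) (hu : DiffOn u (𝔹 r))
    (h : ∀ x ∈ 𝔹 r, u x = goursatOp a k u x) (hil : l ≠ i)
    (hx : x ∈ 𝔹 r) :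
    defect a k u i l x = - ∑ j, coProj i x j * pd l (defect a k u i j) x := by
  have hd : ∀ j, DifferentiableAt ℂ (defect a k u i j) x := fun j =>
    (differentiableOn_defect ha hk hu i j).differentiableAt (isOpen_ball.mem_nhds hx)
  have hc : ∀ j, HasFDerivAt (fun y : ℂ^n => coProj i y j)
      ((ContinuousLinearMap.proj j).comp (coProj i)) x := fun j =>
    ((ContinuousLinearMap.proj (R := ℂ) j).comp (coProj i)).hasFDerivAt
  have h1 : pd l (fun y => ∑ j, coProj i y j * defect a k u i j y) x = 0 := by
    have h2 : (fun y => ∑ j, coProj i y j * defect a k u i j y) =ᶠ[𝓝 x] fun _ => 0 :=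
      Filter.eventuallyEq_of_mem (isOpen_ball.mem_nhds hx) fun y hy =>
        sum_mul_defect ha hk hu h i hy
    rw [pd, h2.fderiv_eq, fderiv_fun_const]; rfl
  have h2 : pd l (fun y => ∑ j, coProj i y j * defect a k u i j y) x =
      ∑ j, pd l (fun y => coProj i y j * defect a k u i j y) x :=
    pd_sum (fun j _ => (hc j).differentiableAt.mul (hd j)) l
  rw [h2] at h1
  simp only [pd_mul (hc _).differentiableAt (hd _), pd_eq_of_hasFDerivAt (hc _),
    ContinuousLinearMap.comp_apply, ContinuousLinearMap.proj_apply, coProj_apply i _ (Pi.single l 1),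
    sum_add_distrib] at h1
  have h3 : ∑ j, (if j = i then 0 else (Pi.single l (1 : ℂ) : ℂ^n) j) *
      defect a k u i j x = defect a k u i l x := by
    rw [sum_eq_single l]
    · simp [hil]
    · intro b _ hb; simp [hb]
    · simp
  rw [h3] at h1
  linear_combination h1

/-- The compatibility conditions of the system `∂_j u_i = a_ij u_i + a_ji u_j + k_ij`. -/
structure GoursatCompatible (a k : Fin n → Fin n → ℂ^n → ℂ) (s : Set ℂ^n) : Prop where
  symm : ∀ i j, ∀ x ∈ s, k i j x = k j i x
  first : ∀ i j l, i ≠ j → i ≠ l → j ≠ l → ∀ x ∈ s, pd l (a i j) x = pd j (a i l) x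
  second : ∀ i j l, i ≠ j → i ≠ l → j ≠ l → ∀ x ∈ s,
    pd l (a j i) x + a j i x * a j l x = a i l x * a j i x + a l i x * a j l x
  third : ∀ i j l, i ≠ j → i ≠ l → j ≠ l → ∀ x ∈ s,
    pd l (k i j) x + a i j x * k i l x + a j i x * k j l x =
      pd j (k i l) x + a i l x * k i j x + a l i x * k l j x

theorem pd_defect_sub (ha : ∀ i j, DiffOn (a i j) (𝔹 r))
    (hk : ∀ i j, DiffOn (k i j) (𝔹 r)) (hu : DiffOn u (𝔹 r))
    (hc : GoursatCompatible a k (𝔹 r)) (hij : i ≠ j) (hil : i ≠ l)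
    (hjl : j ≠ l) (hx : x ∈ 𝔹 r) :
    pd l (defect a k u i j) x - pd j (defect a k u i l) x =
      - (a i j x * defect a k u i l x + a j i x * defect a k u j l x -
        a i l x * defect a k u i j x - a l i x * defect a k u l j x) := by
  have hn := isOpen_ball.mem_nhds hx
  have da : ∀ i j, DifferentiableAt ℂ (a i j) x := fun i j => (ha i j).differentiableAt hn
  have dk : ∀ i j, DifferentiableAt ℂ (k i j) x := fun i j => (hk i j).differentiableAt hn
  have hui : ∀ i, DiffOn (fun x => u x i) (𝔹 r) := differentiableOn_pi.mp hu
  have du : ∀ i, DifferentiableAt ℂ (fun x => u x i) x := fun i => (hui i).differentiableAt hn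
  have key : ∀ j l, pd l (defect a k u i j) x = pd l (pd j fun x => u x i) x -
      (a i j x * pd l (fun x => u x i) x + pd l (a i j) x * u x i +
        (a j i x * pd l (fun x => u x j) x + pd l (a j i) x * u x j) + pd l (k i j) x) := by
    intro j l
    have h1 : DifferentiableAt ℂ (fun x => a i j x * u x i) x := (da i j).mul (du i)
    have h2 : DifferentiableAt ℂ (fun x => a j i x * u x j) x := (da j i).mul (du j)
    have h3 : pd l (goursatRhs a k u i j) x = _ := pd_add (h1.add h2) (dk i j) l
    have h4 : pd l (defect a k u i j) x = _ := pd_sub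
      ((differentiableOn_pd isOpen_ball (hui i) j).differentiableAt hn)
      ((differentiableOn_goursatRhs ha hk hu i j).differentiableAt hn) l
    rw [h4, h3]
    have h5 := pd_add h1 h2 l
    rw [pd_mul (da i j) (du i), pd_mul (da j i) (du j)] at h5
    have h6 : pd l (fun x => a i j x * u x i + a j i x * u x j) x = _ := h5
    exact congrArg (fun z => _ - (z + _)) h6
  rw [key j l, key l j, pd_comm isOpen_ball (hui i) l j hx]
  have e : ∀ i j, pd j (fun x => u x i) x = defect a k u i j x +
      (a i j x * u x i + a j i x * u x j + k i j x) := fun i j => by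
    rw [defect, goursatRhs]; ring
  simp only [e]
  have c1 := hc.first i j l hij hil hjl x hx
  have c2 := hc.second i j l hij hil hjl x hx
  have c3 := hc.second i l j hil hij hjl.symm x hx
  have c4 := hc.third i j l hij hil hjl x hx
  linear_combination (-u x i) * c1 - u x j * c2 + u x l * c3 - c4

/-- If the compatibility conditions hold, the defect contracts. -/
theorem norm_defect_le (ha : ∀ i j, DiffOn (a i j) (𝔹 r))
    (hk : ∀ i j, DiffOn (k i j) (𝔹 r)) (hu : DiffOn u (𝔹 r))
    (h : ∀ x ∈ 𝔹 r, u x = goursatOp a k u x)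
    (hc : GoursatCompatible a k (𝔹 r)) {ρ : ℝ} (hρ : ρ ≤ r)
    (hA : ∀ i j, ∀ x ∈ 𝔹 ρ, ‖a i j x‖ ≤ A) (hA0 : 0 ≤ A)
    (hr : 8 * n * ρ * A ≤ 1) {M : ℝ} (hM0 : 0 ≤ M)
    (hM : ∀ i l, l ≠ i → ∀ x ∈ 𝔹 ρ, ‖defect a k u i l x‖ ≤ M)
    (hil : l ≠ i) (hx : x ∈ 𝔹 ρ) :
    ‖defect a k u i l x‖ ≤ M / 2 := by
  have hxr : 𝔹 ρ ⊆ ball (0 : ℂ^n) r := ball_subset_ball hρ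
  have hder : ∀ t ∈ Icc (0 : ℝ) 1, HasDerivAt
      (fun t : ℝ => (t : ℂ) * defect a k u i l (axisSeg i x t))
      ((t : ℂ) * ∑ j, coProj i x j * (pd j (defect a k u i l) (axisSeg i x t) -
        pd l (defect a k u i j) (axisSeg i x t))) t := by
    intro t ht
    have hm := hxr (axisSeg_mem (i := i) hx ht)
    have h1 := hasDerivAt_comp_segment (f := defect a k u i l) (p := axisProj i x)
      (q := coProj i x) (t := t)
      ((differentiableOn_defect ha hk hu i l).differentiableAt (isOpen_ball.mem_nhds hm))
    have h2 : HasDerivAt (fun t : ℝ => (t : ℂ)) 1 t := by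
      exact (Complex.ofRealCLM.hasDerivAt (x := t)).congr_deriv (by simp)
    refine (h2.mul h1).congr_deriv ?_
    have h3 := defect_eq ha hk hu h hil hm
    have h4 : ∀ j, coProj i (axisSeg i x t) j = t * coProj i x j := fun j => by
      rw [coProj_apply, coProj_apply, axisSeg_apply]
      split_ifs <;> simp
    simp only [h4, mul_assoc, ← mul_sum] at h3
    change 1 * defect a k u i l (axisSeg i x t) + (t : ℂ) *
      ∑ j, coProj i x j * pd j (defect a k u i l) (axisSeg i x t) = _
    rw [h3]
    simp only [mul_sub, sum_sub_distrib]
    ring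
  have hbound : ∀ t ∈ Ico (0 : ℝ) 1, ‖(t : ℂ) * ∑ j, coProj i x j *
      (pd j (defect a k u i l) (axisSeg i x t) -
        pd l (defect a k u i j) (axisSeg i x t))‖ ≤ M / 2 := by
    intro t ht
    have hm := axisSeg_mem (i := i) hx ⟨ht.1, ht.2.le⟩
    -- the term with `j = i` does not contribute
    have h1 : ∑ j, coProj i x j * (pd j (defect a k u i l) (axisSeg i x t) -
        pd l (defect a k u i j) (axisSeg i x t)) = ∑ j, coProj i x j *
        (if j = i then 0 else (pd j (defect a k u i l) (axisSeg i x t) -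
        pd l (defect a k u i j) (axisSeg i x t))) := by
      refine sum_ext fun j => ?_
      rw [coProj_apply]; split_ifs <;> simp
    have h2 : ‖∑ j, coProj i x j * (if j = i then 0 else
        (pd j (defect a k u i l) (axisSeg i x t) -
        pd l (defect a k u i j) (axisSeg i x t)))‖ ≤ n * ρ * (4 * A * M) := by
      refine norm_sum_coProj_le (mem_ball_zero_iff.mp hx).le i fun j => ?_
      split_ifs with hji
      · rw [norm_zero]; positivity
      by_cases hjl : j = l
      · subst hjl; rw [sub_self, norm_zero]; positivity
      rw [← norm_neg, neg_sub, pd_defect_sub ha hk hu hc (Ne.symm hji) hil.symm hjl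
        (hxr hm), norm_neg]
      have bound : ∀ p q i' l', l' ≠ i' → ‖a p q (axisSeg i x t) *
          defect a k u i' l' (axisSeg i x t)‖ ≤ A * M := fun p q i' l' hne => by
        rw [norm_mul]
        exact mul_le_mul (hA p q _ hm) (hM i' l' hne _ hm) (norm_nonneg _) hA0
      have b1 := bound i j i l hil
      have b2 := bound j i j l (Ne.symm hjl)
      have b3 := bound i l i j hji
      have b4 := bound l i l j hjl
      refine (norm_sub_le _ _).trans ?_
      grw [norm_sub_le, norm_add_le]
      linarith
    rw [norm_mul, Complex.norm_real, Real.norm_of_nonneg ht.1, h1]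
    calc t * _ ≤ 1 * (n * ρ * (4 * A * M)) := by
          gcongr
          exact ht.2.le
      _ ≤ M / 2 := by nlinarith [mul_le_mul_of_nonneg_right hr hM0]
  have := norm_image_sub_le_of_norm_deriv_le_segment_01'
    (fun t ht => (hder t ht).hasDerivWithinAt) hbound
  simpa [axisSeg_one] using this

theorem exists_bound_closedBall {b : Fin n → Fin n → ℂ^n → ℂ} {ρ : ℝ} {s : Set ℂ^n}
    (hs : closedBall 0 ρ ⊆ s) (hb : ∀ i j, ContinuousOn (b i j) s) :
    ∃ M, 0 ≤ M ∧ ∀ i j, ∀ x ∈ closedBall 0 ρ, ‖b i j x‖ ≤ M := by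
  have h : ContinuousOn (fun x i j => b i j x) (closedBall 0 ρ) :=
    continuousOn_pi.mpr fun i => continuousOn_pi.mpr fun j => (hb i j).mono hs
  obtain ⟨M, hM⟩ := (isCompact_closedBall (0 : ℂ^n) ρ).exists_bound_of_continuousOn h
  exact ⟨max M 0, le_max_right _ _, fun i j x hx => (norm_le_pi_norm (fun j => b i j x) j).trans
    ((norm_le_pi_norm (fun i j => b i j x) i).trans ((hM x hx).trans (le_max_left _ _)))⟩

/-- Local solvability of the system `∂_j ∂_i f = a_ij ∂_i f + a_ji ∂_j f + k_ij`, `i ≠ j`. -/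
theorem exists_goursat (hr : 0 < r) (ha : ∀ i j, DiffOn (a i j) (𝔹 r))
    (hk : ∀ i j, DiffOn (k i j) (𝔹 r))
    (hc : GoursatCompatible a k (𝔹 r)) :
    ∃ ρ > 0, ρ ≤ r ∧ ∃ f : ℂ^n → ℂ, DiffOn f (𝔹 ρ) ∧
      ∀ i j, i ≠ j → ∀ x ∈ 𝔹 ρ,
        pd j (pd i f) x = a i j x * pd i f x + a j i x * pd j f x + k i j x := by
  have hsub : closedBall (0 : ℂ^n) (r / 2) ⊆ ball 0 r := closedBall_subset_ball (by linarith)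
  obtain ⟨A₁, hA₁, hA⟩ := exists_bound_closedBall hsub fun i j => (ha i j).continuousOn
  obtain ⟨A₂, -, hA'⟩ := exists_bound_closedBall hsub fun i j => (hk i j).continuousOn
  set B := max A₁ A₂ with hB
  have hB0 : 0 ≤ B := hA₁.trans (le_max_left _ _)
  set r₁ := min (r / 2) (1 / (4 * n * B + 1)) with hr₁
  have hden : 0 < 4 * n * B + 1 := by positivity
  have hr₁0 : 0 < r₁ := lt_min (by linarith) (by positivity)
  have hr₁B : 4 * n * r₁ * B ≤ 1 := by
    have h1 : r₁ * (4 * n * B + 1) ≤ 1 := by rw [← le_div_iff₀ hden]; exact min_le_right _ _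
    nlinarith
  have hs₁ : 𝔹 r₁ ⊆ closedBall (0 : ℂ^n) (r / 2) :=
    (ball_subset_ball (min_le_left _ _)).trans ball_subset_closedBall
  have hs : 𝔹 r₁ ⊆ ball 0 r := hs₁.trans hsub
  have ha' : ∀ i j, DiffOn (a i j) (ball 0 r₁) := fun i j => (ha i j).mono hs
  have hk' : ∀ i j, DiffOn (k i j) (ball 0 r₁) := fun i j => (hk i j).mono hs
  have hc' : GoursatCompatible a k (ball 0 r₁) :=
    ⟨fun i j x hx => hc.symm i j x (hs hx),
      fun i j l h1 h2 h3 x hx => hc.first i j l h1 h2 h3 x (hs hx),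
      fun i j l h1 h2 h3 x hx => hc.second i j l h1 h2 h3 x (hs hx),
      fun i j l h1 h2 h3 x hx => hc.third i j l h1 h2 h3 x (hs hx)⟩
  have hAB : ∀ i j, ∀ x ∈ 𝔹 r₁, ‖a i j x‖ ≤ B := fun i j x hx =>
    (hA i j x (hs₁ hx)).trans (le_max_left _ _)
  obtain ⟨u, hu, hfix⟩ := exists_goursatOp_eq ha' hk' hAB hB0 hr₁B
    (fun i j x hx => (hA' i j x (hs₁ hx)).trans (le_max_right _ _))
  set ρ := r₁ / 2 with hρ
  have hρ0 : 0 < ρ := half_pos hr₁0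
  have hρr : 𝔹 ρ ⊆ ball (0 : ℂ^n) r₁ := ball_subset_ball (half_le_self hr₁0.le)
  obtain ⟨M, hM0, hM⟩ := exists_bound_closedBall (closedBall_subset_ball (half_lt_self hr₁0))
    fun i j => (differentiableOn_defect ha' hk' hu i j).continuousOn
  have hdec : ∀ m : ℕ, ∀ i l, l ≠ i → ∀ x ∈ 𝔹 ρ,
      ‖defect a k u i l x‖ ≤ M * (1 / 2) ^ m := by
    intro m
    induction m with
    | zero =>
      intro i l _ x hx
      rw [pow_zero, mul_one]
      exact hM i l x (ball_subset_closedBall hx)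
    | succ m ih =>
      intro i l hil x hx
      have := norm_defect_le ha' hk' hu hfix hc' (half_le_self hr₁0.le)
        (fun i j x hx => hAB i j x (hρr hx)) hB0 (by rw [← hρ, hρ]; linarith)
        (by positivity) ih hil hx
      refine this.trans_eq ?_
      rw [pow_succ]; ring
  have hzero : ∀ i l, l ≠ i → ∀ x ∈ 𝔹 ρ, defect a k u i l x = 0 := by
    intro i l hil x hx
    have h1 : Tendsto (fun m : ℕ => M * (1 / 2 : ℝ) ^ m) atTop (𝓝 0) := by
      simpa using (tendsto_pow_atTop_nhds_zero_of_lt_one (r := (1 / 2 : ℝ)) (by norm_num)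
        (by norm_num)).const_mul M
    exact norm_le_zero_iff.mp (ge_of_tendsto' h1 fun m => hdec m i l hil x hx)
  have hpdu : ∀ i j, i ≠ j → ∀ x ∈ 𝔹 ρ, pd j (fun x => u x i) x =
      a i j x * u x i + a j i x * u x j + k i j x := fun i j hij x hx => by
    have := hzero i j (Ne.symm hij) x hx
    rw [defect, goursatRhs, sub_eq_zero] at this
    exact this
  obtain ⟨f, hf, hfu⟩ := exists_potential (u := fun i x => u x i)
    (fun i => (differentiableOn_pi.mp hu i).mono hρr) (fun i j x hx => by
      by_cases hij : i = j
      · subst hij; rfl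
      · rw [hpdu i j hij x hx, hpdu j i (Ne.symm hij) x hx, hc.symm i j x (hs (hρr hx))]; ring)
  refine ⟨ρ, hρ0, (half_le_self hr₁0.le).trans ((min_le_left _ _).trans (by linarith)), f, hf,
    fun i j hij x hx => ?_⟩
  have h1 : pd i f =ᶠ[𝓝 x] fun x => u x i :=
    Filter.eventuallyEq_of_mem (isOpen_ball.mem_nhds hx) fun y hy => hfu i y hy
  rw [pd, h1.fderiv_eq, hfu i x hx, hfu j x hx]
  exact hpdu i j hij x hx

end GoursatCompat

end

section

variable {N : ℕ} {f f' : Density n} {g : (Fin (N + 2) → ℂ^n) → ℂ}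

/-! ### Jet functions -/

section Truncation

open Filter Topology

/-- The jet variables `v_ℓ` with `ℓ < N + 2`. -/
def truncate (N : ℕ) (j : Jet n) : Fin (N + 2) → ℂ^n := fun ℓ => j ℓ

/-- The truncated jets with `(v, v_x)` in `W`. -/
def truncSet (W : Set (ℂ^n × ℂ^n)) (N : ℕ) : Set (Fin (N + 2) → ℂ^n) := {y | (y 0, y 1) ∈ W}

/-- The unit vector in the direction of `v^α_ℓ`; it vanishes for `ℓ ≥ N + 2`. -/
def unitJet (N ℓ : ℕ) (α : Fin n) : Fin (N + 2) → ℂ^n :=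
  fun m β => if (m : ℕ) = ℓ ∧ β = α then 1 else 0

theorem truncate_mem {j : Jet n} : truncate N j ∈ truncSet W N ↔ j ∈ jetsOver₁ W := by
  have h1 : ((1 : Fin (N + 2)) : ℕ) = 1 := rfl
  simp only [truncSet, Set.mem_ofPred_eq, truncate, jetsOver₁, h1]
  rfl

theorem isOpen_truncSet (hW : IsOpen W) : IsOpen (truncSet W N) := hW.preimage (by fun_prop)

theorem truncate_update (j : Jet n) (ℓ : ℕ) (α : Fin n) (z : ℂ) :
    truncate N (Function.update j ℓ (Function.update (j ℓ) α z)) =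
      truncate N j + (z - j ℓ α) • unitJet N ℓ α := by
  ext m β
  simp only [truncate, Function.update_apply, Pi.add_apply, Pi.smul_apply, unitJet, smul_eq_mul]
  by_cases h : (m : ℕ) = ℓ
  · by_cases h' : β = α
    · subst h; subst h'; simp
    · subst h; simp [h']
  · simp [h]

/-- A density that depends on `v_ℓ`, `ℓ < N + 2`, through the analytic function `g`. -/
structure IsTruncated (W : Set (ℂ^n × ℂ^n)) (N : ℕ) (f : Density n)
    (g : (Fin (N + 2) → ℂ^n) → ℂ) : Prop where
  analytic : Holo g (truncSet W N)
  eq : ∀ j ∈ jetsOver₁ W, f j = g (truncate N j)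

theorem IsTruncated.hasDerivAt (hW : IsOpen W) (h : IsTruncated W N f g) (ℓ : ℕ) (α : Fin n) {j : Jet n}
    (hj : j ∈ jetsOver₁ W) :
    HasDerivAt (fun z : ℂ => f (Function.update j ℓ (Function.update (j ℓ) α z)))
      (fderiv ℂ g (truncate N j) (unitJet N ℓ α)) (j ℓ α) := by
  have h0 : truncate N j + (j ℓ α - j ℓ α) • unitJet N ℓ α = truncate N j := by simp
  have hd : DifferentiableAt ℂ g (truncate N j) :=
    (h.analytic _ (truncate_mem.mpr hj)).differentiableAt
  have hline : HasDerivAt (fun z : ℂ => truncate N j + (z - j ℓ α) • unitJet N ℓ α)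
      (unitJet N ℓ α) (j ℓ α) := by
    have := (((hasDerivAt_id (j ℓ α)).sub_const (j ℓ α)).smul_const
      (unitJet N ℓ α)).const_add (truncate N j)
    simpa using this
  have hmem : ∀ᶠ z in 𝓝 (j ℓ α), truncate N j + (z - j ℓ α) • unitJet N ℓ α ∈ truncSet W N := by
    refine hline.continuousAt.eventually_mem ((isOpen_truncSet hW).mem_nhds ?_)
    rw [h0]; exact truncate_mem.mpr hj
  have heq : (fun z => f (Function.update j ℓ (Function.update (j ℓ) α z))) =ᶠ[𝓝 (j ℓ α)]
      fun z => g (truncate N j + (z - j ℓ α) • unitJet N ℓ α) := by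
    filter_upwards [hmem] with z hz
    rw [← truncate_update] at hz ⊢
    exact h.eq _ (truncate_mem.mp hz)
  refine HasDerivAt.congr_of_eventuallyEq ?_ heq
  have hd' : HasFDerivAt g (fderiv ℂ g (truncate N j))
      (truncate N j + (j ℓ α - j ℓ α) • unitJet N ℓ α) := by rw [h0]; exact hd.hasFDerivAt
  exact hd'.comp_hasDerivAt _ hline

theorem IsTruncated.jetPartial_eq (hW : IsOpen W) (h : IsTruncated W N f g) (ℓ : ℕ) (α : Fin n) {j : Jet n}
    (hj : j ∈ jetsOver₁ W) : jetPartial ℓ α f j = fderiv ℂ g (truncate N j) (unitJet N ℓ α) :=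
  (h.hasDerivAt hW ℓ α hj).deriv

theorem IsTruncated.mono (h : IsTruncated W N f g) {M : ℕ} (hNM : N ≤ M) : IsTruncated W M f fun y =>
      g fun m => y (Fin.castLE (by omega) m) := by
  constructor
  · intro y hy
    have h1 : AnalyticAt ℂ (fun y : Fin (M + 2) → ℂ^n =>
        fun m : Fin (N + 2) => y (Fin.castLE (by omega) m)) y :=
      (ContinuousLinearMap.pi fun m : Fin (N + 2) => (ContinuousLinearMap.proj (R := ℂ)
        (φ := fun _ : Fin (M + 2) => ℂ^n) (Fin.castLE (by omega) m))).analyticAt y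
    exact (h.analytic _ hy).comp h1
  · intro j hj
    rw [h.eq j hj]; rfl

theorem IsTruncated.add {g' : (Fin (N + 2) → ℂ^n) → ℂ}
    (h : IsTruncated W N f g) (h' : IsTruncated W N f' g') :
    IsTruncated W N (f + f') (g + g') :=
  ⟨h.analytic.add h'.analytic, fun j hj => by rw [Pi.add_apply, h.eq j hj, h'.eq j hj]; rfl⟩

theorem IsTruncated.mul {g' : (Fin (N + 2) → ℂ^n) → ℂ}
    (h : IsTruncated W N f g) (h' : IsTruncated W N f' g') :
    IsTruncated W N (f * f') (g * g') :=
  ⟨h.analytic.mul h'.analytic, fun j hj => by rw [Pi.mul_apply, h.eq j hj, h'.eq j hj]; rfl⟩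

theorem isTruncated_const (c : ℂ) (N : ℕ) : IsTruncated W N (fun _ => c) fun _ => c :=
  ⟨analyticOnNhd_const, fun _ _ => rfl⟩

theorem IsTruncated.jetPartial (hW : IsOpen W) (h : IsTruncated W N f g) (ℓ : ℕ) (α : Fin n) :
    IsTruncated W N (jetPartial ℓ α f) fun y => fderiv ℂ g y (unitJet N ℓ α) :=
  ⟨fun y hy => ((ContinuousLinearMap.apply ℂ ℂ (unitJet N ℓ α)).analyticAt _).comp (h.analytic.fderiv y hy),
    fun _ hj => h.jetPartial_eq hW ℓ α hj⟩

/-- Two densities that agree over `W` have the same common truncation. -/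
theorem IsTruncated.congr (h : IsTruncated W N f g) (hf : ∀ j ∈ jetsOver₁ W, f' j = f j) : IsTruncated W N f' g :=
  ⟨h.analytic, fun j hj => (hf j hj).trans (h.eq j hj)⟩

end Truncation

section JetFunctions

/-- The extension by zero of a function on the jets over `W`. -/
def extendJet (a : jetsOver₁ W → ℂ) : Density n :=
  open Classical in fun j => if h : j ∈ jetsOver₁ W then a ⟨j, h⟩ else 0

theorem extendJet_apply (a : jetsOver₁ W → ℂ) (j : jetsOver₁ W) : extendJet a j = a j := by
  simp [extendJet]

/-- The algebra of the functions on the jets over `W` that depend on finitely many jet variables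
and are holomorphic in these. -/
def jetFunctions (W : Set (ℂ^n × ℂ^n)) : Subalgebra ℂ (jetsOver₁ W → ℂ) where
  carrier := {a | ∃ N g, IsTruncated W N (extendJet a) g}
  mul_mem' := by
    rintro a b ⟨N, g, hg⟩ ⟨M, k, hk⟩
    refine ⟨max N M, _, ((hg.mono (le_max_left N M)).mul (hk.mono (le_max_right N M))).congr ?_⟩
    intro j hj
    simp [extendJet, hj]
  add_mem' := by
    rintro a b ⟨N, g, hg⟩ ⟨M, k, hk⟩
    refine ⟨max N M, _, ((hg.mono (le_max_left N M)).add (hk.mono (le_max_right N M))).congr ?_⟩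
    intro j hj
    simp [extendJet, hj]
  algebraMap_mem' c := ⟨0, _, (isTruncated_const c 0).congr fun j hj => by simp [extendJet, hj]⟩

theorem exists_isTruncated₂ (a b : jetFunctions W) : ∃ N g k,
    IsTruncated W N (extendJet a.1) g ∧ IsTruncated W N (extendJet b.1) k := by
  obtain ⟨N, g, hg⟩ := a.2
  obtain ⟨M, k, hk⟩ := b.2
  exact ⟨max N M, _, _, hg.mono (le_max_left N M), hk.mono (le_max_right N M)⟩

theorem jetFunctions_ext {a b : jetFunctions W} (h : ∀ j : jetsOver₁ W, a.1 j = b.1 j) : a = b :=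
  Subtype.ext (funext h)

/-- The density `f` agrees over `W` with the element `a` of the jet algebra. -/
def Represents (a : jetFunctions W) (f : Density n) : Prop := ∀ j : jetsOver₁ W, f j = a.1 j

theorem represents_extendJet (a : jetFunctions W) : Represents a (extendJet a.1) :=
  fun j => extendJet_apply _ j

theorem IsTruncated.represents (h : IsTruncated W N f g) : ∃ a : jetFunctions W, Represents a f :=
  ⟨⟨fun j => f j, N, g, h.congr fun j hj => by simp [extendJet, hj]⟩, fun _ => rfl⟩

theorem Represents.isTruncated {a : jetFunctions W} (h : Represents a f) (hg : IsTruncated W N (extendJet a.1) g) :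
    IsTruncated W N f g :=
  hg.congr fun j hj => (h ⟨j, hj⟩).trans (extendJet_apply a.1 ⟨j, hj⟩).symm

theorem Represents.unique {a b : jetFunctions W} (ha : Represents a f)
    (hb : Represents b f) : a = b := jetFunctions_ext fun j => (ha j).symm.trans (hb j)

theorem Represents.add {a b : jetFunctions W} {g : Density n} (ha : Represents a f)
    (hb : Represents b g) : Represents (a + b) (f + g) :=
  fun j => by rw [Pi.add_apply, ha j, hb j]; rfl

theorem Represents.smul {a : jetFunctions W} (ha : Represents a f) (c : ℂ) :
    Represents (c • a) (c • f) := fun j => by rw [Pi.smul_apply, ha j]; rfl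

theorem represents_zero : Represents (0 : jetFunctions W) 0 := fun _ => rfl

/-- The derivation `∂ / ∂ v^α_ℓ` of the jet algebra. -/
def jetDerivation (hW : IsOpen W) (ℓ : ℕ) (α : Fin n) :
    Derivation ℂ (jetFunctions W) (jetFunctions W) := Derivation.mk'
  { toFun := fun a => ⟨fun j => jetPartial ℓ α (extendJet a.1) j, by
      obtain ⟨N, g, hg⟩ := a.2
      exact ⟨N, _, (hg.jetPartial hW ℓ α).congr fun j hj => by simp [extendJet, hj]⟩⟩
    map_add' := fun a b => jetFunctions_ext fun j => by
      obtain ⟨N, g, k, hg, hk⟩ := exists_isTruncated₂ a b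
      have hs : IsTruncated W N (extendJet (a + b).1) (g + k) := (hg.add hk).congr fun j hj => by
        simp [extendJet, hj]
      have hm := truncate_mem (N := N).mpr j.2
      change jetPartial ℓ α (extendJet (a + b).1) j = jetPartial ℓ α (extendJet a.1) j +
        jetPartial ℓ α (extendJet b.1) j
      rw [hs.jetPartial_eq hW ℓ α j.2, hg.jetPartial_eq hW ℓ α j.2, hk.jetPartial_eq hW ℓ α j.2,
        fderiv_add (hg.analytic _ hm).differentiableAt (hk.analytic _ hm).differentiableAt]
      rfl
    map_smul' := fun c a => jetFunctions_ext fun j => by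
      obtain ⟨N, g, hg⟩ := a.2
      have hs : IsTruncated W N (extendJet (c • a).1) (c • g) :=
        ⟨fun y hy => (hg.analytic y hy).const_smul, fun j hj => by
          have := hg.eq j hj
          simp only [extendJet, hj, dif_pos] at this ⊢
          rw [Pi.smul_apply, ← this]; rfl⟩
      have hm := truncate_mem (N := N).mpr j.2
      change jetPartial ℓ α (extendJet (c • a).1) j = c • jetPartial ℓ α (extendJet a.1) j
      rw [hs.jetPartial_eq hW ℓ α j.2, hg.jetPartial_eq hW ℓ α j.2,
        fderiv_const_smul (hg.analytic _ hm).differentiableAt]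
      rfl }
  (fun a b => jetFunctions_ext fun j => by
      obtain ⟨N, g, k, hg, hk⟩ := exists_isTruncated₂ a b
      have hs : IsTruncated W N (extendJet (a * b).1) (g * k) := (hg.mul hk).congr fun j hj => by
        simp [extendJet, hj]
      have hm := truncate_mem (N := N).mpr j.2
      change jetPartial ℓ α (extendJet (a * b).1) j = a.1 j * jetPartial ℓ α (extendJet b.1) j +
        b.1 j * jetPartial ℓ α (extendJet a.1) j
      rw [hs.jetPartial_eq hW ℓ α j.2, hg.jetPartial_eq hW ℓ α j.2, hk.jetPartial_eq hW ℓ α j.2,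
        fderiv_mul (hg.analytic _ hm).differentiableAt (hk.analytic _ hm).differentiableAt,
        ← extendJet_apply a.1, ← extendJet_apply b.1, hg.eq j j.2, hk.eq j j.2]
      rfl)

theorem jetDerivation_apply (hW : IsOpen W) (ℓ : ℕ) (α : Fin n) (a : jetFunctions W)
    (j : jetsOver₁ W) : (jetDerivation hW ℓ α a).1 j = jetPartial ℓ α (extendJet a.1) j := rfl

theorem Represents.jetPartial (hW : IsOpen W) {a : jetFunctions W} (h : Represents a f) (ℓ : ℕ) (α : Fin n) :
    Represents (jetDerivation hW ℓ α a) (jetPartial ℓ α f) := fun j => by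
  obtain ⟨N, g, hg⟩ := a.2
  rw [jetDerivation_apply, hg.jetPartial_eq hW ℓ α j.2, (h.isTruncated hg).jetPartial_eq hW ℓ α j.2]

theorem unitJet_eq_zero {ℓ : ℕ} (h : N + 2 ≤ ℓ) (α : Fin n) : unitJet N ℓ α = 0 := by
  ext m β
  have := m.2
  simp only [unitJet, Pi.zero_apply]
  rw [if_neg (by omega)]

theorem isTruncated_coord (ℓ : ℕ) (α : Fin n) :
    IsTruncated W ℓ (fun j => j ℓ α) fun y => y ⟨ℓ, by omega⟩ α :=
  ⟨fun y _ => ((ContinuousLinearMap.proj (R := ℂ) (φ := fun _ : Fin n => ℂ) α).comp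
    (ContinuousLinearMap.proj (R := ℂ) (φ := fun _ : Fin (ℓ + 2) => ℂ^n)
      ⟨ℓ, by omega⟩)).analyticAt y, fun _ _ => rfl⟩

/-- The jet variable `v^α_ℓ`. -/
def jetCoord (W : Set (ℂ^n × ℂ^n)) (ℓ : ℕ) (α : Fin n) : jetFunctions W :=
  (isTruncated_coord (W := W) ℓ α).represents.choose

theorem represents_jetCoord (ℓ : ℕ) (α : Fin n) : Represents (jetCoord W ℓ α) fun j => j ℓ α :=
  (isTruncated_coord (W := W) ℓ α).represents.choose_spec

/-- The jet algebra of the open set `W` of pairs `(v, v_x)`. -/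
def jetAlgebra (hW : IsOpen W) : JetAlgebra n (jetFunctions W) where
  x := jetCoord W
  d := jetDerivation hW
  d_x k β ℓ α := jetFunctions_ext fun j => by
    rw [← (represents_jetCoord k β).jetPartial hW ℓ α j,
      (isTruncated_coord k β).jetPartial_eq hW ℓ α j.2]
    set L := (ContinuousLinearMap.proj (R := ℂ) (φ := fun _ : Fin n => ℂ) β).comp
      (ContinuousLinearMap.proj (R := ℂ) (φ := fun _ : Fin (k + 2) => ℂ^n)
      ⟨k, by omega⟩) with hL
    change fderiv ℂ L _ _ = _
    rw [L.fderiv]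
    simp only [hL, ContinuousLinearMap.comp_apply, ContinuousLinearMap.proj_apply, unitJet]
    split_ifs <;> rfl
  d_comm k β ℓ α a := jetFunctions_ext fun j => by
    obtain ⟨N, g, hg⟩ := a.2
    have ha := represents_extendJet a
    rw [← ((ha.jetPartial hW ℓ α).jetPartial hW k β) j,
      ← ((ha.jetPartial hW k β).jetPartial hW ℓ α) j,
      (hg.jetPartial hW ℓ α).jetPartial_eq hW k β j.2,
      (hg.jetPartial hW k β).jetPartial_eq hW ℓ α j.2]
    have hm := truncate_mem (N := N).mpr j.2
    have h1 : DifferentiableAt ℂ (fderiv ℂ g) (truncate N j) :=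
      (hg.analytic.fderiv _ hm).differentiableAt
    have h2 : IsSymmSndFDerivAt ℂ g (truncate N j) :=
      (hg.analytic _ hm).contDiffAt.isSymmSndFDerivAt (n := ⊤) (by simp)
    have h3 : ∀ u w, fderiv ℂ (fun y => fderiv ℂ g y u) (truncate N j) w =
        fderiv ℂ (fderiv ℂ g) (truncate N j) w u := fun u w => by
      rw [fderiv_clm_apply h1 (differentiableAt_const u)]
      simp
    rw [h3, h3]; exact h2 _ _
  finite_order a := by
    obtain ⟨N, g, hg⟩ := a.2
    refine ⟨N + 2, fun ℓ hℓ α => jetFunctions_ext fun j => ?_⟩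
    rw [jetDerivation_apply, hg.jetPartial_eq hW ℓ α j.2, unitJet_eq_zero hℓ, map_zero]
    rfl

end JetFunctions

end

section

variable {a b : jetFunctions W} {f g : Density n} {D : Set (Jet n)}

/-! ### Densities as jet functions -/

section Bridge

open JetAlgebra

theorem Represents.sub (ha : Represents a f) (hb : Represents b g) : Represents (a - b) (f - g) :=
  fun j => by rw [Pi.sub_apply, ha j, hb j]; rfl

theorem represents_algebraMap (c : ℂ) :
    Represents (algebraMap ℂ (jetFunctions W) c) fun _ => c := fun _ => rfl

theorem Represents.congr (ha : Represents a f)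
    (h : ∀ j ∈ jetsOver₁ W, g j = f j) : Represents a g := fun j => (h j j.2).trans (ha j)

/-- Evaluation at a jet. -/
def evalJet (j : jetsOver₁ W) : jetFunctions W →ₐ[ℂ] ℂ :=
  (Pi.evalAlgHom ℂ (fun _ : jetsOver₁ W => ℂ) j).comp (jetFunctions W).val

theorem Represents.evalJet (ha : Represents a f)
    (j : jetsOver₁ W) : evalJet j a = f j := (ha j).symm

theorem represents_iff : Represents a f ↔ ∀ j : jetsOver₁ W, HamPDE.evalJet j a = f j :=
  forall_congr' fun _ => eq_comm

theorem evalJet_ext (h : ∀ j : jetsOver₁ W, evalJet j a = evalJet j b) : a = b := jetFunctions_ext h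

theorem Represents.d (hW : IsOpen W) (ha : Represents a f)
    (ℓ : ℕ) (α : Fin n) : Represents ((jetAlgebra hW).d ℓ α a) (HamPDE.jetPartial ℓ α f) :=
  ha.jetPartial hW ℓ α

theorem Represents.hasDerivAt (hW : IsOpen W) (ha : Represents a f) (ℓ : ℕ) (α : Fin n) (j : jetsOver₁ W) :
    HasDerivAt (fun z : ℂ => f (Function.update j.1 ℓ (Function.update (j.1 ℓ) α z)))
      (HamPDE.evalJet j ((jetAlgebra hW).d ℓ α a)) (j.1 ℓ α) := by
  obtain ⟨N, g, hg⟩ := a.2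
  have h := (ha.isTruncated hg).hasDerivAt hW ℓ α j.2
  rwa [← (ha.isTruncated hg).jetPartial_eq hW ℓ α j.2, ← (ha.d hW ℓ α).evalJet j] at h

theorem Represents.vf (hW : IsOpen W) (ha : Represents a f)
    {Y : ℕ → Fin n → jetFunctions W} {y : ℕ → Fin n → Density n}
    (hY : ∀ ℓ α, Represents (Y ℓ α) (y ℓ α)) : Represents ((jetAlgebra hW).vf Y a)
      fun j => ∑ᶠ ℓ : ℕ, ∑ α, y ℓ α j * HamPDE.jetPartial ℓ α f j := by
  obtain ⟨N, hN⟩ := (jetAlgebra hW).finite_ord a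
  rw [represents_iff]; intro j
  rw [vf_eq_sum' _ hN, map_sum]
  have h1 : ∀ ℓ α, HamPDE.jetPartial ℓ α f j = HamPDE.evalJet j ((jetAlgebra hW).d ℓ α a) := fun ℓ α =>
    ha.d hW ℓ α j
  rw [finsum_eq_sum_range (N := N)]
  · refine sum_ext fun ℓ => ?_
    rw [map_sum]
    exact sum_ext fun α => by rw [map_mul, h1, (hY ℓ α).evalJet]
  · intro ℓ hℓ
    exact sum_eq_zero fun α _ => by rw [h1, hN ℓ hℓ, map_zero, mul_zero]

theorem Represents.totalDeriv (hW : IsOpen W) (ha : Represents a f) : Represents ((jetAlgebra hW).D a) (totalDeriv f) :=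
  ha.vf hW fun ℓ α => represents_jetCoord (ℓ + 1) α

theorem Represents.totalDeriv_iterate (hW : IsOpen W) (ha : Represents a f) (ℓ : ℕ) :
    Represents ((jetAlgebra hW).D^[ℓ] a) (HamPDE.totalDeriv^[ℓ] f) := by
  induction ℓ with
  | zero => exact ha
  | succ ℓ ih =>
    rw [Function.iterate_succ_apply', Function.iterate_succ_apply']
    exact ih.totalDeriv hW

theorem Represents.varDeriv (hW : IsOpen W) (ha : Represents a f) (β : Fin n) : Represents ((jetAlgebra hW).δ β a) (varDeriv β f) := by
  obtain ⟨N, hN⟩ := (jetAlgebra hW).finite_ord a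
  have h1 : ∀ ℓ, Represents ((jetAlgebra hW).D^[ℓ] ((jetAlgebra hW).d ℓ β a))
      (HamPDE.totalDeriv^[ℓ] (HamPDE.jetPartial ℓ β f)) := fun ℓ =>
    (ha.d hW ℓ β).totalDeriv_iterate hW ℓ
  rw [represents_iff]; intro j
  rw [δ_eq_sum β hN, map_sum, HamPDE.varDeriv, finsum_eq_sum_range (N := N)]
  · refine sum_ext fun ℓ => ?_
    rw [map_mul, (h1 ℓ).evalJet, map_pow, map_neg, map_one]
  · intro ℓ hℓ
    rw [← (h1 ℓ).evalJet j, hN ℓ hℓ, D_iterate_zero, map_zero, mul_zero]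

theorem Represents.bracket (hW : IsOpen W) (η : Matrix (Fin n) (Fin n) ℂ) (ha : Represents a f) (hb : Represents b g) :
    Represents ((jetAlgebra hW).br η a b) (bracket η f g) := by
  rw [represents_iff]; intro j
  simp only [br, ham, map_sum, mul_sum, HamPDE.bracket, map_mul]
  refine sum_ext₂ fun α β => ?_
  rw [(ha.varDeriv hW α).evalJet, ((hb.varDeriv hW β).totalDeriv hW).evalJet,
    (represents_algebraMap _).evalJet, mul_assoc]

/-- Two densities define the same functional over `W` if their difference is null. -/
theorem eqFunctionalOn_iff (hW : IsOpen W) (ha : Represents a f) (hb : Represents b g) :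
    EqFunctionalOn (jetsOver₁ W) f g ↔ a - b ∈ (jetAlgebra hW).null := by
  rw [mem_null]
  constructor
  · intro h β
    rw [map_sub, sub_eq_zero]
    refine jetFunctions_ext fun j => ?_
    rw [← ha.varDeriv hW β j, ← hb.varDeriv hW β j]
    exact h j j.2 β
  · intro h j hj β
    have := h β
    rw [map_sub, sub_eq_zero] at this
    rw [ha.varDeriv hW β ⟨j, hj⟩, hb.varDeriv hW β ⟨j, hj⟩, this]

theorem eqFunctionalOn_zero_iff (hW : IsOpen W) (ha : Represents a f) : EqFunctionalOn (jetsOver₁ W) f 0 ↔ a ∈ (jetAlgebra hW).null := by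
  rw [eqFunctionalOn_iff hW ha represents_zero, sub_zero]

theorem Represents.eqFunctionalOn (ha : Represents a f) (hW : IsOpen W)
    (h : ∀ j ∈ jetsOver₁ W, g j = f j) : EqFunctionalOn (jetsOver₁ W) f g :=
  (eqFunctionalOn_iff hW ha (ha.congr h)).mpr (by simp)

theorem eqFunctionalOn_add_right_iff {c : jetFunctions W} {k : Density n} (hW : IsOpen W)
    (ha : Represents a f) (hb : Represents b g) (hc : Represents c k) :
    EqFunctionalOn (jetsOver₁ W) (f + k) (g + k) ↔ EqFunctionalOn (jetsOver₁ W) f g := by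
  rw [eqFunctionalOn_iff hW (ha.add hc) (hb.add hc), eqFunctionalOn_iff hW ha hb,
    add_sub_add_right_eq_sub]

theorem Represents.eqFunctionalOn_bracket {c : jetFunctions W} {k : Density n} (hc : Represents c k)
    (hW : IsOpen W) (η : Matrix (Fin n) (Fin n) ℂ) (ha : Represents a f) (hb : Represents b g)
    (h : EqFunctionalOn (jetsOver₁ W) f g) :
    EqFunctionalOn (jetsOver₁ W) (HamPDE.bracket η k f) (HamPDE.bracket η k g) := by
  rw [eqFunctionalOn_iff hW (hc.bracket hW η ha) (hc.bracket hW η hb)]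
  rw [br_congr (show c - c ∈ (jetAlgebra hW).null by simp) ((eqFunctionalOn_iff hW ha hb).mp h),
    sub_self]
  exact zero_mem _

/-- The homogeneity condition on a first order generator. -/
theorem homogeneous_iff (hW : IsOpen W) (ha : Represents a f) :
    (∀ j ∈ jetsOver₁ W, ∀ β,
      ∑ᶠ r : ℕ, ∑ α, (r : ℂ) * j r α * jetPartial r α (varDeriv β f) j = varDeriv β f j) ↔
    ∀ β, (jetAlgebra hW).euler ((jetAlgebra hW).δ β a) = (jetAlgebra hW).δ β a := by
  have h1 : ∀ β, Represents ((jetAlgebra hW).euler ((jetAlgebra hW).δ β a)) fun j =>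
      ∑ᶠ r : ℕ, ∑ α, (r : ℂ) * j r α * jetPartial r α (varDeriv β f) j := fun β =>
    (ha.varDeriv hW β).vf hW (y := fun r α j => (r : ℂ) * j r α) fun r α => by
      rw [represents_iff]; intro j
      rw [map_mul, map_natCast]
      congr 1
      exact (represents_jetCoord r α).evalJet j
  constructor
  · intro h β
    exact jetFunctions_ext fun j => by rw [← h1 β j, ← ha.varDeriv hW β j]; exact h j j.2 β
  · intro h j hj β
    have h2 := h1 β ⟨j, hj⟩
    rw [h β, ← ha.varDeriv hW β ⟨j, hj⟩] at h2
    exact h2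

theorem jetsOver_eq (V : Set ℂ^n) : jetsOver V = jetsOver₁ (V ×ˢ Set.univ) := by
  ext j; simp [jetsOver, jetsOver₁]

theorem EqFunctionalOn.mono {D' : Set (Jet n)} (h : EqFunctionalOn D f g)
    (hD : D' ⊆ D) : EqFunctionalOn D' f g := fun j hj => h j (hD hj)

theorem EqFunctionalOn.symm (h : EqFunctionalOn D f g) :
    EqFunctionalOn D g f := fun j hj β => (h j hj β).symm

theorem EqFunctionalOn.trans {k : Density n} (h : EqFunctionalOn D f g)
    (h' : EqFunctionalOn D g k) : EqFunctionalOn D f k :=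
  fun j hj β => (h j hj β).trans (h' j hj β)

open Classical in
/-- The element of the jet algebra that represents a density, if there is one. -/
def toJet (W : Set (ℂ^n × ℂ^n)) (f : Density n) : jetFunctions W :=
  if h : ∃ a : jetFunctions W, Represents a f then h.choose else 0

theorem Represents.toJet_eq (h : Represents a f) : toJet W f = a := by
  have h' : ∃ a : jetFunctions W, Represents a f := ⟨a, h⟩
  rw [toJet, dif_pos h']
  exact h'.choose_spec.unique h

theorem Represents.toJet (h : Represents a f) :
    Represents (toJet W f) f := by rw [h.toJet_eq]; exact h

/-- A function of `v`, as an element of the jet algebra. -/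
abbrev ofBase (W : Set (ℂ^n × ℂ^n)) (f : ℂ^n → ℂ) : jetFunctions W := toJet W (lift₀ f)

/-- A function of `(v, v_x)`, as an element of the jet algebra. -/
abbrev ofPair (W : Set (ℂ^n × ℂ^n)) (k : ℂ^n × ℂ^n → ℂ) : jetFunctions W := toJet W (lift₁ k)

theorem represents_ofPair {k : ℂ^n × ℂ^n → ℂ} (hk : Holo k W) :
    Represents (ofPair W k) (lift₁ k) := by
  have h : IsTruncated W 0 (lift₁ k) fun y => k (y 0, y 1) := by
    refine ⟨fun y hy => ?_, fun j _ => rfl⟩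
    have h1 : AnalyticAt ℂ (fun y : Fin 2 → ℂ^n => (y 0, y 1)) y :=
      ((ContinuousLinearMap.proj (R := ℂ) (φ := fun _ : Fin 2 => ℂ^n) 0).prod
        (ContinuousLinearMap.proj (R := ℂ) (φ := fun _ : Fin 2 => ℂ^n) 1)).analyticAt y
    exact AnalyticAt.comp (f := fun y : Fin 2 → ℂ^n => (y 0, y 1)) (hk _ hy) h1
  exact h.represents.choose_spec.toJet

theorem analytic_base {f : ℂ^n → ℂ} (hf : Holo f (π W)) :
    Holo (fun w : ℂ^n × ℂ^n => f w.1) W := fun w hw =>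
  (hf w.1 ⟨w, hw, rfl⟩).comp analyticAt_fst

theorem represents_ofBase {f : ℂ^n → ℂ} (hf : Holo f (π W)) :
    Represents (ofBase W f) (lift₀ f) := represents_ofPair (analytic_base hf)

theorem evalJet_ofBase {f : ℂ^n → ℂ} (hf : Holo f (π W))
    (j : jetsOver₁ W) : evalJet j (ofBase W f) = f (j.1 0) := (represents_ofBase hf).evalJet j

theorem jetsOver₁_base {j : Jet n} (hj : j ∈ jetsOver₁ W) : j 0 ∈ π W := ⟨_, hj, rfl⟩

theorem jetPartial_lift₁ {k : ℂ^n × ℂ^n → ℂ} {ℓ : ℕ} (hℓ : 2 ≤ ℓ) (α : Fin n) :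
    jetPartial ℓ α (lift₁ k) = 0 := by
  funext j
  simp [jetPartial, lift₁, show (0 : ℕ) ≠ ℓ by omega,
    show (1 : ℕ) ≠ ℓ by omega]

theorem jetPartial_lift₀ {f : ℂ^n → ℂ} {ℓ : ℕ} (hℓ : 1 ≤ ℓ) (α : Fin n) :
    jetPartial ℓ α (lift₀ f) = 0 := by
  funext j
  simp [jetPartial, lift₀, show (0 : ℕ) ≠ ℓ by omega]

theorem jetPartial_zero_lift₀ {f : ℂ^n → ℂ} (α : Fin n) {j : Jet n}
    (hf : DifferentiableAt ℂ f (j 0)) : jetPartial 0 α (lift₀ f) j = pd α f (j 0) := by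
  have h1 : HasDerivAt (fun z : ℂ => Function.update (j 0) α z) (Pi.single α 1) (j 0 α) :=
    hasDerivAt_update _ _ _
  have h2 : HasFDerivAt f (fderiv ℂ f (j 0)) (Function.update (j 0) α (j 0 α)) := by
    rw [Function.update_eq_self]; exact hf.hasFDerivAt
  have h3 := (h2.comp_hasDerivAt _ h1).deriv
  rw [pd, ← h3, jetPartial]
  simp only [lift₀, Function.update_self]
  rfl

theorem ord_ofPair (hW : IsOpen W) {k : ℂ^n × ℂ^n → ℂ}
    (hk : Holo k W) : (jetAlgebra hW).OrdLT 2 (ofPair W k) := fun ℓ hℓ α =>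
  jetFunctions_ext fun j => by rw [← ((represents_ofPair hk).d hW ℓ α j), jetPartial_lift₁ hℓ]; rfl

variable {f : ℂ^n → ℂ}

theorem ord_ofBase (hW : IsOpen W) (hf : Holo f (π W)) :
    (jetAlgebra hW).OrdLT 1 (ofBase W f) := fun ℓ hℓ α => jetFunctions_ext fun j => by
  rw [← ((represents_ofBase hf).d hW ℓ α j), jetPartial_lift₀ hℓ]; rfl

theorem isOpen_base (hW : IsOpen W) : IsOpen (π W) := isOpenMap_fst _ hW

theorem analytic_pd {s : Set ℂ^n} (hf : Holo f s) (α : Fin n) : Holo (pd α f) s := fun v hv =>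
  ((ContinuousLinearMap.apply ℂ ℂ (Pi.single α (1 : ℂ) : ℂ^n)).analyticAt _).comp
    (hf.fderiv v hv)

theorem d_zero_ofBase (hW : IsOpen W) (hf : Holo f (π W)) (α : Fin n) :
    (jetAlgebra hW).d 0 α (ofBase W f) = ofBase W (pd α f) := by
  refine jetFunctions_ext fun j => ?_
  rw [← represents_ofBase (analytic_pd hf α) j,
    ← ((represents_ofBase hf).d hW 0 α j), jetPartial_zero_lift₀]
  · rfl
  · exact (hf _ (jetsOver₁_base j.2)).differentiableAt

/-- The jet with the given `v` and `v_x`, all higher derivatives being `0`. -/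
def shortJet (w : ℂ^n × ℂ^n) : Jet n
  | 0 => w.1
  | 1 => w.2
  | _ => 0

theorem shortJet_mem : shortJet w ∈ jetsOver₁ W ↔ w ∈ W := Iff.rfl

/-- Over a product with a convex set, functions of order `0` are functions of `v`. -/
theorem exists_ofBase_eq {Q : Set ℂ^n} (hW : IsOpen (V ×ˢ Q)) (hQ : Convex ℝ Q)
    (hne : Q.Nonempty) {a : jetFunctions (V ×ˢ Q)} (ha : (jetAlgebra hW).OrdLT 1 a) :
    ∃ f : ℂ^n → ℂ, Holo f V ∧ a = ofBase (V ×ˢ Q) f := by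
  obtain ⟨q, hq⟩ := hne
  obtain ⟨N, g, hg⟩ := a.2
  have hfst : π (V ×ˢ Q) = V := Set.fst_image_prod V ⟨q, hq⟩
  set ι : ℂ^n → Fin (N + 2) → ℂ^n := fun v m =>
    if (m : ℕ) = 0 then v else if (m : ℕ) = 1 then q else 0 with hι
  have hιa : ∀ v, AnalyticAt ℂ ι v := fun v => by
    refine AnalyticAt.pi fun m => ?_
    by_cases h0 : (m : ℕ) = 0
    · simp only [h0, if_true]; exact analyticAt_id
    · by_cases h1 : (m : ℕ) = 1
      · simpa [hι, h1] using analyticAt_const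
      · simpa [hι, h0, h1] using analyticAt_const
  have hι0 : ∀ v, ι v 0 = v := fun v => by simp [hι]
  have hι1 : ∀ v, ι v 1 = q := fun v => by simp [hι]
  have hιm : ∀ v ∈ V, ι v ∈ truncSet (V ×ˢ Q) N := fun v hv => by
    change (ι v 0, ι v 1) ∈ V ×ˢ Q
    rw [hι0, hι1]; exact ⟨hv, hq⟩
  have hf : Holo (fun v => g (ι v)) V := fun v hv => (hg.analytic _ (hιm v hv)).comp (hιa v)
  refine ⟨fun v => g (ι v), hf, jetFunctions_ext fun j => ?_⟩
  rw [← represents_ofBase (by rw [hfst]; exact hf) j, ← extendJet_apply a.1 j, hg.eq j j.2]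
  change g (truncate N j) = g (ι (j.1 0))
  -- the partial derivatives of `g` in the directions of positive order vanish
  have hz : ∀ y ∈ truncSet (V ×ˢ Q) N, ∀ ℓ, 1 ≤ ℓ → ∀ α, fderiv ℂ g y (unitJet N ℓ α) = 0 := by
    intro y hy ℓ hℓ α
    set k : Jet n := fun m => if h : m < N + 2 then y ⟨m, h⟩ else 0 with hk
    have hky : truncate N k = y := by funext m; simp [truncate, hk]
    have hkm : k ∈ jetsOver₁ (V ×ˢ Q) := truncate_mem.mp (hky ▸ hy)
    have h1 := congrArg (fun b : jetFunctions (V ×ˢ Q) => b.1 ⟨k, hkm⟩) (ha ℓ hℓ α)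
    have h2 : jetPartial ℓ α (extendJet a.1) k = 0 := h1
    rwa [hg.jetPartial_eq hW ℓ α hkm, hky] at h2
  obtain ⟨hjV, hjQ⟩ := j.2
  set y₁ := truncate N j.1 with hy₁
  set y₀ := ι (j.1 0) with hy₀
  have hdir : ∀ y ∈ truncSet (V ×ˢ Q) N, fderiv ℂ g y (y₁ - y₀) = 0 := by
    intro y hy
    have : y₁ - y₀ = ∑ m : Fin (N + 2), ∑ α, (y₁ - y₀) m α • unitJet N m α := by
      funext m β
      simp only [Finset.sum_apply, Pi.smul_apply, unitJet, smul_eq_mul, mul_ite, mul_one, mul_zero]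
      rw [sum_eq_single m, sum_eq_single β]
      · simp
      · intro b _ hb; simp [hb.symm]
      · simp
      · intro b _ hb
        refine sum_eq_zero fun α _ => if_neg ?_
        rintro ⟨h, -⟩; exact hb (Fin.ext h.symm)
      · simp
    rw [this, map_sum]
    refine sum_eq_zero fun m _ => ?_
    rw [map_sum]
    refine sum_eq_zero fun α _ => ?_
    rw [map_smul]
    by_cases h0 : (m : ℕ) = 0
    · have : m = 0 := Fin.ext h0
      subst this
      have : (y₁ - y₀) 0 α = 0 := by rw [Pi.sub_apply, hy₀, hι0]; simp [hy₁, truncate]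
      rw [this, zero_smul]
    · rw [hz y hy m (Nat.one_le_iff_ne_zero.mpr h0) α, smul_zero]
  have hseg : ∀ t ∈ Set.Icc (0 : ℝ) 1, y₀ + (t : ℂ) • (y₁ - y₀) ∈ truncSet (V ×ˢ Q) N := by
    intro t ht
    refine ⟨?_, ?_⟩
    · change (y₀ + (t : ℂ) • (y₁ - y₀)) 0 ∈ V
      have : (y₀ + (t : ℂ) • (y₁ - y₀)) 0 = j.1 0 := by
        rw [Pi.add_apply, Pi.smul_apply, Pi.sub_apply, hy₀, hι0]; simp [hy₁, truncate]
      rw [this]; exact hjV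
    · change (y₀ + (t : ℂ) • (y₁ - y₀)) 1 ∈ Q
      have : (y₀ + (t : ℂ) • (y₁ - y₀)) 1 = q + t • (j.1 1 - q) := by
        rw [Pi.add_apply, Pi.smul_apply, Pi.sub_apply, hy₀, hι1]
        rfl
      rw [this]
      exact hQ.add_smul_sub_mem hq hjQ ht
  exact eq_of_fderiv_segment_eq_zero fun t ht =>
    ⟨(hg.analytic _ (hseg t ht)).differentiableAt, hdir _ (hseg t ht)⟩

end Bridge

end

section

variable {f : ℂ^n → ℂ}

/-! ### Coordinates as frames -/

section Base

open JetAlgebra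

theorem analyticAt_det {E : Type*} [NormedAddCommGroup E] [NormedSpace ℂ E] {x : E}
    {M : E → Matrix (Fin n) (Fin n) ℂ}
    (h : ∀ i j, AnalyticAt ℂ (fun y => M y i j) x) : AnalyticAt ℂ (fun y => (M y).det) x := by
  simp only [Matrix.det_apply]
  refine analyticAt_fun_sum _ fun σ _ => ?_
  have h1 : AnalyticAt ℂ (fun y => ∏ i, M y (σ i) i) x :=
    Finset.analyticAt_fun_prod _ fun i _ => h _ _
  have h2 : (fun y => Equiv.Perm.sign σ • ∏ i, M y (σ i) i) =
      fun y => ((Equiv.Perm.sign σ : ℤ) : ℂ) * ∏ i, M y (σ i) i := by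
    funext y; simp [Units.smul_def]
  rw [h2]
  exact analyticAt_const.mul h1

theorem analyticAt_inv_apply {E : Type*} [NormedAddCommGroup E] [NormedSpace ℂ E] {x : E}
    {M : E → Matrix (Fin n) (Fin n) ℂ} (h : ∀ i j, AnalyticAt ℂ (fun y => M y i j) x)
    (hx : (M x).det ≠ 0) (i j : Fin n) : AnalyticAt ℂ (fun y => (M y)⁻¹ i j) x := by
  have h1 : (fun y => (M y)⁻¹ i j) =
      fun y => (M y).det⁻¹ * ((M y).updateRow j (Pi.single i 1)).det := by
    funext y
    rw [Matrix.inv_def, Matrix.smul_apply, Matrix.adjugate_apply, smul_eq_mul, Ring.inverse_eq_inv']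
  rw [h1]
  refine ((analyticAt_det h).inv hx).mul (analyticAt_det fun k l => ?_)
  simp only [Matrix.updateRow_apply]
  split_ifs
  · exact analyticAt_const
  · exact h k l

/-- `R` is a system of local coordinates on `V`. -/
structure IsCoordinates (R : Fin n → ℂ^n → ℂ) (V : Set ℂ^n) : Prop where
  analytic : ∀ i, Holo (R i) V
  nondegenerate : ∀ v ∈ V, (jacobian R v).det ≠ 0

theorem IsCoordinates.mono (h : IsCoordinates R V) (hV : V' ⊆ V) : IsCoordinates R V' :=
  ⟨fun i => (h.analytic i).mono hV, fun v hv => h.nondegenerate v (hV hv)⟩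

theorem IsCoordinates.analytic_inv (h : IsCoordinates R V) (α i : Fin n) :
    Holo (fun v => (jacobian R v)⁻¹ α i) V := fun v hv =>
  analyticAt_inv_apply (fun i α => analytic_pd (h.analytic i) α v hv) (h.nondegenerate v hv) α i

theorem IsCoordinates.analytic_pdR (h : IsCoordinates R V) (i : Fin n) (hf : Holo f V) : Holo (pdR R i f) V := fun v hv =>
  analyticAt_fun_sum _ fun α _ => (h.analytic_inv α i v hv).mul (analytic_pd hf α v hv)

theorem IsCoordinates.jacobian_mul_inv (h : IsCoordinates R V) (hv : v ∈ V) :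
    jacobian R v * (jacobian R v)⁻¹ = 1 :=
  Matrix.mul_nonsing_inv _ (isUnit_iff_ne_zero.mpr (h.nondegenerate v hv))

theorem IsCoordinates.inv_mul_jacobian (h : IsCoordinates R V) (hv : v ∈ V) :
    (jacobian R v)⁻¹ * jacobian R v = 1 :=
  Matrix.nonsing_inv_mul _ (isUnit_iff_ne_zero.mpr (h.nondegenerate v hv))

/-- The frame of the jet algebra over `W` given by local coordinates. -/
def frame (hW : IsOpen W) (h : IsCoordinates R (π W)) : Frame (jetAlgebra hW) where
  R i := ofBase W (R i)
  W i α := ofBase W fun v => (jacobian R v)⁻¹ α i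
  ord_R i := ord_ofBase hW (h.analytic i)
  ord_W i α := ord_ofBase hW (h.analytic_inv α i)
  W_R i j := evalJet_ext fun w => by
    have hv := jetsOver₁_base w.2
    have h1 := congrFun (congrFun (h.jacobian_mul_inv hv) j) i
    rw [Matrix.mul_apply, Matrix.one_apply] at h1
    simp only [map_sum, map_mul, d_zero_ofBase hW (h.analytic j),
      evalJet_ofBase (h.analytic_inv _ _), evalJet_ofBase (analytic_pd (h.analytic j) _)]
    rw [apply_ite (evalJet w), map_one, map_zero]
    simp only [jacobian, Matrix.of_apply] at h1 ⊢
    simp only [mul_comm, eq_comm (a := i)] at h1 ⊢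
    exact h1
  R_W α β := evalJet_ext fun w => by
    have hv := jetsOver₁_base w.2
    have h1 := congrFun (congrFun (h.inv_mul_jacobian hv) β) α
    rw [Matrix.mul_apply, Matrix.one_apply] at h1
    simp only [map_sum, map_mul, d_zero_ofBase hW (h.analytic _),
      evalJet_ofBase (h.analytic_inv _ _), evalJet_ofBase (analytic_pd (h.analytic _) _)]
    rw [apply_ite (evalJet w), map_one, map_zero]
    simp only [jacobian, Matrix.of_apply] at h1 ⊢
    simp only [mul_comm, eq_comm (a := α)] at h1 ⊢
    exact h1

theorem ofBase_inj {g : ℂ^n → ℂ} (hf : Holo f (π W)) (hg : Holo g (π W)) :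
    ofBase W f = ofBase W g ↔ ∀ v ∈ π W, f v = g v := by
  constructor
  · rintro h _ ⟨w, hw, rfl⟩
    have h1 := congrArg (evalJet ⟨shortJet w, shortJet_mem.mpr hw⟩) h
    rwa [evalJet_ofBase hf, evalJet_ofBase hg] at h1
  · intro h
    exact evalJet_ext fun w => by
      rw [evalJet_ofBase hf, evalJet_ofBase hg, h _ (jetsOver₁_base w.2)]

theorem ofBase_congr {g : ℂ^n → ℂ} (hf : Holo f (π W))
    (hg : Holo g (π W)) (h : ∀ v ∈ π W, f v = g v) :
    ofBase W f = ofBase W g := (ofBase_inj hf hg).mpr h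

theorem frame_E_ofBase (hW : IsOpen W) (h : IsCoordinates R (π W)) (i : Fin n) (hf : Holo f (π W)) :
    (frame hW h).E i (ofBase W f) = ofBase W (pdR R i f) := evalJet_ext fun w => by
  rw [Frame.E_apply, map_sum, evalJet_ofBase (h.analytic_pdR i hf), pdR]
  refine sum_ext fun α => ?_
  rw [map_mul, d_zero_ofBase hW hf, evalJet_ofBase (analytic_pd hf α)]
  congr 1
  exact evalJet_ofBase (h.analytic_inv α i) w

theorem evalJet_p (hW : IsOpen W) (h : IsCoordinates R (π W)) (i : Fin n)
    (w : jetsOver₁ W) : evalJet w ((frame hW h).p i) = Rx R i (w.1 0, w.1 1) := by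
  have h1 : (frame hW h).p i = _ := vf_ordLT_one _ ((frame hW h).ord_R i)
  rw [h1, map_sum, Rx]
  refine sum_ext fun α => ?_
  have h2 : (jetAlgebra hW).d 0 α ((frame hW h).R i) = ofBase W (pd α (R i)) :=
    d_zero_ofBase hW (h.analytic i) α
  rw [map_mul, h2, evalJet_ofBase (analytic_pd (h.analytic i) α), mul_comm]
  congr 1
  exact (represents_jetCoord 1 α).evalJet w

theorem analytic_Rx (h : IsCoordinates R (π W)) (i : Fin n) : Holo (Rx R i) W := fun w hw =>
  analyticAt_fun_sum _ fun α _ => (analytic_base (analytic_pd (h.analytic i) α) w hw).mul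
    (((ContinuousLinearMap.proj (R := ℂ) (φ := fun _ : Fin n => ℂ) α).comp
      (ContinuousLinearMap.snd ℂ ℂ^n ℂ^n)).analyticAt w)

theorem frame_p_eq (hW : IsOpen W) (h : IsCoordinates R (π W)) (i : Fin n) :
    (frame hW h).p i = ofPair W (Rx R i) := evalJet_ext fun w => by
  rw [evalJet_p, (represents_ofPair (analytic_Rx h i)).evalJet]; rfl

/-- A holomorphic Hamiltonian `h₀` whose flow is diagonal in the coordinates `R_i`, with pairwise
distinct velocities. -/
structure IsDiagonal (η : Matrix (Fin n) (Fin n) ℂ) (h₀ : ℂ^n → ℂ)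
    (R lam : Fin n → ℂ^n → ℂ) (V : Set ℂ^n) : Prop where
  riemann : IsRiemannInvariants η h₀ V R lam
  analytic : Holo h₀ V

/-- `μ` are the velocities, in the coordinates `R_i`, of the flow with Hamiltonian `∫ f dx`. -/
structure HasVelocities (η : Matrix (Fin n) (Fin n) ℂ) (R : Fin n → ℂ^n → ℂ)
    (V : Set ℂ^n) (f : ℂ^n → ℂ) (μ : Fin n → ℂ^n → ℂ) : Prop where
  analytic : ∀ i, Holo (μ i) V
  eq : ∀ v ∈ V, ∀ i β, ∑ α, raisedHessian η f v α β * pd α (R i) v = μ i v * pd β (R i) v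

theorem HasVelocities.mono {μ : Fin n → ℂ^n → ℂ}
    (h : HasVelocities η R V f μ) (hV : V' ⊆ V) : HasVelocities η R V' f μ :=
  ⟨fun i => (h.analytic i).mono hV, fun v hv => h.eq v (hV hv)⟩

namespace IsDiagonal

theorem mono (h : IsDiagonal η h₀ R lam V) (hV : V' ⊆ V) : IsDiagonal η h₀ R lam V' :=
  ⟨⟨fun i => (h.riemann.analytic i).mono hV, fun v hv => h.riemann.nondegenerate v (hV hv),
    fun v hv => h.riemann.diagonal v (hV hv), fun v hv => h.riemann.distinct v (hV hv)⟩,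
    h.analytic.mono hV⟩

theorem coordinates (h : IsDiagonal η h₀ R lam V) : IsCoordinates R V :=
  ⟨h.riemann.analytic, h.riemann.nondegenerate⟩

theorem analytic_lam (h : IsDiagonal η h₀ R lam V) (hV : IsOpen V) (i : Fin n) :
    Holo (lam i) V := by
  have hc := h.coordinates
  have h1 : Holo (fun v => ∑ β, (∑ α, raisedHessian η h₀ v α β * pd α (R i) v) *
      (jacobian R v)⁻¹ β i) V := fun v hv => by
    refine analyticAt_fun_sum _ fun β _ => (analyticAt_fun_sum _ fun α _ => ?_).mul
      (hc.analytic_inv β i v hv)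
    refine AnalyticAt.mul ?_ (analytic_pd (hc.analytic i) α v hv)
    simp only [raisedHessian, Matrix.mul_apply, Matrix.of_apply]
    exact analyticAt_fun_sum _ fun γ _ => analyticAt_const.mul
      (analytic_pd (analytic_pd h.analytic β) γ v hv)
  refine h1.congr hV fun v hv => ?_
  have h2 := congrFun (congrFun (hc.jacobian_mul_inv hv) i) i
  rw [Matrix.mul_apply, Matrix.one_apply_eq] at h2
  simp only [h.riemann.diagonal v hv, mul_assoc, ← mul_sum]
  simp only [jacobian, Matrix.of_apply] at h2 ⊢
  rw [h2, mul_one]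

theorem hasVelocities (h : IsDiagonal η h₀ R lam V) (hV : IsOpen V) :
    HasVelocities η R V h₀ lam := ⟨h.analytic_lam hV, h.riemann.diagonal⟩

theorem sub_ne_zero (h : IsDiagonal η h₀ R lam V) (hv : v ∈ V)
    (hij : i ≠ j) : lam i v - lam j v ≠ 0 :=
  _root_.sub_ne_zero.mpr fun h1 => hij (h.riemann.distinct v hv h1)

/-- The Christoffel coefficients `Γ^i_{ij}` of the diagonal metric. -/
def christoffel (R lam : Fin n → ℂ^n → ℂ) (i j : Fin n) : ℂ^n → ℂ :=
  fun v => pdR R j (lam i) v / (lam j v - lam i v)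

theorem analytic_christoffel (h : IsDiagonal η h₀ R lam V) (hV : IsOpen V) (i j : Fin n) :
    Holo (christoffel R lam i j) V := by
  by_cases hij : i = j
  · subst hij
    have : christoffel R lam i i = fun _ => 0 := by funext v; simp [christoffel]
    rw [this]; exact analyticOnNhd_const
  · exact fun v hv => (h.coordinates.analytic_pdR j (h.analytic_lam hV i) v hv).div
      ((h.analytic_lam hV j v hv).sub (h.analytic_lam hV i v hv)) (h.sub_ne_zero hv (Ne.symm hij))

end IsDiagonal

open IsDiagonal

theorem diagonalizes_iff (hW : IsOpen W) (h : IsCoordinates R (π W))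
    {μ : Fin n → ℂ^n → ℂ} (hf : Holo f (π W))
    (hμ : ∀ i, Holo (μ i) (π W)) :
    (frame hW h).Diagonalizes η (ofBase W f) (fun i => ofBase W (μ i)) ↔
      HasVelocities η R (π W) f μ := by
  have key : ∀ (w : jetsOver₁ W) i β, (evalJet w (∑ α, (∑ γ, algebraMap ℂ _ (η α γ) *
      (jetAlgebra hW).d 0 γ ((jetAlgebra hW).d 0 β (ofBase W f))) *
        (jetAlgebra hW).d 0 α ((frame hW h).R i)) =
      ∑ α, raisedHessian η f (w.1 0) α β * pd α (R i) (w.1 0)) ∧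
      evalJet w (ofBase W (μ i) * (jetAlgebra hW).d 0 β ((frame hW h).R i)) =
        μ i (w.1 0) * pd β (R i) (w.1 0) := by
    intro w i β
    have h2 : ∀ α, (jetAlgebra hW).d 0 α ((frame hW h).R i) = ofBase W (pd α (R i)) := fun α =>
      d_zero_ofBase hW (h.analytic i) α
    constructor
    · simp only [h2, d_zero_ofBase hW hf, d_zero_ofBase hW (analytic_pd hf _), map_sum, map_mul,
        evalJet_ofBase (analytic_pd (analytic_pd hf _) _),
        evalJet_ofBase (analytic_pd (h.analytic i) _), raisedHessian, Matrix.mul_apply,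
        Matrix.of_apply]
      rfl
    · rw [map_mul, h2, evalJet_ofBase (hμ i), evalJet_ofBase (analytic_pd (h.analytic i) β)]
  constructor
  · intro hd
    refine ⟨hμ, ?_⟩
    rintro _ ⟨w, hw, rfl⟩ i β
    have h1 := congrArg (evalJet ⟨shortJet w, shortJet_mem.mpr hw⟩) (hd i β)
    rwa [(key _ i β).1, (key _ i β).2] at h1
  · intro hv i β
    refine evalJet_ext fun w => ?_
    rw [(key _ i β).1, (key _ i β).2]
    exact hv.eq _ (jetsOver₁_base w.2) i β

/-- The Riemann invariants, in the jet algebra over `W`. -/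
def riemann (hW : IsOpen W) (h : IsDiagonal η h₀ R lam (π W)) : Riemann (jetAlgebra hW) η where
  toFrame := frame hW h.coordinates
  h₀ := ofBase W h₀
  lam i := ofBase W (lam i)
  a i j := ofBase W (christoffel R lam i j)
  ord_h₀ := ord_ofBase hW h.analytic
  ord_lam i := ord_ofBase hW (h.analytic_lam (isOpen_base hW) i)
  isUnit_sub i j hij := by
    have hl := h.analytic_lam (isOpen_base hW)
    have hi : Holo (fun v => (lam i v - lam j v)⁻¹) (π W) := fun v hv =>
      ((hl i v hv).sub (hl j v hv)).inv (h.sub_ne_zero hv hij)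
    refine IsUnit.of_mul_eq_one (ofBase W fun v => (lam i v - lam j v)⁻¹) (evalJet_ext fun w => ?_)
    rw [map_mul, map_sub, evalJet_ofBase (hl i), evalJet_ofBase (hl j), evalJet_ofBase hi, map_one,
      mul_inv_cancel₀ (h.sub_ne_zero (jetsOver₁_base w.2) hij)]
  E_lam i j hij := by
    have hl := h.analytic_lam (isOpen_base hW)
    rw [frame_E_ofBase hW h.coordinates j (hl i)]
    refine evalJet_ext fun w => ?_
    rw [map_mul, map_sub, evalJet_ofBase (hl i), evalJet_ofBase (hl j),
      evalJet_ofBase (h.analytic_christoffel (isOpen_base hW) i j),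
      evalJet_ofBase (h.coordinates.analytic_pdR j (hl i)), christoffel,
      div_mul_cancel₀ _ (h.sub_ne_zero (jetsOver₁_base w.2) hij.symm)]
  diag := (diagonalizes_iff hW h.coordinates h.analytic
    (h.analytic_lam (isOpen_base hW))).mpr (h.hasVelocities (isOpen_base hW))

theorem riemann_E (hW : IsOpen W) (h : IsDiagonal η h₀ R lam (π W)) (i : Fin n)
    {f : ℂ^n → ℂ} (hf : Holo f (π W)) : (riemann hW h).E i (ofBase W f) = ofBase W (pdR R i f) :=
  frame_E_ofBase hW h.coordinates i hf

/-- The exponential satisfies the chain rule in the jet algebra. -/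
theorem d_exp (hW : IsOpen W) {k : ℂ^n × ℂ^n → ℂ} (hk : Holo k W)
    (ℓ : ℕ) (α : Fin n) : (jetAlgebra hW).d ℓ α (ofPair W fun w => Complex.exp (k w)) =
      ofPair W (fun w => Complex.exp (k w)) * (jetAlgebra hW).d ℓ α (ofPair W k) := by
  have he : Holo (fun w => Complex.exp (k w)) W := fun w hw => (hk w hw).cexp
  refine evalJet_ext fun j => ?_
  have h1 := ((represents_ofPair hk).hasDerivAt hW ℓ α j).cexp
  have h2 := (represents_ofPair he).hasDerivAt hW ℓ α j
  have h3 := h2.unique h1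
  rw [h3, map_mul, (represents_ofPair he).evalJet]
  simp [lift₁]

/-- The logarithms of `R_{i,x}`, in the jet algebra over `W`. -/
def logBranch (hW : IsOpen W) (h : IsCoordinates R (π W))
    {L : Fin n → ℂ^n × ℂ^n → ℂ} (hL : IsLogBranch R W L) :
    Riemann.LogBranch (frame hW h) where
  L i := ofPair W (L i)
  ord_L i := ord_ofPair hW (hL i).1
  isUnit_p i := by
    have he : Holo (fun w => Complex.exp (-L i w)) W := fun w hw => ((hL i).1 w hw).neg.cexp
    refine IsUnit.of_mul_eq_one (ofPair W fun w => Complex.exp (-L i w)) (evalJet_ext fun j => ?_)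
    rw [map_mul, evalJet_p, (represents_ofPair he).evalJet, ← (hL i).2 _ j.2, map_one, lift₁,
      ← Complex.exp_add, add_neg_cancel, Complex.exp_zero]
  vf_L i Y := by
    have he : Holo (fun w => Complex.exp (L i w)) W := fun w hw => ((hL i).1 w hw).cexp
    have hp : (frame hW h).p i = ofPair W fun w => Complex.exp (L i w) := by
      rw [frame_p_eq]
      refine evalJet_ext fun j => ?_
      rw [(represents_ofPair (analytic_Rx h i)).evalJet, (represents_ofPair he).evalJet]
      exact ((hL i).2 _ j.2).symm
    rw [hp, vf_eq_sum' Y (ord_ofPair hW (hL i).1), vf_eq_sum' Y (ord_ofPair hW he), mul_sum]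
    refine sum_ext fun ℓ => ?_
    rw [mul_sum]
    refine sum_ext fun α => ?_
    rw [d_exp hW (hL i).1]; ring

end Base

end

section

variable {f g : ℂ^n → ℂ}

/-! ### Charts of Riemann invariants -/

section Charts

open Metric Set Filter Topology

variable {ρ : ℝ} {Ψ : ℂ^n → ℂ^n}

/-- The coordinates `R_i`, normalized to vanish at `p`. -/
def centered (R : Fin n → ℂ^n → ℂ) (p v : ℂ^n) : ℂ^n := fun i => R i v - R i p

/-- `V` is mapped onto a polydisc around `0` by the coordinates `R_i - R_i(p)`, with the
holomorphic inverse `Ψ`. -/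
structure IsChart (R : Fin n → ℂ^n → ℂ) (p : ℂ^n) (V : Set ℂ^n) (ρ : ℝ) (Ψ : ℂ^n → ℂ^n) : Prop where
  pos : 0 < ρ
  isOpen : IsOpen V
  mem : p ∈ V
  coordinates : IsCoordinates R V
  differentiable : DiffOn Ψ (𝔹 ρ)
  centered_mem : ∀ v ∈ V, centered R p v ∈ ball 0 ρ
  inv_mem : ∀ x ∈ ball 0 ρ, Ψ x ∈ V
  left_inv : ∀ v ∈ V, Ψ (centered R p v) = v
  right_inv : ∀ x ∈ ball 0 ρ, centered R p (Ψ x) = x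

theorem pd_congr (hV : IsOpen V) (h : ∀ v ∈ V, f v = g v) (α : Fin n)
    (hv : v ∈ V) : pd α f v = pd α g v := by
  rw [pd, pd, Filter.EventuallyEq.fderiv_eq ((hV.eventually_mem hv).mono h)]

theorem pdR_congr (hV : IsOpen V) (h : ∀ v ∈ V, f v = g v) (i : Fin n)
    (hv : v ∈ V) : pdR R i f v = pdR R i g v :=
  sum_ext fun α => by rw [pd_congr hV h α hv]

theorem hasFDerivAt_centered (hc : IsCoordinates R V) (hv : v ∈ V) :
    HasStrictFDerivAt (centered R p) (ContinuousLinearMap.pi fun i => fderiv ℂ (R i) v) v :=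
  hasStrictFDerivAt_pi.mpr fun i => ((hc.analytic i v hv).hasStrictFDerivAt).sub_const (R i p)

theorem exists_equiv_jacobian (hc : IsCoordinates R V) (hv : v ∈ V) :
    ∃ e : ℂ^n ≃L[ℂ] ℂ^n, (e : ℂ^n →L[ℂ] ℂ^n) =
      ContinuousLinearMap.pi fun i => fderiv ℂ (R i) v := by
  set f : ℂ^n →L[ℂ] ℂ^n := ContinuousLinearMap.pi fun i => fderiv ℂ (R i) v
  have hf : ∀ y, f y = (jacobian R v).mulVec y := fun y => by
    funext i
    change fderiv ℂ (R i) v y = _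
    rw [fderiv_apply_eq_sum]
    simp [Matrix.mulVec, dotProduct, jacobian, mul_comm]
  have hinj : Function.Injective f := by
    intro y z hyz
    rw [hf, hf] at hyz
    have := congrArg ((jacobian R v)⁻¹.mulVec) hyz
    rwa [Matrix.mulVec_mulVec, Matrix.mulVec_mulVec, hc.inv_mul_jacobian hv, Matrix.one_mulVec,
      Matrix.one_mulVec] at this
  refine ⟨(LinearEquiv.ofInjectiveEndo (f : ℂ^n →ₗ[ℂ] ℂ^n) hinj).toContinuousLinearEquiv, ?_⟩
  ext y
  rfl

/-- Local coordinates define charts on arbitrarily small neighbourhoods of a point. -/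
theorem exists_chart {N : Set ℂ^n} (hN : IsOpen N) (hp : p ∈ N)
    (hc : IsCoordinates R N) : ∃ V ρ Ψ, IsChart R p V ρ Ψ ∧ V ⊆ N := by
  obtain ⟨f', hf'⟩ := exists_equiv_jacobian hc hp
  have hs : HasStrictFDerivAt (centered R p) (f' : ℂ^n →L[ℂ] ℂ^n) p := by
    rw [hf']; exact hasFDerivAt_centered hc hp
  set e := hs.toOpenPartialHomeomorph (centered R p) with he
  have hec : ∀ v, e v = centered R p v := fun v => by
    rw [he, HasStrictFDerivAt.toOpenPartialHomeomorph_coe]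
  have hps : p ∈ e.source := hs.mem_toOpenPartialHomeomorph_source
  have h0 : e p = 0 := by rw [hec]; funext i; simp [centered]
  have ht : (0 : ℂ^n) ∈ e.target := h0 ▸ e.map_source hps
  have hsymm0 : e.symm 0 = p := by rw [← h0, e.left_inv hps]
  have hev : ∀ᶠ x in 𝓝 (0 : ℂ^n), x ∈ e.target ∧ e.symm x ∈ N := by
    refine (e.open_target.eventually_mem ht).and ?_
    exact (e.continuousAt_symm ht).eventually_mem (hN.mem_nhds (by rwa [hsymm0]))
  obtain ⟨ρ, hρ, hb⟩ := Metric.eventually_nhds_iff_ball.mp hev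
  have hVN : e.source ∩ e ⁻¹' ball 0 ρ ⊆ N := fun v hv => by
    rw [← e.left_inv hv.1]; exact (hb _ hv.2).2
  refine ⟨e.source ∩ e ⁻¹' ball 0 ρ, ρ, e.symm, ⟨hρ, e.isOpen_inter_preimage isOpen_ball,
    ⟨hps, ?_⟩, hc.mono hVN, ?_, ?_, ?_, ?_, ?_⟩, hVN⟩
  · rw [mem_preimage, h0]; exact mem_ball_self hρ
  · intro x hx
    obtain ⟨hxt, hxN⟩ := hb x hx
    obtain ⟨g', hg'⟩ := exists_equiv_jacobian hc hxN
    have h1 : HasFDerivAt e (g' : ℂ^n →L[ℂ] ℂ^n) (e.symm x) := by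
      rw [hg', he, HasStrictFDerivAt.toOpenPartialHomeomorph_coe]
      exact (hasFDerivAt_centered hc hxN).hasFDerivAt
    exact (e.hasFDerivAt_symm hxt h1).differentiableAt.differentiableWithinAt
  · intro v hv; rw [← hec]; exact hv.2
  · intro x hx
    exact ⟨e.map_target (hb x hx).1, by rw [mem_preimage, e.right_inv (hb x hx).1]; exact hx⟩
  · intro v hv; rw [← hec, e.left_inv hv.1]
  · intro x hx; rw [← hec, e.right_inv (hb x hx).1]

namespace IsChart

variable (h : IsChart R p V ρ Ψ)
include h

/-- A chart on a smaller polydisc. -/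
theorem shrink {r : ℝ} (hr : 0 < r) (hrρ : r ≤ ρ) :
    IsChart R p (V ∩ centered R p ⁻¹' ball 0 r) r Ψ where
  pos := hr
  isOpen := by
    have hcont : ContinuousOn (centered R p) V := fun v hv =>
      (hasFDerivAt_centered h.coordinates hv).continuousAt.continuousWithinAt
    exact hcont.isOpen_inter_preimage h.isOpen isOpen_ball
  mem := ⟨h.mem, by
    have : centered R p p = 0 := by funext i; simp [centered]
    rw [mem_preimage, this]; exact mem_ball_self hr⟩
  coordinates := h.coordinates.mono inter_subset_left
  differentiable := h.differentiable.mono (ball_subset_ball hrρ)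
  centered_mem _ hv := hv.2
  inv_mem x hx := ⟨h.inv_mem x (ball_subset_ball hrρ hx), by
    rw [mem_preimage, h.right_inv x (ball_subset_ball hrρ hx)]; exact hx⟩
  left_inv v hv := h.left_inv v hv.1
  right_inv x hx := h.right_inv x (ball_subset_ball hrρ hx)

theorem differentiableAt (hx : x ∈ ball 0 ρ) : DifferentiableAt ℂ Ψ x :=
  h.differentiable.differentiableAt (isOpen_ball.mem_nhds hx)

/-- The Jacobian matrix of the inverse of a chart. -/
theorem fderiv_inv (hx : x ∈ ball 0 ρ) (i α : Fin n) :
    fderiv ℂ Ψ x (Pi.single i 1) α = (jacobian R (Ψ x))⁻¹ α i := by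
  have h1 := (hasFDerivAt_centered (p := p) h.coordinates (h.inv_mem x hx)).hasFDerivAt.comp x
    (h.differentiableAt hx).hasFDerivAt
  have h2 : HasFDerivAt (centered R p ∘ Ψ) (ContinuousLinearMap.id ℂ ℂ^n) x :=
    (hasFDerivAt_id x).congr_of_eventuallyEq
      ((isOpen_ball.eventually_mem hx).mono fun y hy => h.right_inv y hy)
  have h3 := h1.unique h2
  have h4 : jacobian R (Ψ x) * (Matrix.of fun α i => fderiv ℂ Ψ x (Pi.single i 1) α) = 1 := by
    ext k i
    have h5 := congrFun (congrArg (fun L : ℂ^n →L[ℂ] ℂ^n => L (Pi.single i 1)) h3) k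
    have h6 : fderiv ℂ (R k) (Ψ x) (fderiv ℂ Ψ x (Pi.single i 1)) = (Pi.single i 1 : ℂ^n) k := h5
    rw [fderiv_apply_eq_sum] at h6
    simp only [Matrix.mul_apply, jacobian, Matrix.of_apply, Matrix.one_apply]
    rw [Pi.single_apply] at h6
    rw [← h6]
    exact sum_ext fun α => mul_comm _ _
  rw [Matrix.inv_eq_right_inv h4]; rfl

/-- In a chart, the fields `∂ / ∂ R_i` are the partial derivatives. -/
theorem pd_comp_inv (hx : x ∈ ball 0 ρ) (hf : DifferentiableAt ℂ f (Ψ x)) (i : Fin n) :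
    pd i (fun y => f (Ψ y)) x = pdR R i f (Ψ x) := by
  have h1 := hf.hasFDerivAt.comp x (h.differentiableAt hx).hasFDerivAt
  rw [pd_eq_of_hasFDerivAt (f := fun y => f (Ψ y)) h1, ContinuousLinearMap.comp_apply, fderiv_apply_eq_sum, pdR]
  exact sum_ext fun α => by rw [h.fderiv_inv hx]

theorem differentiableOn_comp_inv (hf : Holo f V) :
    DiffOn (fun y => f (Ψ y)) (𝔹 ρ) := fun x hx =>
  ((hf _ (h.inv_mem x hx)).differentiableAt.comp x (h.differentiableAt hx)).differentiableWithinAt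

theorem analyticOnNhd_comp (hg : DiffOn g (𝔹 ρ)) : Holo (fun v => g (centered R p v)) V :=
  DifferentiableOn.analyticOnNhd_of_finiteDimensional h.isOpen fun v hv =>
    ((hg.differentiableAt (isOpen_ball.mem_nhds (h.centered_mem v hv))).comp v
      (hasFDerivAt_centered h.coordinates hv).differentiableAt).differentiableWithinAt

theorem pdR_comp (hg : DiffOn g (𝔹 ρ)) (i : Fin n) (hv : v ∈ V) :
    pdR R i (fun v => g (centered R p v)) v = pd i g (centered R p v) := by
  have hx := h.centered_mem v hv
  have h1 := h.pd_comp_inv hx (f := fun v => g (centered R p v)) (by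
    rw [h.left_inv v hv]; exact (h.analyticOnNhd_comp hg v hv).differentiableAt) i
  rw [h.left_inv v hv] at h1
  rw [← h1, pd, pd]
  congr 1
  refine Filter.EventuallyEq.fderiv_eq ?_
  exact (isOpen_ball.eventually_mem hx).mono fun y hy => by simp only [h.right_inv y hy]

/-- A differential one-form that is closed in the coordinates `R_i` has a potential. -/
theorem exists_potential {u : Fin n → ℂ^n → ℂ} (hu : ∀ i, Holo (u i) V)
    (hc : ∀ i j, ∀ v ∈ V, pdR R j (u i) v = pdR R i (u j) v) :
    ∃ f : ℂ^n → ℂ, Holo f V ∧ ∀ i, ∀ v ∈ V, pdR R i f v = u i v := by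
  obtain ⟨g, hg, hgu⟩ := HamPDE.exists_potential (u := fun i x => u i (Ψ x))
    (fun i => h.differentiableOn_comp_inv (hu i)) fun i j x hx => by
      rw [h.pd_comp_inv hx (hu i _ (h.inv_mem x hx)).differentiableAt,
        h.pd_comp_inv hx (hu j _ (h.inv_mem x hx)).differentiableAt, hc i j _ (h.inv_mem x hx)]
  refine ⟨_, h.analyticOnNhd_comp hg, fun i v hv => ?_⟩
  rw [h.pdR_comp hg i hv, hgu i _ (h.centered_mem v hv), h.left_inv v hv]

/-- A differential two-form that is closed in the coordinates `R_i` is exact. -/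
theorem exists_potential_two {s : Fin n → Fin n → ℂ^n → ℂ}
    (hs : ∀ i j, Holo (s i j) V) (ha : ∀ i j, ∀ v ∈ V, s i j v = - s j i v)
    (hc : ∀ i j k, ∀ v ∈ V, pdR R k (s i j) v + pdR R i (s j k) v + pdR R j (s k i) v = 0) :
    ∃ φ : Fin n → ℂ^n → ℂ, (∀ i, Holo (φ i) V) ∧
      ∀ i k, ∀ v ∈ V, pdR R k (φ i) v - pdR R i (φ k) v = s i k v := by
  obtain ⟨φ, hφ, hφs⟩ := HamPDE.exists_potential_two (s := fun i j x => s i j (Ψ x))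
    (fun i j => h.differentiableOn_comp_inv (hs i j)) (fun i j x hx => ha i j _ (h.inv_mem x hx))
    fun i j k x hx => by
      have hd : ∀ i j, DifferentiableAt ℂ (s i j) (Ψ x) := fun i j =>
        (hs i j _ (h.inv_mem x hx)).differentiableAt
      rw [h.pd_comp_inv hx (hd i j), h.pd_comp_inv hx (hd j k), h.pd_comp_inv hx (hd k i),
        hc i j k _ (h.inv_mem x hx)]
  refine ⟨_, fun i => h.analyticOnNhd_comp (hφ i), fun i k v hv => ?_⟩
  rw [h.pdR_comp (hφ i) k hv, h.pdR_comp (hφ k) i hv, hφs i k _ (h.centered_mem v hv),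
    h.left_inv v hv]

/-- The solution of a compatible Goursat system in the coordinates `R_i`. -/
theorem exists_goursat {a k : Fin n → Fin n → ℂ^n → ℂ}
    (ha : ∀ i j, Holo (a i j) V) (hk : ∀ i j, Holo (k i j) V)
    (hs : ∀ i j, ∀ v ∈ V, k i j v = k j i v)
    (h1 : ∀ i j l, i ≠ j → i ≠ l → j ≠ l → ∀ v ∈ V, pdR R l (a i j) v = pdR R j (a i l) v)
    (h2 : ∀ i j l, i ≠ j → i ≠ l → j ≠ l → ∀ v ∈ V,
      pdR R l (a j i) v + a j i v * a j l v = a i l v * a j i v + a l i v * a j l v)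
    (h3 : ∀ i j l, i ≠ j → i ≠ l → j ≠ l → ∀ v ∈ V,
      pdR R l (k i j) v + a i j v * k i l v + a j i v * k j l v =
        pdR R j (k i l) v + a i l v * k i j v + a l i v * k l j v) :
    ∃ V' r, IsChart R p V' r Ψ ∧ V' ⊆ V ∧ ∃ f : ℂ^n → ℂ, Holo f V' ∧
      ∀ i j, i ≠ j → ∀ v ∈ V', pdR R j (pdR R i f) v =
        a i j v * pdR R i f v + a j i v * pdR R j f v + k i j v := by
  have hda : ∀ i j, ∀ x ∈ 𝔹 ρ, DifferentiableAt ℂ (a i j) (Ψ x) :=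
    fun i j x hx => (ha i j _ (h.inv_mem x hx)).differentiableAt
  have hdk : ∀ i j, ∀ x ∈ 𝔹 ρ, DifferentiableAt ℂ (k i j) (Ψ x) :=
    fun i j x hx => (hk i j _ (h.inv_mem x hx)).differentiableAt
  obtain ⟨r, hr, hrρ, g, hg, hgk⟩ := HamPDE.exists_goursat (a := fun i j x => a i j (Ψ x))
    (k := fun i j x => k i j (Ψ x)) h.pos (fun i j => h.differentiableOn_comp_inv (ha i j))
    (fun i j => h.differentiableOn_comp_inv (hk i j)) {
      symm := fun i j x hx => hs i j _ (h.inv_mem x hx)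
      first := fun i j l hij hil hjl x hx => by
        rw [h.pd_comp_inv hx (hda i j x hx), h.pd_comp_inv hx (hda i l x hx)]
        exact h1 i j l hij hil hjl _ (h.inv_mem x hx)
      second := fun i j l hij hil hjl x hx => by
        rw [h.pd_comp_inv hx (hda j i x hx)]
        exact h2 i j l hij hil hjl _ (h.inv_mem x hx)
      third := fun i j l hij hil hjl x hx => by
        rw [h.pd_comp_inv hx (hdk i j x hx), h.pd_comp_inv hx (hdk i l x hx)]
        exact h3 i j l hij hil hjl _ (h.inv_mem x hx) }
  have h' := h.shrink hr hrρ
  refine ⟨_, r, h', inter_subset_left, _, h'.analyticOnNhd_comp hg, fun i j hij v hv => ?_⟩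
  have hgi : DiffOn (pd i g) (𝔹 r) := differentiableOn_pd isOpen_ball hg i
  have e1 : ∀ l, ∀ v ∈ V ∩ centered R p ⁻¹' ball 0 r,
      pdR R l (fun v => g (centered R p v)) v = pd l g (centered R p v) := fun l v hv =>
    h'.pdR_comp hg l hv
  have e2 : pdR R j (pdR R i fun v => g (centered R p v)) v =
      pdR R j (fun v => pd i g (centered R p v)) v := by
    exact pdR_congr h'.isOpen (fun v hv => e1 i v hv) j hv
  rw [e2, h'.pdR_comp hgi j hv, e1 i v hv, e1 j v hv, hgk i j hij _ hv.2]
  simp only [h.left_inv v hv.1]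

/-- In a chart, a function that depends on `R_i` only is a holomorphic function of `R_i`. -/
theorem exists_eq_comp {c : ℂ^n → ℂ} (hc : Holo c V) (hz : ∀ k, i ≠ k → ∀ v ∈ V, pdR R k c v = 0) :
    ∃ C : ℂ → ℂ, Holo C (R i '' V) ∧ ∀ v ∈ V, c v = C (R i v) := by
  set γ : ℂ → ℂ^n := fun z => Pi.single i (z - R i p) with hγ
  have hnorm : ∀ v ∈ V, ‖R i v - R i p‖ < ρ := fun v hv => by
    have := mem_ball_zero_iff.mp (h.centered_mem v hv)
    exact (norm_le_pi_norm (centered R p v) i).trans_lt this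
  have hsingle : ∀ z : ℂ, ‖z‖ < ρ → (Pi.single i z : ℂ^n) ∈ ball 0 ρ := fun z hz => by
    rw [mem_ball_zero_iff, Pi.norm_single]; exact hz
  refine ⟨fun z => c (Ψ (γ z)), ?_, fun v hv => ?_⟩
  · rintro _ ⟨v, hv, rfl⟩
    have hd : DiffOn (fun z => c (Ψ (γ z))) (ball (R i p) ρ) := by
      intro z hz
      rw [mem_ball, dist_eq_norm] at hz
      have h1 : DifferentiableAt ℂ γ z := by
        rw [differentiableAt_pi]
        intro k
        by_cases hk : k = i
        · subst hk; simp only [hγ, Pi.single_eq_same]; fun_prop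
        · simp only [hγ, Pi.single_eq_of_ne hk]; fun_prop
      have h2 := (h.differentiableOn_comp_inv hc).differentiableAt
        (isOpen_ball.mem_nhds (hsingle _ hz))
      exact (DifferentiableAt.comp z (g := fun y => c (Ψ y)) h2 h1).differentiableWithinAt
    refine hd.analyticOnNhd isOpen_ball _ ?_
    rw [mem_ball, dist_eq_norm]; exact hnorm v hv
  · set x := centered R p v with hx
    have hxb := h.centered_mem v hv
    rw [← h.left_inv v hv, ← hx]
    change c (Ψ x) = c (Ψ (γ (R i (Ψ x))))
    have hγx : γ (R i (Ψ x)) = Pi.single i (x i) := by rw [hx, h.left_inv v hv]; rfl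
    rw [hγx]
    have hd := h.differentiableOn_comp_inv hc
    have hy : (Pi.single i (x i) : ℂ^n) ∈ ball 0 ρ := hsingle _ (hnorm v hv)
    refine eq_of_fderiv_segment_eq_zero (f := fun y => c (Ψ y)) fun t ht => ?_
    have hm := (convex_ball (0 : ℂ^n) ρ).add_smul_sub_mem hy hxb ht
    rw [← Complex.coe_smul] at hm
    refine ⟨hd.differentiableAt (isOpen_ball.mem_nhds hm), ?_⟩
    rw [fderiv_apply_eq_sum]
    refine sum_eq_zero fun k _ => ?_
    by_cases hk : k = i
    · subst hk; simp
    · rw [h.pd_comp_inv hm (hc _ (h.inv_mem _ hm)).differentiableAt,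
        hz k (Ne.symm hk) _ (h.inv_mem _ hm), mul_zero]

end IsChart

end Charts

end

section

variable {m : ℕ × Fin n →₀ ℕ} {d : ℕ} {f g : Density n}

/-! ### Differential polynomials -/

section DiffPoly

open MvPolynomial

/-- The weights of the jet variables `v_ℓ`, `ℓ ≥ 1`. -/
abbrev jetWeight (n : ℕ) : ℕ × Fin n → ℕ := fun q => q.1 + 1

theorem exists_eq_add_single (hm : m ≠ 0) :
    ∃ (m' : ℕ × Fin n →₀ ℕ) (q : ℕ × Fin n), m = m' + Finsupp.single q 1 ∧
      Finsupp.weight (jetWeight n) m' + (q.1 + 1) = Finsupp.weight (jetWeight n) m := by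
  obtain ⟨q, hq⟩ := Finsupp.ne_iff.mp hm
  refine ⟨m - Finsupp.single q 1, q, ?_, Finsupp.weight_sub_single_add hq⟩
  rw [tsub_add_cancel_of_le]
  rw [Finsupp.single_le_iff]; exact Nat.one_le_iff_ne_zero.mpr hq

theorem eq_zero_of_weight (h : Finsupp.weight (jetWeight n) m = 0) : m = 0 := by
  by_contra hm
  obtain ⟨m', q, -, hw⟩ := exists_eq_add_single hm
  omega

theorem exists_of_weight_one (h : Finsupp.weight (jetWeight n) m = 1) :
    ∃ α, m = Finsupp.single (0, α) 1 := by
  obtain ⟨m', ⟨ℓ, α⟩, rfl, hw⟩ := exists_eq_add_single (m := m) (by rintro rfl; simp at h)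
  have h0 : m' = 0 := eq_zero_of_weight (by omega)
  have h1 : ℓ = 0 := by simp only at hw; omega
  exact ⟨α, by rw [h0, h1, zero_add]⟩

theorem exists_of_weight_two (h : Finsupp.weight (jetWeight n) m = 2) :
    (∃ α, m = Finsupp.single (1, α) 1) ∨
      ∃ α β, m = Finsupp.single (0, α) 1 + Finsupp.single (0, β) 1 := by
  obtain ⟨m', ⟨ℓ, β⟩, rfl, hw⟩ := exists_eq_add_single (m := m) (by rintro rfl; simp at h)
  simp only at hw
  by_cases h0 : m' = 0
  · have h1 : ℓ = 1 := by
      rw [h, h0, map_zero] at hw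
      omega
    exact Or.inl ⟨β, by rw [h0, h1, zero_add]⟩
  · have h1 : Finsupp.weight (jetWeight n) m' ≠ 0 := fun hc => h0 (eq_zero_of_weight hc)
    obtain ⟨α, hα⟩ := exists_of_weight_one (m := m') (by omega)
    have h2 : ℓ = 0 := by omega
    exact Or.inr ⟨α, β, by rw [hα, h2]⟩

theorem prod_single_jet (q : ℕ × Fin n) (j : Jet n) :
    ((Finsupp.single q 1).prod fun (q : ℕ × Fin n) (e : ℕ) => j (q.1 + 1) q.2 ^ e) =
      j (q.1 + 1) q.2 := by
  rw [Finsupp.prod_single_index (h := fun (q : ℕ × Fin n) (e : ℕ) => j (q.1 + 1) q.2 ^ e)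
    (pow_zero _), pow_one]

theorem prod_add_jet (m m' : ℕ × Fin n →₀ ℕ) (j : Jet n) :
    ((m + m').prod fun (q : ℕ × Fin n) (e : ℕ) => j (q.1 + 1) q.2 ^ e) =
      (m.prod fun q e => j (q.1 + 1) q.2 ^ e) * m'.prod fun q e => j (q.1 + 1) q.2 ^ e :=
  Finsupp.prod_add_index' (h := fun (q : ℕ × Fin n) (e : ℕ) => j (q.1 + 1) q.2 ^ e)
    (fun _ => pow_zero _) fun _ _ _ => pow_add _ _ _

/-- A class of densities that is closed under sums contains a differential polynomial as soon as it
contains the monomials of the same degree. -/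
@[elab_as_elim]
theorem IsDiffPoly.induction {Q : Density n → Prop} (hf : IsDiffPoly V d f)
    (h0 : Q 0) (hadd : ∀ f g, Q f → Q g → Q (f + g))
    (hcongr : ∀ f g, (∀ j ∈ jetsOver V, g j = f j) → Q f → Q g)
    (hmon : ∀ (u : ℂ^n → ℂ) (m : ℕ × Fin n →₀ ℕ), Holo u V → Finsupp.weight (jetWeight n) m = d →
      Q fun j => u (j 0) * m.prod fun q e => j (q.1 + 1) q.2 ^ e) : Q f := by
  obtain ⟨P, hP, ha, he⟩ := hf
  have h1 : ∀ s : Finset (ℕ × Fin n →₀ ℕ), s ⊆ P.support →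
      Q (∑ m ∈ s, fun j => P.coeff m (j 0) * m.prod fun q e => j (q.1 + 1) q.2 ^ e) := by
    intro s
    induction s using Finset.induction_on with
    | empty => intro _; simpa using h0
    | insert m s hm ih =>
      intro hs
      rw [Finset.sum_insert hm]
      refine hadd _ _ (hmon _ m (ha m) (hP ?_)) (ih fun k hk => hs (Finset.mem_insert_of_mem hk))
      exact mem_support_iff.mp (hs (Finset.mem_insert_self _ _))
  refine hcongr _ _ (fun j hj => ?_) (h1 P.support subset_rfl)
  rw [he j hj, eval₂_eq, Finset.sum_apply]
  rfl

theorem analyticOnNhd_zero : Holo (0 : ℂ^n → ℂ) V := analyticOnNhd_const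

theorem IsDiffPoly.exists_degree_zero (hf : IsDiffPoly V 0 f) :
    ∃ u : ℂ^n → ℂ, Holo u V ∧ ∀ j ∈ jetsOver V, f j = u (j 0) := by
  refine hf.induction ?_ ?_ ?_ ?_
  · exact ⟨0, analyticOnNhd_zero, fun _ _ => rfl⟩
  · rintro f g ⟨u, hu, hf⟩ ⟨w, hw, hg⟩
    exact ⟨u + w, hu.add hw, fun j hj => by rw [Pi.add_apply, hf j hj, hg j hj]; rfl⟩
  · rintro f g h ⟨u, hu, hf⟩
    exact ⟨u, hu, fun j hj => (h j hj).trans (hf j hj)⟩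
  · intro u m hu hm
    exact ⟨u, hu, fun j _ => by rw [eq_zero_of_weight hm]; simp⟩

theorem IsDiffPoly.exists_degree_one (hf : IsDiffPoly V 1 f) :
    ∃ u : Fin n → ℂ^n → ℂ, (∀ α, Holo (u α) V) ∧
      ∀ j ∈ jetsOver V, f j = ∑ α, u α (j 0) * j 1 α := by
  refine hf.induction ?_ ?_ ?_ ?_
  · exact ⟨0, fun _ => analyticOnNhd_zero, fun _ _ => by simp⟩
  · rintro f g ⟨u, hu, hf⟩ ⟨w, hw, hg⟩
    exact ⟨u + w, fun α => (hu α).add (hw α), fun j hj => by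
      rw [Pi.add_apply, hf j hj, hg j hj, ← sum_add_distrib]
      exact sum_ext fun α => (add_mul _ _ _).symm⟩
  · rintro f g h ⟨u, hu, hf⟩
    exact ⟨u, hu, fun j hj => (h j hj).trans (hf j hj)⟩
  · intro u m hu hm
    obtain ⟨α, rfl⟩ := exists_of_weight_one hm
    refine ⟨fun β => if β = α then u else 0, fun β => ?_, fun j _ => ?_⟩
    · dsimp only; split_ifs
      exacts [hu, analyticOnNhd_zero]
    · dsimp only
      rw [prod_single_jet, sum_eq_single α]
      · simp
      · intro β _ hβ; simp [hβ]
      · simp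

theorem IsDiffPoly.exists_degree_two (hf : IsDiffPoly V 2 f) :
    ∃ (s : Fin n → Fin n → ℂ^n → ℂ) (t : Fin n → ℂ^n → ℂ),
      (∀ α β, Holo (s α β) V) ∧ (∀ α, Holo (t α) V) ∧
      ∀ j ∈ jetsOver V, f j = ∑ α, ∑ β, s α β (j 0) * j 1 α * j 1 β + ∑ α, t α (j 0) * j 2 α := by
  refine hf.induction ?_ ?_ ?_ ?_
  · exact ⟨0, 0, fun _ _ => analyticOnNhd_zero, fun _ => analyticOnNhd_zero,
      fun _ _ => by simp⟩
  · rintro f g ⟨s, t, hs, ht, hf⟩ ⟨s', t', hs', ht', hg⟩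
    refine ⟨s + s', t + t', fun α β => (hs α β).add (hs' α β), fun α => (ht α).add (ht' α),
      fun j hj => ?_⟩
    rw [Pi.add_apply, hf j hj, hg j hj]
    simp only [Pi.add_apply, add_mul, sum_add_distrib]
    ring
  · rintro f g h ⟨s, t, hs, ht, hf⟩
    exact ⟨s, t, hs, ht, fun j hj => (h j hj).trans (hf j hj)⟩
  · intro u m hu hm
    rcases exists_of_weight_two hm with ⟨α, rfl⟩ | ⟨α, β, rfl⟩
    · refine ⟨0, fun β => if β = α then u else 0, fun _ _ => analyticOnNhd_zero,
        fun β => ?_, fun j _ => ?_⟩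
      · dsimp only; split_ifs
        exacts [hu, analyticOnNhd_zero]
      · dsimp only
        rw [prod_single_jet, sum_eq_single α (f := fun α' =>
          (if α' = α then u else 0) (j 0) * j 2 α')]
        · simp
        · intro β _ hβ; simp [hβ]
        · simp
    · refine ⟨fun α' β' => if α' = α ∧ β' = β then u else 0, 0, fun α' β' => ?_,
        fun _ => analyticOnNhd_zero, fun j _ => ?_⟩
      · dsimp only; split_ifs
        exacts [hu, analyticOnNhd_zero]
      · dsimp only
        rw [prod_add_jet, prod_single_jet, prod_single_jet, sum_eq_single α, sum_eq_single β]
        · simp [mul_assoc]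
        · intro γ _ hγ; simp [hγ]
        · simp
        · intro γ _ hγ; simp [hγ]
        · simp

theorem isDiffPoly_zero (V : Set ℂ^n) (d : ℕ) : IsDiffPoly V d (0 : Density n) :=
  ⟨0, isWeightedHomogeneous_zero _ _ _, fun m => by
    rw [coeff_zero]; exact analyticOnNhd_zero, fun _ _ => by simp⟩

theorem IsDiffPoly.add (hf : IsDiffPoly V d f)
    (hg : IsDiffPoly V d g) : IsDiffPoly V d (f + g) := by
  obtain ⟨P, hP, ha, he⟩ := hf
  obtain ⟨Q, hQ, hb, he'⟩ := hg
  exact ⟨P + Q, hP.add hQ, fun m => by rw [coeff_add]; exact (ha m).add (hb m), fun j hj => by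
    rw [Pi.add_apply, he j hj, he' j hj, eval₂_add]⟩

theorem IsDiffPoly.sum {ι : Type*} {s : Finset ι} {f : ι → Density n}
    (h : ∀ i ∈ s, IsDiffPoly V d (f i)) : IsDiffPoly V d (∑ i ∈ s, f i) :=
  Finset.sum_induction _ (IsDiffPoly V d) (fun _ _ => IsDiffPoly.add) (isDiffPoly_zero V d) h

theorem IsDiffPoly.mul {e : ℕ} (hf : IsDiffPoly V d f)
    (hg : IsDiffPoly V e g) : IsDiffPoly V (d + e) (f * g) := by
  classical
  obtain ⟨P, hP, ha, he⟩ := hf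
  obtain ⟨Q, hQ, hb, he'⟩ := hg
  refine ⟨P * Q, hP.mul hQ, fun m => ?_, fun j hj => by
    rw [Pi.mul_apply, he j hj, he' j hj, eval₂_mul]⟩
  rw [coeff_mul]
  exact fun v hv => Finset.analyticAt_sum _ fun x _ => (ha x.1 v hv).mul (hb x.2 v hv)

theorem IsDiffPoly.congr (hf : IsDiffPoly V d f)
    (h : ∀ j ∈ jetsOver V, g j = f j) : IsDiffPoly V d g := by
  obtain ⟨P, hP, ha, he⟩ := hf
  exact ⟨P, hP, ha, fun j hj => (h j hj).trans (he j hj)⟩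

theorem IsDiffPoly.mono (hf : IsDiffPoly V d f) (hV : V' ⊆ V) : IsDiffPoly V' d f := by
  obtain ⟨P, hP, ha, he⟩ := hf
  exact ⟨P, hP, fun m => (ha m).mono hV, fun j hj => he j (hV hj)⟩

theorem isDiffPoly_lift₀ {u : ℂ^n → ℂ} (hu : Holo u V) : IsDiffPoly V 0 (lift₀ u) := by
  classical
  refine ⟨C u, isWeightedHomogeneous_C _ _, fun m => ?_, fun j _ => by simp [lift₀]⟩
  rw [coeff_C]; split_ifs
  exacts [hu, analyticOnNhd_zero]

theorem isDiffPoly_coord (α : Fin n) : IsDiffPoly V 1 fun j => j 1 α := by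
  classical
  refine ⟨X (0, α), isWeightedHomogeneous_X _ _ _, fun m => ?_, fun j _ => by simp⟩
  rw [coeff_X]; split_ifs
  exacts [analyticOnNhd_const, analyticOnNhd_zero]

end DiffPoly

section Forms

open JetAlgebra

/-- The one-form `∑ ω_i R_{i,x}`, as a function of `(v, v_x)`. -/
def linForm (R : Fin n → ℂ^n → ℂ) (ω : Fin n → ℂ^n → ℂ)
    (w : ℂ^n × ℂ^n) : ℂ := ∑ i, ω i w.1 * Rx R i w

/-- The quadratic form `∑ q_ij R_{i,x} R_{j,x}`, as a function of `(v, v_x)`. -/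
def quadForm (R : Fin n → ℂ^n → ℂ) (q : Fin n → Fin n → ℂ^n → ℂ)
    (w : ℂ^n × ℂ^n) : ℂ := ∑ i, ∑ j, q i j w.1 * Rx R i w * Rx R j w

theorem isDiffPoly_Rx (h : IsCoordinates R V) (i : Fin n) : IsDiffPoly V 1 (lift₁ (Rx R i)) := by
  have h1 : IsDiffPoly V (0 + 1) (∑ α, lift₀ (pd α (R i)) * fun j => j 1 α) :=
    IsDiffPoly.sum fun α _ =>
      (isDiffPoly_lift₀ (analytic_pd (h.analytic i) α)).mul (isDiffPoly_coord α)
  exact h1.congr fun j _ => by simp [lift₁, Rx, lift₀]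

theorem isDiffPoly_linForm (h : IsCoordinates R V) {ω : Fin n → ℂ^n → ℂ}
    (hω : ∀ i, Holo (ω i) V) : IsDiffPoly V 1 (lift₁ (linForm R ω)) := by
  have h1 : IsDiffPoly V (0 + 1) (∑ i, lift₀ (ω i) * lift₁ (Rx R i)) :=
    IsDiffPoly.sum fun i _ => (isDiffPoly_lift₀ (hω i)).mul (isDiffPoly_Rx h i)
  exact h1.congr fun j _ => by simp [lift₁, linForm, lift₀]

theorem isDiffPoly_quadForm (h : IsCoordinates R V) {q : Fin n → Fin n → ℂ^n → ℂ}
    (hq : ∀ i j, Holo (q i j) V) : IsDiffPoly V 2 (lift₁ (quadForm R q)) := by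
  have h1 : IsDiffPoly V (0 + 1 + 1) (∑ i, ∑ j, lift₀ (q i j) * lift₁ (Rx R i) * lift₁ (Rx R j)) :=
    IsDiffPoly.sum fun i _ => IsDiffPoly.sum fun j _ =>
      ((isDiffPoly_lift₀ (hq i j)).mul (isDiffPoly_Rx h i)).mul (isDiffPoly_Rx h j)
  exact h1.congr fun j _ => by simp [lift₁, quadForm, lift₀]

theorem represents_oneForm (hW : IsOpen W) (h : IsCoordinates R (π W))
    {ω : Fin n → ℂ^n → ℂ} (hω : ∀ i, Holo (ω i) (π W)) :
    Represents ((frame hW h).oneForm fun i => ofBase W (ω i)) (lift₁ (linForm R ω)) := by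
  rw [represents_iff]; intro j
  simp only [Frame.oneForm, map_sum, map_mul, evalJet_ofBase (hω _), evalJet_p]
  rfl

theorem represents_quad (hW : IsOpen W) (h : IsCoordinates R (π W))
    {q : Fin n → Fin n → ℂ^n → ℂ} (hq : ∀ i j, Holo (q i j) (π W)) :
    Represents ((frame hW h).quad fun i j => ofBase W (q i j)) (lift₁ (quadForm R q)) := by
  rw [represents_iff]; intro j
  simp only [Frame.quad, map_sum, map_mul, evalJet_ofBase (hq _ _), evalJet_p]
  rfl

theorem evalJet_x (hW : IsOpen W) (ℓ : ℕ) (α : Fin n) (j : jetsOver₁ W) :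
    evalJet j ((jetAlgebra hW).x ℓ α) = j.1 ℓ α := (represents_jetCoord ℓ α).evalJet j

theorem jet_one_eq (h : IsCoordinates R V) {j : Jet n} (hj : j ∈ jetsOver V) (α : Fin n) :
    j 1 α = ∑ i, (jacobian R (j 0))⁻¹ α i * Rx R i (j 0, j 1) := by
  have h1 : (fun i => Rx R i (j 0, j 1)) = (jacobian R (j 0)).mulVec (j 1) := rfl
  have h2 : (jacobian R (j 0))⁻¹.mulVec (fun i => Rx R i (j 0, j 1)) = j 1 := by
    rw [h1, Matrix.mulVec_mulVec, h.inv_mul_jacobian hj, Matrix.one_mulVec]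
  exact (congrFun h2 α).symm

/-- Differential polynomials of degree `1` are one-forms. -/
theorem IsDiffPoly.exists_linForm (hf : IsDiffPoly V 1 f)
    (h : IsCoordinates R V) : ∃ ω : Fin n → ℂ^n → ℂ, (∀ i, Holo (ω i) V) ∧
      ∀ j ∈ jetsOver V, f j = lift₁ (linForm R ω) j := by
  obtain ⟨u, hu, he⟩ := hf.exists_degree_one
  refine ⟨fun i v => ∑ α, u α v * (jacobian R v)⁻¹ α i, fun i v hv =>
    analyticAt_fun_sum _ fun α _ => (hu α v hv).mul (h.analytic_inv α i v hv),
    fun j hj => ?_⟩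
  rw [he j hj, lift₁, linForm]
  simp only [sum_mul]
  rw [sum_comm]
  refine sum_ext fun α => ?_
  conv_lhs => rw [jet_one_eq h hj]
  rw [mul_sum]
  exact sum_ext fun i => (mul_assoc _ _ _).symm

theorem sum_comm_four (T : Fin n → Fin n → Fin n → Fin n → ℂ) :
    ∑ i, ∑ k, ∑ α, ∑ β, T i k α β = ∑ α, ∑ β, ∑ i, ∑ k, T i k α β := by
  have h1 : ∀ i, ∑ k, ∑ α, ∑ β, T i k α β = ∑ α, ∑ β, ∑ k, T i k α β := fun i => by
    rw [sum_comm]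
    exact sum_ext fun α => sum_comm
  simp only [h1]
  rw [sum_comm]
  exact sum_ext fun α => sum_comm

/-- The functionals with differential polynomial densities of degree `2` are the quadratic
forms. -/
theorem IsDiffPoly.exists_quadForm (hV : IsOpen V) (hf : IsDiffPoly V 2 f)
    (h : IsCoordinates R V) : ∃ q : Fin n → Fin n → ℂ^n → ℂ,
      (∀ i j, Holo (q i j) V) ∧ (∀ i j, q i j = q j i) ∧
      EqFunctionalOn (jetsOver V) f (lift₁ (quadForm R q)) ∧
      ∃ a : jetFunctions (V ×ˢ Set.univ), Represents a f := by
  obtain ⟨s, t, hs, ht, he⟩ := hf.exists_degree_two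
  have hW : IsOpen (V ×ˢ (Set.univ : Set ℂ^n)) := hV.prod isOpen_univ
  have hfst : π (V ×ˢ (Set.univ : Set ℂ^n)) = V := Set.fst_image_prod V ⟨0, trivial⟩
  have h' : IsCoordinates R (π (V ×ˢ (Set.univ : Set ℂ^n))) := by rwa [hfst]
  set W := V ×ˢ (Set.univ : Set ℂ^n)
  set X := (jetAlgebra hW).x with hX
  -- integration by parts of the terms with `v_xx`
  set s' : Fin n → Fin n → ℂ^n → ℂ := fun α β v => s α β v - pd β (t α) v with hs'
  have as' : ∀ α β, Holo (s' α β) V := fun α β => (hs α β).sub (analytic_pd (ht α) β)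
  set q₀ : Fin n → Fin n → ℂ^n → ℂ := fun i k v =>
    ∑ α, ∑ β, s' α β v * (jacobian R v)⁻¹ α i * (jacobian R v)⁻¹ β k with hq₀
  have aq₀ : ∀ i k, Holo (q₀ i k) V := fun i k v hv =>
    analyticAt_fun_sum _ fun α _ => analyticAt_fun_sum _ fun β _ =>
      ((as' α β v hv).mul (h.analytic_inv α i v hv)).mul (h.analytic_inv β k v hv)
  set q : Fin n → Fin n → ℂ^n → ℂ := fun i k v => 1 / 2 * (q₀ i k v + q₀ k i v) with hq
  have aq : ∀ i k, Holo (q i k) V := fun i k => analyticOnNhd_const.mul ((aq₀ i k).add (aq₀ k i))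
  have aq' := fun i k => hfst.symm ▸ aq i k
  have as := fun α β => hfst.symm ▸ hs α β
  have at' := fun α => hfst.symm ▸ ht α
  set a : jetFunctions W := ∑ α, ∑ β, ofBase W (s α β) * X 1 α * X 1 β +
    ∑ α, ofBase W (t α) * X 2 α with ha
  have ra : Represents a f := by
    rw [represents_iff]; intro j
    rw [he j (by rw [jetsOver_eq]; exact j.2)]
    simp only [ha, map_add, map_sum, map_mul, evalJet_ofBase (as _ _), evalJet_ofBase (at' _)]
    simp only [hX, evalJet_x]
  refine ⟨q, aq, fun i k => by funext v; simp only [hq]; ring, ?_, a, ra⟩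
  rw [jetsOver_eq, eqFunctionalOn_iff hW ra (represents_quad hW h' aq')]
  have hD : (jetAlgebra hW).D (∑ α, ofBase W (t α) * X 1 α) = ∑ α, ofBase W (t α) * X 2 α +
      ∑ α, ∑ β, ofBase W (pd β (t α)) * X 1 α * X 1 β := by
    rw [map_sum, ← sum_add_distrib]
    refine sum_ext fun α => ?_
    have h1 : (jetAlgebra hW).D (ofBase W (t α)) = ∑ β, X 1 β * ofBase W (pd β (t α)) :=
      (vf_ordLT_one _ (ord_ofBase hW (at' α))).trans
        (sum_ext fun β => by rw [d_zero_ofBase hW (at' α)])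
    rw [leibniz, smul_eq_mul, smul_eq_mul, (jetAlgebra hW).D_x, h1, mul_sum]
    congr 1
    exact sum_ext fun β => by ring
  convert (jetAlgebra hW).D_mem_null (∑ α, ofBase W (t α) * X 1 α) using 1
  rw [hD, ha]
  have hquad : (frame hW h').quad (fun i k => ofBase W (q i k)) =
      ∑ α, ∑ β, ofBase W (s α β) * X 1 α * X 1 β -
        ∑ α, ∑ β, ofBase W (pd β (t α)) * X 1 α * X 1 β := by
    refine evalJet_ext fun j => ?_
    have hj : j.1 ∈ jetsOver V := by rw [jetsOver_eq]; exact j.2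
    rw [(represents_quad hW h' aq').evalJet]
    simp only [map_sub, map_sum, map_mul, evalJet_ofBase (as _ _),
      evalJet_ofBase (analytic_pd (at' _) _)]
    simp only [hX, evalJet_x]
    have e1 : lift₁ (quadForm R q₀) j.1 = ∑ α, ∑ β, s' α β (j.1 0) * j.1 1 α * j.1 1 β := by
      have e2 : ∀ α β, s' α β (j.1 0) * j.1 1 α * j.1 1 β = ∑ i, ∑ k, s' α β (j.1 0) *
          (jacobian R (j.1 0))⁻¹ α i * (jacobian R (j.1 0))⁻¹ β k *
            Rx R i (j.1 0, j.1 1) * Rx R k (j.1 0, j.1 1) := by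
        intro α β
        rw [jet_one_eq h hj α, jet_one_eq h hj β, mul_assoc, Finset.sum_mul_sum, mul_sum]
        refine sum_ext fun i => ?_
        rw [mul_sum]
        exact sum_ext fun k => by ring
      simp only [lift₁, quadForm, e2, hq₀, sum_mul]
      exact sum_comm_four _
    have e3 : lift₁ (quadForm R fun i k => q₀ k i) j.1 = lift₁ (quadForm R q₀) j.1 := by
      simp only [lift₁, quadForm]
      rw [sum_comm]
      exact sum_ext₂ fun i k => mul_right_comm _ _ _
    calc lift₁ (quadForm R q) j.1 = 1 / 2 * (lift₁ (quadForm R q₀) j.1 +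
          lift₁ (quadForm R fun i k => q₀ k i) j.1) := by
          simp only [lift₁, quadForm, hq, mul_sum, ← sum_add_distrib]
          exact sum_ext₂ fun i k => by ring
      _ = ∑ α, ∑ β, s' α β (j.1 0) * j.1 1 α * j.1 1 β := by rw [e3, e1]; ring
      _ = _ := by simp only [hs', sub_mul, sum_sub_distrib]
  rw [hquad]; ring

end Forms

end

section

variable {f : ℂ^n → ℂ} {μ : Fin n → ℂ^n → ℂ}

/-! ### Velocities of conserved quantities -/

namespace JetAlgebra

/-- In terms of the diagonal metric, the Hessian of the density of a diagonal flow is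
`∑ μ_l g_l⁻¹ dR_l²`. -/
theorem Riemann.hessian_eq (F : S.Riemann η) (hη : η.IsSymm) {f : A} {μ G : Fin n → A}
    (hf : F.Diagonalizes η f μ) (hG : ∀ l, F.metric l l * G l = 1) (β γ : Fin n) :
    S.d 0 β (S.d 0 γ f) = ∑ l, μ l * G l * S.d 0 β (F.R l) * S.d 0 γ (F.R l) := by
  set H : Matrix (Fin n) (Fin n) A := Matrix.of fun γ β => S.d 0 γ (S.d 0 β f) with hH
  have h1 : F.J * Frame.rHess S η f = Matrix.diagonal μ * F.J := (F.diagonalizes_iff η f μ).mp hf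
  have h2 : F.J.transpose * F.Wm.transpose = 1 := by
    rw [← Matrix.transpose_mul, F.Wm_mul_J, Matrix.transpose_one]
  have h3 : F.J * Frame.rHess S η f = F.metric * (F.Wm.transpose * H) := by
    rw [Riemann.metric, Matrix.mul_assoc (F.J * _), ← Matrix.mul_assoc F.J.transpose, h2,
      Matrix.one_mul, Frame.rHess, Matrix.mul_assoc]
  have h4 : Matrix.diagonal G * F.metric = 1 := by
    rw [F.metric_eq_diagonal hη, Matrix.diagonal_mul_diagonal, ← Matrix.diagonal_one]
    congr 1
    funext l
    rw [mul_comm]; exact hG l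
  have h5 : F.Wm.transpose * H = Matrix.diagonal (fun l => G l * μ l) * F.J := by
    rw [h3] at h1
    have := congrArg (Matrix.diagonal G * ·) h1
    rwa [← Matrix.mul_assoc, h4, Matrix.one_mul, ← Matrix.mul_assoc,
      Matrix.diagonal_mul_diagonal] at this
  have h6 : H = F.J.transpose * (Matrix.diagonal (fun l => G l * μ l) * F.J) := by
    rw [← h5, ← Matrix.mul_assoc, h2, Matrix.one_mul]
  have h7 := congrFun (congrFun h6 β) γ
  rw [Matrix.mul_apply] at h7
  simp only [Matrix.diagonal_mul] at h7
  change S.d 0 β (S.d 0 γ f) = _ at h7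
  rw [h7]
  refine sum_ext fun l => ?_
  simp only [Frame.J, Matrix.transpose_apply, Matrix.of_apply]
  ring

namespace Frame

variable (F : S.Frame) (F' : S.Frame)

/-- The chain rule for two systems of coordinates. -/
theorem E_eq_sum (i : Fin n) (a : A) : F'.E i a = ∑ k, F.E k a * F'.E i (F.R k) := by
  simp only [F'.E_apply, mul_sum]
  rw [sum_comm]
  refine sum_ext fun α => ?_
  rw [F.d_zero_eq a α, mul_sum]
  exact sum_ext fun k => by ring

end Frame

namespace Riemann

variable (F : S.Riemann η) (F' : S.Frame) {f : A} {μ G : Fin n → A}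

theorem E_E_density (hη : η.IsSymm) (hf : F.Diagonalizes η f μ)
    (hG : ∀ l, F.metric l l * G l = 1) (i : Fin n) :
    F'.E i (F'.E i f) = ∑ l, μ l * (G l * F'.E i (F.R l) ^ 2) +
      ∑ α, F'.E i (F'.W i α) * S.d 0 α f := by
  have h1 : F'.E i f = ∑ α, F'.W i α * S.d 0 α f := F'.E_apply i f
  have h2 : ∑ α, F'.W i α * F'.E i (S.d 0 α f) = ∑ l, μ l * (G l * F'.E i (F.R l) ^ 2) := by
    have h3 : ∀ α, F'.E i (S.d 0 α f) = ∑ l, μ l * G l * F'.E i (F.R l) * S.d 0 α (F.R l) := by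
      intro α
      simp only [F'.E_apply, F.hessian_eq hη hf hG, mul_sum, sum_mul]
      rw [sum_comm]
      exact sum_ext₂ fun l β => by ring
    simp only [h3, mul_sum]
    rw [sum_comm]
    refine sum_ext fun l => ?_
    have h4 : F'.E i (F.R l) = ∑ α, F'.W i α * S.d 0 α (F.R l) := F'.E_apply i _
    calc _ = μ l * G l * F'.E i (F.R l) * ∑ α, F'.W i α * S.d 0 α (F.R l) := by
          rw [mul_sum]
          exact sum_ext fun α => by ring
      _ = _ := by rw [← h4]; ring
  rw [← h2]
  conv_lhs => rw [h1]
  rw [map_sum, ← sum_add_distrib]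
  refine sum_ext fun α => ?_
  rw [leibniz, smul_eq_mul, smul_eq_mul]; ring

variable (ev : A →ₐ[ℂ] ℂ)

theorem ev_d_zero (h : ∀ i, ev (F'.E i f) = 0) (α : Fin n) : ev (S.d 0 α f) = 0 := by
  rw [F'.d_zero_eq f α, map_sum]
  exact sum_eq_zero fun i _ => by rw [map_mul, h, zero_mul]

/-- At a critical point of the density, its second derivatives along the coordinate curves of any
coordinate system are determined by the velocities. -/
theorem ev_second (hη : η.IsSymm) (hf : F.Diagonalizes η f μ)
    (hG : ∀ l, F.metric l l * G l = 1) (h : ∀ i, ev (F'.E i f) = 0) (i : Fin n) :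
    ev (F'.E i (F'.E i f)) = ∑ l, ev (G l) * ev (F'.E i (F.R l)) ^ 2 * ev (μ l) := by
  rw [F.E_E_density F' hη hf hG, map_add, map_sum, map_sum]
  have h1 : ∑ α, ev (F'.E i (F'.W i α) * S.d 0 α f) = 0 :=
    sum_eq_zero fun α _ => by rw [map_mul, ev_d_zero F' ev h, mul_zero]
  rw [h1, add_zero]
  exact sum_ext fun l => by rw [map_mul, map_mul, map_pow]; ring

/-- At a point where the first and second derivatives of the density vanish, its third derivatives
along the coordinate curves are determined by the derivatives `∂_l μ_l` of the velocities. -/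
theorem ev_third (hη : η.IsSymm) (hf : F.Diagonalizes η f μ)
    (hG : ∀ l, F.metric l l * G l = 1) (h : ∀ i, ev (F'.E i f) = 0) (hμ : ∀ l, ev (μ l) = 0)
    (i : Fin n) : ev (F'.E i (F'.E i (F'.E i f))) =
      ∑ l, ev (G l) * ev (F'.E i (F.R l)) ^ 3 * ev (F.E l (μ l)) := by
  have hd := ev_d_zero F' ev h
  have hE : ∀ l, ev (F'.E i (μ l)) = ev (F.E l (μ l)) * ev (F'.E i (F.R l)) := by
    intro l
    rw [F.E_eq_sum F' i (μ l), map_sum, sum_eq_single l]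
    · rw [map_mul]
    · intro k _ hk
      rw [E_vel hf (Ne.symm hk), map_mul, map_mul, map_sub, hμ, hμ, sub_zero, mul_zero, zero_mul]
    · simp
  have hX : ∀ α, ev (F'.E i (S.d 0 α f)) = 0 := by
    intro α
    rw [F'.E_apply, map_sum]
    refine sum_eq_zero fun β _ => ?_
    rw [F.hessian_eq hη hf hG, map_mul, map_sum]
    have : ∑ l, ev (μ l * G l * S.d 0 β (F.R l) * S.d 0 α (F.R l)) = 0 :=
      sum_eq_zero fun l _ => by rw [map_mul, map_mul, map_mul, hμ]; ring
    rw [this, mul_zero]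
  rw [F.E_E_density F' hη hf hG, map_add, map_sum, map_sum, map_add, map_sum, map_sum]
  have h1 : ∑ α, ev (F'.E i (F'.E i (F'.W i α) * S.d 0 α f)) = 0 := sum_eq_zero fun α _ => by
      rw [leibniz, map_add, smul_eq_mul, smul_eq_mul, map_mul, map_mul, hX, hd]; ring
  rw [h1, add_zero]
  refine sum_ext fun l => ?_
  rw [leibniz, map_add, smul_eq_mul, smul_eq_mul, map_mul ev, map_mul ev, hμ, hE,
    map_mul ev, map_pow]
  ring

end Riemann

end JetAlgebra

section Velocities

open JetAlgebra IsDiagonal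

/-- The pairs `(v, v_x)` with `v ∈ V`. -/
abbrev cylinder (V : Set ℂ^n) : Set (ℂ^n × ℂ^n) := V ×ˢ Set.univ

theorem isOpen_cylinder (hV : IsOpen V) : IsOpen (cylinder V) := hV.prod isOpen_univ

theorem fst_cylinder (V : Set ℂ^n) : π (cylinder V) = V := Set.fst_image_prod V ⟨0, trivial⟩

theorem fst_cylinder_subset (V : Set ℂ^n) : π (cylinder V) ⊆ V := (fst_cylinder V).le

theorem subset_fst_cylinder (V : Set ℂ^n) : V ⊆ π (cylinder V) := (fst_cylinder V).ge

theorem IsConservationLaw.mono (h : IsConservationLaw η h₀ V f)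
    (hV : V' ⊆ V) : IsConservationLaw η h₀ V' f :=
  ⟨h.1.mono hV, h.2.mono fun _ hj => hV hj⟩

theorem IsConservationLaw.mem_null (hW : IsOpen W) (hd : IsDiagonal η h₀ R lam (π W))
    (h : IsConservationLaw η h₀ (π W) f) :
    (jetAlgebra hW).br η (ofBase W h₀) (ofBase W f) ∈ (jetAlgebra hW).null := by
  rw [← eqFunctionalOn_zero_iff hW
    ((represents_ofBase hd.analytic).bracket hW η (represents_ofBase h.1))]
  exact h.2.mono fun j hj => jetsOver₁_base hj

/-- The flow of a conservation law is diagonal in the Riemann invariants. -/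
theorem exists_velocities (hη : η.IsSymm) (hV : IsOpen V) (hd : IsDiagonal η h₀ R lam V)
    (hf : IsConservationLaw η h₀ V f) :
    ∃ μ, HasVelocities η R V f μ := by
  have hW := isOpen_cylinder hV
  have hd' := hd.mono (fst_cylinder_subset V)
  have hf' := hf.mono (fst_cylinder_subset V)
  obtain ⟨μ, oμ, hμ⟩ := (riemann hW hd').exists_diagonalizes hη (ord_ofBase hW hf'.1)
    (hf'.mem_null hW hd')
  choose u hu hue using fun i => exists_ofBase_eq hW convex_univ ⟨0, trivial⟩ (oμ i)
  have h1 : (frame hW hd'.coordinates).Diagonalizes η (ofBase _ f)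
      (fun i => ofBase (cylinder V) (u i)) := by
    have : μ = fun i => ofBase (cylinder V) (u i) := funext hue
    rw [← this]; exact hμ
  exact ⟨u, ((diagonalizes_iff hW hd'.coordinates hf'.1 fun i =>
    (hu i).mono (fst_cylinder_subset V)).mp h1).mono (subset_fst_cylinder V)⟩

theorem HasVelocities.diagonalizes (hW : IsOpen W)
    (hd : IsDiagonal η h₀ R lam (π W)) (hf : Holo f (π W)) (hμ : HasVelocities η R (π W) f μ) :
    (riemann hW hd).Diagonalizes η (ofBase W f) fun i => ofBase W (μ i) :=
  (diagonalizes_iff hW hd.coordinates hf hμ.analytic).mpr hμ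

theorem HasVelocities.add (hV : IsOpen V) {g : ℂ^n → ℂ}
    {ν : Fin n → ℂ^n → ℂ} (hf : Holo f V) (hg : Holo g V)
    (hμ : HasVelocities η R V f μ) (hν : HasVelocities η R V g ν) :
    HasVelocities η R V (f + g) (μ + ν) := by
  refine ⟨fun i => (hμ.analytic i).add (hν.analytic i), fun v hv i β => ?_⟩
  have h1 : ∀ a b, pd a (pd b (f + g)) v = pd a (pd b f) v + pd a (pd b g) v := by
    intro a b
    have h0 : ∀ x ∈ V, pd b (f + g) x = pd b f x + pd b g x := fun x hx =>
      pd_add (hf x hx).differentiableAt (hg x hx).differentiableAt b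
    rw [pd_congr hV h0 a hv]
    exact pd_add (analytic_pd hf b v hv).differentiableAt (analytic_pd hg b v hv).differentiableAt a
  have h2 : ∀ α, raisedHessian η (f + g) v α β =
      raisedHessian η f v α β + raisedHessian η g v α β := fun α => by
    simp only [raisedHessian, Matrix.mul_apply, Matrix.of_apply, h1, mul_add, sum_add_distrib]
  simp only [h2, add_mul, sum_add_distrib, Pi.add_apply]
  rw [hμ.eq v hv, hν.eq v hv]

theorem IsConservationLaw.add (hV : IsOpen V) (hd : Holo h₀ V)
    {g : ℂ^n → ℂ} (hf : IsConservationLaw η h₀ V f) (hg : IsConservationLaw η h₀ V g) :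
    IsConservationLaw η h₀ V (f + g) := by
  refine ⟨hf.1.add hg.1, ?_⟩
  have hW := isOpen_cylinder hV
  have rh := represents_ofBase (hd.mono (fst_cylinder_subset V))
  have rf := represents_ofBase (hf.1.mono (fst_cylinder_subset V))
  have rg := represents_ofBase (hg.1.mono (fst_cylinder_subset V))
  have hf2 := hf.2
  have hg2 := hg.2
  rw [jetsOver_eq, eqFunctionalOn_zero_iff hW (rh.bracket hW η rf)] at hf2
  rw [jetsOver_eq, eqFunctionalOn_zero_iff hW (rh.bracket hW η rg)] at hg2
  rw [jetsOver_eq, eqFunctionalOn_zero_iff hW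
    (rh.bracket hW η ((rf.add rg).congr (g := lift₀ (f + g)) fun _ _ => rfl)), br_add_right]
  exact add_mem hf2 hg2

/-- A density whose flow has pairwise distinct velocities is generic. -/
theorem HasVelocities.isGeneric (hc : IsCoordinates R V) (h : HasVelocities η R V f μ)
    (hμ : ∀ v ∈ V, Function.Injective fun i => μ i v) : IsGeneric η V f := by
  intro v hv
  refine ⟨fun i => μ i v, hμ v hv, fun i => ?_⟩
  have h1 : jacobian R v * raisedHessian η f v =
      Matrix.diagonal (fun i => μ i v) * jacobian R v := by
    ext i β
    rw [Matrix.mul_apply, Matrix.diagonal_mul, jacobian, Matrix.of_apply, ← h.eq v hv]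
    exact sum_ext fun α => mul_comm _ _
  have h2 : raisedHessian η f v * (jacobian R v)⁻¹ =
      (jacobian R v)⁻¹ * Matrix.diagonal fun i => μ i v := by
    calc raisedHessian η f v * (jacobian R v)⁻¹ =
        (jacobian R v)⁻¹ * (jacobian R v * raisedHessian η f v) * (jacobian R v)⁻¹ := by
          rw [← Matrix.mul_assoc, hc.inv_mul_jacobian hv, Matrix.one_mul]
      _ = _ := by
          rw [h1, Matrix.mul_assoc, Matrix.mul_assoc, hc.jacobian_mul_inv hv, Matrix.mul_one]
  refine Module.End.hasEigenvalue_of_hasEigenvector (x := (jacobian R v)⁻¹.col i) ⟨?_, ?_⟩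
  · rw [Module.End.mem_eigenspace_iff, Matrix.toLin'_apply]
    funext α
    have h3 := congrFun (congrFun h2 α) i
    rw [Matrix.mul_diagonal, Matrix.mul_apply] at h3
    simp only [Matrix.mulVec, dotProduct, Matrix.col_apply, Pi.smul_apply, smul_eq_mul]
    rw [h3, mul_comm]
  · intro h0
    have h3 := congrFun (congrFun (hc.jacobian_mul_inv hv) i) i
    rw [Matrix.mul_apply, Matrix.one_apply_eq] at h3
    have h4 : ∀ α, (jacobian R v)⁻¹ α i = 0 := fun α => congrFun h0 α
    simp [h4] at h3

end Velocities

end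

/-! ### Conserved quantities with prescribed velocities -/

section Existence

open JetAlgebra IsDiagonal Filter Topology Metric

variable {r : Fin n → ℂ^n → ℂ}

theorem exists_coordinates (hr : ∀ i, AnalyticAt ℂ (r i) p) (hd : (jacobian r p).det ≠ 0) :
    ∃ N, IsOpen N ∧ p ∈ N ∧ IsCoordinates r N := by
  have h1 : ∀ᶠ v in 𝓝 p, ∀ i, AnalyticAt ℂ (r i) v :=
    eventually_all.mpr fun i => (hr i).eventually_analyticAt
  have h2 : ContinuousAt (fun v => (jacobian r v).det) p :=
    (analyticAt_det fun i α => analytic_pd (s := {p}) (fun v hv => by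
      rw [Set.mem_singleton_iff.mp hv]; exact hr i) α p rfl).continuousAt
  obtain ⟨N, hN, hNo, hp⟩ := _root_.eventually_nhds_iff.mp (h1.and (h2.eventually_ne hd))
  exact ⟨N, hNo, hp, fun i v hv => (hN v hv).1 i, fun v hv => (hN v hv).2⟩

/-- Differentiation along the coordinate curve through the centre of a chart. -/
theorem IsChart.pdR_axis {ρ : ℝ} {Ψ : ℂ^n → ℂ^n} (h : IsChart r p V ρ Ψ)
    {f : ℂ^n → ℂ} (hf : Holo f V) {G G' : ℂ → ℂ}
    (hG : ∀ t, ‖t‖ < ρ → f (Ψ (Pi.single i t)) = G t)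
    (hG' : ∀ t, HasDerivAt G (G' t) t) :
    ∀ t, ‖t‖ < ρ → pdR r i f (Ψ (Pi.single i t)) = G' t := by
  intro t ht
  have hx : (Pi.single i t : ℂ^n) ∈ ball 0 ρ := by rwa [mem_ball_zero_iff, Pi.norm_single]
  have h1 : HasDerivAt (fun t : ℂ => (Pi.single i t : ℂ^n)) (Pi.single i 1) t := by
    have := hasDerivAt_update (𝕜 := ℂ) (0 : ℂ^n) i t
    exact this
  have h2 := ((h.differentiableOn_comp_inv hf).differentiableAt
    (isOpen_ball.mem_nhds hx)).hasFDerivAt.comp_hasDerivAt t h1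
  have h3 : ((fun y => f (Ψ y)) ∘ fun t : ℂ => (Pi.single i t : ℂ^n)) =ᶠ[𝓝 t] G := by
    have : ∀ᶠ s : ℂ in 𝓝 t, ‖s‖ < ρ := continuous_norm.continuousAt.eventually_lt_const ht
    exact this.mono fun s hs => hG s hs
  rw [← h.pd_comp_inv hx (hf _ (h.inv_mem _ hx)).differentiableAt]
  exact (h2.congr_of_eventuallyEq h3.symm).unique (hG' t)

/-- An integrable system has conserved densities with a critical point at `p` and prescribed second
and third derivatives along some coordinate curves through `p`. -/
theorem IsIntegrable.exists_law (h : IsIntegrable η h₀ U) (hp : p ∈ U) :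
    ∃ r N, IsOpen N ∧ p ∈ N ∧ IsCoordinates r N ∧ ∀ c d : ℂ^n, ∃ V f,
      IsOpen V ∧ p ∈ V ∧ V ⊆ U ∧ V ⊆ N ∧ IsConservationLaw η h₀ V f ∧
      (∀ i, pdR r i f p = 0) ∧ (∀ i, pdR r i (pdR r i f) p = c i) ∧
      ∀ i, pdR r i (pdR r i (pdR r i f)) p = d i := by
  obtain ⟨r, hr, hdet, hfam⟩ := h p hp
  obtain ⟨N, hN, hpN, hc⟩ := exists_coordinates hr hdet
  refine ⟨r, N, hN, hpN, hc, fun c d => ?_⟩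
  -- prescribe a cubic polynomial without linear term on each coordinate curve
  obtain ⟨V₀, f, hV₀, hpV₀, hV₀U, hf, hfg⟩ := hfam
    (fun i z => c i / 2 * (z - r i p) ^ 2 + d i / 6 * (z - r i p) ^ 3) fun i => by fun_prop
  obtain ⟨V, ρ, Ψ, hch, hVN⟩ := exists_chart (hV₀.inter hN) ⟨hpV₀, hpN⟩
    (hc.mono Set.inter_subset_right)
  have hVV₀ : V ⊆ V₀ := hVN.trans Set.inter_subset_left
  have hfV := hf.1.mono hVV₀
  have hΨ0 : ∀ i, Ψ (Pi.single i 0) = p := fun i => by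
    have := hch.left_inv p hch.mem
    rw [← this]; congr 1
    funext k; simp [centered]
  have h0 : ‖(0 : ℂ)‖ < ρ := by rw [norm_zero]; exact hch.pos
  have e0 : ∀ i t, ‖t‖ < ρ → f (Ψ (Pi.single i t)) = f p + (c i / 2 * t ^ 2 + d i / 6 * t ^ 3) := by
    intro i t ht
    have hx : (Pi.single i t : ℂ^n) ∈ ball 0 ρ := by rwa [mem_ball_zero_iff, Pi.norm_single]
    have h1 : ∀ k, r k (Ψ (Pi.single i t)) - r k p = (Pi.single i t : ℂ^n) k := fun k =>
      congrFun (hch.right_inv _ hx) k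
    have h2 := hfg i _ (hVV₀ (hch.inv_mem _ hx)) fun k hk => by
      have := h1 k
      rwa [Pi.single_eq_of_ne hk, sub_eq_zero] at this
    have h3 := h1 i
    rw [Pi.single_eq_same] at h3
    rw [h3] at h2
    linear_combination h2
  have d1 : ∀ i t, HasDerivAt (fun t => f p + (c i / 2 * t ^ 2 + d i / 6 * t ^ 3))
      (c i * t + d i / 2 * t ^ 2) t := fun i t => by
    have := (((hasDerivAt_pow 2 t).const_mul (c i / 2)).add
      ((hasDerivAt_pow 3 t).const_mul (d i / 6))).const_add (f p)
    exact this.congr_deriv (by push_cast; ring)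
  have d2 : ∀ i t, HasDerivAt (fun t => c i * t + d i / 2 * t ^ 2) (c i + d i * t) t :=
    fun i t => by
    have := ((hasDerivAt_id t).const_mul (c i)).add ((hasDerivAt_pow 2 t).const_mul (d i / 2))
    exact this.congr_deriv (by push_cast; ring)
  have d3 : ∀ i t, HasDerivAt (fun t => c i + d i * t) (d i) t := fun i t => by
    have := ((hasDerivAt_id t).const_mul (d i)).const_add (c i)
    exact this.congr_deriv (by ring)
  have e1 := fun i => hch.pdR_axis hfV (e0 i) (d1 i)
  have e2 := fun i => hch.pdR_axis (hch.coordinates.analytic_pdR i hfV) (e1 i) (d2 i)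
  have e3 := fun i => hch.pdR_axis (hch.coordinates.analytic_pdR i
    (hch.coordinates.analytic_pdR i hfV)) (e2 i) (d3 i)
  refine ⟨V, f, hch.isOpen, hch.mem, hVV₀.trans hV₀U, hVN.trans Set.inter_subset_right,
    hf.mono hVV₀, fun i => ?_, fun i => ?_, fun i => ?_⟩
  · have := e1 i 0 h0
    rw [hΨ0] at this; rw [this]; ring
  · have := e2 i 0 h0
    rw [hΨ0] at this; rw [this]; ring
  · have := e3 i 0 h0
    rw [hΨ0] at this; rw [this]

/-- The diagonal component `∑ R_{l,α} η^{αβ} R_{l,β}` of the metric. -/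
def metricAt (η : Matrix (Fin n) (Fin n) ℂ) (R : Fin n → ℂ^n → ℂ) (l : Fin n)
    (v : ℂ^n) : ℂ := ∑ β, (∑ α, pd α (R l) v * η α β) * pd β (R l) v

theorem analytic_metricAt (hc : IsCoordinates R V) (l : Fin n) :
    Holo (metricAt η R l) V := fun v hv =>
  analyticAt_fun_sum _ fun β _ => (analyticAt_fun_sum _ fun α _ =>
    (analytic_pd (hc.analytic l) α v hv).mul analyticAt_const).mul
      (analytic_pd (hc.analytic l) β v hv)

theorem metric_eq_ofBase (hW : IsOpen W) (hd : IsDiagonal η h₀ R lam (π W)) (l : Fin n) :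
    (riemann hW hd).metric l l = ofBase W (metricAt η R l) := by
  refine evalJet_ext fun j => ?_
  have h1 : ∀ α, (jetAlgebra hW).d 0 α ((riemann hW hd).R l) = ofBase W (pd α (R l)) := fun α =>
    d_zero_ofBase hW (hd.coordinates.analytic l) α
  rw [evalJet_ofBase (analytic_metricAt hd.coordinates l)]
  simp only [Riemann.metric, Matrix.mul_apply, Frame.J, Matrix.of_apply, Matrix.map_apply,
    Matrix.transpose_apply, h1, map_sum, map_mul,
    evalJet_ofBase (analytic_pd (hd.coordinates.analytic l) _), metricAt]
  rfl

theorem metricAt_ne_zero (hη : η.IsSymm) (hη' : η.det ≠ 0) (hV : IsOpen V)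
    (hd : IsDiagonal η h₀ R lam V) (hv : v ∈ V) (l : Fin n) :
    metricAt η R l v ≠ 0 := by
  have hd' := hd.mono (fst_cylinder_subset V)
  have hW := isOpen_cylinder hV
  have h1 := (riemann hW hd').isUnit_metric hη hη' l
  rw [metric_eq_ofBase] at h1
  have hj : shortJet (v, 0) ∈ jetsOver₁ (cylinder V) := shortJet_mem.mpr ⟨hv, trivial⟩
  have h2 := h1.map (evalJet ⟨shortJet (v, 0), hj⟩)
  rw [evalJet_ofBase (analytic_metricAt hd'.coordinates l)] at h2
  exact h2.ne_zero

/-- The second and third derivatives of a conserved density along coordinate curves, at a critical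
point, in terms of the velocities. -/
theorem HasVelocities.derivatives (hη : η.IsSymm) (hη' : η.det ≠ 0) (hV : IsOpen V) (hp : p ∈ V)
    (hd : IsDiagonal η h₀ R lam V) (hr : IsCoordinates r V) {f : ℂ^n → ℂ}
    (hf : Holo f V) {μ : Fin n → ℂ^n → ℂ} (hμ : HasVelocities η R V f μ)
    (h : ∀ i, pdR r i f p = 0) :
    (∀ i, pdR r i (pdR r i f) p = ∑ l, (metricAt η R l p)⁻¹ * pdR r i (R l) p ^ 2 * μ l p) ∧
    ((∀ l, μ l p = 0) → ∀ i, pdR r i (pdR r i (pdR r i f)) p =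
      ∑ l, (metricAt η R l p)⁻¹ * pdR r i (R l) p ^ 3 * pdR R l (μ l) p) := by
  have hs := fst_cylinder_subset V
  have hW := isOpen_cylinder hV
  have hd' := hd.mono hs
  have hr' := hr.mono hs
  have hf' := hf.mono hs
  have hμ' := hμ.mono hs
  set F := riemann hW hd' with hF
  set F' := frame hW hr'
  set j : jetsOver₁ (cylinder V) := ⟨shortJet (p, 0), shortJet_mem.mpr ⟨hp, trivial⟩⟩ with hj
  choose G hG using fun l => (F.isUnit_metric hη hη' l).exists_right_inv
  have hGe : ∀ l, evalJet j (G l) = (metricAt η R l p)⁻¹ := fun l => by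
    have h1 := congrArg (evalJet j) (hG l)
    rw [hF, metric_eq_ofBase, map_mul, evalJet_ofBase (analytic_metricAt hd'.coordinates l),
      map_one] at h1
    exact eq_inv_of_mul_eq_one_right h1
  have hE : ∀ i {g : ℂ^n → ℂ} (_ : Holo g (π (cylinder V))),
      F'.E i (ofBase _ g) = ofBase _ (pdR r i g) := fun i _ hg => frame_E_ofBase hW hr' i hg
  have a1 := fun i => hr'.analytic_pdR i hf'
  have a2 := fun i => hr'.analytic_pdR i (a1 i)
  have a3 := fun i => hr'.analytic_pdR i (a2 i)
  have hR : ∀ i l, evalJet j (F'.E i (F.R l)) = pdR r i (R l) p := fun i l => by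
    have h1 : F.R l = ofBase _ (R l) := rfl
    rw [h1, hE i (hd'.coordinates.analytic l),
      evalJet_ofBase (hr'.analytic_pdR i (hd'.coordinates.analytic l))]
    rfl
  have h0 : ∀ i, evalJet j (F'.E i (ofBase _ f)) = 0 := fun i => by
    rw [hE i hf', evalJet_ofBase (a1 i)]; exact h i
  have hdiag := hμ'.diagonalizes hW hd' hf'
  constructor
  · intro i
    have h1 := F.ev_second F' (evalJet j) hη hdiag hG h0 i
    rw [hE i hf', hE i (a1 i), evalJet_ofBase (a2 i)] at h1
    simp only [hGe, hR, evalJet_ofBase (hμ'.analytic _)] at h1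
    exact h1
  · intro hz i
    have h1 := F.ev_third F' (evalJet j) hη hdiag hG h0
      (fun l => by rw [evalJet_ofBase (hμ'.analytic l)]; exact hz l) i
    rw [hE i hf', hE i (a1 i), hE i (a2 i), evalJet_ofBase (a3 i)] at h1
    have h2 : ∀ l, F.E l (ofBase _ (μ l)) = ofBase _ (pdR R l (μ l)) := fun l =>
      frame_E_ofBase hW hd'.coordinates l (hμ'.analytic l)
    simp only [hGe, hR, h2, evalJet_ofBase (hd'.coordinates.analytic_pdR _ (hμ'.analytic _))] at h1
    exact h1

/-- A surjective linear endomorphism of `ℂⁿ` is injective. -/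
theorem eq_of_mulVec_surjective {M : Matrix (Fin n) (Fin n) ℂ}
    (h : ∀ c, ∃ m, M.mulVec m = c) {m m' : ℂ^n} (hm : M.mulVec m = M.mulVec m') :
    m = m' := by
  have h1 : Function.Surjective (Matrix.toLin' M) := fun c => by
    obtain ⟨m, hm⟩ := h c
    exact ⟨m, by rw [Matrix.toLin'_apply, hm]⟩
  exact LinearMap.injective_iff_surjective.mpr h1 (by simpa [Matrix.toLin'_apply] using hm)

/-- An integrable system has, near every point, conserved quantities with prescribed values at this
point of the velocities `μ_i` and of their derivatives `∂_i μ_i`. -/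
theorem IsIntegrable.exists_velocities (hη : η.IsSymm) (hη' : η.det ≠ 0)
    (hd : IsDiagonal η h₀ R lam U) (hint : IsIntegrable η h₀ U) (hp : p ∈ U)
    (m t : ℂ^n) : ∃ V f μ, IsOpen V ∧ p ∈ V ∧ V ⊆ U ∧ IsConservationLaw η h₀ V f ∧
      HasVelocities η R V f μ ∧ (∀ i, μ i p = m i) ∧ ∀ i, pdR R i (μ i) p = t i := by
  obtain ⟨r, N, hN, hpN, hr, hlaw⟩ := hint.exists_law hp
  set M : Matrix (Fin n) (Fin n) ℂ := Matrix.of fun i l =>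
    (metricAt η R l p)⁻¹ * pdR r i (R l) p ^ 2 with hM
  set M' : Matrix (Fin n) (Fin n) ℂ := Matrix.of fun i l =>
    (metricAt η R l p)⁻¹ * pdR r i (R l) p ^ 3 with hM'
  have key : ∀ c d : ℂ^n, ∃ V f μ, IsOpen V ∧ p ∈ V ∧ V ⊆ U ∧ IsConservationLaw η h₀ V f ∧
      HasVelocities η R V f μ ∧ M.mulVec (fun l => μ l p) = c ∧
      ((∀ l, μ l p = 0) → M'.mulVec (fun l => pdR R l (μ l) p) = d) := by
    intro c d
    obtain ⟨V, f, hV, hpV, hVU, hVN, hf, h1, h2, h3⟩ := hlaw c d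
    have hdV := hd.mono hVU
    obtain ⟨μ, hμ⟩ := HamPDE.exists_velocities hη hV hdV hf
    obtain ⟨e2, e3⟩ := hμ.derivatives hη hη' hV hpV hdV (hr.mono hVN) hf.1 h1
    exact ⟨V, f, μ, hV, hpV, hVU, hf, hμ, funext fun i => (e2 i).symm.trans (h2 i),
      fun hz => funext fun i => (e3 hz i).symm.trans (h3 i)⟩
  -- `M` and `M'` are surjective since all derivatives occur, so the derivatives determine the data
  have hsurj : ∀ c, ∃ m, M.mulVec m = c := fun c => by
    obtain ⟨V, f, μ, -, -, -, -, -, h1, -⟩ := key c 0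
    exact ⟨_, h1⟩
  have hzero : ∀ d, ∃ V f μ, IsOpen V ∧ p ∈ V ∧ V ⊆ U ∧ IsConservationLaw η h₀ V f ∧
      HasVelocities η R V f μ ∧ (∀ l, μ l p = 0) ∧
      M'.mulVec (fun l => pdR R l (μ l) p) = d := fun d => by
    obtain ⟨V, f, μ, h1, h2, h3, h4, h5, h6, h7⟩ := key 0 d
    have hz := eq_of_mulVec_surjective hsurj (m' := 0) (by rw [h6, Matrix.mulVec_zero])
    have hz' : ∀ l, μ l p = 0 := fun l => congrFun hz l
    exact ⟨V, f, μ, h1, h2, h3, h4, h5, hz', h7 hz'⟩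
  have hsurj' : ∀ d, ∃ t, M'.mulVec t = d := fun d => by
    obtain ⟨V, f, μ, -, -, -, -, -, -, h1⟩ := hzero d
    exact ⟨_, h1⟩
  -- `f₁` has the right values of the velocities; `f₂`, with velocities `0` at `p`, corrects `∂_i μ_i`
  obtain ⟨V₁, f₁, μ, o1, p1, u1, l1, v1, w1, -⟩ := key (M.mulVec m) 0
  obtain ⟨V₂, f₂, ν, o2, p2, u2, l2, v2, z2, w2⟩ := hzero (M'.mulVec fun i => t i - pdR R i (μ i) p)
  have hm := eq_of_mulVec_surjective hsurj w1
  have ht := eq_of_mulVec_surjective hsurj' w2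
  have s1 : V₁ ∩ V₂ ⊆ V₁ := Set.inter_subset_left
  have s2 : V₁ ∩ V₂ ⊆ V₂ := Set.inter_subset_right
  have hV := o1.inter o2
  refine ⟨V₁ ∩ V₂, f₁ + f₂, μ + ν, hV, ⟨p1, p2⟩, s1.trans u1,
    (l1.mono s1).add hV (hd.analytic.mono (s1.trans u1)) (l2.mono s2),
    (v1.mono s1).add hV (l1.1.mono s1) (l2.1.mono s2) (v2.mono s2), fun i => ?_, fun i => ?_⟩
  · rw [Pi.add_apply, Pi.add_apply, z2, add_zero]; exact congrFun hm i
  · have h1 : pdR R i ((μ + ν) i) p = pdR R i (μ i) p + pdR R i (ν i) p := by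
      simp only [pdR, ← sum_add_distrib, ← mul_add]
      refine sum_ext fun α => ?_
      congr 1
      exact pd_add (v1.analytic i p p1).differentiableAt (v2.analytic i p p2).differentiableAt α
    rw [h1]
    have := congrFun ht i
    rw [this]; ring

end Existence

section

variable {h f b₁ : A} {μ θ : Fin n → A}

namespace JetAlgebra

/-! ### Extensions of conservation laws -/

section Extension

variable (hη : η.IsSymm)
include hη

/-- If `{h, f} = 0` then `{{h, k}, f} + {h, {f, k}} = 0`. -/
theorem br_br_add_mem_null (k : A) (hf : S.br η h f ∈ S.null) :
    S.br η (S.br η h k) f + S.br η h (S.br η f k) ∈ S.null := by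
  have h1 := S.br_br_leibniz hη h f k
  have h2 : S.br η (S.br η h f) k = S.br η 0 k := br_congr (by simpa using hf) (by simp)
  rw [h2, br_zero_left] at h1
  simpa using neg_mem h1

/-- The second order term of the invariance of `{h, f} = 0` under the flow of `k`. -/
theorem second_order_flow (k : A) (hf : S.br η h f ∈ S.null) :
    S.br η h ((1 / 2 : ℂ) • S.br η (S.br η f k) k) + S.br η (S.br η h k) (S.br η f k) +
      S.br η ((1 / 2 : ℂ) • S.br η (S.br η h k) k) f ∈ S.null := by
  have h1 := br_br_add_mem_null hη k hf
  have h2 := S.br_br_leibniz hη (S.br η h k) f k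
  have h3 := S.br_br_leibniz hη h (S.br η f k) k
  have h4 : S.br η (S.br η (S.br η h k) f + S.br η h (S.br η f k)) k = S.br η 0 k :=
    br_congr (by simpa using h1) (by simp)
  rw [br_zero_left, br_add_left] at h4
  have h5 := S.null.smul_mem (-(1 / 2 : ℂ)) (add_mem h2 h3)
  convert h5 using 1
  rw [br_smul_right, br_smul_left]
  rw [eq_neg_of_add_eq_zero_right h4]
  module

/-- The conserved quantities of the normal form: transport by the generator `k`, and a quadratic
term compatible with the quadratic term of the perturbation. -/
theorem second_order_normal_form {k q r b₂ F₁ F₂ : A} (hf : S.br η h f ∈ S.null)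
    (h1 : b₁ - S.br η h k ∈ S.null)
    (h2 : b₂ - (q + (1 / 2 : ℂ) • S.br η (S.br η h k) k) ∈ S.null)
    (hF1 : F₁ - S.br η f k ∈ S.null)
    (hF2 : F₂ - (r + (1 / 2 : ℂ) • S.br η (S.br η f k) k) ∈ S.null) :
    (S.br η b₁ f + S.br η h F₁ ∈ S.null) ∧
      (S.br η h F₂ + S.br η b₁ F₁ + S.br η b₂ f ∈ S.null ↔ S.br η q f + S.br η h r ∈ S.null) := by
  have z : ∀ a : A, a - a ∈ S.null := fun a => by simp
  rw [br_congr h1 (z f), br_congr (z h) hF1, br_congr (z h) hF2, br_congr h1 hF1, br_congr h2 (z f)]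
  refine ⟨br_br_add_mem_null hη k hf, ?_⟩
  have h3 := second_order_flow hη k hf
  rw [br_add_left, br_add_right, ← Submodule.sub_mem_iff_left _ h3]
  have e : ∀ u v w x y : A, u + v + w + (x + y) - (v + w + y) = x + u := fun _ _ _ _ _ => by ring
  rw [e]

end Extension

namespace Frame

variable (F : S.Frame)

theorem quad_smul (c : ℂ) (q : Fin n → Fin n → A) :
    c • F.quad q = F.quad (fun i j => algebraMap ℂ A c * q i j) := by
  simp only [quad, Algebra.smul_def, mul_sum, mul_assoc]

theorem quad_symmetrize (q : Fin n → Fin n → A) :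
    F.quad q = F.quad (fun i j => half A * (q i j + q j i)) := by
  rw [← sub_eq_zero, F.quad_sub]
  apply F.quad_eq_zero
  intro i j
  linear_combination (-(q i j + q j i)) * two_mul_half (A := A)

variable {F} in
/-- `{F₀, K₀}` is the functional of a one-form when the flow of `F₀` is diagonal. -/
theorem Diagonalizes.br_ord_one (hη : η.IsSymm) (h : F.Diagonalizes η f μ) (of : S.OrdLT 1 f) {k : A} (hk : S.OrdLT 1 k) :
    S.br η f k - F.oneForm (fun i => -(μ i * F.E i k)) ∈ S.tot := by
  have h1 := S.br_add_br_mem_tot hη f k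
  have h2 := S.pr_sub_br_mem_tot η k f
  convert add_mem h1 h2 using 1
  rw [F.pr_eq _ hk, Frame.oneForm]
  simp only [h.pr_R of, neg_mul, Finset.sum_neg_distrib]
  have : ∑ i, μ i * F.E i k * F.p i = ∑ i, F.E i k * (μ i * F.p i) := sum_ext fun i => by ring
  rw [this]; ring

/-- The bracket of a one-form with `K₀` is a quadratic Hamiltonian. -/
theorem exists_quad_br_oneForm {ω : Fin n → A} (hω : ∀ i, S.OrdLT 1 (ω i)) {k : A}
    (hk : S.OrdLT 1 k) : ∃ r : Fin n → Fin n → A, (∀ i j, S.OrdLT 1 (r i j)) ∧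
      (∀ i j, r i j = r j i) ∧ S.br η (F.oneForm ω) k - F.quad r ∈ S.null := by
  let m : Fin n → Fin n → A := fun j l =>
    ∑ α, ∑ β, algebraMap ℂ A (η α β) * F.E l (S.d 0 β k) * S.d 0 α (F.R j)
  have om : ∀ j l, S.OrdLT 1 (m j l) := fun j l => OrdLT.sum fun α _ => OrdLT.sum fun β _ =>
    ((S.ordLT_algebraMap 1 _).mul (F.ord_E (hk.d 0 β) l)).mul ((F.ord_R j).d 0 α)
  have hm : ∀ j, S.pr (S.ham η k) (F.R j) = ∑ l, m j l * F.p l := by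
    intro j
    rw [pr, vf_ordLT_one _ (F.ord_R j)]
    simp only [Function.iterate_zero, id, ham, δ_ord_one S hk, F.D_eq (hk.d 0 _), m,
      sum_mul, mul_sum]
    symm
    rw [sum_comm]
    refine sum_ext fun α => ?_
    rw [sum_comm]
    exact sum_ext₂ fun β l => by ring
  let q : Fin n → Fin n → A := fun l i => ∑ j, (F.E j (ω i) - F.E i (ω j)) * m j l
  have oq : ∀ l i, S.OrdLT 1 (q l i) := fun l i => OrdLT.sum fun j _ =>
    ((F.ord_E (hω i) j).sub (F.ord_E (hω j) i)).mul (om j l)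
  refine ⟨fun i j => half A * (q i j + q j i), fun i j => (S.ordLT_algebraMap 1 _).mul
    ((oq i j).add (oq j i)), fun i j => by ring, ?_⟩
  rw [← F.quad_symmetrize]
  have h1 := S.tot_le_null (F.pr_oneForm (S.ham η k) hω)
  have h2 := S.pr_sub_br_mem_null η (F.oneForm ω) k
  convert sub_mem h1 h2 using 1
  rw [sub_sub_sub_cancel_left]
  congr 1
  have e1 : ∑ i, ∑ j, F.E j (ω i) * (S.pr (S.ham η k) (F.R j) * F.p i -
      S.pr (S.ham η k) (F.R i) * F.p j) =
      ∑ i, ∑ j, (F.E j (ω i) - F.E i (ω j)) * (S.pr (S.ham η k) (F.R j) * F.p i) := by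
    simp only [mul_sub, sub_mul, sum_sub_distrib]
    congr 1
    rw [sum_comm]
  rw [e1, quad, sum_comm]
  refine sum_ext fun i => ?_
  simp only [q, hm, sum_mul, mul_sum]
  rw [sum_comm]
  exact sum_ext₂ fun _ _ => by ring

variable {F} in
theorem Diagonalizes.exists_quad_br_br (hη : η.IsSymm) (h : F.Diagonalizes η f μ) (of : S.OrdLT 1 f) (hμ : ∀ i, S.OrdLT 1 (μ i)) {k : A}
    (hk : S.OrdLT 1 k) : ∃ r : Fin n → Fin n → A, (∀ i j, S.OrdLT 1 (r i j)) ∧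
      (∀ i j, r i j = r j i) ∧
      (1 / 2 : ℂ) • S.br η (S.br η f k) k - F.quad r ∈ S.null := by
  have o1 : ∀ i, S.OrdLT 1 (-(μ i * F.E i k)) := fun i => ((hμ i).mul (F.ord_E hk i)).neg
  obtain ⟨r, h1, h2, h3⟩ := F.exists_quad_br_oneForm (η := η) o1 hk
  refine ⟨fun i j => algebraMap ℂ A (1 / 2) * r i j,
    fun i j => (S.ordLT_algebraMap 1 _).mul (h1 i j), fun i j => by simp only [h2 i j], ?_⟩
  rw [← F.quad_smul, ← smul_sub,
    br_congr (S.tot_le_null (h.br_ord_one hη of hk)) (show k - k ∈ S.null by simp)]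
  exact S.null.smul_mem _ h3

end Frame

namespace Riemann

variable (F : S.Riemann η)

/-- The compatibility condition of the first order equation, tested against a conserved quantity
with velocities `μ`. -/
theorem first_order_compat (hη : η.IsSymm) (hf : F.Diagonalizes η f μ)
    (of : S.OrdLT 1 f) (hμ : ∀ i, S.OrdLT 1 (μ i)) {ω : Fin n → A}
    (hω : ∀ i, S.OrdLT 1 (ω i)) (hθ : ∀ i, S.OrdLT 1 (θ i))
    (h : S.br η (F.oneForm ω) f + S.br η F.h₀ (F.oneForm θ) ∈ S.null)
    {k : Fin n → Fin n → A} (hk : ∀ i j, k i j = k j i)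
    (hωk : ∀ i j, i ≠ j → F.E i (ω j) - F.E j (ω i) = (F.lam i - F.lam j) * k i j)
    (hij : i ≠ j) (hil : i ≠ l) (hjl : j ≠ l) :
    ((μ j - μ i) * (F.lam l - F.lam j) - (F.lam j - F.lam i) * (μ l - μ j)) *
      ((F.E l (k i j) + F.a i j * k i l + F.a j i * k j l) -
        (F.E j (k i l) + F.a i l * k i j + F.a l i * k l j)) = 0 := by
  have hθk : ∀ i j, i ≠ j → F.E i (θ j) - F.E j (θ i) = (μ i - μ j) * k i j := by
    intro i j hij
    have h1 := F.first_order hη hf of hμ hω hθ h j i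
    rw [hωk i j hij] at h1
    rw [← sub_eq_zero]
    apply F.eq_zero_of_sub_mul hij
    linear_combination -h1
  have closed : ∀ {ν θ : Fin n → A}, (∀ i j, i ≠ j → F.E j (ν i) = F.a i j * (ν j - ν i)) →
      (∀ i j, i ≠ j → F.E i (θ j) - F.E j (θ i) = (ν i - ν j) * k i j) →
      (ν j - ν i) * (F.E l (k i j) + F.a i j * k i l + F.a j i * k j l) +
      (ν l - ν j) * (F.E i (k j l) + F.a j l * k j i + F.a l j * k l i) +
      (ν i - ν l) * (F.E j (k i l) + F.a i l * k i j + F.a l i * k l j) = 0 := by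
    intro ν θ hν hθ
    have e1 := congrArg (F.E l) (hθ i j hij)
    have e2 := congrArg (F.E i) (hθ j l hjl)
    have e3 := congrArg (F.E j) (hθ l i hil.symm)
    simp only [map_sub, leibniz, smul_eq_mul, hν _ _ hij, hν _ _ hij.symm,
      hν _ _ hil, hν _ _ hil.symm, hν _ _ hjl, hν _ _ hjl.symm] at e1 e2 e3
    have c1 := F.E_comm l i (θ j)
    have c2 := F.E_comm l j (θ i)
    have c3 := F.E_comm i j (θ l)
    rw [hk l i] at e3
    rw [hk l i, hk j i, hk l j]
    linear_combination e1 + e2 + e3 - c1 + c2 - c3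
  have h1 := closed (fun i j hij => E_vel hf hij) hθk
  have h2 := closed (fun i j hij => F.E_lam i j hij) hωk
  linear_combination (F.lam l - F.lam j) * h1 - (μ l - μ j) * h2

/-- The first order term of a conserved quantity of a perturbation with `H₁ = {H₀, K₀}` is
`{F₀, K₀}`. -/
theorem first_order_unique (hη : η.IsSymm) {k : A} (hf : F.Diagonalizes η f μ) (of : S.OrdLT 1 f) (hμ : ∀ i, S.OrdLT 1 (μ i))
    (hfh : S.br η F.h₀ f ∈ S.null) (hk : S.OrdLT 1 k)
    (h1 : b₁ - S.br η F.h₀ k ∈ S.null) (hθ : ∀ i, S.OrdLT 1 (θ i))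
    (h : S.br η b₁ f + S.br η F.h₀ (F.oneForm θ) ∈ S.null) :
    F.oneForm θ - S.br η f k ∈ S.null := by
  have o1 : ∀ i, S.OrdLT 1 (-(μ i * F.E i k)) := fun i => ((hμ i).mul (F.ord_E hk i)).neg
  have e1 := S.tot_le_null (hf.br_ord_one hη of hk)
  rw [br_congr h1 (show f - f ∈ S.null by simp)] at h
  have h2 := br_br_add_mem_null hη k hfh
  rw [br_congr (show F.h₀ - F.h₀ ∈ S.null by simp) e1] at h2
  have h3 := sub_mem h h2
  rw [add_sub_add_left_eq_sub] at h3
  have h4 : S.br η (F.oneForm fun _ => 0) f + S.br η F.h₀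
      (F.oneForm fun i => θ i - -(μ i * F.E i k)) ∈ S.null := by
    rw [← F.oneForm_sub]
    have e2 : F.oneForm (fun _ => (0 : A)) = 0 := by simp [Frame.oneForm]
    rw [e2, br_zero_left, zero_add]
    have e3 : S.br η F.h₀ (F.oneForm θ - F.oneForm fun i => -(μ i * F.E i k)) =
        S.br η F.h₀ (F.oneForm θ) - S.br η F.h₀ (F.oneForm fun i => -(μ i * F.E i k)) := by
      have := S.br_add_right η F.h₀ (F.oneForm θ - F.oneForm fun i => -(μ i * F.E i k))
        (F.oneForm fun i => -(μ i * F.E i k))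
      rw [sub_add_cancel] at this
      rw [this, add_sub_cancel_right]
    rw [e3]; exact h3
  have h5 : F.oneForm (fun i => θ i - -(μ i * F.E i k)) ∈ S.null := by
    rw [F.oneForm_mem_null_iff fun i => (hθ i).sub (o1 i)]
    intro i j
    have := F.first_order hη hf of hμ (fun _ => fun _ _ _ => map_zero _)
      (fun i => (hθ i).sub (o1 i)) h4 i j
    by_cases hij : i = j
    · subst hij; rfl
    rw [← sub_eq_zero]
    apply F.eq_zero_of_sub_mul (Ne.symm hij)
    rw [map_zero, map_zero, sub_zero, mul_zero] at this
    exact this.symm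
  rw [← F.oneForm_sub] at h5
  have := sub_mem h5 e1
  convert this using 1
  ring

/-- The second order condition for the extension of a conservation law, reduced to the quadratic
part `q` of the perturbation. -/
theorem second_order (hη : η.IsSymm) {k b₂ : A} (hf : F.Diagonalizes η f μ) (of : S.OrdLT 1 f) (hμ : ∀ i, S.OrdLT 1 (μ i))
    (hfh : S.br η F.h₀ f ∈ S.null) (hk : S.OrdLT 1 k)
    (h1 : b₁ - S.br η F.h₀ k ∈ S.null) {q : Fin n → Fin n → A}
    (h2 : b₂ - (F.quad q + (1 / 2 : ℂ) • S.br η (S.br η F.h₀ k) k) ∈ S.null)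
    (hθ : ∀ i, S.OrdLT 1 (θ i)) {t : Fin n → Fin n → A}
    (ht : ∀ i j, S.OrdLT 1 (t i j)) (hts : ∀ i j, t i j = t j i)
    (e1 : S.br η b₁ f + S.br η F.h₀ (F.oneForm θ) ∈ S.null)
    (e2 : S.br η F.h₀ (F.quad t) + S.br η b₁ (F.oneForm θ) + S.br η b₂ f ∈ S.null) :
    ∃ r : Fin n → Fin n → A, (∀ i j, S.OrdLT 1 (r i j)) ∧ (∀ i j, r i j = r j i) ∧
      S.br η (F.quad q) f + S.br η F.h₀ (F.quad r) ∈ S.null := by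
  obtain ⟨u, hu, hus, h3⟩ := hf.exists_quad_br_br hη of hμ hk
  refine ⟨fun i j => t i j - u i j, fun i j => (ht i j).sub (hu i j),
    fun i j => by simp only [hts i j, hus i j], ?_⟩
  have h4 := F.first_order_unique hη hf of hμ hfh hk h1 hθ e1
  refine ((second_order_normal_form hη hfh h1 h2 h4 (F₂ := F.quad t) ?_).2).mp e2
  rw [← F.quad_sub]
  convert neg_mem h3 using 1
  ring

/-- The second order condition on a perturbation whose quadratic part has diagonal coefficients
`-c_i λ_{i,i}` and off-diagonal coefficients `(λ_i - λ_k) s_ik`. -/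
theorem second_order_stdQuad (hη : η.IsSymm) (hf : F.Diagonalizes η f μ) (of : S.OrdLT 1 f) (hμ : ∀ i, S.OrdLT 1 (μ i))
    (hu : ∀ i, IsUnit (F.E i (F.lam i))) {c : Fin n → A} {s : Fin n → Fin n → A}
    (oc : ∀ i, S.OrdLT 1 (c i)) (os : ∀ i k, S.OrdLT 1 (s i k)) (hs : ∀ i k, s i k = - s k i)
    {r : Fin n → Fin n → A} (hr : ∀ i j, S.OrdLT 1 (r i j)) (hrs : ∀ i j, r i j = r j i)
    (h : S.br η (F.quad (F.stdQuad F.lam c s)) f + S.br η F.h₀ (F.quad r) ∈ S.null) :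
    (∀ i k, i ≠ k →
      F.E k (c i) * (F.E i (F.lam i) * (μ k - μ i) - F.E i (μ i) * (F.lam k - F.lam i)) = 0) ∧
    ∀ i j k, i ≠ j → i ≠ k → j ≠ k → (F.E k (s i j) + F.E i (s j k) + F.E j (s k i)) *
      ((F.lam j - F.lam k) * (μ i - μ k) - (F.lam i - F.lam k) * (μ j - μ k)) = 0 := by
  rw [F.br_quad_add_br_quad_mem_null_iff hη hf F.diagonalizes of F.ord_h₀ hμ F.ord_lam
    (F.ord_stdQuad F.ord_lam oc os) hr (F.stdQuad_symm hs) hrs] at h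
  obtain ⟨hI, hII⟩ := h
  have key : r = F.stdQuad μ c s := by
    funext i j
    by_cases hij : i = j
    · subst hij
      rw [stdQuad, if_pos rfl]
      have h1 := congrArg (2 * ·) (hII i i i)
      simp only [F.two_mul_flowSymm] at h1
      rw [stdQuad, if_pos rfl] at h1
      rw [← sub_eq_zero, ← (hu i).mul_right_eq_zero]
      have h6 : (6 : ℂ) • (F.E i (F.lam i) * (r i i - -(c i * F.E i (μ i)))) = 0 := by
        have h7 : (6 : ℂ) • (F.E i (F.lam i) * (r i i - -(c i * F.E i (μ i)))) =
            6 * (F.E i (F.lam i) * (r i i - -(c i * F.E i (μ i)))) := by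
          rw [Algebra.smul_def, map_ofNat]
        rw [h7]
        linear_combination -h1
      exact (smul_eq_zero_iff_right (by norm_num)).mp h6
    · rw [stdQuad, if_neg hij]
      have h1 := hI i j
      rw [stdQuad, if_neg hij] at h1
      rw [← sub_eq_zero]
      apply F.eq_zero_of_sub_mul hij
      linear_combination h1
  subst key
  constructor
  · intro i k hik
    have h1 := flowSymm_stdQuad_diag hf c hs hik
    rw [hII, sub_self] at h1
    exact neg_eq_zero.mp h1.symm
  · intro i j k hij hik hjk
    have h1 := flowSymm_stdQuad_off_diag hf c (s := s) hij hik hjk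
    rw [hII, sub_self] at h1
    exact h1.symm

end Riemann

end JetAlgebra

end

open JetAlgebra IsDiagonal Filter Topology

variable {h : ℕ → Density n} {k₁ : ℂ^n × ℂ^n → ℂ} {C : Fin n → ℂ → ℂ} {φ : Fin n → ℂ^n → ℂ}
  {L : Fin n → ℂ^n × ℂ^n → ℂ}

/-! ### Necessary conditions for integrability -/

theorem IsDiffPoly.exists_represents {d : ℕ} {f : Density n} (hf : IsDiffPoly V d f)
    (hW : IsOpen W) (hV : π W ⊆ V) :
    ∃ a : jetFunctions W, Represents a f := by
  refine hf.induction ⟨0, represents_zero⟩ ?_ ?_ ?_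
  · rintro f g ⟨a, ha⟩ ⟨b, hb⟩; exact ⟨a + b, ha.add hb⟩
  · rintro f g hfg ⟨a, ha⟩
    exact ⟨a, ha.congr fun j hj => hfg j (hV (jetsOver₁_base hj))⟩
  · intro u m hu _
    refine ⟨ofBase W u * ∏ q ∈ m.support, (jetAlgebra hW).x (q.1 + 1) q.2 ^ m q, ?_⟩
    rw [represents_iff]
    intro j
    simp only [map_mul, map_prod, map_pow, evalJet_ofBase (hu.mono hV), evalJet_x]
    rfl

theorem sum_antidiagonal_one (f : ℕ × ℕ → Density n) :
    ∑ ab ∈ Finset.HasAntidiagonal.antidiagonal 1, f ab = f (0, 1) + f (1, 0) := by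
  simp [Finset.Nat.antidiagonal_succ]

theorem sum_antidiagonal_two (f : ℕ × ℕ → Density n) :
    ∑ ab ∈ Finset.HasAntidiagonal.antidiagonal 2, f ab = f (0, 2) + f (1, 1) + f (2, 0) := by
  simp [Finset.Nat.antidiagonal_succ, add_assoc]

/-- Conserved quantities with prescribed velocities at a point, which are generic and extend to
second order. -/
theorem IsOIntegrable.exists_extension (hη : η.IsSymm) (hη' : η.det ≠ 0)
    (hd : IsDiagonal η h₀ R lam U) (hh₀ : h 0 = lift₀ h₀) (hO : IsOIntegrable 2 η h₀ h U)
    (hp : p ∈ U) (m t : ℂ^n) (hm : Function.Injective m) :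
    ∃ V f μ F₁ F₂, IsOpen V ∧ p ∈ V ∧ V ⊆ U ∧ IsConservationLaw η h₀ V f ∧
      HasVelocities η R V f μ ∧ (∀ i, μ i p = m i) ∧ (∀ i, pdR R i (μ i) p = t i) ∧
      IsDiffPoly V 1 F₁ ∧ IsDiffPoly V 2 F₂ ∧
      EqFunctionalOn (jetsOver V) (bracket η (lift₀ h₀) F₁ + bracket η (h 1) (lift₀ f)) 0 ∧
      EqFunctionalOn (jetsOver V) (bracket η (lift₀ h₀) F₂ + bracket η (h 1) F₁ +
        bracket η (h 2) (lift₀ f)) 0 := by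
  obtain ⟨V, f, μ, hV, hpV, hVU, hf, hμ, hm1, ht⟩ := hO.1.exists_velocities hη hη' hd hp m t
  have hev : ∀ᶠ v in 𝓝 p, Function.Injective fun i => μ i v := by
    have h1 : ∀ i j, i ≠ j → ∀ᶠ v in 𝓝 p, μ i v ≠ μ j v := fun i j hij =>
      (((hμ.analytic i p hpV).sub (hμ.analytic j p hpV)).continuousAt.eventually_ne (by
        change μ i p - μ j p ≠ 0
        rw [hm1, hm1]
        exact sub_ne_zero.mpr fun h => hij (hm h))).mono fun v hv => sub_ne_zero.mp hv
    have h2 : ∀ᶠ v in 𝓝 p, ∀ i j, i ≠ j → μ i v ≠ μ j v :=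
      eventually_all.mpr fun i => eventually_all.mpr fun j => by
        by_cases hij : i = j
        · exact Eventually.of_forall fun v hij' => absurd hij hij'
        · exact (h1 i j hij).mono fun v hv _ => hv
    exact h2.mono fun v hv i j hij => by_contra fun hne => hv i j hne hij
  obtain ⟨N, hN, hNo, hpN⟩ := eventually_nhds_iff.mp hev
  have hVN : V ∩ N ⊆ V := Set.inter_subset_left
  obtain ⟨V', F, hV', hpV', hVV', hF0, hF, hE⟩ := hO.2 (V ∩ N) f (hV.inter hNo) (hVN.trans hVU)
    (hf.mono hVN) ((hμ.mono hVN).isGeneric (hd.coordinates.mono (hVN.trans hVU))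
      fun v hv => hN v hv.2) p ⟨hpV, hpN⟩
  have e1 := hE 1 (by norm_num)
  have e2 := hE 2 le_rfl
  rw [sum_antidiagonal_one, hh₀, hF0] at e1
  rw [sum_antidiagonal_two, hh₀, hF0] at e2
  exact ⟨V', f, μ, F 1, F 2, hV', hpV', hVV'.trans (hVN.trans hVU), hf.mono (hVV'.trans hVN),
    hμ.mono (hVV'.trans hVN), hm1, ht, hF 1, hF 2, e1, e2⟩

/-- The equations for an extended conserved quantity, inside the jet algebra. -/
theorem IsOIntegrable.exists_extension_forms (hη : η.IsSymm) (hη' : η.det ≠ 0)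
    (hd : IsDiagonal η h₀ R lam U) (hh₀ : h 0 = lift₀ h₀) (hO : IsOIntegrable 2 η h₀ h U)
    (hp : p ∈ U) (m t : ℂ^n) (hm : Function.Injective m) :
    ∃ (V : Set ℂ^n) (f : ℂ^n → ℂ) (μ θ : Fin n → ℂ^n → ℂ)
      (q : Fin n → Fin n → ℂ^n → ℂ) (hW : IsOpen (cylinder V))
      (hdV : IsDiagonal η h₀ R lam (π (cylinder V))), p ∈ V ∧ V ⊆ U ∧
      IsConservationLaw η h₀ V f ∧ HasVelocities η R V f μ ∧ (∀ i, μ i p = m i) ∧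
      (∀ i, pdR R i (μ i) p = t i) ∧ (∀ i, Holo (θ i) V) ∧
      (∀ i j, Holo (q i j) V) ∧ (∀ i j, q i j = q j i) ∧
      (∀ b₁ : jetFunctions (cylinder V), Represents b₁ (h 1) →
        (jetAlgebra hW).br η b₁ (ofBase _ f) + (jetAlgebra hW).br η (riemann hW hdV).h₀
          ((riemann hW hdV).oneForm fun i => ofBase _ (θ i)) ∈ (jetAlgebra hW).null) ∧
      ∀ b₁ b₂ : jetFunctions (cylinder V), Represents b₁ (h 1) → Represents b₂ (h 2) →
        (jetAlgebra hW).br η (riemann hW hdV).h₀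
            ((riemann hW hdV).quad fun i j => ofBase _ (q i j)) +
          (jetAlgebra hW).br η b₁ ((riemann hW hdV).oneForm fun i => ofBase _ (θ i)) +
          (jetAlgebra hW).br η b₂ (ofBase _ f) ∈ (jetAlgebra hW).null := by
  obtain ⟨V, f, μ, F₁, F₂, hV, hpV, hVU, hf, hμ, hm1, ht, hF1, hF2, e1, e2⟩ :=
    hO.exists_extension hη hη' hd hh₀ hp m t hm
  have hW := isOpen_cylinder hV
  have hdV := hd.mono ((fst_cylinder_subset V).trans hVU)
  have hcV := hd.coordinates.mono hVU
  obtain ⟨θ, hθ, e3⟩ := hF1.exists_linForm hcV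
  obtain ⟨q, hq, hqs, e4, a, ra⟩ := hF2.exists_quadForm hV hcV
  have s := fst_cylinder_subset V
  have rθ : Represents ((riemann hW hdV).oneForm fun i => ofBase _ (θ i)) F₁ :=
    (represents_oneForm hW hdV.coordinates fun i => (hθ i).mono s).congr fun j hj =>
      e3 j (s (jetsOver₁_base hj))
  have rh := represents_ofBase hdV.analytic
  have rf := represents_ofBase (hf.1.mono s)
  rw [jetsOver_eq] at e1 e2 e4
  rw [eqFunctionalOn_iff hW ra (represents_quad hW hdV.coordinates fun i j => (hq i j).mono s)]
    at e4
  refine ⟨V, f, μ, θ, q, hW, hdV, hpV, hVU, hf, hμ, hm1, ht, hθ, hq, hqs, fun b₁ r1 => ?_,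
    fun b₁ b₂ r1 r2 => ?_⟩
  · rw [add_comm]
    exact (eqFunctionalOn_zero_iff hW ((rh.bracket hW η rθ).add (r1.bracket hW η rf))).mp e1
  · have := (eqFunctionalOn_zero_iff hW (((rh.bracket hW η ra).add (r1.bracket hW η rθ)).add
      (r2.bracket hW η rf))).mp e2
    rwa [br_congr (show ofBase _ h₀ - ofBase _ h₀ ∈ (jetAlgebra hW).null by simp) e4] at this

/-- A quadratic polynomial separates finitely many points together with the points
themselves. -/
theorem exists_injective_quadratic {l : ℂ^n} (hl : Function.Injective l) :
    ∃ c : ℂ, Function.Injective fun i => l i ^ 2 + c * l i := by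
  obtain ⟨c, hc⟩ := (Set.finite_range fun ij : Fin n × Fin n => -(l ij.1 + l ij.2)).exists_notMem
  refine ⟨c, fun i j hij => hl ?_⟩
  have h1 : (l i - l j) * (l i + l j + c) = 0 := by simp only at hij; linear_combination hij
  rcases mul_eq_zero.mp h1 with h2 | h2
  · exact sub_eq_zero.mp h2
  · exact absurd ⟨(i, j), by linear_combination -h2⟩ hc

/-- The compatibility conditions for the first order generator. -/
theorem IsOIntegrable.first_order_compat (hη : η.IsSymm) (hη' : η.det ≠ 0)
    (hd : IsDiagonal η h₀ R lam U) (hh₀ : h 0 = lift₀ h₀) (hO : IsOIntegrable 2 η h₀ h U)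
    {ω : Fin n → ℂ^n → ℂ} (hω : ∀ i, Holo (ω i) U)
    (h1 : ∀ j ∈ jetsOver U, h 1 j = lift₁ (linForm R ω) j)
    {k : Fin n → Fin n → ℂ^n → ℂ} (hk : ∀ i j, Holo (k i j) U)
    (hks : ∀ i j, k i j = k j i)
    (hωk : ∀ i j, i ≠ j → ∀ v ∈ U,
      pdR R i (ω j) v - pdR R j (ω i) v = (lam i v - lam j v) * k i j v)
    (hij : i ≠ j) (hil : i ≠ l) (hjl : j ≠ l) (hv : v ∈ U) :
    pdR R l (k i j) v + christoffel R lam i j v * k i l v + christoffel R lam j i v * k j l v =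
      pdR R j (k i l) v + christoffel R lam i l v * k i j v + christoffel R lam l i v * k l j v := by
  -- velocities `μ_i = λ_i² + cλ_i` at `v`, pairwise distinct: the factor in front of the condition
  -- becomes the Vandermonde determinant `(λ_i - λ_j) (λ_i - λ_l) (λ_j - λ_l)`
  obtain ⟨c, hc⟩ := exists_injective_quadratic (hd.riemann.distinct v hv)
  obtain ⟨V, f, μ, θ, -, hW, hdV, hvV, hVU, hf, hμ, hm, -, hθ, -, -, e1, -⟩ :=
    hO.exists_extension_forms hη hη' hd hh₀ hv _ 0 hc
  have s := fst_cylinder_subset V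
  have sU := s.trans hVU
  have aμ := fun i => (hμ.analytic i).mono s
  have aω := fun i => (hω i).mono sU
  have ak := fun i j => (hk i j).mono sU
  have al := fun i => hdV.analytic_lam (isOpen_base hW) i
  have ac := fun i j => hdV.analytic_christoffel (isOpen_base hW) i j
  have hE := riemann_E hW hdV
  have r1 : Represents ((riemann hW hdV).oneForm fun i => ofBase _ (ω i)) (h 1) :=
    (represents_oneForm hW hdV.coordinates aω).congr fun j hj => h1 j (sU (jetsOver₁_base hj))
  have key := (riemann hW hdV).first_order_compat hη
    ((hμ.mono s).diagonalizes hW hdV (hf.1.mono s)) (ord_ofBase hW (hf.1.mono s))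
    (fun i => ord_ofBase hW (aμ i)) (fun i => ord_ofBase hW (aω i))
    (fun i => ord_ofBase hW ((hθ i).mono s)) (e1 _ r1) (k := fun i j => ofBase _ (k i j))
    (fun i j => by simp only [hks i j]) (fun i j hij => by
      rw [hE i (aω j), hE j (aω i)]
      refine evalJet_ext fun w => ?_
      change evalJet w (_ - _) = evalJet w ((ofBase _ (lam i) - ofBase _ (lam j)) * _)
      rw [map_sub, map_mul, map_sub, evalJet_ofBase (al i), evalJet_ofBase (al j),
        evalJet_ofBase (ak i j), evalJet_ofBase (hdV.coordinates.analytic_pdR i (aω j)),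
        evalJet_ofBase (hdV.coordinates.analytic_pdR j (aω i))]
      exact hωk i j hij _ (sU (jetsOver₁_base w.2))) hij hil hjl
  let w : jetsOver₁ (cylinder V) := ⟨shortJet (v, 0), shortJet_mem.mpr ⟨hvV, trivial⟩⟩
  have key2 := congrArg (evalJet w) key
  rw [hE l (ak i j), hE j (ak i l)] at key2
  change evalJet w (((ofBase _ (μ j) - ofBase _ (μ i)) * (ofBase _ (lam l) - ofBase _ (lam j)) -
    (ofBase _ (lam j) - ofBase _ (lam i)) * (ofBase _ (μ l) - ofBase _ (μ j))) *
    ((ofBase _ (pdR R l (k i j)) + ofBase _ (christoffel R lam i j) * _ +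
      ofBase _ (christoffel R lam j i) * _) - (ofBase _ (pdR R j (k i l)) +
      ofBase _ (christoffel R lam i l) * _ + ofBase _ (christoffel R lam l i) * _))) = _ at key2
  simp only [map_sub, map_mul, map_add, evalJet_ofBase (aμ _), evalJet_ofBase (al _),
    evalJet_ofBase (ak _ _), evalJet_ofBase (ac _ _),
    evalJet_ofBase (hdV.coordinates.analytic_pdR _ (ak _ _)), map_zero] at key2
  simp only [w, shortJet, hm] at key2
  have d1 := hd.sub_ne_zero hv hij
  have d2 := hd.sub_ne_zero hv hil
  have d3 := hd.sub_ne_zero hv hjl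
  rw [← sub_eq_zero]
  refine (mul_eq_zero.mp ?_).resolve_left (mul_ne_zero (mul_ne_zero d1 d2) d3)
  linear_combination key2

/-! ### Necessary conditions at second order -/

theorem IsIntegrable.mono (hI : IsIntegrable η h₀ U) (hV : IsOpen V) (hVU : V ⊆ U) :
    IsIntegrable η h₀ V := by
  intro p hp
  obtain ⟨r, h1, h2, h3⟩ := hI p (hVU hp)
  refine ⟨r, h1, h2, fun g hg => ?_⟩
  obtain ⟨V', f, hV', hpV', -, hf, hfg⟩ := h3 g hg
  exact ⟨V' ∩ V, f, hV'.inter hV, ⟨hpV', hp⟩, Set.inter_subset_right,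
    hf.mono Set.inter_subset_left, fun i v hv => hfg i v hv.1⟩

theorem IsOIntegrable.mono {N : ℕ} (hO : IsOIntegrable N η h₀ h U) (hV : IsOpen V) (hVU : V ⊆ U) :
    IsOIntegrable N η h₀ h V :=
  ⟨hO.1.mono hV hVU, fun V' f hV' hV'V => hO.2 V' f hV' (hV'V.trans hVU)⟩

/-- The coefficients of the quadratic form
`-∑ c_i μ_{i,i} R_{i,x}² + ∑_{i≠k} (μ_i - μ_k) s_ik R_{i,x} R_{k,x}`. -/
def stdCoeff (R μ c : Fin n → ℂ^n → ℂ) (s : Fin n → Fin n → ℂ^n → ℂ) (i k : Fin n) (v : ℂ^n) : ℂ :=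
  if i = k then -(c i v * pdR R i (μ i) v) else (μ i v - μ k v) * s i k v

section Std

variable {μ c : Fin n → ℂ^n → ℂ} {s : Fin n → Fin n → ℂ^n → ℂ}

theorem analytic_stdCoeff (hc : IsCoordinates R V) (aμ : ∀ i, Holo (μ i) V)
    (ac : ∀ i, Holo (c i) V) (as : ∀ i k, Holo (s i k) V) (i k : Fin n) :
    Holo (stdCoeff R μ c s i k) V := by
  unfold stdCoeff
  split_ifs
  · exact fun v hv => ((ac i v hv).mul (hc.analytic_pdR i (aμ i) v hv)).neg
  · exact fun v hv => ((aμ i v hv).sub (aμ k v hv)).mul (as i k v hv)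

theorem ofBase_stdCoeff (hW : IsOpen W) (hd : IsDiagonal η h₀ R lam (π W))
    (aμ : ∀ i, Holo (μ i) (π W))
    (ac : ∀ i, Holo (c i) (π W))
    (as : ∀ i k, Holo (s i k) (π W)) (i k : Fin n) :
    ofBase W (stdCoeff R μ c s i k) = (riemann hW hd).stdQuad (fun i => ofBase W (μ i))
      (fun i => ofBase W (c i)) (fun i k => ofBase W (s i k)) i k := by
  refine evalJet_ext fun w => ?_
  rw [evalJet_ofBase (analytic_stdCoeff hd.coordinates aμ ac as i k), Riemann.stdQuad, stdCoeff]
  split_ifs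
  · rw [show (riemann hW hd).E i (ofBase W (μ i)) = ofBase W (pdR R i (μ i)) from
      frame_E_ofBase hW hd.coordinates i (aμ i), map_neg, map_mul, evalJet_ofBase (ac i),
      evalJet_ofBase (hd.coordinates.analytic_pdR i (aμ i))]
  · rw [map_mul, map_sub, evalJet_ofBase (aμ i), evalJet_ofBase (aμ k), evalJet_ofBase (as i k)]

theorem represents_stdQuad (hW : IsOpen W) (hd : IsDiagonal η h₀ R lam (π W))
    (aμ : ∀ i, Holo (μ i) (π W))
    (ac : ∀ i, Holo (c i) (π W))
    (as : ∀ i k, Holo (s i k) (π W)) :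
    Represents ((riemann hW hd).quad ((riemann hW hd).stdQuad (fun i => ofBase W (μ i))
      (fun i => ofBase W (c i)) (fun i k => ofBase W (s i k))))
      (lift₁ (quadForm R (stdCoeff R μ c s))) := by
  have := represents_quad hW hd.coordinates (analytic_stdCoeff hd.coordinates aμ ac as)
  simp only [ofBase_stdCoeff hW hd aμ ac as] at this
  exact this

/-- The normal form of the first and second order terms of a perturbation, up to the canonical
transformation generated by `∫ k₀ dx`. -/
structure HasNormalForm (η : Matrix (Fin n) (Fin n) ℂ) (h₀ : ℂ^n → ℂ) (h : ℕ → Density n)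
    (D : Set (Jet n)) (k₀ : ℂ^n → ℂ) (k : ℂ^n × ℂ^n → ℂ) : Prop where
  first : EqFunctionalOn D (h 1) (bracket η (lift₀ h₀) (lift₀ k₀))
  second : EqFunctionalOn D (h 2)
    (lift₁ k + (1 / 2 : ℂ) • bracket η (bracket η (lift₀ h₀) (lift₀ k₀)) (lift₀ k₀))

theorem HasNormalForm.mono {D D' : Set (Jet n)} {k : ℂ^n × ℂ^n → ℂ} (hN : HasNormalForm η h₀ h D k₀ k) (hD : D' ⊆ D) :
    HasNormalForm η h₀ h D' k₀ k := ⟨hN.first.mono hD, hN.second.mono hD⟩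

theorem hasNormalForm_iff (hW : IsOpen W) (hd : IsDiagonal η h₀ R lam (π W)) (hk₀ : Holo k₀ (π W))
    {k : ℂ^n × ℂ^n → ℂ} {q b₁ b₂ : jetFunctions W} (hq : Represents q (lift₁ k))
    (h1 : Represents b₁ (h 1)) (h2 : Represents b₂ (h 2)) :
    HasNormalForm η h₀ h (jetsOver₁ W) k₀ k ↔
      b₁ - (jetAlgebra hW).br η (riemann hW hd).h₀ (ofBase W k₀) ∈ (jetAlgebra hW).null ∧
      b₂ - (q + (1 / 2 : ℂ) • (jetAlgebra hW).br η ((jetAlgebra hW).br η (riemann hW hd).h₀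
        (ofBase W k₀)) (ofBase W k₀)) ∈ (jetAlgebra hW).null := by
  have r0 := represents_ofBase hd.analytic
  have rk := represents_ofBase hk₀
  have e1 := eqFunctionalOn_iff hW h1 (r0.bracket hW η rk)
  have e2 := eqFunctionalOn_iff hW h2
    (hq.add (((r0.bracket hW η rk).bracket hW η rk).smul (1 / 2 : ℂ)))
  exact ⟨fun hN => ⟨e1.mp hN.first, e2.mp hN.second⟩, fun hN => ⟨e1.mpr hN.1, e2.mpr hN.2⟩⟩

/-- Necessary conditions at second order: `c_i` depends on `R_i` only, and `s` is closed. -/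
theorem IsOIntegrable.second_order_compat (hη : η.IsSymm) (hη' : η.det ≠ 0)
    (hd : IsDiagonal η h₀ R lam U) (hh₀ : h 0 = lift₀ h₀)
    (hO : IsOIntegrable 2 η h₀ h U)
    (h1 : IsDiffPoly U 1 (h 1)) (h2 : IsDiffPoly U 2 (h 2))
    (hu : ∀ v ∈ U, ∀ i, pdR R i (lam i) v ≠ 0)
    (hk₀ : Holo k₀ U) (ac : ∀ i, Holo (c i) U)
    (as : ∀ i k, Holo (s i k) U) (hs : ∀ i k, ∀ v ∈ U, s i k v = - s k i v)
    (hN : HasNormalForm η h₀ h (jetsOver U) k₀ (quadForm R (stdCoeff R lam c s)))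
    (hv : v ∈ U) :
    (∀ i k, i ≠ k → pdR R k (c i) v = 0) ∧ ∀ i j k, i ≠ j → i ≠ k → j ≠ k →
      pdR R k (s i j) v + pdR R i (s j k) v + pdR R j (s k i) v = 0 := by
  -- velocities `μ_i = λ_i² + zλ_i`, pairwise distinct, with `∂_i μ_i = 0` at `v`: the factors in front
  -- of the conditions become `λ_{i,i} (μ_k - μ_i)` and a Vandermonde determinant
  obtain ⟨z, hz⟩ := exists_injective_quadratic (hd.riemann.distinct v hv)
  obtain ⟨V, f, μ, θ, q, hW, hdV, hvV, hVU, hf, hμ, hm, ht, hθ, hq, hqs, e1, e2⟩ :=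
    hO.exists_extension_forms hη hη' hd hh₀ hv _ 0 hz
  have sV := fst_cylinder_subset V
  have sU := sV.trans hVU
  have aμ := fun i => (hμ.analytic i).mono sV
  have al := fun i => hdV.analytic_lam (isOpen_base hW) i
  have ac' := fun i => (ac i).mono sU
  have as' := fun i k => (as i k).mono sU
  have hE := riemann_E hW hdV
  obtain ⟨b₁, r1⟩ := h1.exists_represents hW sU
  obtain ⟨b₂, r2⟩ := h2.exists_represents hW sU
  have hsub : jetsOver₁ (cylinder V) ⊆ jetsOver U := fun j hj => sU (jetsOver₁_base hj)
  obtain ⟨n1, n2⟩ := (hasNormalForm_iff hW hdV (hk₀.mono sU)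
    (represents_stdQuad hW hdV al ac' as') r1 r2).mp (hN.mono hsub)
  have hfm := (hf.mono sV).mem_null hW hdV
  have of := ord_ofBase hW (hf.1.mono sV)
  have oμ := fun i => ord_ofBase hW (aμ i)
  have hdiag := (hμ.mono sV).diagonalizes hW hdV (hf.1.mono sV)
  obtain ⟨r, hr, hrs, e3⟩ := (riemann hW hdV).second_order hη hdiag of oμ hfm
    (ord_ofBase hW (hk₀.mono sU)) n1 n2 (fun i => ord_ofBase hW ((hθ i).mono sV))
    (fun i j => ord_ofBase hW ((hq i j).mono sV)) (fun i j => by simp only [hqs i j])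
    (e1 _ r1) (e2 _ _ r1 r2)
  have hs' : ∀ i k, ofBase (cylinder V) (s i k) = - ofBase (cylinder V) (s k i) := by
    intro i k
    refine evalJet_ext fun w => ?_
    rw [map_neg, evalJet_ofBase (as' i k), evalJet_ofBase (as' k i)]
    exact hs i k _ (sU (jetsOver₁_base w.2))
  have hunit : ∀ i, IsUnit ((riemann hW hdV).E i ((riemann hW hdV).lam i)) := by
    intro i
    change IsUnit ((riemann hW hdV).E i (ofBase _ (lam i)))
    rw [hE i (al i)]
    have a1 := hdV.coordinates.analytic_pdR i (al i)
    have hne : ∀ v ∈ π (cylinder V), pdR R i (lam i) v ≠ 0 := fun v hv => hu v (sU hv) i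
    refine IsUnit.of_mul_eq_one (ofBase _ fun v => (pdR R i (lam i) v)⁻¹) ?_
    refine evalJet_ext fun w => ?_
    have a2 : Holo (fun v => (pdR R i (lam i) v)⁻¹) (π (cylinder V)) :=
      fun v hv => (a1 v hv).inv (hne v hv)
    rw [map_mul, evalJet_ofBase a1, evalJet_ofBase a2, map_one, mul_inv_cancel₀ (hne _ (jetsOver₁_base w.2))]
  obtain ⟨k1, k2⟩ := (riemann hW hdV).second_order_stdQuad hη hdiag of oμ hunit
    (fun i => ord_ofBase hW (ac' i)) (fun i k => ord_ofBase hW (as' i k)) hs' hr hrs e3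
  let w : jetsOver₁ (cylinder V) := ⟨shortJet (v, 0), shortJet_mem.mpr ⟨hvV, trivial⟩⟩
  constructor
  · intro i k hik
    have k3 := congrArg (evalJet w) (k1 i k hik)
    rw [hE k (ac' i), hE i (aμ i)] at k3
    change evalJet w (_ * ((riemann hW hdV).E i (ofBase _ (lam i)) * _ - _ *
      (ofBase _ (lam k) - ofBase _ (lam i)))) = _ at k3
    rw [hE i (al i)] at k3
    simp only [map_sub, map_mul, evalJet_ofBase (aμ _), evalJet_ofBase (al _), map_zero,
      evalJet_ofBase (hdV.coordinates.analytic_pdR _ (ac' _)),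
      evalJet_ofBase (hdV.coordinates.analytic_pdR _ (al _)),
      evalJet_ofBase (hdV.coordinates.analytic_pdR _ (aμ _))] at k3
    simp only [w, shortJet, hm, ht, Pi.zero_apply, zero_mul, sub_zero] at k3
    refine (mul_eq_zero.mp k3).resolve_right (mul_ne_zero (hu v hv i) ?_)
    exact sub_ne_zero.mpr fun h => hik (hz h).symm
  · intro i j k hij hik hjk
    have k3 := congrArg (evalJet w) (k2 i j k hij hik hjk)
    rw [hE k (as' i j), hE i (as' j k), hE j (as' k i)] at k3
    change evalJet w (_ * ((ofBase _ (lam j) - ofBase _ (lam k)) * _ -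
      (ofBase _ (lam i) - ofBase _ (lam k)) * _)) = _ at k3
    simp only [map_sub, map_mul, map_add, evalJet_ofBase (aμ _), evalJet_ofBase (al _), map_zero,
      evalJet_ofBase (hdV.coordinates.analytic_pdR _ (as' _ _))] at k3
    simp only [w, shortJet, hm] at k3
    have d1 := hd.sub_ne_zero hv hij
    have d2 := hd.sub_ne_zero hv hik
    have d3 := hd.sub_ne_zero hv hjk
    refine (mul_eq_zero.mp ?_).resolve_right (mul_ne_zero (mul_ne_zero d1 d2) d3)
    linear_combination k3

end Std

/-- The compatibility conditions satisfied by the Christoffel coefficients. -/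
theorem IsDiagonal.christoffel_compat (hd : IsDiagonal η h₀ R lam V) (hV : IsOpen V)
    (hij : i ≠ j) (hil : i ≠ l) (hjl : j ≠ l) (hv : v ∈ V) :
    pdR R l (christoffel R lam i j) v = pdR R j (christoffel R lam i l) v ∧
    pdR R l (christoffel R lam j i) v + christoffel R lam j i v * christoffel R lam j l v =
      christoffel R lam i l v * christoffel R lam j i v +
        christoffel R lam l i v * christoffel R lam j l v := by
  have hW := isOpen_cylinder hV
  have hdV := hd.mono (fst_cylinder_subset V)
  have ac := fun i j => hdV.analytic_christoffel (isOpen_base hW) i j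
  have hE := riemann_E hW hdV
  obtain ⟨k1, k2⟩ := (HamPDE.riemann hW hdV).compat hij hil hjl
  let w : jetsOver₁ (cylinder V) := ⟨shortJet (v, 0), shortJet_mem.mpr ⟨hv, trivial⟩⟩
  have k3 := congrArg (evalJet w) k1
  have k4 := congrArg (evalJet w) k2
  change evalJet w ((HamPDE.riemann hW hdV).E l (ofBase _ (christoffel R lam i j))) =
    evalJet w ((HamPDE.riemann hW hdV).E j (ofBase _ (christoffel R lam i l))) at k3
  change evalJet w ((HamPDE.riemann hW hdV).E l (ofBase _ (christoffel R lam j i)) +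
    ofBase _ (christoffel R lam j i) * ofBase _ (christoffel R lam j l)) =
    evalJet w (ofBase _ (christoffel R lam i l) * ofBase _ (christoffel R lam j i) +
      ofBase _ (christoffel R lam l i) * ofBase _ (christoffel R lam j l)) at k4
  rw [hE _ (ac _ _)] at k4
  rw [hE _ (ac _ _), hE _ (ac _ _)] at k3
  simp only [map_mul, map_add, evalJet_ofBase (ac _ _),
    evalJet_ofBase (hdV.coordinates.analytic_pdR _ (ac _ _))] at k3 k4
  exact ⟨k3, k4⟩

/-- The quadratic form of the normal form. -/
theorem hamiltonianForm_eq (R lam : Fin n → ℂ^n → ℂ) (C : Fin n → ℂ → ℂ) (φ : Fin n → ℂ^n → ℂ) :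
    hamiltonianForm R lam C φ = quadForm R (stdCoeff R lam (fun i v => C i (R i v))
      fun i k v => 1 / 2 * (pdR R k (φ i) v - pdR R i (φ k) v)) := by
  funext w
  rw [hamiltonianForm, quadForm, ← Finset.sum_neg_distrib, mul_sum, ← sum_add_distrib]
  refine sum_ext fun i => ?_
  rw [← Finset.add_sum_erase _ _ (mem_univ i), stdCoeff, if_pos rfl]
  congr 1
  · ring
  · rw [mul_sum]
    have : Finset.univ.filter (fun k => k ≠ i) = Finset.univ.erase i := by ext k; simp
    rw [this]
    refine sum_congr rfl fun k hk => ?_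
    rw [stdCoeff, if_neg (Finset.ne_of_mem_erase hk).symm]
    ring

/-! ### Integrable perturbations have a normal form -/

/-- Near every point, a canonical transformation generated by a function of `v` removes the first
order term of the perturbation and brings the second order term to the normal form. -/
def HasLocalNormalForm (η : Matrix (Fin n) (Fin n) ℂ) (h₀ : ℂ^n → ℂ) (h : ℕ → Density n)
    (R lam : Fin n → ℂ^n → ℂ) (U : Set ℂ^n) : Prop :=
  ∀ p ∈ U, ∃ (V : Set ℂ^n) (k₀ : ℂ^n → ℂ) (C : Fin n → ℂ → ℂ)
    (φ : Fin n → ℂ^n → ℂ), IsOpen V ∧ p ∈ V ∧ V ⊆ U ∧ Holo k₀ V ∧ IsCoefficients R V C φ ∧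
      HasNormalForm η h₀ h (jetsOver V) k₀ (hamiltonianForm R lam C φ)

theorem analytic_div_sub (hd : IsDiagonal η h₀ R lam V) (hV : IsOpen V)
    {q : Fin n → Fin n → ℂ^n → ℂ} (hq : ∀ i j, Holo (q i j) V) (i j : Fin n) :
    Holo (fun v => q i j v / (lam i v - lam j v)) V := by
  by_cases hij : i = j
  · subst hij
    simp only [sub_self, div_zero]
    exact analyticOnNhd_const
  · exact fun v hv => (hq i j v hv).div ((hd.analytic_lam hV i v hv).sub
      (hd.analytic_lam hV j v hv)) (hd.sub_ne_zero hv hij)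

/-- The first order term of an integrable perturbation is removed by a canonical
transformation. -/
theorem IsOIntegrable.exists_first (hη : η.IsSymm) (hη' : η.det ≠ 0)
    (hd : IsDiagonal η h₀ R lam U) (hU : IsOpen U) (hh₀ : h 0 = lift₀ h₀)
    (hO : IsOIntegrable 2 η h₀ h U) (h1 : IsDiffPoly U 1 (h 1)) (hp : p ∈ U) :
    ∃ V r Ψ k₀, IsChart R p V r Ψ ∧ V ⊆ U ∧ Holo k₀ V ∧
      EqFunctionalOn (jetsOver V) (h 1) (bracket η (lift₀ h₀) (lift₀ k₀)) := by
  obtain ⟨ω, aω, e1⟩ := h1.exists_linForm hd.coordinates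
  have adω : ∀ i j, Holo (fun v => pdR R i (ω j) v - pdR R j (ω i) v) U :=
    fun i j v hv => (hd.coordinates.analytic_pdR i (aω j) v hv).sub
      (hd.coordinates.analytic_pdR j (aω i) v hv)
  set k : Fin n → Fin n → ℂ^n → ℂ := fun i j v =>
    (pdR R i (ω j) v - pdR R j (ω i) v) / (lam i v - lam j v) with hk
  have ak : ∀ i j, Holo (k i j) U :=
    analytic_div_sub hd hU (q := fun i j v => pdR R i (ω j) v - pdR R j (ω i) v) adω
  have hks : ∀ i j, k i j = k j i := fun i j => by
    funext v
    simp only [hk]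
    rw [← neg_sub, ← neg_sub (lam j v), neg_div_neg_eq]
  have hωk : ∀ i j, i ≠ j → ∀ v ∈ U,
      pdR R i (ω j) v - pdR R j (ω i) v = (lam i v - lam j v) * k i j v := fun i j hij v hv => by
    rw [hk, mul_div_cancel₀ _ (hd.sub_ne_zero hv hij)]
  obtain ⟨N, ρ, Ψ, hchart, hNU⟩ := exists_chart hU hp hd.coordinates
  obtain ⟨V, r, hV, hVN, k₀, ak₀, e2⟩ := hchart.exists_goursat (a := christoffel R lam) (k := k)
    (fun i j => (hd.analytic_christoffel hU i j).mono hNU) (fun i j => (ak i j).mono hNU)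
    (fun i j v _ => by rw [hks])
    (fun i j l hij hil hjl v hv => (hd.christoffel_compat hU hij hil hjl (hNU hv)).1)
    (fun i j l hij hil hjl v hv => (hd.christoffel_compat hU hij hil hjl (hNU hv)).2)
    (fun i j l hij hil hjl v hv =>
      hO.first_order_compat hη hη' hd hh₀ aω e1 ak hks hωk hij hil hjl (hNU hv))
  have hVU := hVN.trans hNU
  refine ⟨V, r, Ψ, k₀, hV, hVU, ak₀, ?_⟩
  have hW := isOpen_cylinder hV.isOpen
  have s := fst_cylinder_subset V
  have hdV := hd.mono (s.trans hVU)
  have aω' := fun i => (aω i).mono (s.trans hVU)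
  have al := fun i => hdV.analytic_lam (isOpen_base hW) i
  have ac := fun i j => hdV.analytic_christoffel (isOpen_base hW) i j
  have ak' := ak₀.mono s
  have hE := riemann_E hW hdV
  have r1 : Represents ((riemann hW hdV).oneForm fun i => ofBase _ (ω i)) (h 1) :=
    (represents_oneForm hW hdV.coordinates aω').congr fun j hj => e1 j (hVU (s (jetsOver₁_base hj)))
  rw [jetsOver_eq, eqFunctionalOn_iff hW r1 ((represents_ofBase hdV.analytic).bracket hW η
    (represents_ofBase ak'))]
  refine ((riemann hW hdV).oneForm_sub_br_mem_null_iff hη (ord_ofBase hW ak')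
    (fun i => ord_ofBase hW (aω' i))).mpr fun i j hij => ?_
  have ap := fun i => hdV.coordinates.analytic_pdR i ak'
  rw [hE i ak', hE j ak', hE j (ap i), hE i (aω' j), hE j (aω' i)]
  refine evalJet_ext fun w => ?_
  change evalJet w ((ofBase _ (lam i) - ofBase _ (lam j)) * (_ -
    ofBase _ (christoffel R lam i j) * _ - ofBase _ (christoffel R lam j i) * _)) = _
  simp only [map_sub, map_mul, evalJet_ofBase (al _), evalJet_ofBase (ac _ _),
    evalJet_ofBase (ap _), evalJet_ofBase (hdV.coordinates.analytic_pdR _ (ap _)),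
    evalJet_ofBase (hdV.coordinates.analytic_pdR _ (aω' _))]
  have hwV := s (jetsOver₁_base w.2)
  rw [hωk i j hij _ (hVU hwV), e2 i j hij _ hwV]
  ring

/-- The second variation of a diagonal Hamiltonian has a quadratic density. -/
theorem exists_quadForm_half_br_br (hη : η.IsSymm) (hd : IsDiagonal η h₀ R lam V)
    (hV : IsOpen V) (hk₀ : Holo k₀ V) {f : ℂ^n → ℂ}
    (hf : Holo f V) {μ : Fin n → ℂ^n → ℂ} (hμ : HasVelocities η R V f μ) :
    ∃ q : Fin n → Fin n → ℂ^n → ℂ, (∀ i j, Holo (q i j) V) ∧ (∀ i j, ∀ v ∈ V, q i j v = q j i v) ∧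
      EqFunctionalOn (jetsOver V)
        ((1 / 2 : ℂ) • bracket η (bracket η (lift₀ f) (lift₀ k₀)) (lift₀ k₀))
        (lift₁ (quadForm R q)) := by
  have hW := isOpen_cylinder hV
  have s := fst_cylinder_subset V
  have hdV := hd.mono s
  have rk := represents_ofBase (hk₀.mono s)
  obtain ⟨r, or, rs, e1⟩ := ((hμ.mono s).diagonalizes hW hdV (hf.mono s)).exists_quad_br_br hη
    (ord_ofBase hW (hf.mono s)) (fun i => ord_ofBase hW ((hμ.analytic i).mono s))
    (ord_ofBase hW (hk₀.mono s))
  choose q aq hq using fun i j => exists_ofBase_eq hW convex_univ ⟨0, trivial⟩ (or i j)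
  refine ⟨q, aq, fun i j v hv => ?_, ?_⟩
  · refine (ofBase_inj ((aq i j).mono s) ((aq j i).mono s)).mp ?_ v (subset_fst_cylinder V hv)
    rw [← hq, ← hq, rs]
  · rw [jetsOver_eq, eqFunctionalOn_iff hW
      ((((represents_ofBase (hf.mono s)).bracket hW η rk).bracket hW η rk).smul (1 / 2 : ℂ))
      (represents_quad hW hdV.coordinates fun i j => (aq i j).mono s)]
    have : r = fun i j => ofBase (cylinder V) (q i j) := by funext i j; exact hq i j
    rw [← this]
    exact e1

theorem quadForm_sub (q r : Fin n → Fin n → ℂ^n → ℂ) (w : ℂ^n × ℂ^n) :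
    quadForm R (fun i j v => q i j v - r i j v) w = quadForm R q w - quadForm R r w := by
  simp only [quadForm, sub_mul, sum_sub_distrib]

/-- The density `½{{h₀, k₀}, k₀}`. -/
abbrev secondVariation (η : Matrix (Fin n) (Fin n) ℂ) (h₀ k₀ : ℂ^n → ℂ) : Density n :=
  (1 / 2 : ℂ) • bracket η (bracket η (lift₀ h₀) (lift₀ k₀)) (lift₀ k₀)

theorem exists_represents_secondVariation (hW : IsOpen W) (hh : Holo h₀ (π W)) (hk : Holo k₀ (π W)) :
    ∃ b : jetFunctions W, Represents b (secondVariation η h₀ k₀) :=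
  ⟨_, (((represents_ofBase hh).bracket hW η (represents_ofBase hk)).bracket hW η
    (represents_ofBase hk)).smul (1 / 2 : ℂ)⟩

/-- The quadratic form of a perturbation whose first order term is `{H₀, K₀}`. -/
theorem exists_quadForm_remainder (hη : η.IsSymm) (hd : IsDiagonal η h₀ R lam V)
    (hV : IsOpen V) (h2 : IsDiffPoly V 2 (h 2)) (hk₀ : Holo k₀ V) :
    ∃ q : Fin n → Fin n → ℂ^n → ℂ, (∀ i j, Holo (q i j) V) ∧ (∀ i j, ∀ v ∈ V, q i j v = q j i v) ∧
      EqFunctionalOn (jetsOver V) (h 2) (lift₁ (quadForm R q) + secondVariation η h₀ k₀) := by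
  obtain ⟨q₁, aq₁, sq₁, e2, a₂, ra₂⟩ := h2.exists_quadForm hV hd.coordinates
  obtain ⟨q₂, aq₂, sq₂, e3⟩ :=
    exists_quadForm_half_br_br hη hd hV hk₀ hd.analytic (hd.hasVelocities hV)
  refine ⟨fun i j v => q₁ i j v - q₂ i j v, fun i j v hv => (aq₁ i j v hv).sub (aq₂ i j v hv),
    fun i j v hv => by simp only [sq₁ i j, sq₂ i j v hv], ?_⟩
  have hW := isOpen_cylinder hV
  have sV := fst_cylinder_subset V
  have hdW := hd.mono sV
  have rq₁ := represents_quad hW hdW.coordinates fun i j => (aq₁ i j).mono sV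
  have rq₂ := represents_quad hW hdW.coordinates fun i j => (aq₂ i j).mono sV
  obtain ⟨b, rb⟩ := exists_represents_secondVariation (η := η) hW hdW.analytic (hk₀.mono sV)
  have r4 := (rq₁.sub rq₂).congr (g := lift₁ (quadForm R fun i j v => q₁ i j v - q₂ i j v))
    fun j _ => quadForm_sub q₁ q₂ _
  rw [jetsOver_eq] at e2 e3 ⊢
  rw [eqFunctionalOn_iff hW ra₂ (r4.add rb)]
  rw [eqFunctionalOn_iff hW ra₂ rq₁] at e2
  rw [eqFunctionalOn_iff hW rb rq₂] at e3
  convert sub_mem e2 e3 using 1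
  ring

theorem IsOIntegrable.hasLocalNormalForm (hη : η.IsSymm) (hη' : η.det ≠ 0)
    (hd : IsDiagonal η h₀ R lam U) (hU : IsOpen U) (hh₀ : h 0 = lift₀ h₀)
    (hu : ∀ v ∈ U, ∀ i, pdR R i (lam i) v ≠ 0)
    (h1 : IsDiffPoly U 1 (h 1)) (h2 : IsDiffPoly U 2 (h 2)) (hO : IsOIntegrable 2 η h₀ h U) :
    HasLocalNormalForm η h₀ h R lam U := by
  intro p hp
  obtain ⟨V, r, Ψ, k₀, hchart, hVU, ak₀, e1⟩ := hO.exists_first hη hη' hd hU hh₀ h1 hp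
  have hV := hchart.isOpen
  have hdV := hd.mono hVU
  have al := hdV.analytic_lam hV
  obtain ⟨q, aq, sq, e2⟩ := exists_quadForm_remainder hη hdV hV (h2.mono hVU) ak₀
  set c : Fin n → ℂ^n → ℂ := fun i v => -(q i i v / pdR R i (lam i) v) with hc
  set s : Fin n → Fin n → ℂ^n → ℂ := fun i k v => q i k v / (lam i v - lam k v) with hs
  have ac : ∀ i, Holo (c i) V := fun i v hv =>
    ((aq i i v hv).div (hdV.coordinates.analytic_pdR i (al i) v hv) (hu v (hVU hv) i)).neg
  have as : ∀ i k, Holo (s i k) V := analytic_div_sub hdV hV aq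
  have ss : ∀ i k, ∀ v ∈ V, s i k v = - s k i v := fun i k v hv => by
    simp only [hs]; rw [sq i k v hv, ← neg_sub, div_neg]
  have hqc : ∀ i k, ∀ v ∈ V, stdCoeff R lam c s i k v = q i k v := by
    intro i k v hv
    rw [stdCoeff]
    split_ifs with hik
    · subst hik
      simp only [hc]
      rw [neg_mul, neg_neg, div_mul_cancel₀ _ (hu v (hVU hv) i)]
    · exact mul_div_cancel₀ _ (hdV.sub_ne_zero hv hik)
  have hW := isOpen_cylinder hV
  have sV := fst_cylinder_subset V
  have hdW := hdV.mono sV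
  obtain ⟨b, rb⟩ := exists_represents_secondVariation (η := η) hW hdW.analytic (ak₀.mono sV)
  have rq := represents_quad hW hdW.coordinates fun i j => (aq i j).mono sV
  rw [jetsOver_eq] at e2
  have e3 := e2.trans ((rq.add rb).eqFunctionalOn hW
      (g := lift₁ (quadForm R (stdCoeff R lam c s)) + secondVariation η h₀ k₀) fun j hj => by
    simp only [Pi.add_apply, lift₁, quadForm, hqc _ _ _ (sV (jetsOver₁_base hj))])
  have key := fun v (hv : v ∈ V) => (hO.mono hV hVU).second_order_compat hη hη' hdV hh₀
    (h1.mono hVU) (h2.mono hVU) (fun v hv => hu v (hVU hv)) ak₀ ac as ss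
    ⟨e1, by rwa [jetsOver_eq]⟩ hv
  choose C aC hC using fun i => hchart.exists_eq_comp (ac i) (i := i)
    fun k hik v hv => (key v hv).1 i k hik
  have as2 : ∀ i k, Holo (fun v => 2 * s i k v) V := fun i k v hv =>
    analyticAt_const.mul (as i k v hv)
  have hs0 : ∀ i, ∀ v ∈ V, s i i v = 0 := fun i v _ => by simp [hs]
  have pd0 : ∀ i k, ∀ v ∈ V, pdR R k (s i i) v = 0 := fun i k v hv => by
    rw [pdR_congr hV (hs0 i) k hv]
    simp [pdR, pd]
  have pdn : ∀ i j k, ∀ v ∈ V, pdR R k (s i j) v = - pdR R k (s j i) v := fun i j k v hv => by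
    rw [pdR_congr hV (ss i j) k hv]
    simp [pdR, pd, fderiv_fun_neg]
  have pd2 : ∀ i j k, ∀ v ∈ V, pdR R k (fun v => 2 * s i j v) v = 2 * pdR R k (s i j) v := by
    intro i j k v hv
    simp only [pdR, pd, mul_sum]
    rw [fderiv_const_mul (as i j v hv).differentiableAt]
    exact sum_ext fun α => mul_left_comm _ _ _
  -- the factor `2` cancels the `½` of the normal form
  obtain ⟨φ, aφ, hφ⟩ := hchart.exists_potential_two as2
    (fun i j v hv => by rw [ss i j v hv]; ring) (fun i j k v hv => by
      rw [pd2 _ _ _ v hv, pd2 _ _ _ v hv, pd2 _ _ _ v hv]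
      have : pdR R k (s i j) v + pdR R i (s j k) v + pdR R j (s k i) v = 0 := by
        rcases eq_or_ne i j with rfl | hij
        · rw [pd0 i k v hv, pdn k i i v hv]; ring
        rcases eq_or_ne i k with rfl | hik
        · rw [pd0 i j v hv, pdn j i i v hv]; ring
        rcases eq_or_ne j k with rfl | hjk
        · rw [pd0 j i v hv, pdn j i j v hv]; ring
        exact (key v hv).2 i j k hij hik hjk
      linear_combination 2 * this)
  refine ⟨V, k₀, C, φ, hV, hchart.mem, hVU, ak₀, fun i => ⟨aC i, aφ i⟩, e1, ?_⟩
  rw [jetsOver_eq]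
  refine e2.trans ((rq.add rb).eqFunctionalOn hW fun j hj => ?_)
  have hj' := sV (jetsOver₁_base hj)
  rw [hamiltonianForm_eq]
  simp only [Pi.add_apply, lift₁, quadForm, ← hqc _ _ _ hj', stdCoeff, ← hC _ _ hj',
    hφ _ _ _ hj']
  simp

/-! ### Logarithmic generators and the normal form -/

theorem IsCoefficients.mono (hC : IsCoefficients R V C φ) (hV : V' ⊆ V) : IsCoefficients R V' C φ :=
  fun i => ⟨(hC i).1.mono (Set.image_mono hV), (hC i).2.mono hV⟩

theorem IsCoefficients.analytic_comp (hC : IsCoefficients R V C φ) (hc : IsCoordinates R V)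
    (i : Fin n) : Holo (fun v => C i (R i v)) V := fun v hv =>
  ((hC i).1 (R i v) ⟨v, hv, rfl⟩).comp (hc.analytic i v hv)

theorem IsCoordinates.analytic_curl (hc : IsCoordinates R V) (aφ : ∀ i, Holo (φ i) V)
    (i k : Fin n) : Holo (fun v => 1 / 2 * (pdR R k (φ i) v - pdR R i (φ k) v)) V := fun v hv =>
  analyticAt_const.mul ((hc.analytic_pdR k (aφ i) v hv).sub (hc.analytic_pdR i (aφ k) v hv))

theorem represents_hamiltonianForm (hW : IsOpen W) (hd : IsDiagonal η h₀ R lam (π W))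
    (hC : IsCoefficients R (π W) C φ) :
    Represents ((riemann hW hd).quad ((riemann hW hd).stdQuad (fun i => ofBase W (lam i))
      (fun i => ofBase W fun v => C i (R i v))
        fun i k => ofBase W fun v => 1 / 2 * (pdR R k (φ i) v - pdR R i (φ k) v)))
      (lift₁ (hamiltonianForm R lam C φ)) := by
  rw [hamiltonianForm_eq]
  exact represents_stdQuad hW hd (fun i => hd.analytic_lam (isOpen_base hW) i)
    (hC.analytic_comp hd.coordinates) (hd.coordinates.analytic_curl fun i => (hC i).2)

/-- A function of `R_i` does not depend on the other coordinates. -/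
theorem IsCoefficients.pdR_comp (hC : IsCoefficients R V C φ) (hc : IsCoordinates R V)
    (hik : i ≠ k) (hv : v ∈ V) :
    pdR R k (fun v => C i (R i v)) v = 0 := by
  have h1 : ∀ α, pd α (fun v => C i (R i v)) v = deriv (C i) (R i v) * pd α (R i) v := by
    intro α
    have h2 := ((hC i).1 (R i v) ⟨v, hv, rfl⟩).differentiableAt.hasDerivAt.comp_hasFDerivAt v
      (hc.analytic i v hv).differentiableAt.hasFDerivAt
    have h3 : fderiv ℂ (fun v => C i (R i v)) v = deriv (C i) (R i v) • fderiv ℂ (R i) v :=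
      h2.fderiv
    simp only [pd, h3, FunLike.coe_smul, Pi.smul_apply, smul_eq_mul]
  have h4 := congrFun (congrFun (hc.jacobian_mul_inv hv) i) k
  rw [Matrix.mul_apply, Matrix.one_apply_ne hik] at h4
  simp only [pdR, h1]
  rw [← mul_zero (deriv (C i) (R i v)), ← h4, mul_sum]
  refine sum_ext fun α => ?_
  simp only [jacobian, Matrix.of_apply]
  ring

theorem represents_generatorForm (hW : IsOpen W) (hc : IsCoordinates R (π W))
    (hC : IsCoefficients R (π W) C φ)
    (hL : IsLogBranch R W L) :
    Represents (Frame.logForm (logBranch hW hc hL) (fun i => ofBase W fun v => C i (R i v)) +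
      (frame hW hc).oneForm fun i => ofBase W (φ i)) (lift₁ (generatorForm R C φ L)) := by
  rw [represents_iff]
  intro w
  have hLw : ∀ i, evalJet w ((logBranch hW hc hL).L i) = L i (w.1 0, w.1 1) := fun i =>
    (represents_ofPair (hL i).1).evalJet w
  simp only [Frame.logForm, Frame.oneForm, map_add, map_sum, map_mul, map_sub, hLw, evalJet_p,
    evalJet_ofBase (hC.analytic_comp hc _), evalJet_ofBase (hC _).2, lift₁, generatorForm,
    ← sum_add_distrib]
  exact sum_ext fun i => by ring

theorem analyticOnNhd_generatorForm (hc : IsCoordinates R (π W)) (hC : IsCoefficients R (π W) C φ)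
    (hL : IsLogBranch R W L) :
    Holo (generatorForm R C φ L) W := by
  have aC := fun i => analytic_base (hC.analytic_comp hc i)
  have aφ := fun i => analytic_base (hC i).2
  intro w hw
  unfold generatorForm
  exact analyticAt_fun_sum _ fun i _ => ((((aC i w hw).mul (analytic_Rx hc i w hw)).mul
    ((hL i).1 w hw)).sub ((aC i w hw).mul (analytic_Rx hc i w hw))).add
    ((aφ i w hw).mul (analytic_Rx hc i w hw))

/-- The variational derivatives of a logarithmic generator are homogeneous of degree one. -/
theorem homogeneous_generatorForm (hW : IsOpen W) (hd : IsDiagonal η h₀ R lam (π W))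
    (hC : IsCoefficients R (π W) C φ)
    (hL : IsLogBranch R W L) :
    ∀ j ∈ jetsOver₁ W, ∀ β,
      ∑ᶠ r : ℕ, ∑ α, (r : ℂ) * j r α *
        jetPartial r α (varDeriv β (lift₁ (generatorForm R C φ L))) j =
      varDeriv β (lift₁ (generatorForm R C φ L)) j := by
  have hc := hd.coordinates
  rw [homogeneous_iff hW (represents_generatorForm hW hc hC hL)]
  intro β
  rw [euler_δ]
  apply δ_congr
  refine (riemann hW hd).euler_δ_generator (logBranch hW hc hL)
    (fun i => ord_ofBase hW (hC.analytic_comp hc i)) (fun i => ord_ofBase hW (hC i).2)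
    fun i k hik => ?_
  have := frame_E_ofBase hW hc k (hC.analytic_comp hc i)
  refine this.trans (evalJet_ext fun w => ?_)
  rw [evalJet_ofBase (hc.analytic_pdR k (hC.analytic_comp hc i)), map_zero]
  exact hC.pdR_comp hc hik (jetsOver₁_base w.2)

theorem evalJet_half (w : jetsOver₁ W) : evalJet w (Frame.half (jetFunctions W)) = 1 / 2 := by
  rw [Frame.half, AlgHom.commutes]; rfl

/-- `{H₀, K₁}` for a logarithmic generator is a quadratic Hamiltonian in normal form. -/
theorem bracket_generatorForm (hη : η.IsSymm) (hW : IsOpen W) (hd : IsDiagonal η h₀ R lam (π W))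
    (hC : IsCoefficients R (π W) C φ)
    (hL : IsLogBranch R W L)
    {ψ : Fin n → ℂ^n → ℂ} (aψ : ∀ i, Holo (ψ i) (π W))
    (hψ : ∀ i k, i ≠ k → ∀ v ∈ π W, pdR R k (ψ i) v = C i (R i v) * christoffel R lam i k v) :
    EqFunctionalOn (jetsOver₁ W) (bracket η (lift₀ h₀) (lift₁ (generatorForm R C φ L)))
      (lift₁ (hamiltonianForm R lam C fun i v => φ i v + ψ i v)) := by
  have hc := hd.coordinates
  have aC := hC.analytic_comp hc
  have aφ := fun i => (hC i).2
  have al := fun i => hd.analytic_lam (isOpen_base hW) i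
  have achr := fun i j => hd.analytic_christoffel (isOpen_base hW) i j
  have ap : ∀ i, Holo (fun v => φ i v + ψ i v) (π W) := fun i v hv => (aφ i v hv).add (aψ i v hv)
  have as := hc.analytic_curl ap
  have hE := riemann_E hW hd
  have hadd : ∀ i, ofBase W (φ i) + ofBase W (ψ i) = ofBase W fun v => φ i v + ψ i v := by
    intro i
    refine evalJet_ext fun w => ?_
    rw [map_add, evalJet_ofBase (aφ i), evalJet_ofBase (aψ i), evalJet_ofBase (ap i)]
  have hs : ∀ i k, Frame.half (jetFunctions W) * ((riemann hW hd).E k (ofBase W (φ i) +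
      ofBase W (ψ i)) - (riemann hW hd).E i (ofBase W (φ k) + ofBase W (ψ k))) =
      ofBase W fun v => 1 / 2 * (pdR R k (fun v => φ i v + ψ i v) v -
        pdR R i (fun v => φ k v + ψ k v) v) := by
    intro i k
    rw [hadd, hadd, hE k (ap i), hE i (ap k)]
    refine evalJet_ext fun w => ?_
    rw [map_mul, map_sub, evalJet_half, evalJet_ofBase (hc.analytic_pdR k (ap i)),
      evalJet_ofBase (hc.analytic_pdR i (ap k)), evalJet_ofBase (as i k)]
  have key := (riemann hW hd).br_h₀_generator (logBranch hW hc hL) hη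
    (fun i => ord_ofBase hW (aC i)) (fun i => ord_ofBase hW (aφ i)) (ψ := fun i => ofBase W (ψ i))
    (fun i k hik => by
      rw [hE k (aC i)]
      refine evalJet_ext fun w => ?_
      rw [evalJet_ofBase (hc.analytic_pdR k (aC i)), map_zero]
      exact hC.pdR_comp hc hik (jetsOver₁_base w.2))
    (fun i k hik => by
      rw [hE k (aψ i)]
      refine evalJet_ext fun w => ?_
      change _ = evalJet w (_ * ofBase W (christoffel R lam i k))
      rw [evalJet_ofBase (hc.analytic_pdR k (aψ i)), map_mul, evalJet_ofBase (aC i),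
        evalJet_ofBase (achr i k)]
      exact hψ i k hik _ (jetsOver₁_base w.2))
  simp only [hs] at key
  exact (eqFunctionalOn_iff hW ((represents_ofBase hd.analytic).bracket hW η
    (represents_generatorForm hW hc hC hL))
    (represents_hamiltonianForm hW hd fun i => ⟨(hC i).1, ap i⟩)).mpr key

/-- Logarithms of the diagonal metric coefficients, as potentials of the Christoffel
coefficients. -/
theorem exists_log_metric (hη : η.IsSymm) (hη' : η.det ≠ 0) {r : ℝ}
    {Ψ : ℂ^n → ℂ^n} (hchart : IsChart R p V r Ψ)
    (hd : IsDiagonal η h₀ R lam V) :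
    ∃ l : Fin n → ℂ^n → ℂ, (∀ i, Holo (l i) V) ∧
      ∀ i k, i ≠ k → ∀ v ∈ V, pdR R k (l i) v = -2 * christoffel R lam i k v := by
  have hV := hchart.isOpen
  have hW := isOpen_cylinder hV
  have s := fst_cylinder_subset V
  have hdW := hd.mono s
  have ag := fun i => analytic_metricAt (η := η) hd.coordinates i
  have agp := fun i k => hd.coordinates.analytic_pdR k (ag i)
  have hg : ∀ i, ∀ v ∈ V, metricAt η R i v ≠ 0 := fun i v hv => metricAt_ne_zero hη hη' hV hd hv i
  have au : ∀ i k, Holo (fun v => pdR R k (metricAt η R i) v * (metricAt η R i v)⁻¹) V :=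
    fun i k v hv => (agp i k v hv).mul ((ag i v hv).inv (hg i v hv))
  have agi : ∀ i, Holo (fun v => (metricAt η R i v)⁻¹) V := fun i v hv =>
    (ag i v hv).inv (hg i v hv)
  have hE := fun i {f : ℂ^n → ℂ} (hf : Holo f V) => riemann_E hW hdW i (hf.mono s)
  have hgG : ∀ i, ofBase (cylinder V) (metricAt η R i) *
      ofBase (cylinder V) (fun v => (metricAt η R i v)⁻¹) = 1 := by
    intro i
    refine evalJet_ext fun w => ?_
    rw [map_mul, evalJet_ofBase ((ag i).mono s), evalJet_ofBase ((agi i).mono s), map_one,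
      mul_inv_cancel₀ (hg i _ (s (jetsOver₁_base w.2)))]
  have hu : ∀ i k, ofBase (cylinder V) (fun v => pdR R k (metricAt η R i) v *
      (metricAt η R i v)⁻¹) = (riemann hW hdW).E k (ofBase _ (metricAt η R i)) *
        ofBase (cylinder V) (fun v => (metricAt η R i v)⁻¹) := by
    intro i k
    rw [hE k (ag i)]
    refine evalJet_ext fun w => ?_
    rw [map_mul, evalJet_ofBase ((au i k).mono s), evalJet_ofBase ((agp i k).mono s),
      evalJet_ofBase ((agi i).mono s)]
  have hc : ∀ i k j, ∀ v ∈ V,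
      pdR R j (fun v => pdR R k (metricAt η R i) v * (metricAt η R i v)⁻¹) v =
        pdR R k (fun v => pdR R j (metricAt η R i) v * (metricAt η R i v)⁻¹) v := by
    intro i k j v hv
    refine (ofBase_inj ((hd.coordinates.analytic_pdR j (au i k)).mono s)
      ((hd.coordinates.analytic_pdR k (au i j)).mono s)).mp ?_ v (subset_fst_cylinder V hv)
    rw [← hE j (au i k), ← hE k (au i j), hu, hu]
    set E := (riemann hW hdW).E
    set g := ofBase (cylinder V) (metricAt η R i)
    set G := ofBase (cylinder V) (fun v => (metricAt η R i v)⁻¹)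
    have h1 : ∀ j, g * E j G + G * E j g = 0 := fun j => by
      have := congrArg (E j) (hgG i)
      rwa [leibniz, Derivation.map_one_eq_zero, smul_eq_mul, smul_eq_mul] at this
    have h2 : ∀ j, E j G = -(G * G * E j g) := fun j => by
      linear_combination G * h1 j - E j G * hgG i
    have h3 := (riemann hW hdW).E_comm j k g
    rw [leibniz, leibniz, h2, h2]
    simp only [smul_eq_mul]
    linear_combination G * h3
  choose l al hl using fun i => hchart.exists_potential (au i) (hc i)
  refine ⟨l, al, fun i k hik v hv => ?_⟩
  rw [hl i k v hv]
  have h1 := (riemann hW hdW).E_metric hη hik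
  rw [metric_eq_ofBase hW hdW, hE k (ag i)] at h1
  let w : jetsOver₁ (cylinder V) := ⟨shortJet (v, 0), shortJet_mem.mpr ⟨hv, trivial⟩⟩
  have h2 := congrArg (evalJet w) h1
  change _ = evalJet w (-2 * ofBase _ (christoffel R lam i k) * _) at h2
  rw [map_mul, map_mul, evalJet_ofBase ((agp i k).mono s), evalJet_ofBase ((ag i).mono s),
    evalJet_ofBase (hdW.analytic_christoffel (isOpen_base hW) i k), map_neg, map_ofNat] at h2
  simp only [w, shortJet] at h2
  rw [h2, mul_inv_cancel_right₀ (hg i v hv)]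

/-- Solutions of `ψ_{i,k} = C_i Γ^i_{ik}`, `k ≠ i`. -/
theorem exists_christoffel_potential (hη : η.IsSymm) (hη' : η.det ≠ 0) {r : ℝ}
    {Ψ : ℂ^n → ℂ^n} (hchart : IsChart R p V r Ψ)
    (hd : IsDiagonal η h₀ R lam V) (hC : IsCoefficients R V C φ) :
    ∃ ψ : Fin n → ℂ^n → ℂ, (∀ i, Holo (ψ i) V) ∧
      ∀ i k, i ≠ k → ∀ v ∈ V, pdR R k (ψ i) v = C i (R i v) * christoffel R lam i k v := by
  obtain ⟨l, al, hl⟩ := exists_log_metric hη hη' hchart hd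
  have aC := hC.analytic_comp hd.coordinates
  refine ⟨fun i v => C i (R i v) * (-(1 / 2) * l i v), fun i v hv =>
    (aC i v hv).mul (analyticAt_const.mul (al i v hv)), fun i k hik v hv => ?_⟩
  have h1 := hC.pdR_comp hd.coordinates hik hv
  have h2 := hl i k hik v hv
  simp only [pdR, pd] at h1 h2 ⊢
  have dl := (al i v hv).differentiableAt
  have h3 : fderiv ℂ (fun v => C i (R i v) * (-(1 / 2) * l i v)) v =
      C i (R i v) • (-(1 / 2 : ℂ)) • fderiv ℂ (l i) v +
        (-(1 / 2) * l i v) • fderiv ℂ (fun v => C i (R i v)) v := by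
    rw [fderiv_fun_mul (aC i v hv).differentiableAt (dl.const_mul _), fderiv_const_mul dl]
  simp only [h3, FunLike.coe_add, FunLike.coe_smul, Pi.add_apply, Pi.smul_apply, smul_eq_mul]
  have h4 : ∀ α, (jacobian R v)⁻¹ α k * (C i (R i v) * (-(1 / 2) *
      fderiv ℂ (l i) v (Pi.single α 1)) + -(1 / 2) * l i v *
      fderiv ℂ (fun v => C i (R i v)) v (Pi.single α 1)) =
      C i (R i v) * (-(1 / 2)) * ((jacobian R v)⁻¹ α k * fderiv ℂ (l i) v (Pi.single α 1)) +
      -(1 / 2) * l i v *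
        ((jacobian R v)⁻¹ α k * fderiv ℂ (fun v => C i (R i v)) v (Pi.single α 1)) :=
    fun α => by ring
  simp only [h4, sum_add_distrib, ← mul_sum, h1, h2]
  ring

/-! ### Quasi-trivial perturbations -/

theorem IsLogBranch.mono (hL : IsLogBranch R W L) (hW : W' ⊆ W) : IsLogBranch R W' L :=
  fun i => ⟨(hL i).1.mono hW, fun w hw => (hL i).2 w (hW hw)⟩

theorem jetsOver_mono (hV : V' ⊆ V) : jetsOver (n := n) V' ⊆ jetsOver V := fun _ hj => hV hj

theorem jetsOver₁_mono (hW : W' ⊆ W) : jetsOver₁ W' ⊆ jetsOver₁ W := fun _ hj => hW hj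

theorem jetsOver₁_subset_jetsOver (hV : π W ⊆ V) : jetsOver₁ W ⊆ jetsOver V :=
  fun _ hj => hV (jetsOver₁_base hj)

theorem IsQuasiGenerator.mono (hK : IsQuasiGenerator η h₀ h W k₀ k₁) (hW : W' ⊆ W) :
    IsQuasiGenerator η h₀ h W' k₀ k₁ where
  analytic₀ := hK.analytic₀.mono (Set.image_mono hW)
  analytic₁ := hK.analytic₁.mono hW
  homogeneous j hj := hK.homogeneous j (hW hj)
  first := hK.first.mono (jetsOver_mono (Set.image_mono hW))
  second := hK.second.mono (jetsOver₁_mono hW)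

theorem exists_ball_prod_subset (hW : IsOpen W) (hw : w ∈ W) :
    ∃ (N Q : Set ℂ^n), IsOpen N ∧ w.1 ∈ N ∧ IsOpen Q ∧ Convex ℝ Q ∧ w.2 ∈ Q ∧ N ×ˢ Q ⊆ W := by
  obtain ⟨N, Q, hN, hQ, h1, h2, h3⟩ := isOpen_prod_iff.mp hW w.1 w.2 hw
  obtain ⟨ε, hε, hb⟩ := Metric.isOpen_iff.mp hQ _ h2
  exact ⟨N, Metric.ball w.2 ε, hN, h1, Metric.isOpen_ball, convex_ball _ _,
    Metric.mem_ball_self hε, (Set.prod_mono_right hb).trans h3⟩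

/-- A quasi-Miura generator has the logarithmic form near every point. -/
theorem IsQuasiGenerator.exists_generatorForm (hη : η.IsSymm)
    (hd : IsDiagonal η h₀ R lam U) (h2 : IsDiffPoly U 2 (h 2))
    (hW : IsOpen W) (hWU : π W ⊆ U) (hK : IsQuasiGenerator η h₀ h W k₀ k₁)
    (hL : IsLogBranch R W L)
    (hw : w ∈ W) :
    ∃ V Q r Ψ C φ, IsChart R w.1 V r Ψ ∧ IsOpen Q ∧ w.2 ∈ Q ∧ V ×ˢ Q ⊆ W ∧ IsCoefficients R V C φ ∧
      EqFunctionalOn (jetsOver₁ (V ×ˢ Q)) (lift₁ k₁) (lift₁ (generatorForm R C φ L)) := by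
  obtain ⟨N, Q, hN, hwN, hQ, hQc, hwQ, hNQ⟩ := exists_ball_prod_subset hW hw
  have hNW : N ⊆ π W := fun v hv => ⟨(v, w.2), hNQ ⟨hv, hwQ⟩, rfl⟩
  obtain ⟨V, r, Ψ, hchart, hVN⟩ := exists_chart hN hwN (hd.coordinates.mono (hNW.trans hWU))
  have hV := hchart.isOpen
  have hVW : V ×ˢ Q ⊆ W := (Set.prod_mono_left hVN).trans hNQ
  have hVU := (hVN.trans hNW).trans hWU
  have hP : IsOpen (V ×ˢ Q) := hV.prod hQ
  have sV : π (V ×ˢ Q) ⊆ V := Set.fst_image_prod_subset V Q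
  have sV' : V ⊆ π (V ×ˢ Q) := fun v hv => ⟨(v, w.2), ⟨hv, hwQ⟩, rfl⟩
  have hdP := hd.mono (sV.trans hVU)
  have hc := hdP.coordinates
  have hKP := hK.mono hVW
  have hLP := hL.mono hVW
  obtain ⟨q, aq, -, e1⟩ := exists_quadForm_remainder hη (hd.mono hVU) hV (h2.mono hVU)
    (hK.analytic₀.mono (hVN.trans hNW))
  have rk₁ := represents_ofPair hKP.analytic₁
  have rh := represents_ofBase hdP.analytic
  obtain ⟨b, rb⟩ := exists_represents_secondVariation (η := η) hP hdP.analytic hKP.analytic₀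
  have rq := represents_quad hP hc fun i j => (aq i j).mono sV
  have e4 := (eqFunctionalOn_iff hP (rh.bracket hP η rk₁) rq).mp
    ((eqFunctionalOn_add_right_iff hP (rh.bracket hP η rk₁) rq rb).mp
      (hKP.second.symm.trans (e1.mono (jetsOver₁_subset_jetsOver sV))))
  have hE := fun i {f : ℂ^n → ℂ} (hf : Holo f V) => riemann_E hP hdP i (hf.mono sV)
  obtain ⟨c, φ, oc, oφ, hcz, hk⟩ := (riemann hP hdP).exists_logForm (logBranch hP hc hLP) hη
    (ord_ofPair hP hKP.analytic₁) ((homogeneous_iff hP rk₁).mp hKP.homogeneous)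
    (fun i j => ord_ofBase hP ((aq i j).mono sV)) e4
  choose c' ac' hc' using fun i => exists_ofBase_eq hP hQc ⟨_, hwQ⟩ (oc i)
  choose φ' aφ' hφ' using fun i => exists_ofBase_eq hP hQc ⟨_, hwQ⟩ (oφ i)
  obtain rfl : c = fun i => ofBase _ (c' i) := funext hc'
  obtain rfl : φ = fun i => ofBase _ (φ' i) := funext hφ'
  have hz : ∀ i k, i ≠ k → ∀ v ∈ V, pdR R k (c' i) v = 0 := by
    intro i k hik v hv
    have h3 := hcz i k hik
    rw [hE k (ac' i)] at h3
    let j : jetsOver₁ (V ×ˢ Q) := ⟨shortJet (v, w.2), shortJet_mem.mpr ⟨hv, hwQ⟩⟩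
    have h4 := congrArg (evalJet j) h3
    rwa [evalJet_ofBase (hc.analytic_pdR k ((ac' i).mono sV)), map_zero] at h4
  choose C aC hC using fun i => hchart.exists_eq_comp (ac' i) (i := i) (hz i)
  have hcoef : IsCoefficients R V C φ' := fun i => ⟨aC i, aφ' i⟩
  refine ⟨V, Q, r, Ψ, C, φ', hchart, hQ, hwQ, hVW, hcoef, ?_⟩
  have hcc : ∀ i, ofBase (V ×ˢ Q) (c' i) = ofBase (V ×ˢ Q) fun v => C i (R i v) := fun i =>
    ofBase_congr ((ac' i).mono sV) ((hcoef.analytic_comp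
      (hd.coordinates.mono hVU) i).mono sV) fun v hv => hC i v (sV hv)
  have rgen := represents_generatorForm hP hc (hcoef.mono sV) hLP
  rw [eqFunctionalOn_iff hP rk₁ rgen]
  simp only [← hcc]
  exact hk

/-- Local functionals of quadratic forms which agree over an open set of pairs `(v, v_x)` agree
everywhere. -/
theorem EqFunctionalOn.of_quadForm {Q : Set ℂ^n} (hV : IsOpen V) (hQ : IsOpen Q)
    (hne : Q.Nonempty) (hc : IsCoordinates R V) {q r : Fin n → Fin n → ℂ^n → ℂ}
    (hq : ∀ i j, Holo (q i j) V) (hr : ∀ i j, Holo (r i j) V)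
    (he : EqFunctionalOn (jetsOver₁ (V ×ˢ Q)) (lift₁ (quadForm R q)) (lift₁ (quadForm R r))) :
    EqFunctionalOn (jetsOver V) (lift₁ (quadForm R q)) (lift₁ (quadForm R r)) := by
  obtain ⟨z, hz⟩ := hne
  have hP : IsOpen (V ×ˢ Q) := hV.prod hQ
  have sV : π (V ×ˢ Q) ⊆ V := Set.fst_image_prod_subset V Q
  have rq := represents_quad hP (hc.mono sV) fun i j => (hq i j).mono sV
  have rr := represents_quad hP (hc.mono sV) fun i j => (hr i j).mono sV
  rw [eqFunctionalOn_iff hP rq rr, Frame.quad_sub] at he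
  have h1 := (frame hP (hc.mono sV)).quad_mem_null_imp (fun i j =>
    (ord_ofBase hP ((hq i j).mono sV)).sub (ord_ofBase hP ((hr i j).mono sV))) he
  have h2 : ∀ v ∈ V, ∀ i j, (q i j v - r i j v) + (q j i v - r j i v) = 0 := by
    intro v hv i j
    let w : jetsOver₁ (V ×ˢ Q) := ⟨shortJet (v, z), shortJet_mem.mpr ⟨hv, hz⟩⟩
    have h3 := congrArg (evalJet w) (h1 j i)
    simp only [map_add, map_sub, evalJet_ofBase ((hq _ _).mono sV),
      evalJet_ofBase ((hr _ _).mono sV), map_zero] at h3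
    exact h3
  have hW := isOpen_cylinder hV
  have s := fst_cylinder_subset V
  have rq' := represents_quad hW (hc.mono s) fun i j => (hq i j).mono s
  have rr' := represents_quad hW (hc.mono s) fun i j => (hr i j).mono s
  rw [jetsOver_eq, eqFunctionalOn_iff hW rq' rr', Frame.quad_sub, Frame.quad_eq_zero]
  · exact zero_mem _
  · intro i j
    refine evalJet_ext fun w => ?_
    simp only [map_add, map_sub, evalJet_ofBase ((hq _ _).mono s),
      evalJet_ofBase ((hr _ _).mono s), map_zero]
    exact h2 _ (s (jetsOver₁_base w.2)) i j

/-- A vector with `R_{i,x} = 1` for all `i`. -/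
theorem exists_Rx_eq_one (hc : IsCoordinates R V) (hp : p ∈ V) :
    ∃ z : ℂ^n, ∀ i, Rx R i (p, z) = 1 := by
  refine ⟨fun α => ∑ k, (jacobian R p)⁻¹ α k, fun i => ?_⟩
  have h1 : ∀ k, ∑ α, pd α (R i) p * (jacobian R p)⁻¹ α k = if i = k then 1 else 0 := by
    intro k
    have := congrFun (congrFun (hc.jacobian_mul_inv hp) i) k
    rwa [Matrix.mul_apply, Matrix.one_apply] at this
  simp only [Rx, mul_sum]
  rw [sum_comm]
  simp [h1]

theorem Rx_add_smul (i : Fin n) (v q z : ℂ^n) (t : ℂ) :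
    Rx R i (v, q + t • z) = Rx R i (v, q) + t * Rx R i (v, z) := by
  simp only [Rx, mul_sum, ← sum_add_distrib]
  refine sum_ext fun α => ?_
  simp only [Pi.add_apply, Pi.smul_apply, smul_eq_mul]
  ring

/-- Branches of the logarithms exist near a generic jet. -/
theorem exists_logBranch (hW : IsOpen W) (hc : IsCoordinates R (π W)) {q : ℂ^n} (hpq : (p, q) ∈ W) :
    ∃ W' q' L, IsOpen W' ∧ W' ⊆ W ∧ (p, q') ∈ W' ∧ IsLogBranch R W' L := by
  have hp : p ∈ π W := ⟨_, hpq, rfl⟩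
  -- a small displacement of `q` in the direction in which all `R_{i,x}` are `1` makes these nonzero
  obtain ⟨z, hz⟩ := exists_Rx_eq_one hc hp
  have h1 : ∀ᶠ t : ℂ in 𝓝[≠] 0, (p, q + t • z) ∈ W := by
    have hcont : ContinuousAt (fun t : ℂ => (p, q + t • z)) 0 := by fun_prop
    have : (p, q + (0 : ℂ) • z) ∈ W := by simpa using hpq
    exact (hcont.eventually (hW.mem_nhds this)).filter_mono nhdsWithin_le_nhds
  have h2 : ∀ᶠ t : ℂ in 𝓝[≠] 0, ∀ i, Rx R i (p, q + t • z) ≠ 0 := by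
    refine eventually_all.mpr fun i => ?_
    simp only [Rx_add_smul, hz, mul_one]
    by_cases h0 : Rx R i (p, q) = 0
    · simp only [h0, zero_add]
      exact eventually_mem_nhdsWithin
    · have hcont : ContinuousAt (fun t : ℂ => Rx R i (p, q) + t) 0 := by fun_prop
      exact (hcont.eventually_ne (by simpa using h0)).filter_mono nhdsWithin_le_nhds
  obtain ⟨t, ht1, ht2⟩ := (h1.and h2).exists
  set q' := q + t • z
  set a : ℂ^n := fun i => Rx R i (p, q') with ha
  have aR : ∀ i, Holo (fun w => Rx R i w / a i) W := fun i w hw =>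
    (analytic_Rx hc i w hw).div analyticAt_const (ht2 i)
  refine ⟨W ∩ {w | ∀ i, w ∈ W → Rx R i w / a i ∈ Complex.slitPlane}, q',
    fun i w => Complex.log (Rx R i w / a i) + Complex.log (a i), ?_, Set.inter_subset_left,
    ⟨ht1, fun i _ => by rw [div_self (ht2 i)]; exact Complex.one_mem_slitPlane⟩, fun i => ⟨?_, ?_⟩⟩
  · rw [isOpen_iff_mem_nhds]
    rintro w ⟨hw, hw'⟩
    have h3 : ∀ᶠ w' in 𝓝 w, ∀ i, Rx R i w' / a i ∈ Complex.slitPlane := eventually_all.mpr fun i =>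
        (aR i w hw).continuousAt.eventually (Complex.isOpen_slitPlane.mem_nhds (hw' i hw))
    filter_upwards [hW.mem_nhds hw, h3] with w' h4 h5
    exact ⟨h4, fun i _ => h5 i⟩
  · rintro w ⟨hw, hw'⟩
    exact ((aR i w hw).clog (hw' i hw)).add analyticAt_const
  · rintro w ⟨hw, hw'⟩
    rw [Complex.exp_add, Complex.exp_log (Complex.slitPlane_ne_zero (hw' i hw)),
      Complex.exp_log (ht2 i), div_mul_cancel₀ _ (ht2 i)]

/-- Quasi-trivial perturbations have the normal form. -/
theorem IsQuasiTrivial.hasLocalNormalForm (hη : η.IsSymm) (hη' : η.det ≠ 0)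
    (hd : IsDiagonal η h₀ R lam U) (h2 : IsDiffPoly U 2 (h 2))
    (hQ : IsQuasiTrivial η h₀ h U) : HasLocalNormalForm η h₀ h R lam U := by
  intro p hp
  obtain ⟨q, W₀, hW₀, hpq, hWU₀, k₀, k₁, hK₀⟩ := hQ p hp
  obtain ⟨W, q', L, hW, hWW₀, hpq', hL⟩ := exists_logBranch hW₀ (hd.coordinates.mono hWU₀) hpq
  have hK := hK₀.mono hWW₀
  have hWU := (Set.image_mono hWW₀).trans hWU₀
  obtain ⟨V, Q, r, Ψ, C, φ, hchart, hQo, hq'Q, hVW, hC, e1⟩ :=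
    hK.exists_generatorForm hη hd h2 hW hWU hL hpq'
  have hV := hchart.isOpen
  have hVW' : V ⊆ π W := fun v hv => ⟨(v, q'), hVW ⟨hv, hq'Q⟩, rfl⟩
  have hVU := hVW'.trans hWU
  have hdV := hd.mono hVU
  obtain ⟨ψ, aψ, hψ⟩ := exists_christoffel_potential hη hη' hchart hdV hC
  have hP : IsOpen (V ×ˢ Q) := hV.prod hQo
  have sV : π (V ×ˢ Q) ⊆ V := Set.fst_image_prod_subset V Q
  have hdP := hdV.mono sV
  have hLP := hL.mono hVW
  have hKP := hK.mono hVW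
  have ak₀ : Holo k₀ V := hK.analytic₀.mono hVW'
  have e2 := bracket_generatorForm hη hP hdP (hC.mono sV) hLP (fun i => (aψ i).mono sV)
    fun i k hik v hv => hψ i k hik v (sV hv)
  have hC' : IsCoefficients R V C fun i v => φ i v + ψ i v := fun i =>
    ⟨(hC i).1, fun v hv => ((hC i).2 v hv).add (aψ i v hv)⟩
  refine ⟨V, k₀, C, fun i v => φ i v + ψ i v, hV, hchart.mem, hVU, ak₀, hC',
    hK.first.mono (jetsOver_mono hVW'), ?_⟩
  obtain ⟨qr, aqr, -, e3⟩ := exists_quadForm_remainder hη hdV hV (h2.mono hVU) ak₀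
  have al := hdV.analytic_lam hV
  have hcV := hdV.coordinates
  have astd := analytic_stdCoeff hcV al (hC'.analytic_comp hcV)
    (hcV.analytic_curl fun i => (hC' i).2)
  rw [hamiltonianForm_eq] at e2 ⊢
  set std := stdCoeff R lam (fun i v => C i (R i v)) fun i k v =>
    1 / 2 * (pdR R k (fun v => φ i v + ψ i v) v - pdR R i (fun v => φ k v + ψ k v) v)
  have rh := represents_ofBase hdP.analytic
  have rk₁ := rh.bracket hP η (represents_ofPair hKP.analytic₁)
  have rgen := represents_generatorForm hP hdP.coordinates (hC.mono sV) hLP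
  obtain ⟨b, rb⟩ := exists_represents_secondVariation (η := η) hP hdP.analytic hKP.analytic₀
  have rqr := represents_quad hP hdP.coordinates fun i j => (aqr i j).mono sV
  have e4 : EqFunctionalOn (jetsOver V) (lift₁ (quadForm R qr)) (lift₁ (quadForm R std)) :=
    EqFunctionalOn.of_quadForm hV hQo ⟨_, hq'Q⟩ hcV aqr astd
      (((eqFunctionalOn_add_right_iff hP rqr rk₁ rb).mp
        ((e3.mono (jetsOver₁_subset_jetsOver sV)).symm.trans hKP.second)).trans
          ((Represents.eqFunctionalOn_bracket rh hP η (represents_ofPair hKP.analytic₁) rgen e1).trans e2))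
  have hWc := isOpen_cylinder hV
  have s := fst_cylinder_subset V
  have hdW := hdV.mono s
  obtain ⟨b', rb'⟩ := exists_represents_secondVariation (η := η) hWc hdW.analytic (ak₀.mono s)
  rw [jetsOver_eq] at e3 e4 ⊢
  exact e3.trans ((eqFunctionalOn_add_right_iff hWc
    (represents_quad hWc hdW.coordinates fun i j => (aqr i j).mono s)
    (represents_quad hWc hdW.coordinates fun i j => (astd i j).mono s) rb').mpr e4)

/-- A perturbation in normal form is generated by logarithmic generators. -/
theorem HasLocalNormalForm.exists_generator (hη : η.IsSymm) (hη' : η.det ≠ 0)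
    (hd : IsDiagonal η h₀ R lam U) (hN : HasLocalNormalForm η h₀ h R lam U) (hp : p ∈ U) :
    ∃ (V : Set ℂ^n) (k₀ : ℂ^n → ℂ) (C : Fin n → ℂ → ℂ)
      (φ : Fin n → ℂ^n → ℂ), IsOpen V ∧ p ∈ V ∧ V ⊆ U ∧ IsCoefficients R V C φ ∧
      ∀ (W : Set (ℂ^n × ℂ^n)) (L : Fin n → ℂ^n × ℂ^n → ℂ), IsOpen W → π W ⊆ V → IsLogBranch R W L →
        IsQuasiGenerator η h₀ h W k₀ (generatorForm R C φ L) := by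
  obtain ⟨V₀, k₀, C, φ, hV₀, hpV₀, hVU₀, ak₀, hC₀, hN₀⟩ := hN p hp
  obtain ⟨V, r, Ψ, hchart, hVV₀⟩ := exists_chart hV₀ hpV₀ (hd.coordinates.mono hVU₀)
  have hVU := hVV₀.trans hVU₀
  have hdV := hd.mono hVU
  -- the bracket with `H₀` shifts `φ` by `ψ`
  obtain ⟨ψ, aψ, hψ⟩ := exists_christoffel_potential hη hη' hchart hdV (hC₀.mono hVV₀)
  have hC : IsCoefficients R V C fun i v => φ i v - ψ i v := fun i =>
    ⟨((hC₀.mono hVV₀) i).1, fun v hv => ((hC₀ i).2 v (hVV₀ hv)).sub (aψ i v hv)⟩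
  refine ⟨V, k₀, C, fun i v => φ i v - ψ i v, hchart.isOpen, hchart.mem, hVU, hC,
    fun W L hW hWV hL => ?_⟩
  have hdW := hdV.mono hWV
  have hCW := hC.mono hWV
  have ak := ak₀.mono (hWV.trans hVV₀)
  have hNW := hN₀.mono (jetsOver_mono (hWV.trans hVV₀))
  refine ⟨ak, analyticOnNhd_generatorForm hdW.coordinates hCW hL,
    homogeneous_generatorForm hW hdW hCW hL, hNW.first, ?_⟩
  have e1 := bracket_generatorForm hη hW hdW hCW hL (fun i => (aψ i).mono hWV)
    fun i k hik v hv => hψ i k hik v (hWV hv)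
  simp only [sub_add_cancel] at e1
  obtain ⟨b, rb⟩ := exists_represents_secondVariation (η := η) hW hdW.analytic ak
  have rgen := (represents_ofBase hdW.analytic).bracket hW η
    (represents_generatorForm hW hdW.coordinates hCW hL)
  exact (hNW.second.mono (jetsOver₁_subset_jetsOver le_rfl)).trans
    ((eqFunctionalOn_add_right_iff hW
      (represents_hamiltonianForm hW hdW (hC₀.mono (hWV.trans hVV₀))) rgen rb).mpr e1.symm)

theorem HasLocalNormalForm.isQuasiTrivial (hη : η.IsSymm) (hη' : η.det ≠ 0)
    (hd : IsDiagonal η h₀ R lam U) (hN : HasLocalNormalForm η h₀ h R lam U) : IsQuasiTrivial η h₀ h U := by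
  intro p hp
  obtain ⟨V, k₀, C, φ, hV, hpV, hVU, -, hgen⟩ := hN.exists_generator hη hη' hd hp
  have hc := hd.coordinates.mono hVU
  obtain ⟨z, hz⟩ := exists_Rx_eq_one hc hpV
  obtain ⟨W, q, L, hW, hWV, hpq, hL⟩ := exists_logBranch (isOpen_cylinder hV)
    (hc.mono (fst_cylinder_subset V)) (p := p) (q := z) ⟨hpV, trivial⟩
  have s : π W ⊆ V := (Set.image_mono hWV).trans (fst_cylinder_subset V)
  exact ⟨q, W, hW, hpq, s.trans hVU, k₀, _, hgen W L hW s hL⟩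

/-! ### Perturbations in normal form are integrable -/

/-- A conserved quantity of the dispersionless limit extends to second order over every open set
on which the perturbation has a normal form. -/
theorem HasNormalForm.exists_extension (hη : η.IsSymm) (hV : IsOpen V)
    (hd : IsDiagonal η h₀ R lam V) (h1 : IsDiffPoly V 1 (h 1)) (h2 : IsDiffPoly V 2 (h 2))
    (ak₀ : Holo k₀ V) (hC : IsCoefficients R V C φ)
    (hN : HasNormalForm η h₀ h (jetsOver V) k₀ (hamiltonianForm R lam C φ))
    {f : ℂ^n → ℂ} (hf : IsConservationLaw η h₀ V f) :
    ∃ F₁ F₂, IsDiffPoly V 1 F₁ ∧ IsDiffPoly V 2 F₂ ∧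
      EqFunctionalOn (jetsOver V) (bracket η (lift₀ h₀) F₁ + bracket η (h 1) (lift₀ f)) 0 ∧
      EqFunctionalOn (jetsOver V) (bracket η (lift₀ h₀) F₂ + bracket η (h 1) F₁ +
        bracket η (h 2) (lift₀ f)) 0 := by
  obtain ⟨μ, hμ⟩ := exists_velocities hη hV hd hf
  have hc := hd.coordinates
  set c : Fin n → ℂ^n → ℂ := fun i v => C i (R i v)
  set s : Fin n → Fin n → ℂ^n → ℂ := fun i k v => 1 / 2 * (pdR R k (φ i) v - pdR R i (φ k) v)
  have ac : ∀ i, Holo (c i) V := hC.analytic_comp hc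
  have aφ := fun i => (hC i).2
  have as : ∀ i k, Holo (s i k) V := hc.analytic_curl aφ
  obtain ⟨r, ar, -, e1⟩ := exists_quadForm_half_br_br hη hd hV ak₀ hf.1 hμ
  have aω : ∀ i, Holo (fun v => -(μ i v * pdR R i k₀ v)) V := fun i v hv =>
    ((hμ.analytic i v hv).mul (hc.analytic_pdR i ak₀ v hv)).neg
  have astd := analytic_stdCoeff hc hμ.analytic ac as
  -- `F₁ = {F₀, K₀}`, and `F₂` is `½{{F₀, K₀}, K₀}` plus the normal form with `μ` in place of `λ`
  refine ⟨lift₁ (linForm R fun i v => -(μ i v * pdR R i k₀ v)),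
    lift₁ (quadForm R (stdCoeff R μ c s)) + lift₁ (quadForm R r),
    isDiffPoly_linForm hc aω, (isDiffPoly_quadForm hc astd).add (isDiffPoly_quadForm hc ar), ?_⟩
  have hW := isOpen_cylinder hV
  have sV := fst_cylinder_subset V
  have hdW := hd.mono sV
  have hcW := hdW.coordinates
  have aμ := fun i => (hμ.analytic i).mono sV
  have al := fun i => hdW.analytic_lam (isOpen_base hW) i
  have ac' := fun i => (ac i).mono sV
  have as' := fun i k => (as i k).mono sV
  have aφ' := fun i => (aφ i).mono sV
  have hE := fun i {f : ℂ^n → ℂ} (hf : Holo f V) => riemann_E hW hdW i (hf.mono sV)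
  obtain ⟨b₁, rb₁⟩ := h1.exists_represents hW sV
  obtain ⟨b₂, rb₂⟩ := h2.exists_represents hW sV
  have rh := represents_ofBase hdW.analytic
  have rf := represents_ofBase (hf.1.mono sV)
  have rk := represents_ofBase (ak₀.mono sV)
  have rstd := represents_stdQuad hW hdW aμ ac' as'
  have rr := represents_quad hW hcW fun i j => (ar i j).mono sV
  have rω := represents_oneForm hW hcW fun i => (aω i).mono sV
  obtain ⟨n1, n2⟩ := (hasNormalForm_iff hW hdW (ak₀.mono sV)
    (represents_hamiltonianForm hW hdW (hC.mono sV)) rb₁ rb₂).mp (hN.mono (jetsOver₁_subset_jetsOver sV))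
  have of := ord_ofBase hW (hf.1.mono sV)
  have hdiag := (hμ.mono sV).diagonalizes hW hdW (hf.1.mono sV)
  have g1 : (frame hW hcW).oneForm (fun i => ofBase _ fun v => -(μ i v * pdR R i k₀ v)) -
      (jetAlgebra hW).br η (ofBase _ f) (ofBase _ k₀) ∈ (jetAlgebra hW).null := by
    have hω : ∀ i, ofBase (cylinder V) (fun v => -(μ i v * pdR R i k₀ v)) =
        -(ofBase _ (μ i) * (riemann hW hdW).E i (ofBase _ k₀)) := by
      intro i
      rw [hE i ak₀]
      refine evalJet_ext fun w => ?_
      rw [evalJet_ofBase ((aω i).mono sV), map_neg, map_mul, evalJet_ofBase (aμ i),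
        evalJet_ofBase ((hc.analytic_pdR i ak₀).mono sV)]
    simp only [hω]
    have := neg_mem ((jetAlgebra hW).tot_le_null
      (hdiag.br_ord_one hη of (ord_ofBase hW (ak₀.mono sV))))
    rwa [neg_sub] at this
  have g2 := (eqFunctionalOn_iff hW (((rf.bracket hW η rk).bracket hW η rk).smul (1 / 2 : ℂ))
    rr).mp (e1.mono (jetsOver₁_subset_jetsOver sV))
  have hs : ∀ i k, ofBase (cylinder V) (s i k) = Frame.half _ *
      ((riemann hW hdW).E k (ofBase _ (φ i)) - (riemann hW hdW).E i (ofBase _ (φ k))) := by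
    intro i k
    rw [hE k (aφ i), hE i (aφ k)]
    refine evalJet_ext fun w => ?_
    rw [map_mul, map_sub, evalJet_half, evalJet_ofBase (hcW.analytic_pdR k (aφ' i)),
      evalJet_ofBase (hcW.analytic_pdR i (aφ' k)), evalJet_ofBase (as' i k)]
  have g3 := (riemann hW hdW).br_stdQuad_mem_null hη hdiag of (fun i => ord_ofBase hW (aμ i))
    (fun i => ord_ofBase hW (ac' i)) (fun i k => ord_ofBase hW (as' i k))
    (fun i k => by rw [hs, hs]; ring)
    (fun i k hik => by
      rw [hE k (ac i)]
      refine evalJet_ext fun w => ?_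
      rw [evalJet_ofBase (hcW.analytic_pdR k (ac' i)), map_zero]
      exact hC.pdR_comp hc hik (sV (jetsOver₁_base w.2)))
    (fun i j k => by
      simp only [hs, leibniz, Frame.derivation_half, smul_eq_mul,
        map_sub, (riemann hW hdW).E_comm k j, (riemann hW hdW).E_comm k i,
        (riemann hW hdW).E_comm i j]
      ring)
  have g4 := second_order_normal_form hη ((hf.mono sV).mem_null hW hdW) n1 n2 g1
    (F₂ := (riemann hW hdW).quad ((riemann hW hdW).stdQuad (fun i => ofBase _ (μ i))
      (fun i => ofBase _ (c i)) fun i k => ofBase _ (s i k)) +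
      (frame hW hcW).quad fun i j => ofBase _ (r i j)) (r := (riemann hW hdW).quad
        ((riemann hW hdW).stdQuad (fun i => ofBase _ (μ i)) (fun i => ofBase _ (c i))
          fun i k => ofBase _ (s i k))) (by
      rw [add_sub_add_left_eq_sub, ← neg_sub]
      exact neg_mem g2)
  rw [jetsOver_eq]
  refine ⟨(eqFunctionalOn_zero_iff hW ((rh.bracket hW η rω).add (rb₁.bracket hW η rf))).mpr ?_,
    (eqFunctionalOn_zero_iff hW (((rh.bracket hW η (rstd.add rr)).add
      (rb₁.bracket hW η rω)).add (rb₂.bracket hW η rf))).mpr (g4.2.mpr g3)⟩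
  rw [add_comm]
  exact g4.1

theorem HasLocalNormalForm.isOIntegrable (hη : η.IsSymm)
    (hd : IsDiagonal η h₀ R lam U) (hint : IsIntegrable η h₀ U) (hh₀ : h 0 = lift₀ h₀)
    (h1 : IsDiffPoly U 1 (h 1)) (h2 : IsDiffPoly U 2 (h 2))
    (hN : HasLocalNormalForm η h₀ h R lam U) : IsOIntegrable 2 η h₀ h U := by
  refine ⟨hint, fun V f hV hVU hf _ p hp => ?_⟩
  obtain ⟨V₁, k₀, C, φ, hV₁, hpV₁, hVU₁, ak₀, hC, hN₁⟩ := hN p (hVU hp)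
  have s1 : V ∩ V₁ ⊆ V := Set.inter_subset_left
  have s2 : V ∩ V₁ ⊆ V₁ := Set.inter_subset_right
  have sU := s1.trans hVU
  have hf' := hf.mono s1
  obtain ⟨F₁, F₂, d1, d2, e1, e2⟩ := (hN₁.mono (jetsOver_mono s2)).exists_extension hη
    (hV.inter hV₁) (hd.mono sU) (h1.mono sU) (h2.mono sU) (ak₀.mono s2) (hC.mono s2) hf'
  refine ⟨V ∩ V₁, fun k => match k with
    | 0 => lift₀ f
    | 1 => F₁
    | 2 => F₂
    | _ => 0, hV.inter hV₁, ⟨hp, hpV₁⟩, s1, rfl, fun k => ?_, fun m hm => ?_⟩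
  · match k with
    | 0 => exact isDiffPoly_lift₀ hf'.1
    | 1 => exact d1
    | 2 => exact d2
    | k + 3 => exact isDiffPoly_zero _ _
  · interval_cases m
    · rw [show Finset.HasAntidiagonal.antidiagonal 0 = {((0 : ℕ), (0 : ℕ))} from rfl,
        Finset.sum_singleton, hh₀]
      exact hf'.2
    · rw [sum_antidiagonal_one, hh₀]
      exact e1
    · rw [sum_antidiagonal_two, hh₀]
      exact e2

/-- A quadratic Hamiltonian in normal form is a perturbation in normal form. -/
theorem hasLocalNormalForm_of_hamiltonianForm (hd : IsDiagonal η h₀ R lam U)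
    (h1 : EqFunctionalOn (jetsOver U) (h 1) 0)
    (hN : ∀ p ∈ U, ∃ (V : Set ℂ^n) (C : Fin n → ℂ → ℂ) (φ : Fin n → ℂ^n → ℂ),
      IsOpen V ∧ p ∈ V ∧ V ⊆ U ∧ IsCoefficients R V C φ ∧
      EqFunctionalOn (jetsOver V) (h 2) (lift₁ (hamiltonianForm R lam C φ))) :
    HasLocalNormalForm η h₀ h R lam U := by
  intro p hp
  obtain ⟨V, C, φ, hV, hpV, hVU, hC, e⟩ := hN p hp
  have hW := isOpen_cylinder hV
  have sV := fst_cylinder_subset V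
  have hdW := hd.mono (sV.trans hVU)
  have rh := represents_ofBase hdW.analytic
  have r0 : Represents (0 : jetFunctions (cylinder V)) (lift₀ 0) := represents_zero
  have rb := rh.bracket hW η r0
  have rbb := (rb.bracket hW η r0).smul (1 / 2 : ℂ)
  refine ⟨V, 0, C, φ, hV, hpV, hVU, analyticOnNhd_const, hC, ?_, ?_⟩
  · refine (h1.mono (jetsOver_mono hVU)).trans ?_
    rw [jetsOver_eq]
    refine ((eqFunctionalOn_zero_iff hW rb).mpr ?_).symm
    rw [br_zero_right]
    exact zero_mem _
  · refine e.trans ?_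
    rw [jetsOver_eq]
    have rham := represents_hamiltonianForm hW hdW (hC.mono sV)
    refine (eqFunctionalOn_iff hW rham (rham.add rbb)).mpr ?_
    rw [br_zero_right, smul_zero, add_zero, sub_self]
    exact zero_mem _

end HamPDE

end

theorem theorem2 {n : ℕ} (η : Matrix (Fin n) (Fin n) ℂ) (hη : η.IsSymm) (hη' : η.det ≠ 0)
    (U : Set (Fin n → ℂ)) (hU : IsOpen U)
    (h₀ : (Fin n → ℂ) → ℂ) (h : ℕ → Density n)
    (hh₀ : h 0 = lift₀ h₀) (hh : ∀ k, IsDiffPoly U k (h k))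
    (R lam : Fin n → (Fin n → ℂ) → ℂ) (hR : IsRiemannInvariants η h₀ U R lam)
    (hint : IsIntegrable η h₀ U)
    (hlam : ∀ v ∈ U, ∀ i, pdR R i (lam i) v ≠ 0) :
    -- Part I: the equivalence
    (IsQuasiTrivial η h₀ h U ↔ IsOIntegrable 2 η h₀ h U) ∧
    -- Part I: every generator has the logarithmic form
    (∀ (W : Set ((Fin n → ℂ) × (Fin n → ℂ))) (k₀ : (Fin n → ℂ) → ℂ)
        (k₁ : (Fin n → ℂ) × (Fin n → ℂ) → ℂ) (L : Fin n → (Fin n → ℂ) × (Fin n → ℂ) → ℂ),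
      IsOpen W → Prod.fst '' W ⊆ U → IsQuasiGenerator η h₀ h W k₀ k₁ → IsLogBranch R W L →
      ∀ w ∈ W, ∃ (W' : Set ((Fin n → ℂ) × (Fin n → ℂ))) (C : Fin n → ℂ → ℂ)
        (φ : Fin n → (Fin n → ℂ) → ℂ), IsOpen W' ∧ w ∈ W' ∧ W' ⊆ W ∧
        IsCoefficients R (Prod.fst '' W') C φ ∧
        EqFunctionalOn (jetsOver₁ W') (lift₁ k₁) (lift₁ (generatorForm R C φ L))) ∧
    -- Part I: in the quasi-trivial case there are generators of this form
    (IsQuasiTrivial η h₀ h U →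
      ∀ p ∈ U, ∃ (V : Set (Fin n → ℂ)) (k₀ : (Fin n → ℂ) → ℂ) (C : Fin n → ℂ → ℂ)
        (φ : Fin n → (Fin n → ℂ) → ℂ), IsOpen V ∧ p ∈ V ∧ V ⊆ U ∧ IsCoefficients R V C φ ∧
        ∀ (W : Set ((Fin n → ℂ) × (Fin n → ℂ)))
          (L : Fin n → (Fin n → ℂ) × (Fin n → ℂ) → ℂ),
          IsOpen W → Prod.fst '' W ⊆ V → IsLogBranch R W L →
          IsQuasiGenerator η h₀ h W k₀ (generatorForm R C φ L)) ∧
    -- Part II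
    (EqFunctionalOn (jetsOver U) (h 1) 0 →
      (∀ p ∈ U, ∃ (V : Set (Fin n → ℂ)) (C : Fin n → ℂ → ℂ) (φ : Fin n → (Fin n → ℂ) → ℂ),
        IsOpen V ∧ p ∈ V ∧ V ⊆ U ∧ IsCoefficients R V C φ ∧
        EqFunctionalOn (jetsOver V) (h 2) (lift₁ (hamiltonianForm R lam C φ))) →
      IsOIntegrable 2 η h₀ h U) := by
  have hd : IsDiagonal η h₀ R lam U := by
    refine ⟨hR, ?_⟩
    obtain ⟨u, au, hu⟩ := (hh 0).exists_degree_zero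
    refine au.congr hU fun v hv => ?_
    have := hu (shortJet (v, 0)) hv
    rw [hh₀] at this
    exact this.symm
  have h1 := hh 1
  have h2 := hh 2
  have hQ : IsQuasiTrivial η h₀ h U → HasLocalNormalForm η h₀ h R lam U :=
    fun h => h.hasLocalNormalForm hη hη' hd h2
  refine ⟨⟨fun h => (hQ h).isOIntegrable hη hd hint hh₀ h1 h2, fun h =>
    (h.hasLocalNormalForm hη hη' hd hU hh₀ hlam h1 h2).isQuasiTrivial hη hη' hd⟩,
    fun W k₀ k₁ L hW hWU hK hL w hw => ?_, fun h p hp =>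
    (hQ h).exists_generator hη hη' hd hp, fun e1 hN =>
    (hasLocalNormalForm_of_hamiltonianForm hd e1 hN).isOIntegrable hη hd hint hh₀ h1 h2⟩
  obtain ⟨V, Q, r, Ψ, C, φ, hchart, hQo, hwQ, hVW, hC, e⟩ :=
    hK.exists_generatorForm hη hd h2 hW hWU hL hw
  exact ⟨V ×ˢ Q, C, φ, hchart.isOpen.prod hQo, ⟨hchart.mem, hwQ⟩, hVW,
    hC.mono (Set.fst_image_prod_subset V Q), e⟩
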